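/- Let $k$ be a field of any characteristic, and let $C_1,C_2$ be smooth conics over $k$, that is, smooth $k$-schemes isomorphic to plane curves $(q=0)\subset\mathbb P^2_k$ with $q\neq 0$ a quadratic form. Let $P(C_1,C_2)$ be the $k$-scheme parametrizing effective divisors of bidegree $(1,1)$ on $C_1\times C_2$ (a component of the Hilbert scheme, isomorphic to $\mathbb P^3$ over $\bar k$). A Brauer product $C_1*C_2$ is a smooth curve of degree one in $P(C_1,C_2)$ (a line over $\bar k$) defined over $k$, if one exists. Suppose that the Brauer product $C_1*C_2$ exists and is a smooth conic. Then the following hold (all products are over $k$). 1. $C_1\times C_2$ is birational over $k$ to $C_1\times (C_1*C_2)$. 2. $C_1\times C_2$ and $C_1\times (C_1*C_2)$ are reduced and quasi-projective, and $[C_1\times C_2]=[C_1\times (C_1*C_2)]$ in the Grothendieck ring $K_0[\mathrm{Var}_k]$. The additive group of this ring is generated by the isomorphism classes of reduced quasi-projective $k$-schemes, with the relations $[X]=[Y]+[X\setminus Y]$ for $Y\subset X$ closed. 3. There are isomorphic closed subschemes $Z\subset C_1\times C_2$ and $Z'\subset C_1\times (C_1*C_2)$, finite of degree $2$ over $k$,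 and a $k$-scheme $B$ with $k$-morphisms $\beta:B\to C_1\times C_2$ and $\beta':B\to C_1\times (C_1*C_2)$, such that $\beta$ is the blow-up of $Z$, $\beta'$ is the blow-up of $Z'$, and $\beta,\beta'$ have the same composite with the projections to $C_1$. If moreover $\operatorname{char} k\neq 2$, these can be chosen such that for suitable $a,b,c\in k^*$ and suitable plane embeddings $$C_1=(x_1^2-ax_2^2-bx_3^2=0),\quad C_2=(y_1^2-ay_2^2-cy_3^2=0),\quad C_1*C_2=(z_1^2-az_2^2-bcz_3^2=0),$$ the resulting rational map $C_1\times C_2\dashrightarrow C_1*C_2$ is given by $$(z_1:z_2:z_3)=(x_1y_1+ax_2y_2:\ x_1y_2+x_2y_1:\ x_3y_3)$$ wherever the right-hand side is defined. -/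

import Mathlib

open CategoryTheory MonoidalCategory CartesianMonoidalCategory AlgebraicGeometry MvPolynomial

universe u

noncomputable section

namespace Conics

attribute [local instance] MvPolynomial.gradedAlgebra

/-! ## Schemes over a field and projective space -/

/-- The category of schemes over the field `k`; the product `X ×ₖ Y` is `X ⊗ Y`. -/
abbrev Sch (k : Type u) [Field k] : Type (u + 1) := Over (Spec (CommRingCat.of k))

/-- `Spec K` as a `k`-scheme, for a field extension `K` of `k`. -/
def pt (k : Type u) [Field k] (K : Type u) [Field K] [Algebra k K] : Sch k :=
  Over.mk (Spec.map (CommRingCat.ofHom (algebraMap k K)))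

/-- The standard grading of `k[x₀, …, xₙ]`. -/
abbrev gr (k : Type u) [Field k] (n : ℕ) : ℕ → Submodule k (MvPolynomial (Fin (n + 1)) k) :=
  homogeneousSubmodule (Fin (n + 1)) k

/-- Projective `n`-space `ℙⁿ` over `k`. -/
def projSpace (k : Type u) [Field k] (n : ℕ) : Sch k :=
  Over.mk (Proj.toSpecZero (gr k n) ≫
    Spec.map (CommRingCat.ofHom (algebraMap k (gr k n 0))))

/-- The evaluation `k[x₀, …, xₙ] → K = Γ(Spec K)` at a vector `v`. -/
def evalAt (k : Type u) [Field k] {n : ℕ} {K : Type u} [Field K] [Algebra k K]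
    (v : Fin (n + 1) → K) :
    MvPolynomial (Fin (n + 1)) k →+* Γ(Spec (CommRingCat.of K), ⊤) :=
  (Scheme.ΓSpecIso (CommRingCat.of K)).inv.hom.comp (aeval v).toRingHom

theorem evalAt_irrelevant (k : Type u) [Field k] {n : ℕ} {K : Type u} [Field K] [Algebra k K]
    (v : Fin (n + 1) → K) (hv : v ≠ 0) :
    (HomogeneousIdeal.irrelevant (gr k n)).toIdeal.map (evalAt k v) = ⊤ := by
  obtain ⟨j, hj⟩ := Function.ne_iff.mp hv
  have hX : (X j : MvPolynomial (Fin (n + 1)) k) ∈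
      (HomogeneousIdeal.irrelevant (gr k n)).toIdeal := by
    have := HomogeneousIdeal.mem_irrelevant_of_mem (gr k n) (i := 1) one_pos
      (show X j ∈ gr k n 1 from isHomogeneous_X k j)
    exact this
  refine Ideal.eq_top_of_isUnit_mem _ (Ideal.mem_map_of_mem (evalAt k v) hX) ?_
  have hu : IsUnit (v j) := isUnit_iff_ne_zero.mpr hj
  have : evalAt k v (X j) = (Scheme.ΓSpecIso (CommRingCat.of K)).inv.hom (v j) := by
    simp [evalAt]
  rw [this]
  exact hu.map _

/-- The point `(v₀ : … : vₙ)` of `ℙⁿ` with values in a field extension `K` of `k`. -/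
def homogPoint (k : Type u) [Field k] {n : ℕ} {K : Type u} [Field K] [Algebra k K]
    (v : Fin (n + 1) → K) (hv : v ≠ 0) : Spec (CommRingCat.of K) ⟶ (projSpace k n).left :=
  Proj.fromOfGlobalSections (gr k n) (evalAt k v) (evalAt_irrelevant k v hv)

/-- The standard affine chart `xⱼ ≠ 0` of `ℙⁿ`. -/
def chart (k : Type u) [Field k] (n : ℕ) (j : Fin (n + 1)) : (projSpace k n).left.affineOpens :=
  ⟨Proj.basicOpen (gr k n) (X j),
    Proj.isAffineOpen_basicOpen (gr k n) (X j) (isHomogeneous_X k j) one_pos⟩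

/-- `i` is a closed immersion whose image is the hypersurface `q = 0`, where `q` is a form of
degree `d`: on the chart `xⱼ ≠ 0` its ideal is generated by `q / xⱼ ^ d`. -/
def IsHypersurface {k : Type u} [Field k] {n : ℕ} {Y : Sch k} (i : Y ⟶ projSpace k n)
    (d : ℕ) (q : MvPolynomial (Fin (n + 1)) k) : Prop :=
  IsClosedImmersion i.left ∧ ∃ hq : q ∈ gr k n (d • 1), ∀ j : Fin (n + 1),
    i.left.ker.ideal (chart k n j) = Ideal.span
      {(Proj.awayToSection (gr k n) (X j)).hom
        (HomogeneousLocalization.Away.mk (gr k n) (isHomogeneous_X k j) d q hq)}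

/-- A smooth conic over `k`: a smooth `k`-scheme which is isomorphic to a plane curve `q = 0`,
with `q ≠ 0` a quadratic form in three variables. -/
def IsSmoothConic {k : Type u} [Field k] (C : Sch k) : Prop :=
  Smooth C.hom ∧ ∃ q : MvPolynomial (Fin 3) k, q ≠ 0 ∧
    ∃ i : C ⟶ projSpace k 2, IsHypersurface i 2 q

/-! ## Divisors on a product of two conics and the Brauer product -/

/-- The closed subscheme with ideal sheaf `I` is an effective Cartier divisor: locally, `I` is
generated by one nonzerodivisor. -/
def IsEffectiveCartier {X : Scheme.{u}} (I : X.IdealSheafData) : Prop :=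
  ∀ x : X, ∃ U : X.affineOpens, x ∈ U.1 ∧
    ∃ f ∈ nonZeroDivisors Γ(X, U.1), I.ideal U = Ideal.span {f}

/-- A closed subscheme of `Y_K` is all of `Y_K`, or it is a single reduced `K`-point. (For `Y` a
curve and a divisor on an ambient variety that is restricted to `Y_K`: either the divisor
contains `Y_K`, or its intersection number with `Y_K` is one.) -/
def AllOrOnePoint {k : Type u} [Field k] {Y : Sch k} {K : Type u} [Field K] [Algebra k K]
    (J : (Y ⊗ pt k K).left.IdealSheafData) : Prop :=
  J = ⊥ ∨ IsIso (J.subschemeι ≫ (snd Y (pt k K)).left)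

/-- `D` is a family, parametrized by `T`, of effective divisors of bidegree `(1,1)` on `C₁ × C₂`:
a relative effective Cartier divisor `D ⊆ (C₁ × C₂) × T` over `T` such that, for every geometric
point `t` of `T`, the curves `{p} × C₂` and `C₁ × {q}` that are not contained in the divisor
`D_t` have intersection number one with it. -/
structure IsBidegreeOneOne {k : Type u} [Field k] (C₁ C₂ T : Sch k)
    (D : ((C₁ ⊗ C₂) ⊗ T).left.IdealSheafData) : Prop where
  cartier : IsEffectiveCartier D
  flat : Flat (D.subschemeι ≫ (snd (C₁ ⊗ C₂) T).left)
  fst_ruling : ∀ (K : Type u) [Field K] [IsAlgClosed K] [Algebra k K]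
    (t : pt k K ⟶ T) (p : pt k K ⟶ C₁),
    AllOrOnePoint (Y := C₂) (D.comap
      (lift (lift (snd C₂ (pt k K) ≫ p) (fst C₂ (pt k K))) (snd C₂ (pt k K) ≫ t)).left)
  snd_ruling : ∀ (K : Type u) [Field K] [IsAlgClosed K] [Algebra k K]
    (t : pt k K ⟶ T) (q : pt k K ⟶ C₂),
    AllOrOnePoint (Y := C₁) (D.comap
      (lift (lift (fst C₁ (pt k K)) (snd C₁ (pt k K) ≫ q)) (snd C₁ (pt k K) ≫ t)).left)

/-- `P`, with its universal divisor `𝒟`, is the scheme `P(C₁, C₂)` of divisors of bidegree `(1,1)`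
on `C₁ × C₂` (a component of the Hilbert scheme of `C₁ × C₂`): every family of such divisors is
the pullback of `𝒟` by a unique morphism to `P`. -/
structure IsDivisorScheme {k : Type u} [Field k] (C₁ C₂ P : Sch k)
    (𝒟 : ((C₁ ⊗ C₂) ⊗ P).left.IdealSheafData) : Prop where
  universal_mem : IsBidegreeOneOne C₁ C₂ P 𝒟
  existsUnique : ∀ (T : Sch k) (D : ((C₁ ⊗ C₂) ⊗ T).left.IdealSheafData),
    IsBidegreeOneOne C₁ C₂ T D → ∃! f : T ⟶ P, 𝒟.comap ((C₁ ⊗ C₂) ◁ f).left = D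

/-- The curve `i : C ⟶ P(C₁, C₂)` has degree one. Geometrically `P(C₁, C₂)` is the projective space
`|𝒪(1,1)| ≅ ℙ³`, and for a point `x` of `C₁ × C₂` the divisors through `x` form a hyperplane
`H_x`. Degree one means that such a hyperplane has intersection number one with `C` unless it
contains `C`. The pullback in the definition is the intersection of `C` with `H_x`. -/
def IsDegreeOne {k : Type u} [Field k] {C₁ C₂ P : Sch k}
    (𝒟 : ((C₁ ⊗ C₂) ⊗ P).left.IdealSheafData) {C : Sch k} (i : C ⟶ P) : Prop :=
  ∀ (K : Type u) [Field K] [IsAlgClosed K] [Algebra k K] (x : pt k K ⟶ C₁ ⊗ C₂),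
    AllOrOnePoint (Y := C) (𝒟.comap
      (lift (snd C (pt k K) ≫ x) (fst C (pt k K) ≫ i)).left)

/-- `C` is a Brauer product `C₁ ∗ C₂`: a smooth curve of degree one in `P(C₁, C₂)`, defined over
`k`. -/
def IsBrauerProduct {k : Type u} [Field k] (C₁ C₂ C : Sch k) : Prop :=
  SmoothOfRelativeDimension 1 C.hom ∧
    ∃ (P : Sch k) (𝒟 : ((C₁ ⊗ C₂) ⊗ P).left.IdealSheafData),
      IsDivisorScheme C₁ C₂ P 𝒟 ∧
        ∃ i : C ⟶ P, IsClosedImmersion i.left ∧ IsDegreeOne 𝒟 i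

/-! ## The Grothendieck ring -/

/-- Reduced quasi-projective `k`-schemes. -/
def IsQuasiProjVar {k : Type u} [Field k] (X : Sch k) : Prop :=
  IsReduced X.left ∧ ∃ (n : ℕ) (i : X ⟶ projSpace k n), IsImmersion i.left

/-- The type of reduced quasi-projective `k`-schemes. -/
abbrev Var (k : Type u) [Field k] : Type (u + 1) := {X : Sch k // IsQuasiProjVar X}

/-- The defining relations of the additive group of `K₀[Var_k]`: `[X] = [Y]` if `X` and `Y` are
isomorphic, and `[X] = [Y] + [X ∖ Y]` if `Y` is closed in `X`. -/
inductive GrothendieckRel (k : Type u) [Field k] : FreeAbelianGroup (Var k) → Prop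
  | iso (X Y : Var k) (e : X.1 ≅ Y.1) :
      GrothendieckRel k (FreeAbelianGroup.of X - FreeAbelianGroup.of Y)
  | scissor (X Y U : Var k) (i : Y.1 ⟶ X.1) (j : U.1 ⟶ X.1)
      (hi : IsClosedImmersion i.left) (hj : IsOpenImmersion j.left)
      (hij : Set.range j.left = (Set.range i.left)ᶜ) :
      GrothendieckRel k
        (FreeAbelianGroup.of X - (FreeAbelianGroup.of Y + FreeAbelianGroup.of U))

/-- The additive group of the Grothendieck ring `K₀[Var_k]`. (The multiplication is induced by
`X, Y ↦ X ×ₖ Y`; an equality of classes only involves the additive group.) -/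
abbrev K₀ (k : Type u) [Field k] : Type (u + 1) :=
  FreeAbelianGroup (Var k) ⧸ AddSubgroup.closure {r | GrothendieckRel k r}

/-- The class `[X]` in the Grothendieck ring. -/
def K₀.cls {k : Type u} [Field k] (X : Var k) : K₀ k :=
  QuotientAddGroup.mk (FreeAbelianGroup.of X)

/-! ## Blow-ups -/

/-- `β : B ⟶ X` is the blow-up of the closed subscheme with ideal sheaf `I`: it is universal among
the morphisms for which the inverse image of that subscheme is an effective Cartier divisor. -/
structure IsBlowup {B X : Scheme.{u}} (I : X.IdealSheafData) (β : B ⟶ X) : Prop where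
  cartier : IsEffectiveCartier (I.comap β)
  existsUnique : ∀ (W : Scheme.{u}) (g : W ⟶ X), IsEffectiveCartier (I.comap g) →
    ∃! h : W ⟶ B, h ≫ β = g

/-- The closed subscheme of `X` with ideal sheaf `I`, as a `k`-scheme. -/
def closedSub {k : Type u} [Field k] {X : Sch k} (I : X.left.IdealSheafData) : Sch k :=
  Over.mk (I.subschemeι ≫ X.hom)

/-- The `k`-scheme `Z` is finite of degree two. -/
def IsDegreeTwo {k : Type u} [Field k] (Z : Sch k) : Prop :=
  IsFinite Z.hom ∧ ∀ s, Z.hom.finrank s = 2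

/-- A `k`-scheme `B` that is both the blow-up of `C₁ × C₂` and the blow-up of `C₁ × C` in
isomorphic closed subschemes of degree two, compatibly with the projections to `C₁`. -/
structure BlowupLink {k : Type u} [Field k] (C₁ C₂ C : Sch k) where
  B : Sch k
  Z : (C₁ ⊗ C₂).left.IdealSheafData
  Z' : (C₁ ⊗ C).left.IdealSheafData
  β : B ⟶ C₁ ⊗ C₂
  β' : B ⟶ C₁ ⊗ C
  degree_Z : IsDegreeTwo (closedSub Z)
  degree_Z' : IsDegreeTwo (closedSub Z')
  iso_Z : Nonempty (closedSub Z ≅ closedSub Z')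
  blowup : IsBlowup Z β.left
  blowup' : IsBlowup Z' β'.left
  comp_fst : β ≫ fst C₁ C₂ = β' ≫ fst C₁ C

/-- The quadratic form `x₁² - a x₂² - b x₃²`. -/
def diagForm {k : Type u} [Field k] (a b : k) : MvPolynomial (Fin 3) k :=
  X 0 ^ 2 - MvPolynomial.C a * X 1 ^ 2 - MvPolynomial.C b * X 2 ^ 2

/-- The vector `(x₁y₁ + a x₂y₂, x₁y₂ + x₂y₁, x₃y₃)`. -/
def prodVec {K : Type u} [Field K] (a : K) (x y : Fin 3 → K) : Fin 3 → K :=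
  ![x 0 * y 0 + a * (x 1 * y 1), x 0 * y 1 + x 1 * y 0, x 2 * y 2]

/-- In the homogeneous coordinates given by `i₁`, `i₂`, `i`, the rational map `C₁ × C₂ ⇢ C` that
underlies the link `L` is `(z₁ : z₂ : z₃) = (x₁y₁ + a x₂y₂ : x₁y₂ + x₂y₁ : x₃y₃)`, wherever the
right hand side is defined. -/
def BlowupLink.IsGivenBy {k : Type u} [Field k] {C₁ C₂ C : Sch k} (L : BlowupLink C₁ C₂ C)
    (a : k) (i₁ : C₁ ⟶ projSpace k 2) (i₂ : C₂ ⟶ projSpace k 2) (i : C ⟶ projSpace k 2) : Prop :=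
  ∀ (K : Type u) [Field K] [Algebra k K] (s : pt k K ⟶ L.B) (x y : Fin 3 → K)
    (hx : x ≠ 0) (hy : y ≠ 0) (hz : prodVec (algebraMap k K a) x y ≠ 0),
    (s ≫ L.β ≫ fst C₁ C₂ ≫ i₁).left = homogPoint k x hx →
    (s ≫ L.β ≫ snd C₁ C₂ ≫ i₂).left = homogPoint k y hy →
    (s ≫ L.β' ≫ snd C₁ C ≫ i).left = homogPoint k (prodVec (algebraMap k K a) x y) hz

end Conics

end

open Conics

/-!
The theorem is proved by bringing the three conics into a common normal form and by writing down the
birational map in terms of it.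

*Normal forms.* Let `θ² = eθ + a` generate a separable quadratic algebra with norm form
`N(x₀, x₁) = x₀² + ex₀x₁ - ax₁²`. If `C₁`, `C₂`, `C` are the conics `N = bx₂²`, `N = cx₂²` and `N = bcx₂²`
(a `ConicTriple`), then multiplication `(x₀ + θx₁)(y₀ + θy₁)`, together with `x₂y₂`, is a rational map
`C₁ × C₂ ⇢ C`, the product map. For `e = 0` it is the map in the statement. Where `x₂ ≠ 0` it is defined,
and multiplication with the conjugate of `x` inverts it; so `C₁ × C₂` and `C₁ × C` agree over the open
subset `x₂ ≠ 0` of `C₁`. This gives the birational equivalence. Over the degree two point `x₂ = 0` of `C₁`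
the same argument works with another point of `C₁` over the quadratic algebra, whence the equality of
classes (`ConicTriple.cls_eq`).

*The blow-up.* The product map is undefined at a conjugate pair of points of `C₁ × C₂`, where
`x₂ = y₂ = 0` and `x`, `y` are conjugate. Let `I` be the ideal of this pair. The key is that `I²` is the
ideal generated by the coordinates of the product (`pairIdeal_mul`). On the closure `B` of the graph of
the product map the latter ideal is principal, and hence `I` is invertible on `B`; conversely, where `I`
is generated by a regular element `f`, division by `f²` extends the product map. So `B` is the blow-up
of the pair (`ConicTriple.isBlowup`). As `C₂` and `C` can be exchanged, `B` is also a blow-up of `C₁ × C`.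

*Existence of the normal forms* (`exists_conicTriple`). Smoothness gives each conic a normal form with
`e = 1` and its own quadratic algebra. Over the separable closure, the conics become projective lines,
and the incidence relation "the point `(x, y)` lies on the divisor with parameter `z`" is given by a
form `f` in three pairs of variables. It is trilinear, since the divisors have bidegree `(1, 1)` and the
Brauer product has degree one; it is nondegenerate, since a relative Cartier divisor contains no whole
fibre; and it is equivariant under the Galois group up to factors, since forms with the same zeros are
proportional (`exists_tri_galois`). The Plücker coordinates of the pencil `f` descend to an isotropic
vector of a six-dimensional Albert form over `k` (`IsEquivariant.exists_albert`), and such a vector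
gives a quadratic algebra over which `C₁` and `C₂` both have points (`exists_common_root`). Then `C` has
a point over it, too (`IsEquivariant.hasPt_third`), so that all three conics have normal forms over the
same algebra, with constants `b`, `c`, `d`. Comparing two conjugate coefficients of `f` shows that `bcd` is
a norm (`IsEquivariant.exists_norm_eq`), and hence `d` can be replaced by `bc`.

Schemes are handled through their points with values in arbitrary `k`-schemes: `Coord i h v` says that
the point `h` has homogeneous coordinates `v`, and `HasForm i q` that the points of the image of `i` are
those whose coordinates are zeros of `q`.
-/

open CategoryTheory MonoidalCategory CartesianMonoidalCategory AlgebraicGeometry MvPolynomial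

noncomputable section

namespace Conics

attribute [local instance] MvPolynomial.gradedAlgebra

/-! ### Morphisms to projective space -/

section Basic
variable {k : Type u} [Field k] {n : ℕ}

variable (k) in
theorem X_mem_gr (j : Fin (n + 1)) : X j ∈ gr k n 1 := isHomogeneous_X k j

variable (k) in
/-- The inclusion of the standard affine chart `xⱼ ≠ 0`, with its coordinate ring
`k[x₀, …, xₙ]_(xⱼ)`. -/
def chartι (j : Fin (n + 1)) :
    Spec (.of <| HomogeneousLocalization.Away (gr k n) (X j)) ⟶ (projSpace k n).left :=
  Proj.awayι (gr k n) (X j) (X_mem_gr k j) one_pos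

/-- The structure map `k → Γ(W, ⊤)` of a `k`-scheme. -/
def strHom (W : Sch k) : k →+* Γ(W.left, ⊤) :=
  ((Scheme.ΓSpecIso (CommRingCat.of k)).inv ≫ W.hom.appTop).hom

theorem toSpecΓ_strHom (W : Sch k) :
    W.left.toSpecΓ ≫ Spec.map (CommRingCat.ofHom (strHom W)) = W.hom := by
  have := Scheme.toSpecΓ_naturality W.hom
  rw [strHom, CommRingCat.ofHom_hom, Spec.map_comp, ← reassoc_of% this]
  simp [← SpecMap_ΓSpecIso_hom, ← Spec.map_comp]

theorem strHom_comp {W W' : Sch k} (g : W' ⟶ W) (a : k) :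
    g.left.appTop.hom (strHom W a) = strHom W' a := by
  simp only [strHom, ← Over.w g, Scheme.Hom.comp_appTop, CommRingCat.hom_comp, RingHom.coe_comp,
    Function.comp_apply]

/-- Substitution of global sections for the variables. -/
def coordHom (W : Sch k) (v : Fin (n + 1) → Γ(W.left, ⊤)) :
    MvPolynomial (Fin (n + 1)) k →+* Γ(W.left, ⊤) :=
  eval₂Hom (strHom W) v

/-- The entries of `v` generate the unit ideal. -/
def Unimod {R : Type*} [CommRing R] {ι : Type*} (v : ι → R) : Prop := Ideal.span (Set.range v) = ⊤

theorem Unimod.map {R S : Type*} [CommRing R] [CommRing S] {ι : Type*} {v : ι → R} (hv : Unimod v)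
    (f : R →+* S) : Unimod (fun i => f (v i)) := by
  have := congrArg (Ideal.map f) hv
  rwa [Ideal.map_span, Ideal.map_top, ← Set.range_comp] at this

theorem unimod_of_isUnit {R : Type*} [CommRing R] {ι : Type*} {v : ι → R} {j : ι}
    (h : IsUnit (v j)) : Unimod v :=
  Ideal.eq_top_of_isUnit_mem _ (Ideal.subset_span ⟨j, rfl⟩) h

theorem irrelevant_map_coordHom (W : Sch k) {v : Fin (n + 1) → Γ(W.left, ⊤)} (hv : Unimod v) :
    (HomogeneousIdeal.irrelevant (gr k n)).toIdeal.map (coordHom W v) = ⊤ := by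
  rw [eq_top_iff, ← hv, Ideal.span_le]
  rintro _ ⟨j, rfl⟩
  have hX : (X j : MvPolynomial (Fin (n + 1)) k) ∈
      (HomogeneousIdeal.irrelevant (gr k n)).toIdeal :=
    HomogeneousIdeal.mem_irrelevant_of_mem (gr k n) (i := 1) one_pos (isHomogeneous_X k j)
  simpa [coordHom] using! Ideal.mem_map_of_mem (coordHom W v) hX

/-- The morphism to projective space with homogeneous coordinates `v`. -/
def toProj (W : Sch k) (v : Fin (n + 1) → Γ(W.left, ⊤)) (hv : Unimod v) : W ⟶ projSpace k n :=
  Over.homMk (Proj.fromOfGlobalSections (gr k n) (coordHom W v) (irrelevant_map_coordHom W hv)) (by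
    dsimp [projSpace]
    rw [Proj.fromOfGlobalSections_toSpecZero_assoc, ← Spec.map_comp, ← CommRingCat.ofHom_comp]
    rw [← toSpecΓ_strHom W]
    congr 3
    ext a
    simp [coordHom])

/-- The ring map `k[x₀, …, xₙ]_(xⱼ) → Γ(W, ⊤)` given by a vector whose entry `vⱼ` is a unit. -/
def awayHom (W : Sch k) (v : Fin (n + 1) → Γ(W.left, ⊤)) (j : Fin (n + 1)) (hj : IsUnit (v j)) :
    HomogeneousLocalization.Away (gr k n) (X j) →+* Γ(W.left, ⊤) :=
  (IsLocalization.Away.lift (S := Localization.Away (X j : MvPolynomial (Fin (n + 1)) k))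
    (X j) (g := coordHom W v) (by simpa [coordHom] using hj)).comp
    (algebraMap _ _)

theorem basicOpen_ι_fromOfGlobalSections {A σ : Type*} [CommRing A] [SetLike σ A]
    [AddSubgroupClass σ A] (𝒜 : ℕ → σ) [GradedRing 𝒜] {X : Scheme} (f : A →+* Γ(X, ⊤))
    (hf : (HomogeneousIdeal.irrelevant 𝒜).toIdeal.map f = ⊤) {r : A} {m : ℕ} (hm : 0 < m)
    (hr : r ∈ 𝒜 m) : (X.basicOpen (f r)).ι ≫ Proj.fromOfGlobalSections 𝒜 f hf =
      Proj.toBasicOpenOfGlobalSections 𝒜 f rfl hm hr ≫ (Proj.basicOpen 𝒜 r).ι := by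
  have h := Proj.fromOfGlobalSections_morphismRestrict 𝒜 f hf hm hr
  rw [← Iso.inv_comp_eq] at h
  rw [← h]
  simp [Scheme.isoOfEq_inv]

/-- The pullback of a vector of global sections. -/
def pull {W W' : Sch k} (g : W' ⟶ W) {ι : Type*} (v : ι → Γ(W.left, ⊤)) : ι → Γ(W'.left, ⊤) :=
  fun i => g.left.appTop.hom (v i)

@[simp] theorem pull_apply {W W' : Sch k} (g : W' ⟶ W) {ι : Type*} (v : ι → Γ(W.left, ⊤)) (i : ι) :
    pull g v i = g.left.appTop.hom (v i) := rfl

theorem pull_comp {W W' W'' : Sch k} (h : W'' ⟶ W') (g : W' ⟶ W) {ι : Type*}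
    (v : ι → Γ(W.left, ⊤)) : pull (h ≫ g) v = pull h (pull g v) := by
  ext i
  simp only [pull_apply, Over.comp_left, Scheme.Hom.comp_appTop, CommRingCat.hom_comp,
    RingHom.comp_apply]

theorem pull_id {W : Sch k} {ι : Type*} (v : ι → Γ(W.left, ⊤)) : pull (𝟙 W) v = v := by
  ext i; simp

theorem Unimod.pull {W W' : Sch k} (g : W' ⟶ W) {ι : Type*} {v : ι → Γ(W.left, ⊤)}
    (hv : Unimod v) : Unimod (pull g v) := hv.map _

theorem coordHom_pull {W W' : Sch k} (g : W' ⟶ W) (v : Fin (n + 1) → Γ(W.left, ⊤)) :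
    coordHom W' (pull g v) = g.left.appTop.hom.comp (coordHom W v) := by
  ext <;> simp [coordHom, strHom_comp]

/-- The open subscheme of a `k`-scheme, as a `k`-scheme. -/
def opn (W : Sch k) (U : W.left.Opens) : Sch k := Over.mk (U.ι ≫ W.hom)

/-- The inclusion of an open subscheme. -/
def opnι (W : Sch k) (U : W.left.Opens) : opn W U ⟶ W := Over.homMk U.ι

theorem hom_ext_of_cover {W Y : Sch k} (f g : W ⟶ Y)
    (h : ∀ w : W.left, ∃ U : W.left.Opens, w ∈ U ∧ opnι W U ≫ f = opnι W U ≫ g) : f = g := by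
  choose U hU h using h
  have hc : TopologicalSpace.IsOpenCover U := by
    rw [TopologicalSpace.IsOpenCover, eq_top_iff]
    exact fun x _ => TopologicalSpace.Opens.mem_iSup.mpr ⟨x, hU x⟩
  ext1
  refine Scheme.Cover.hom_ext (W.left.openCoverOfIsOpenCover U hc) _ _ fun x => ?_
  exact congrArg Over.Hom.left (h x)

/-- The restriction of a morphism to open subschemes. -/
def opnMap {W W' : Sch k} (g : W' ⟶ W) (U : W.left.Opens) (U' : W'.left.Opens)
    (h : U' ≤ g.left ⁻¹ᵁ U) : opn W' U' ⟶ opn W U :=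
  Over.homMk (g.left.resLE U U' h) (by simp [opn])

theorem opnMap_ι {W W' : Sch k} (g : W' ⟶ W) (U : W.left.Opens) (U' : W'.left.Opens)
    (h : U' ≤ g.left ⁻¹ᵁ U) : opnMap g U U' h ≫ opnι W U = opnι W' U' ≫ g := by
  ext1; exact Scheme.Hom.resLE_comp_ι _ _

theorem eq_toSpecΓ {W : Scheme.{u}} {R : CommRingCat.{u}} (h : W ⟶ Spec R) :
    h = W.toSpecΓ ≫ Spec.map ((Scheme.ΓSpecIso R).inv ≫ h.appTop) := by
  rw [Spec.map_comp, ← Scheme.toSpecΓ_naturality_assoc]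
  simp

theorem toSpecΓ_cancel {W : Scheme.{u}} {R : CommRingCat.{u}} {φ ψ : R ⟶ Γ(W, ⊤)}
    (h : W.toSpecΓ ≫ Spec.map φ = W.toSpecΓ ≫ Spec.map ψ) : φ = ψ := by
  have h1 := congrArg (fun f => (Scheme.ΓSpecIso R).inv ≫ f.appTop) h
  simpa using h1

theorem isUnit_appTop_basicOpen_ι {X : Scheme.{u}} (a : Γ(X, ⊤)) (U : X.Opens)
    (hU : U ≤ X.basicOpen a) : IsUnit (U.ι.appTop.hom a) := by
  have h : IsUnit ((X.presheaf.map (homOfLE le_top).op).hom a : Γ(X, X.basicOpen a)) :=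
    X.toRingedSpace.isUnit_res_basicOpen a
  have hV : U.ι ''ᵁ ⊤ ≤ X.basicOpen a := by simpa using hU
  have h2 := h.map (X.presheaf.map (homOfLE hV).op).hom
  rw [← RingHom.comp_apply, ← CommRingCat.hom_comp, ← Functor.map_comp] at h2
  exact h2

/-- Where `x = f r` is invertible, the morphism to `Proj` determined by `f` is given by the map that `f`
induces on the degree zero part of the localization at `r`. -/
theorem toBasicOpenOfGlobalSections_ι {A σ : Type u} [CommRing A] [SetLike σ A]
    [AddSubgroupClass σ A] (𝒜 : ℕ → σ) [GradedRing 𝒜] {X : Scheme.{u}} (f : A →+* Γ(X, ⊤))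
    {r : A} {x : Γ(X, ⊤)} (H : f r = x) {m : ℕ} (hm : 0 < m) (hr : r ∈ 𝒜 m)
    (hu : IsUnit (((X.basicOpen x).ι.appTop.hom.comp f) r)) :
    Proj.toBasicOpenOfGlobalSections 𝒜 f H hm hr ≫ (Proj.basicOpen 𝒜 r).ι =
      (X.basicOpen x).toScheme.toSpecΓ ≫ Spec.map (CommRingCat.ofHom
        ((IsLocalization.Away.lift (S := Localization.Away r) r hu).comp (algebraMap _ _))) ≫
        Proj.awayι 𝒜 r hr hm := by
  let e : (X.basicOpen x).toScheme ⟶ Spec (.of (Localization.Away x)) :=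
    (X.isoOfEq (X.toSpecΓ_preimage_basicOpen x)).inv ≫
    X.toSpecΓ ∣_ PrimeSpectrum.basicOpen x ≫ (basicOpenIsoSpecAway x).hom
  have he : e ≫ Spec.map (CommRingCat.ofHom (algebraMap _ (Localization.Away x))) =
      (X.basicOpen x).toScheme.toSpecΓ ≫ Spec.map (X.basicOpen x).ι.appTop := by
    rw [← Scheme.toSpecΓ_naturality]
    simp only [e, Category.assoc]
    rw [basicOpenIsoSpecAway_hom_SpecMap, Scheme.isoOfEq_inv]
    refine (congrArg _ (morphismRestrict_ι _ _)).trans ?_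
    rw [Scheme.homOfLE_ι_assoc]
  rw [eq_toSpecΓ e, Category.assoc, ← Spec.map_comp] at he
  have he2 := toSpecΓ_cancel he
  have h1 : Proj.toBasicOpenOfGlobalSections 𝒜 f H hm hr ≫ (Proj.basicOpen 𝒜 r).ι =
    e ≫ Spec.map (CommRingCat.ofHom (RingHom.comp (IsLocalization.map (M := .powers r)
      (T := .powers x) _ f (by
        rw [← Submonoid.map_le_iff_le_comap, Submonoid.map_powers]; simp [H]))
      (algebraMap _ (Localization.Away r)))) ≫ Proj.awayι 𝒜 r hr hm := by
    simp only [Proj.toBasicOpenOfGlobalSections, Category.assoc, e, Proj.basicOpenIsoSpec_inv_ι]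
  rw [h1, eq_toSpecΓ e, Category.assoc, ← Spec.map_comp_assoc]
  congr 3
  ext1
  simp only [CommRingCat.hom_comp, CommRingCat.hom_ofHom]
  rw [← RingHom.comp_assoc]
  congr 1
  refine IsLocalization.ringHom_ext (Submonoid.powers r) ?_
  rw [IsLocalization.Away.lift_comp, RingHom.comp_assoc, IsLocalization.map_comp,
    ← RingHom.comp_assoc]
  congr 1
  have h := congrArg CommRingCat.Hom.hom he2
  simpa only [CommRingCat.hom_comp, CommRingCat.hom_ofHom] using! h

theorem isUnit_pull_basicOpen (W : Sch k) (a : Γ(W.left, ⊤)) (U : W.left.Opens)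
    (hU : U ≤ W.left.basicOpen a) : IsUnit ((opnι W U).left.appTop.hom a) :=
  isUnit_appTop_basicOpen_ι a U hU

/-- The morphism to a chart of projective space. -/
def awayMor (W : Sch k) (v : Fin (n + 1) → Γ(W.left, ⊤)) (j : Fin (n + 1)) (hj : IsUnit (v j)) :
    W.left ⟶ (projSpace k n).left :=
  W.left.toSpecΓ ≫ Spec.map (CommRingCat.ofHom (awayHom W v j hj)) ≫ chartι k j

theorem awayHom_pull {W W' : Sch k} (g : W' ⟶ W) (v : Fin (n + 1) → Γ(W.left, ⊤))
    (j : Fin (n + 1)) (hj : IsUnit (v j)) (hj' : IsUnit (pull g v j)) :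
    awayHom W' (pull g v) j hj' = g.left.appTop.hom.comp (awayHom W v j hj) := by
  unfold awayHom
  rw [← RingHom.comp_assoc]
  congr 1
  refine IsLocalization.ringHom_ext (Submonoid.powers (X j : MvPolynomial (Fin (n + 1)) k)) ?_
  rw [IsLocalization.Away.lift_comp, RingHom.comp_assoc, IsLocalization.Away.lift_comp,
    coordHom_pull]

theorem comp_awayMor {W W' : Sch k} (g : W' ⟶ W) (v : Fin (n + 1) → Γ(W.left, ⊤))
    (j : Fin (n + 1)) (hj : IsUnit (v j)) (hj' : IsUnit (pull g v j)) :
    g.left ≫ awayMor W v j hj = awayMor W' (pull g v) j hj' := by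
  unfold awayMor
  rw [awayHom_pull g v j hj, CommRingCat.ofHom_comp, Spec.map_comp, Category.assoc,
    Scheme.toSpecΓ_naturality_assoc, CommRingCat.ofHom_hom]

/-- Where `vⱼ` is invertible, `toProj` is the morphism to the `j`-th chart. -/
theorem basicOpen_ι_toProj (W : Sch k) (v : Fin (n + 1) → Γ(W.left, ⊤)) (hv : Unimod v)
    (j : Fin (n + 1)) (hj : IsUnit (pull (opnι W (W.left.basicOpen (v j))) v j)) :
    (opnι W (W.left.basicOpen (v j)) ≫ toProj W v hv).left =
      awayMor (opn W (W.left.basicOpen (v j))) (pull (opnι W _) v) j hj := by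
  have hX : coordHom W v (X j) = v j := by simp [coordHom]
  have hju : IsUnit (pull (opnι W (W.left.basicOpen (coordHom W v (X j)))) v j) :=
    isUnit_pull_basicOpen W (v j) _ (by rw [hX])
  suffices H : (opnι W (W.left.basicOpen (coordHom W v (X j))) ≫ toProj W v hv).left =
      awayMor _ (pull (opnι W (W.left.basicOpen (coordHom W v (X j)))) v) j hju by
    revert H hju hj
    rw [hX]
    exact fun _ _ H => H
  refine (basicOpen_ι_fromOfGlobalSections (gr k n) _ _ one_pos (X_mem_gr k j)).trans ?_
  have hu : IsUnit (((W.left.basicOpen (coordHom W v (X j))).ι.appTop.hom.comp (coordHom W v))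
      (X j)) := by
    rw [RingHom.comp_apply]
    exact isUnit_appTop_basicOpen_ι _ _ le_rfl
  refine (toBasicOpenOfGlobalSections_ι (gr k n) (coordHom W v) rfl one_pos
        (X_mem_gr k j) hu).trans ?_
  have hh : awayHom _ (pull (opnι W (W.left.basicOpen (coordHom W v (X j)))) v) j hju =
      (IsLocalization.Away.lift (S := Localization.Away (X j : MvPolynomial (Fin (n + 1)) k))
        (X j) hu).comp (algebraMap _ _) := by
    have key : ∀ (g : MvPolynomial (Fin (n + 1)) k →+*
        Γ((W.left.basicOpen (coordHom W v (X j))).toScheme, ⊤)) (hg : IsUnit (g (X j))),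
        g = (W.left.basicOpen (coordHom W v (X j))).ι.appTop.hom.comp (coordHom W v) →
        IsLocalization.Away.lift (S := Localization.Away (X j : MvPolynomial (Fin (n + 1)) k))
          (X j) hg = IsLocalization.Away.lift (X j) hu := by
      rintro _ _ rfl
      rfl
    exact congrArg (fun h => RingHom.comp h (algebraMap
      (HomogeneousLocalization.Away (gr k n) (X j)) _)) (key _ _ (coordHom_pull (opnι W _) v))
  unfold awayMor
  rw [hh]
  rfl

end Basic

/-! ### Homogeneous coordinates -/

section Points
variable {k : Type u} [Field k] {n : ℕ}

/-- Lift of a morphism to an open subscheme containing its image. -/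
def opnLift {W' W : Sch k} (h : W' ⟶ W) (U : W.left.Opens) (hU : ∀ x, h.left x ∈ U) :
    W' ⟶ opn W U :=
  have hr : Set.range h.left ⊆ Set.range U.ι := by
    rintro _ ⟨x, rfl⟩; rw [Scheme.Opens.range_ι]; exact hU x
  let l : W'.left ⟶ U.toScheme := IsOpenImmersion.lift U.ι h.left hr
  Over.homMk l (by
    change l ≫ U.ι ≫ W.hom = _
    rw [IsOpenImmersion.lift_fac_assoc, Over.w])

theorem opnLift_ι {W' W : Sch k} (h : W' ⟶ W) (U : W.left.Opens) (hU : ∀ x, h.left x ∈ U) :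
    opnLift h U hU ≫ opnι W U = h := by
  ext1
  exact IsOpenImmersion.lift_fac U.ι h.left _

theorem mem_basicOpen_of_isUnit {W' W : Sch k} (h : W' ⟶ W) (a : Γ(W.left, ⊤))
    (ha : IsUnit (h.left.appTop.hom a)) (x : W'.left) : h.left x ∈ W.left.basicOpen a := by
  have h1 := Scheme.preimage_basicOpen_top h.left a
  have h2 : x ∈ W'.left.basicOpen (h.left.appTop a) := by
    rw [Scheme.basicOpen_of_isUnit _ ha]; trivial
  rw [← h1] at h2
  exact h2

theorem exists_mem_basicOpen {W : Sch k} {v : Fin (n + 1) → Γ(W.left, ⊤)} (hv : Unimod v)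
    (w : W.left) : ∃ j, w ∈ W.left.basicOpen (v j) := by
  have h := iSup_basicOpen_of_span_eq_top (X := W.left) ⊤ _ hv
  have h2 : w ∈ (⊤ : W.left.Opens) := trivial
  rw [← h] at h2
  simpa using h2

/-- A morphism lands in the chart `xⱼ ≠ 0` when the `j`-th coordinate becomes invertible. -/
theorem comp_toProj_of_isUnit {W' W : Sch k} (h : W' ⟶ W) (v : Fin (n + 1) → Γ(W.left, ⊤))
    (hv : Unimod v) (j : Fin (n + 1)) (hj : IsUnit (pull h v j)) :
    (h ≫ toProj W v hv).left = awayMor W' (pull h v) j hj := by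
  obtain ⟨l, rfl⟩ : ∃ l : W' ⟶ opn W (W.left.basicOpen (v j)), l ≫ opnι W _ = h :=
    ⟨opnLift h _ (mem_basicOpen_of_isUnit h _ hj), opnLift_ι _ _ _⟩
  have hj0 : IsUnit (pull (opnι W (W.left.basicOpen (v j))) v j) :=
    isUnit_pull_basicOpen W (v j) _ le_rfl
  have hj1 : IsUnit (pull l (pull (opnι W _) v) j) := by rwa [← pull_comp]
  rw [Category.assoc, Over.comp_left, basicOpen_ι_toProj W v hv j hj0, comp_awayMor _ _ _ _ hj1]
  congr 1

theorem toProj_left_of_isUnit (W : Sch k) (v : Fin (n + 1) → Γ(W.left, ⊤))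
    (hv : Unimod v) (j : Fin (n + 1)) (hj : IsUnit (v j)) :
    (toProj W v hv).left = awayMor W v j hj := by
  have := comp_toProj_of_isUnit (𝟙 W) v hv j (by simpa using hj)
  simpa [pull_id] using! this

theorem comp_toProj {W' W : Sch k} (g : W' ⟶ W) (v : Fin (n + 1) → Γ(W.left, ⊤))
    (hv : Unimod v) : g ≫ toProj W v hv = toProj W' (pull g v) (hv.pull g) := by
  refine hom_ext_of_cover _ _ fun w => ?_
  obtain ⟨j, hj⟩ := exists_mem_basicOpen (hv.pull g) w
  refine ⟨_, hj, ?_⟩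
  have hu := isUnit_pull_basicOpen W' (pull g v j) _ le_rfl
  ext1
  rw [comp_toProj_of_isUnit _ _ _ j hu, ← Category.assoc, comp_toProj_of_isUnit _ _ _ j
    (by rw [pull_comp]; exact hu)]
  congr 1

/-- The constants in the coordinate ring of a standard chart. -/
def constHom (k : Type u) [Field k] (n : ℕ) (j : Fin (n + 1)) :
    k →+* HomogeneousLocalization.Away (gr k n) (X j) :=
  (HomogeneousLocalization.fromZeroRingHom (gr k n) _).comp (algebraMap k (gr k n 0))

/-- The coordinate `xᵢ / xⱼ` on a standard chart. -/
def chartCoord (k : Type u) [Field k] {n : ℕ} (j i : Fin (n + 1)) :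
    HomogeneousLocalization.Away (gr k n) (X j) :=
  HomogeneousLocalization.Away.mk (gr k n) (X_mem_gr k j) 1 (X i)
    (by simpa using X_mem_gr k i)

theorem eval₂_mul_of_isHomogeneous {σ R S : Type*} [CommSemiring R] [CommSemiring S] (c : R →+* S)
    (w : σ → S) (u : S) {d : ℕ} {f : MvPolynomial σ R} (hf : f.IsHomogeneous d) :
    eval₂ c (fun i => u * w i) f = u ^ d * eval₂ c w f := by
  rw [eval₂_eq, eval₂_eq, Finset.mul_sum]
  refine Finset.sum_congr rfl fun m hm => ?_
  have h := hf (mem_support_iff.mp hm)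
  simp only [mul_pow, Finset.prod_mul_distrib, Finset.prod_pow_eq_pow_sum]
  rw [← h, Finsupp.weight_apply, Finsupp.sum]
  simp only [Pi.one_apply, smul_eq_mul, mul_one]
  ring

theorem val_constHom (j : Fin (n + 1)) (a : k) : (constHom k n j a).val =
    algebraMap (MvPolynomial (Fin (n + 1)) k) _ (MvPolynomial.C a) := by
  rw [← Localization.mk_one_eq_algebraMap]
  rfl

/-- Dehomogenization: `f / xⱼᵈ` is the value of `f` at the chart coordinates. -/
theorem away_mk_eq (j : Fin (n + 1)) (d : ℕ) (f : MvPolynomial (Fin (n + 1)) k)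
    (hf : f ∈ gr k n (d • 1)) : HomogeneousLocalization.Away.mk (gr k n) (X_mem_gr k j) d f hf =
      eval₂ (constHom k n j) (chartCoord k j) f := by
  have hf' : f.IsHomogeneous d := by simpa using hf
  apply HomogeneousLocalization.val_injective
  let ψ := algebraMap (MvPolynomial (Fin (n + 1)) k)
    (Localization.Away (X j : MvPolynomial (Fin (n + 1)) k))
  let val := algebraMap (HomogeneousLocalization.Away (gr k n) (X j))
    (Localization.Away (X j : MvPolynomial (Fin (n + 1)) k))
  have hu : IsUnit (ψ (X j)) := IsLocalization.Away.algebraMap_isUnit _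
  have h1 : ∀ (d : ℕ) (f : MvPolynomial (Fin (n + 1)) k) (hf : f ∈ gr k n (d • 1)),
      ψ (X j) ^ d * val (HomogeneousLocalization.Away.mk (gr k n) (X_mem_gr k j) d f hf) = ψ f := by
    intro d f hf
    change _ * (HomogeneousLocalization.Away.mk (gr k n) (X_mem_gr k j) d f hf).val = _
    rw [HomogeneousLocalization.Away.val_mk, ← map_pow, Localization.mk_eq_mk']
    exact IsLocalization.mk'_spec' _ f ⟨X j ^ d, _⟩
  refine (hu.pow d).mul_left_cancel ((h1 d f hf).trans ?_)
  change _ = _ * val (eval₂ _ _ _)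
  rw [hom_eval₂, ← eval₂_mul_of_isHomogeneous _ _ _ hf']
  have h2 : (fun i => ψ (X j) * (val ∘ chartCoord k j) i) = fun i => ψ (X i) := by
    funext i
    have := h1 1 (X i) (by simpa using X_mem_gr k i)
    rwa [pow_one] at this
  have h3 : val.comp (constHom k n j) = ψ.comp MvPolynomial.C := by
    ext a
    exact val_constHom j a
  rw [h3]
  change _ = eval₂ _ (fun i => ψ (X j) * (val ∘ chartCoord k j) i) f
  rw [h2]
  conv_lhs => rw [← eval₂_eta f, eval₂_comp_left]
  rfl

theorem away_ringHom_ext {R : Type*} [CommRing R] (j : Fin (n + 1))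
    {φ ψ : HomogeneousLocalization.Away (gr k n) (X j) →+* R}
    (h0 : φ.comp (constHom k n j) = ψ.comp (constHom k n j))
    (h1 : ∀ i, φ (chartCoord k j i) = ψ (chartCoord k j i)) : φ = ψ := by
  ext t
  obtain ⟨d, f, hf, rfl⟩ := HomogeneousLocalization.Away.mk_surjective (gr k n) (X_mem_gr k j) t
  rw [away_mk_eq, hom_eval₂, hom_eval₂, h0]
  congr 1
  funext i
  exact h1 i

theorem awayHom_mk (W : Sch k) (v : Fin (n + 1) → Γ(W.left, ⊤)) (j : Fin (n + 1))
    (hj : IsUnit (v j)) (d : ℕ) (f : MvPolynomial (Fin (n + 1)) k) (hf : f ∈ gr k n (d • 1)) :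
    v j ^ d * awayHom W v j hj
      (HomogeneousLocalization.Away.mk (gr k n) (X_mem_gr k j) d f hf) = coordHom W v f := by
  let L := (IsLocalization.Away.lift (S := Localization.Away (X j : MvPolynomial (Fin (n + 1)) k))
    (X j) (g := coordHom W v) (by simpa [coordHom] using hj))
  have hL : ∀ f, L (algebraMap _ _ f) = coordHom W v f := fun f =>
    IsLocalization.Away.lift_eq _ _ _
  change v j ^ d * L (HomogeneousLocalization.Away.mk (gr k n) (X_mem_gr k j) d f hf).val = _
  have hX : coordHom W v (X j) = v j := by simp [coordHom]
  rw [← hX, ← map_pow, ← hL, ← map_mul, HomogeneousLocalization.Away.val_mk,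
    Localization.mk_eq_mk', ← hL]
  congr 1
  exact IsLocalization.mk'_spec' _ f ⟨X j ^ d, _⟩

theorem awayHom_chartCoord (W : Sch k) (v : Fin (n + 1) → Γ(W.left, ⊤)) (j : Fin (n + 1))
    (hj : IsUnit (v j)) (i : Fin (n + 1)) : v j * awayHom W v j hj (chartCoord k j i) = v i := by
  have := awayHom_mk W v j hj 1 (X i) (by simpa using X_mem_gr k i)
  rw [pow_one] at this
  exact this.trans (by simp [coordHom])

theorem awayHom_comp_constHom (W : Sch k) (v : Fin (n + 1) → Γ(W.left, ⊤)) (j : Fin (n + 1))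
    (hj : IsUnit (v j)) : (awayHom W v j hj).comp (constHom k n j) = strHom W := by
  ext a
  have : constHom k n j a = HomogeneousLocalization.Away.mk (gr k n) (X_mem_gr k j) 0
      (MvPolynomial.C a) (by simp) := by
    apply HomogeneousLocalization.val_injective
    rw [HomogeneousLocalization.Away.val_mk]
    simp only [pow_zero]
    rfl
  have h := awayHom_mk W v j hj 0 (MvPolynomial.C a) (by simp)
  rw [pow_zero, one_mul, ← this] at h
  exact h.trans (by simp [coordHom])

/-- Sections are equal if they are equal on the members of an open cover. -/
theorem section_ext_of_cover {W : Sch k} (a b : Γ(W.left, ⊤))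
    (h : ∀ w : W.left, ∃ U : W.left.Opens, w ∈ U ∧
      (opnι W U).left.appTop.hom a = (opnι W U).left.appTop.hom b) : a = b := by
  choose U hU h using h
  have hc : TopologicalSpace.IsOpenCover U := by
    rw [TopologicalSpace.IsOpenCover, eq_top_iff]
    exact fun x _ => TopologicalSpace.Opens.mem_iSup.mpr ⟨x, hU x⟩
  rw [← sub_eq_zero]
  refine Scheme.zero_of_zero_cover _ (W.left.openCoverOfIsOpenCover U hc) fun x => ?_
  have := sub_eq_zero.mpr (h x)
  rw [← map_sub] at this
  exact this

theorem chartι_hom (j : Fin (n + 1)) : chartι k j ≫ (projSpace k n).hom =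
    Spec.map (CommRingCat.ofHom (constHom k n j)) := by
  change Proj.awayι _ _ _ _ ≫ Proj.toSpecZero (gr k n) ≫ _ = _
  rw [Proj.awayι_toSpecZero_assoc, ← Spec.map_comp]
  rfl

instance (j : Fin (n + 1)) : IsOpenImmersion (chartι k j) :=
  inferInstanceAs (IsOpenImmersion (Proj.awayι _ _ _ _))

theorem range_chartι (j : Fin (n + 1)) :
    Set.range (chartι k j) = (Proj.basicOpen (gr k n) (X j) : Set (Proj (gr k n))) :=
  congrArg (fun U : (Proj (gr k n)).Opens => U.carrier)
    (Proj.opensRange_awayι (gr k n) (X j) (X_mem_gr k j) one_pos)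

theorem exists_eq_toProj_of_comp_chartι {W : Sch k} (g : W ⟶ projSpace k n) (j : Fin (n + 1))
    (l : W.left ⟶ Spec (.of <| HomogeneousLocalization.Away (gr k n) (X j)))
    (hl : l ≫ chartι k j = g.left) :
    ∃ (s : Fin (n + 1) → Γ(W.left, ⊤)) (hs : Unimod s), s j = 1 ∧ g = toProj W s hs ∧
      ∀ hu : IsUnit (s j), awayHom W s j hu = ((Scheme.ΓSpecIso _).inv ≫ l.appTop).hom := by
  have h1 := eq_toSpecΓ l
  set φ : CommRingCat.of (HomogeneousLocalization.Away (gr k n) (X j)) ⟶ Γ(W.left, ⊤) :=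
    (Scheme.ΓSpecIso _).inv ≫ l.appTop with hφ
  clear_value φ
  subst h1
  have hs1 : φ.hom (chartCoord k j j) = 1 := by
    rw [← map_one φ.hom]
    congr 1
    apply HomogeneousLocalization.val_injective
    rw [chartCoord, HomogeneousLocalization.Away.val_mk, HomogeneousLocalization.val_one,
      Localization.mk_eq_mk', IsLocalization.mk'_eq_iff_eq_mul]
    simp
  have hu : IsUnit ((fun i => φ.hom (chartCoord k j i)) j) := by
    change IsUnit (φ.hom (chartCoord k j j)); rw [hs1]; exact isUnit_one
  have key : awayHom W (fun i => φ.hom (chartCoord k j i)) j hu = φ.hom := by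
    have h2 := Over.w g
    rw [← hl, Category.assoc, Category.assoc, chartι_hom, ← Spec.map_comp, ← toSpecΓ_strHom] at h2
    have h3 := congrArg CommRingCat.Hom.hom (toSpecΓ_cancel h2)
    refine away_ringHom_ext j ?_ fun i => ?_
    · rw [awayHom_comp_constHom]
      exact h3.symm
    · have := awayHom_chartCoord W (fun i => φ.hom (chartCoord k j i)) j hu i
      dsimp only at this
      rwa [hs1, one_mul] at this
  refine ⟨fun i => φ.hom (chartCoord k j i), unimod_of_isUnit hu, hs1, ?_, fun _ => key⟩
  ext1
  rw [toProj_left_of_isUnit _ _ _ j hu, ← hl, awayMor, Category.assoc, key]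
  rfl

/-- A morphism into a standard chart is given by a vector with an entry `1`. -/
theorem exists_eq_toProj {W : Sch k} (g : W ⟶ projSpace k n) (j : Fin (n + 1))
    (hg : ∀ x, g.left x ∈ (chart k n j).1) :
    ∃ (s : Fin (n + 1) → Γ(W.left, ⊤)) (hs : Unimod s), s j = 1 ∧ g = toProj W s hs := by
  have hr : Set.range g.left ⊆ Set.range (chartι k j) := by
    rintro _ ⟨x, rfl⟩; rw [range_chartι]; exact hg x
  obtain ⟨s, hs, h1, h2, -⟩ := exists_eq_toProj_of_comp_chartι g j
    (IsOpenImmersion.lift _ _ hr) (IsOpenImmersion.lift_fac _ _ _)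
  exact ⟨s, hs, h1, h2⟩

theorem exists_mem_chart (x : (projSpace k n).left) : ∃ j, x ∈ (chart k n j).1 := by
  have h : (⨆ j : Fin (n + 1), Proj.basicOpen (gr k n) (X j)) = ⊤ := by
    refine Proj.iSup_basicOpen_eq_top' _ _ (fun j => ⟨1, X_mem_gr k j⟩) ?_
    rw [eq_top_iff]
    rintro p -
    induction p using MvPolynomial.induction_on with
    | C a => exact Subalgebra.algebraMap_mem _ (algebraMap k (gr k n 0) a)
    | add p q hp hq => exact add_mem hp hq
    | mul_X p i hp => exact mul_mem hp (Algebra.subset_adjoin ⟨i, rfl⟩)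
  have h2 : x ∈ (⊤ : (Proj (gr k n)).Opens) := trivial
  rw [← h] at h2
  exact TopologicalSpace.Opens.mem_iSup.mp h2

/-- Every morphism to projective space is locally given by homogeneous coordinates. -/
theorem exists_local_eq_toProj {W : Sch k} (g : W ⟶ projSpace k n) (w : W.left) :
    ∃ U : W.left.Opens, w ∈ U ∧ ∃ (s : Fin (n + 1) → Γ((opn W U).left, ⊤)) (hs : Unimod s),
      (∃ j, s j = 1) ∧ opnι W U ≫ g = toProj (opn W U) s hs := by
  obtain ⟨j, hj⟩ := exists_mem_chart (g.left w)
  refine ⟨g.left ⁻¹ᵁ (chart k n j).1, hj, ?_⟩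
  obtain ⟨s, hs, h1, h2⟩ := exists_eq_toProj (opnι W (g.left ⁻¹ᵁ (chart k n j).1) ≫ g) j
    (fun x => x.2)
  exact ⟨s, hs, ⟨j, h1⟩, h2⟩

theorem toProj_congr_of_isUnit {W : Sch k} {v w : Fin (n + 1) → Γ(W.left, ⊤)} (hv : Unimod v)
    (hw : Unimod w) (h : ∀ i j, v i * w j = v j * w i) {j : Fin (n + 1)} (hj : IsUnit (v j)) :
    toProj W v hv = toProj W w hw := by
  have hwj : IsUnit (w j) := by
    rw [← Ideal.span_singleton_eq_top, eq_top_iff, ← hw, Ideal.span_le]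
    rintro _ ⟨i, rfl⟩
    refine Ideal.mem_span_singleton'.mpr ?_
    obtain ⟨u, hu⟩ := hj
    refine ⟨↑u⁻¹ * v i, ?_⟩
    rw [mul_assoc, h i j, ← hu, Units.inv_mul_cancel_left]
  ext1
  rw [toProj_left_of_isUnit _ _ _ j hj, toProj_left_of_isUnit _ _ _ j hwj, awayMor, awayMor]
  congr 4
  refine away_ringHom_ext j ?_ fun i => ?_
  · rw [awayHom_comp_constHom, awayHom_comp_constHom]
  · refine (hj.mul hwj).mul_left_cancel ?_
    rw [mul_right_comm, awayHom_chartCoord, mul_assoc, awayHom_chartCoord, h]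

theorem toProj_congr {W : Sch k} {v w : Fin (n + 1) → Γ(W.left, ⊤)} (hv : Unimod v)
    (hw : Unimod w) (h : ∀ i j, v i * w j = v j * w i) : toProj W v hv = toProj W w hw := by
  refine hom_ext_of_cover _ _ fun x => ?_
  obtain ⟨j, hj⟩ := exists_mem_basicOpen hv x
  refine ⟨_, hj, ?_⟩
  rw [comp_toProj, comp_toProj]
  refine toProj_congr_of_isUnit _ _ (fun i j => ?_) (j := j) (isUnit_pull_basicOpen W _ _ le_rfl)
  simpa using congrArg (opnι W _).left.appTop.hom (h i j)

theorem preimage_chart_toProj {W : Sch k} {v : Fin (n + 1) → Γ(W.left, ⊤)} (hv : Unimod v)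
    (j : Fin (n + 1)) : (toProj W v hv).left ⁻¹ᵁ (chart k n j).1 = W.left.basicOpen (v j) := by
  have := Proj.fromOfGlobalSections_preimage_basicOpen (gr k n) (coordHom W v)
    (irrelevant_map_coordHom W hv) one_pos (X_mem_gr k j)
  rwa [show coordHom W v (X j) = v j by simp [coordHom]] at this

theorem toProj_eq_iff {W : Sch k} {v w : Fin (n + 1) → Γ(W.left, ⊤)} (hv : Unimod v)
    (hw : Unimod w) : toProj W v hv = toProj W w hw ↔ ∀ i j, v i * w j = v j * w i := by
  refine ⟨fun h i j => ?_, toProj_congr hv hw⟩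
  refine section_ext_of_cover _ _ fun x => ?_
  obtain ⟨l, hl⟩ := exists_mem_basicOpen hv x
  refine ⟨_, hl, ?_⟩
  set U := W.left.basicOpen (v l) with hU
  have hvl : IsUnit (pull (opnι W U) v l) := isUnit_pull_basicOpen W _ _ le_rfl
  have hwl : IsUnit (pull (opnι W U) w l) := by
    refine isUnit_pull_basicOpen W _ _ ?_
    rw [← preimage_chart_toProj hw, ← h, preimage_chart_toProj hv]
  have h1 := congrArg (fun f => (opnι W U ≫ f).left) h
  rw [comp_toProj_of_isUnit _ _ _ l hvl, comp_toProj_of_isUnit _ _ _ l hwl] at h1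
  unfold awayMor at h1
  rw [← Category.assoc, ← Category.assoc, cancel_mono] at h1
  have h2 := congrArg CommRingCat.Hom.hom (toSpecΓ_cancel h1)
  rw [CommRingCat.hom_ofHom, CommRingCat.hom_ofHom] at h2
  have e1 := awayHom_chartCoord _ (pull (opnι W U) v) l hvl
  have e2 := awayHom_chartCoord _ (pull (opnι W U) w) l hwl
  rw [map_mul, map_mul]
  change pull (opnι W U) v i * pull (opnι W U) w j = pull (opnι W U) v j * pull (opnι W U) w i
  rw [← e1 i, ← e1 j, ← e2 i, ← e2 j, h2]
  ring

end Points

/-! ### Hypersurfaces and their functors of points -/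

section Hypersurface
variable {k : Type u} [Field k] {n : ℕ}

/-- The identification of the coordinate ring of a standard chart with its ring of sections. -/
abbrev chartSec (k : Type u) [Field k] (n : ℕ) (j : Fin (n + 1)) :
    HomogeneousLocalization.Away (gr k n) (X j) →+* Γ((projSpace k n).left, (chart k n j).1) :=
  (Proj.awayToSection (gr k n) (X j)).hom

theorem chartSec_bijective (j : Fin (n + 1)) : Function.Bijective (chartSec k n j) := by
  have := (Proj.basicOpenIsoAway (gr k n) (X j) (X_mem_gr k j) one_pos).isIso_hom
  rw [Proj.basicOpenIsoAway_hom] at this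
  exact ConcreteCategory.bijective_of_isIso (Proj.awayToSection (gr k n) (X j))

theorem top_le_preimage_chartι (j : Fin (n + 1)) : ⊤ ≤ chartι k j ⁻¹ᵁ (chart k n j).1 := by
  intro x _
  have : chartι k j x ∈ Set.range (chartι k j) := ⟨x, rfl⟩
  rwa [range_chartι] at this

theorem appLE_congr_hom {X Y : Scheme.{u}} {f g : X ⟶ Y} (h : f = g) (U : Y.Opens) (V : X.Opens)
    (e : V ≤ f ⁻¹ᵁ U) (e' : V ≤ g ⁻¹ᵁ U) : f.appLE U V e = g.appLE U V e' := by
  subst h; rfl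

theorem comp_appLE_top {X Y Z : Scheme.{u}} (f : X ⟶ Y) (g : Y ⟶ Z) (U : Z.Opens)
    (e : ⊤ ≤ g ⁻¹ᵁ U) (e' : ⊤ ≤ (f ≫ g) ⁻¹ᵁ U) :
    (f ≫ g).appLE U ⊤ e' = g.appLE U ⊤ e ≫ f.appTop := by
  have : f.appTop = f.appLE ⊤ ⊤ le_rfl := Scheme.Hom.app_eq_appLE f
  rw [this]
  exact (Scheme.Hom.appLE_comp_appLE f g U ⊤ ⊤ e le_rfl).symm

theorem awayToSection_appLE_chartι (j : Fin (n + 1)) :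
    Proj.awayToSection (gr k n) (X j) ≫ (chartι k j).appLE (chart k n j).1 ⊤
      (top_le_preimage_chartι j) = (Scheme.ΓSpecIso _).inv := by
  set e := Proj.basicOpenIsoSpec (gr k n) (X j) (X_mem_gr k j) one_pos with he
  have h1 := Proj.basicOpenToSpec_app_top (gr k n) (X j)
  have h2 : e.hom ≫ chartι k j = (Proj.basicOpen (gr k n) (X j)).ι := by
    simp only [chartι, Proj.awayι, e]
    exact Iso.hom_inv_id_assoc _ _
  have h3 : (chartι k j).appLE (chart k n j).1 ⊤ (top_le_preimage_chartι j) ≫ e.hom.appTop =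
      (Proj.basicOpen (gr k n) (X j)).topIso.inv := by
    have hle : ⊤ ≤ (Proj.basicOpen (gr k n) (X j)).ι ⁻¹ᵁ (chart k n j).1 := fun x _ => x.2
    rw [← comp_appLE_top _ _ _ _ (by rw [h2]; exact hle),
      appLE_congr_hom h2 _ _ _ hle]
    exact (Scheme.Opens.ι_appLE (Proj.basicOpen (gr k n) (X j)) _ _ _).trans
      (Scheme.Opens.topIso_inv _).symm
  have h4 : IsIso e.hom.appTop := inferInstanceAs (IsIso (e.hom.app ⊤))
  rw [← cancel_mono e.hom.appTop]
  refine (Category.assoc _ _ _).trans ((congrArg _ h3).trans ?_)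
  rw [Iso.eq_inv_comp, ← h1]
  rfl

theorem appLE_chartSec {W : Sch k} {s : Fin (n + 1) → Γ(W.left, ⊤)} (hs : Unimod s)
    {j : Fin (n + 1)} (hj : IsUnit (s j)) {g : W ⟶ projSpace k n} (hg : g = toProj W s hs)
    (hle : ⊤ ≤ g.left ⁻¹ᵁ (chart k n j).1) (t) :
    (g.left.appLE (chart k n j).1 ⊤ hle).hom (chartSec k n j t) = awayHom W s j hj t := by
  have h1 : g.left = (W.left.toSpecΓ ≫ Spec.map (CommRingCat.ofHom (awayHom W s j hj))) ≫
      chartι k j := by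
    rw [hg, toProj_left_of_isUnit _ _ _ j hj, awayMor, Category.assoc]
  rw [appLE_congr_hom h1 _ _ _ (h1 ▸ hle), comp_appLE_top _ _ _ (top_le_preimage_chartι j)]
  have h2 := RingHom.congr_fun (congrArg CommRingCat.Hom.hom
    (awayToSection_appLE_chartι (k := k) (n := n) j)) t
  have h3 : ∀ x, ((W.left.toSpecΓ ≫ Spec.map (CommRingCat.ofHom (awayHom W s j hj))).appTop.hom
      ((Scheme.ΓSpecIso _).inv.hom x)) = awayHom W s j hj x := by
    intro x
    rw [Scheme.Hom.comp_appTop, ← CommRingCat.comp_apply, ← Category.assoc,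
      ← Scheme.ΓSpecIso_inv_naturality]
    simp
  exact (congrArg _ h2).trans (h3 t)

/-- The functor of points of the hypersurface `q = 0`: `i` is a closed immersion, and a point of
projective space with homogeneous coordinates `v` factors through `i` exactly when `q(v) = 0`. -/
structure HasForm {Y : Sch k} (i : Y ⟶ projSpace k n) (q : MvPolynomial (Fin (n + 1)) k) :
    Prop where
  closed : IsClosedImmersion i.left
  coord_eq_zero : ∀ {W : Sch k} (h : W ⟶ Y) {v : Fin (n + 1) → Γ(W.left, ⊤)} (hv : Unimod v),
    h ≫ i = toProj W v hv → coordHom W v q = 0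
  exists_lift : ∀ {W : Sch k} {v : Fin (n + 1) → Γ(W.left, ⊤)} (hv : Unimod v),
    coordHom W v q = 0 → ∃ h : W ⟶ Y, h ≫ i = toProj W v hv

theorem mono_of_closed {Y Z : Sch k} (i : Y ⟶ Z) [IsClosedImmersion i.left] : Mono i :=
  Over.mono_of_mono_left i

/-- Gluing of morphisms. -/
theorem exists_glue {W Y : Sch k} (U : W.left → W.left.Opens) (hU : ∀ w, w ∈ U w)
    (l : ∀ w, opn W (U w) ⟶ Y) (hl : ∀ (x y : W.left) (T : Sch k) (a : T ⟶ opn W (U x))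
      (b : T ⟶ opn W (U y)), a ≫ opnι W (U x) = b ≫ opnι W (U y) → a ≫ l x = b ≫ l y) :
    ∃ L : W ⟶ Y, ∀ w, opnι W (U w) ≫ L = l w := by
  have hc : TopologicalSpace.IsOpenCover U := by
    rw [TopologicalSpace.IsOpenCover, eq_top_iff]
    exact fun x _ => TopologicalSpace.Opens.mem_iSup.mpr ⟨x, hU x⟩
  let 𝒰 := W.left.openCoverOfIsOpenCover U hc
  have key : ∀ x y : W.left, Limits.pullback.fst (U x).ι (U y).ι ≫ (l x).left =
      Limits.pullback.snd (U x).ι (U y).ι ≫ (l y).left := by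
    intro x y
    let P : Sch k := Over.mk (Limits.pullback.fst (U x).ι (U y).ι ≫ (U x).ι ≫ W.hom)
    let a : P ⟶ opn W (U x) := Over.homMk (Limits.pullback.fst (U x).ι (U y).ι) rfl
    let b : P ⟶ opn W (U y) := Over.homMk (Limits.pullback.snd (U x).ι (U y).ι) (by
      change _ ≫ (U y).ι ≫ W.hom = _ ≫ (U x).ι ≫ W.hom
      rw [Limits.pullback.condition_assoc])
    have hab : a ≫ opnι W (U x) = b ≫ opnι W (U y) := by
      ext1
      exact Limits.pullback.condition
    exact congrArg Over.Hom.left (hl x y P a b hab)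
  let L : W.left ⟶ Y.left := 𝒰.glueMorphisms (fun x => (l x).left) key
  have hL : ∀ x : W.left, (opnι W (U x)).left ≫ L = (l x).left :=
    fun x => 𝒰.ι_glueMorphisms _ key x
  refine ⟨Over.homMk L ?_, fun x => ?_⟩
  · refine Scheme.Cover.hom_ext 𝒰 _ _ fun x => ?_
    change (opnι W (U x)).left ≫ L ≫ Y.hom = (opnι W (U x)).left ≫ W.hom
    rw [reassoc_of% (hL x), Over.w, Over.w]
  · ext1
    exact hL x

/-- Gluing of factorizations through a monomorphism. -/
theorem exists_lift_of_cover {W Y Z : Sch k} (i : Y ⟶ Z) [Mono i] (g : W ⟶ Z)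
    (h : ∀ w : W.left, ∃ U : W.left.Opens, w ∈ U ∧ ∃ l : opn W U ⟶ Y, l ≫ i = opnι W U ≫ g) :
    ∃ l : W ⟶ Y, l ≫ i = g := by
  choose U hU l hl using h
  obtain ⟨L, hL⟩ := exists_glue U hU l fun x y T a b hab => by
    rw [← cancel_mono i, Category.assoc, Category.assoc, hl, hl, reassoc_of% hab]
  refine ⟨L, hom_ext_of_cover _ _ fun w => ⟨U w, hU w, ?_⟩⟩
  rw [reassoc_of% (hL w), hl]

theorem coordHom_eq_zero_of_awayHom {W : Sch k} {s : Fin (n + 1) → Γ(W.left, ⊤)} {j : Fin (n + 1)}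
    (hj : IsUnit (s j)) {d : ℕ} {q : MvPolynomial (Fin (n + 1)) k} (hq : q ∈ gr k n (d • 1)) :
    awayHom W s j hj (HomogeneousLocalization.Away.mk (gr k n) (X_mem_gr k j) d q hq) = 0 ↔
      coordHom W s q = 0 := by
  rw [← awayHom_mk W s j hj d q hq, (hj.pow d).mul_right_eq_zero]

theorem coordHom_pull_eq_zero {W W' : Sch k} (g : W' ⟶ W) {s : Fin (n + 1) → Γ(W.left, ⊤)}
    {q : MvPolynomial (Fin (n + 1)) k} (h : coordHom W s q = 0) : coordHom W' (pull g s) q = 0 := by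
  rw [coordHom_pull, RingHom.comp_apply, h, map_zero]

theorem preimage_chart_eq_top {W : Sch k} {s : Fin (n + 1) → Γ(W.left, ⊤)} (hs : Unimod s)
    {j : Fin (n + 1)} (hj : IsUnit (s j)) :
    (⊤ : W.left.Opens) ≤ (toProj W s hs).left ⁻¹ᵁ (chart k n j).1 := by
  rw [preimage_chart_toProj, Scheme.basicOpen_of_isUnit _ hj]

theorem isClosedImmersion_ker_ideal {Y X : Scheme.{u}} (i : Y ⟶ X) [IsClosedImmersion i]
    (U : X.affineOpens) : i.ker.ideal U = RingHom.ker (i.app U.1).hom :=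
  Scheme.Hom.ker_apply i U

theorem comp_appLE_apply_eq_zero {Y Z X : Scheme.{u}} (h : Z ⟶ Y) (i : Y ⟶ X) {U : X.Opens}
    {V : Z.Opens} (e : V ≤ (h ≫ i) ⁻¹ᵁ U) {a : Γ(X, U)} (ha : (i.app U).hom a = 0) :
    ((h ≫ i).appLE U V e).hom a = 0 := by
  rw [Scheme.Hom.comp_appLE, CommRingCat.hom_comp, RingHom.comp_apply, ha, map_zero]

/-- The equation of a hypersurface vanishes at the coordinates of its points. -/
theorem IsHypersurface.coord_eq_zero {Y : Sch k} {i : Y ⟶ projSpace k n} {d : ℕ}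
    {q : MvPolynomial (Fin (n + 1)) k} (hi : IsHypersurface i d q) {W : Sch k} (h : W ⟶ Y)
    {v : Fin (n + 1) → Γ(W.left, ⊤)} (hv : Unimod v) (hh : h ≫ i = toProj W v hv) :
    coordHom W v q = 0 := by
  obtain ⟨hc, hq, H⟩ := hi
  refine section_ext_of_cover _ _ fun x => ?_
  obtain ⟨j, hj⟩ := exists_mem_basicOpen hv x
  refine ⟨_, hj, ?_⟩
  set U := W.left.basicOpen (v j) with hU
  have hu : IsUnit (pull (opnι W U) v j) := isUnit_pull_basicOpen W _ _ le_rfl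
  have h1 : (opnι W U ≫ h) ≫ i = toProj _ (pull (opnι W U) v) (hv.pull _) := by
    rw [Category.assoc, hh, comp_toProj]
  rw [map_zero]
  have h0 := coordHom_pull (opnι W U) v
  refine (RingHom.congr_fun h0 q).symm.trans ?_
  rw [← coordHom_eq_zero_of_awayHom hu hq]
  have hle := preimage_chart_eq_top (hv.pull (opnι W U)) hu
  rw [← h1] at hle
  rw [← appLE_chartSec (hv.pull (opnι W U)) hu h1 hle]
  refine comp_appLE_apply_eq_zero _ i.left _ ?_
  have := (H j).symm ▸ Ideal.subset_span (Set.mem_singleton _)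
  rw [isClosedImmersion_ker_ideal] at this
  exact this

end Hypersurface

section Hypersurface
variable {k : Type u} [Field k] {n : ℕ}

theorem app_apply_eq_zero_of_appLE {Y X : Scheme.{u}} (g : Y ⟶ X) (U : X.Opens) {a : Γ(X, U)}
    (h : (((g ⁻¹ᵁ U).ι ≫ g).appLE U ⊤ (fun x _ => x.2)).hom a = 0) : (g.app U).hom a = 0 := by
  have h1 : ((g ⁻¹ᵁ U).ι ≫ g).appLE U ⊤ (fun x _ => x.2) =
      g.app U ≫ (g ⁻¹ᵁ U).ι.appLE (g ⁻¹ᵁ U) ⊤ (Scheme.Opens.ι_preimage_self _).ge :=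
    Scheme.Hom.comp_appLE _ _ _ _ _
  rw [h1, CommRingCat.hom_comp, RingHom.comp_apply] at h
  have : Function.Injective ((g ⁻¹ᵁ U).ι.appLE (g ⁻¹ᵁ U) ⊤
      (Scheme.Opens.ι_preimage_self _).ge).hom :=
    (ConcreteCategory.bijective_of_isIso _).1
  exact this (h.trans (map_zero _).symm)

theorem toProj_app_eq_zero {W : Sch k} {v : Fin (n + 1) → Γ(W.left, ⊤)} (hv : Unimod v) {d : ℕ}
    {q : MvPolynomial (Fin (n + 1)) k} (hq : q ∈ gr k n (d • 1)) (h0 : coordHom W v q = 0)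
    (j : Fin (n + 1)) : ((toProj W v hv).left.app (chart k n j).1).hom (chartSec k n j
      (HomogeneousLocalization.Away.mk (gr k n) (X_mem_gr k j) d q hq)) = 0 := by
  apply app_apply_eq_zero_of_appLE
  set V := (toProj W v hv).left ⁻¹ᵁ (chart k n j).1 with hV
  have hu : IsUnit (pull (opnι W V) v j) :=
    isUnit_pull_basicOpen W _ _ (preimage_chart_toProj hv j).le
  have h1 : opnι W V ≫ toProj W v hv = toProj _ (pull (opnι W V) v) (hv.pull _) := comp_toProj _ _ _
  refine (appLE_chartSec (hv.pull (opnι W V)) hu h1 (fun x _ => x.2) _).trans ?_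
  exact (coordHom_eq_zero_of_awayHom hu hq).mpr (coordHom_pull_eq_zero _ h0)

instance : IsSeparated (projSpace k n).hom := by
  have : IsSeparated (Proj.toSpecZero (gr k n)) := inferInstance
  exact inferInstanceAs (IsSeparated (Proj.toSpecZero (gr k n) ≫ _))

instance {W : Sch k} [IsAffine W.left] (g : W ⟶ projSpace k n) : QuasiCompact g.left := by
  have : QuasiCompact (g.left ≫ (projSpace k n).hom) := by
    rw [Over.w]; infer_instance
  exact QuasiCompact.of_comp g.left (projSpace k n).hom

theorem mem_ker_ideal {Y X : Scheme.{u}} (f : Y ⟶ X) [QuasiCompact f] {U : X.affineOpens}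
    (a : Γ(X, U.1)) : a ∈ f.ker.ideal U ↔ (f.app U.1).hom a = 0 := by
  rw [Scheme.Hom.ker_apply, RingHom.mem_ker]

/-- Conversely, a vector at which the equation vanishes is a point of the hypersurface: on each chart
the kernel of `toProj` contains the ideal of the hypersurface. -/
theorem IsHypersurface.exists_lift_of_isAffine {Y : Sch k} {i : Y ⟶ projSpace k n} {d : ℕ}
    {q : MvPolynomial (Fin (n + 1)) k} (hi : IsHypersurface i d q) {W : Sch k} [IsAffine W.left]
    {v : Fin (n + 1) → Γ(W.left, ⊤)} (hv : Unimod v) (h0 : coordHom W v q = 0) :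
    ∃ h : W ⟶ Y, h ≫ i = toProj W v hv := by
  obtain ⟨hc, hq, H⟩ := hi
  have hle : i.left.ker ≤ (toProj W v hv).left.ker := by
    refine Scheme.IdealSheafData.le_of_iSup_eq_top (chart k n) ?_ fun j => ?_
    · rw [eq_top_iff]
      exact fun x _ => TopologicalSpace.Opens.mem_iSup.mpr (exists_mem_chart x)
    · rw [H j]
      exact (Ideal.span_singleton_le_iff_mem _).mpr
        ((mem_ker_ideal _ _).mpr (toProj_app_eq_zero hv hq h0 j))
  refine ⟨Over.homMk (IsClosedImmersion.lift i.left _ hle) ?_, ?_⟩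
  · rw [← Over.w i, IsClosedImmersion.lift_fac_assoc, Over.w]
  · ext1
    exact IsClosedImmersion.lift_fac _ _ _

theorem exists_isAffineOpen_mem {W : Sch k} (w : W.left) :
    ∃ U : W.left.Opens, w ∈ U ∧ IsAffine (opn W U).left := by
  obtain ⟨U, hU, hw, -⟩ := TopologicalSpace.Opens.isBasis_iff_nbhd.mp W.left.isBasis_affineOpens
    (show w ∈ (⊤ : W.left.Opens) from trivial)
  exact ⟨U, hw, hU⟩

theorem IsHypersurface.hasForm {Y : Sch k} {i : Y ⟶ projSpace k n} {d : ℕ}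
    {q : MvPolynomial (Fin (n + 1)) k} (hi : IsHypersurface i d q) : HasForm i q where
  closed := hi.1
  coord_eq_zero := hi.coord_eq_zero
  exists_lift {W v} hv h0 := by
    have := hi.1
    have := mono_of_closed i
    refine exists_lift_of_cover i _ fun w => ?_
    obtain ⟨U, hU, hA⟩ := exists_isAffineOpen_mem w
    refine ⟨U, hU, ?_⟩
    rw [comp_toProj]
    exact hi.exists_lift_of_isAffine _ (coordHom_pull_eq_zero _ h0)

/-- A polynomial describing the functor of points of `Y` generates the ideal of `Y` on each chart.
Indeed, let `W` be the closed subscheme of the chart defined by the polynomial. Its coordinates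
satisfy the equation, so `W` lies in `Y`, and a function vanishing on `Y` vanishes on `W`. -/
theorem HasForm.isHypersurface {Y : Sch k} {i : Y ⟶ projSpace k n} {d : ℕ}
    {q : MvPolynomial (Fin (n + 1)) k} (hi : HasForm i q) (hq : q.IsHomogeneous d) :
    IsHypersurface i d q := by
  have := hi.closed
  have hq' : q ∈ gr k n (d • 1) := by simpa using hq
  refine ⟨hi.closed, hq', fun j => ?_⟩
  set t := HomogeneousLocalization.Away.mk (gr k n) (X_mem_gr k j) d q hq' with ht
  rw [isClosedImmersion_ker_ideal]
  apply le_antisymm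
  · intro a ha
    obtain ⟨b, rfl⟩ := (chartSec_bijective (k := k) j).2 a
    suffices b ∈ Ideal.span {t} by
      have h := Ideal.mem_map_of_mem (chartSec k n j) this
      rwa [Ideal.map_span, Set.image_singleton] at h
    let A := HomogeneousLocalization.Away (gr k n) (X j)
    let R := A ⧸ Ideal.span {t}
    let φ : CommRingCat.of A ⟶ CommRingCat.of R := CommRingCat.ofHom (Ideal.Quotient.mk _)
    let W : Sch k := Over.mk (Spec.map φ ≫ chartι k j ≫ (projSpace k n).hom)
    let g : W ⟶ projSpace k n := Over.homMk (Spec.map φ ≫ chartι k j) (by simp [W])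
    obtain ⟨s, hs, h1, h2, h4⟩ := exists_eq_toProj_of_comp_chartι g j (Spec.map φ) rfl
    have hu : IsUnit (s j) := by rw [h1]; exact isUnit_one
    have h6 : ∀ x, awayHom W s j hu x = (Scheme.ΓSpecIso (CommRingCat.of R)).inv.hom (φ.hom x) := by
      intro x
      rw [h4 hu]
      exact (RingHom.congr_fun (congrArg CommRingCat.Hom.hom
        (Scheme.ΓSpecIso_inv_naturality φ)) x).symm
    have hq0 : coordHom W s q = 0 := by
      rw [← coordHom_eq_zero_of_awayHom hu hq', h6]
      have : φ.hom t = 0 := Ideal.Quotient.eq_zero_iff_mem.mpr (Ideal.mem_span_singleton_self t)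
      rw [this, map_zero]
    obtain ⟨h, hh⟩ := hi.exists_lift hs hq0
    have hle : ⊤ ≤ (h ≫ i).left ⁻¹ᵁ (chart k n j).1 := by
      rw [hh]; exact preimage_chart_eq_top hs hu
    have h7 := appLE_chartSec hs hu hh hle b
    have h8 := comp_appLE_apply_eq_zero h.left i.left hle ha
    have h9 : awayHom W s j hu b = 0 := h7.symm.trans h8
    rw [h6] at h9
    have h10 := (ConcreteCategory.bijective_of_isIso (Scheme.ΓSpecIso (CommRingCat.of R)).inv).1
      (h9.trans (map_zero _).symm)
    exact Ideal.Quotient.eq_zero_iff_mem.mp h10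
  · refine (Ideal.span_singleton_le_iff_mem _).mpr (RingHom.mem_ker.mpr ?_)
    apply app_apply_eq_zero_of_appLE
    set V := i.left ⁻¹ᵁ (chart k n j).1 with hV
    obtain ⟨s, hs, h1, h2⟩ := exists_eq_toProj (opnι Y V ≫ i) j (fun x => x.2)
    have hu : IsUnit (s j) := by rw [h1]; exact isUnit_one
    refine (appLE_chartSec hs hu h2 (fun x _ => x.2) _).trans ?_
    exact (coordHom_eq_zero_of_awayHom hu hq').mpr (hi.coord_eq_zero _ hs h2)

theorem HasForm.mono {Y : Sch k} {i : Y ⟶ projSpace k n} {q : MvPolynomial (Fin (n + 1)) k}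
    (hi : HasForm i q) : Mono i :=
  have := hi.closed
  mono_of_closed i

end Hypersurface

/-! ### Points of a subscheme of projective space -/

section Relation
variable {k : Type u} [Field k] {n : ℕ}

/-- A morphism can be defined by its effect on the functors of points, locally on the source. -/
theorem exists_of_relation {W Y : Sch k} (R : ∀ T : Sch k, (T ⟶ W) → (T ⟶ Y) → Prop)
    (ex : ∀ w : W.left, ∃ U : W.left.Opens, w ∈ U ∧ ∃ f, R (opn W U) (opnι W U) f)
    (uniq : ∀ T a f f', R T a f → R T a f' → f = f')
    (pull : ∀ T T' a f (b : T' ⟶ T), R T a f → R T' (b ≫ a) (b ≫ f)) :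
    ∃ L : W ⟶ Y, ∀ T a f, R T a f → a ≫ L = f := by
  choose U hU f hf using ex
  obtain ⟨L, hL⟩ := exists_glue U hU f fun x y T a b hab =>
    uniq T (a ≫ opnι W (U x)) _ _ (pull _ _ _ _ a (hf x)) (hab ▸ pull _ _ _ _ b (hf y))
  refine ⟨L, fun T a g hg => hom_ext_of_cover _ _ fun t => ?_⟩
  refine ⟨a.left ⁻¹ᵁ U (a.left t), hU _, ?_⟩
  set V := a.left ⁻¹ᵁ U (a.left t)
  have h1 := opnMap_ι a (U (a.left t)) V le_rfl
  refine uniq _ (opnι T V ≫ a) _ _ ?_ (pull _ _ _ _ _ hg)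
  rw [← Category.assoc, ← h1, Category.assoc, hL]
  exact pull _ _ _ _ _ (hf _)

/-- The morphism `h` to `Y`, followed by the embedding `i` of `Y` in projective space, has
homogeneous coordinates `v`. -/
def Coord {Y : Sch k} (i : Y ⟶ projSpace k n) {W : Sch k} (h : W ⟶ Y)
    (v : Fin (n + 1) → Γ(W.left, ⊤)) : Prop :=
  ∃ hv : Unimod v, h ≫ i = toProj W v hv

namespace Coord
variable {Y : Sch k} {i : Y ⟶ projSpace k n} {W W' : Sch k} {h h' : W ⟶ Y}
  {v v' : Fin (n + 1) → Γ(W.left, ⊤)}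

theorem unimod (H : Coord i h v) : Unimod v := H.1

theorem pull (H : Coord i h v) (g : W' ⟶ W) : Coord i (g ≫ h) (pull g v) := by
  obtain ⟨hv, H⟩ := H
  exact ⟨hv.pull g, by rw [Category.assoc, H, comp_toProj]⟩

theorem prop (H : Coord i h v) (H' : Coord i h v') (a b : Fin (n + 1)) :
    v a * v' b = v b * v' a := by
  obtain ⟨hv, H⟩ := H
  obtain ⟨hv', H'⟩ := H'
  exact (toProj_eq_iff hv hv').mp (H.symm.trans H') a b

theorem eq_of_prop [Mono i] (H : Coord i h v) (H' : Coord i h' v')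
    (hp : ∀ a b, v a * v' b = v b * v' a) : h = h' := by
  obtain ⟨hv, H⟩ := H
  obtain ⟨hv', H'⟩ := H'
  rw [← cancel_mono i, H, H']
  exact toProj_congr hv hv' hp

theorem of_prop (H : Coord i h v) (hv' : Unimod v') (hp : ∀ a b, v a * v' b = v b * v' a) :
    Coord i h v' := by
  obtain ⟨hv, H⟩ := H
  exact ⟨hv', H.trans (toProj_congr hv hv' hp)⟩

theorem form_eq_zero {q : MvPolynomial (Fin (n + 1)) k} (hi : HasForm i q) (H : Coord i h v) :
    coordHom W v q = 0 := by
  obtain ⟨hv, H⟩ := H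
  exact hi.coord_eq_zero h hv H

end Coord

theorem exists_coord_of_form {Y : Sch k} {i : Y ⟶ projSpace k n} {q : MvPolynomial (Fin (n + 1)) k}
    (hi : HasForm i q) {W : Sch k} {v : Fin (n + 1) → Γ(W.left, ⊤)} (hv : Unimod v)
    (h0 : coordHom W v q = 0) : ∃ h : W ⟶ Y, Coord i h v := by
  obtain ⟨h, hh⟩ := hi.exists_lift hv h0
  exact ⟨h, hv, hh⟩

/-- Morphisms to a subscheme of projective space locally have homogeneous coordinates. -/
theorem exists_local_coord {Y : Sch k} (i : Y ⟶ projSpace k n) {W : Sch k} (h : W ⟶ Y)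
    (w : W.left) : ∃ U : W.left.Opens, w ∈ U ∧ ∃ s, (∃ j, s j = 1) ∧ Coord i (opnι W U ≫ h) s := by
  obtain ⟨U, hU, s, hs, hj, H⟩ := exists_local_eq_toProj (h ≫ i) w
  exact ⟨U, hU, s, hj, hs, by rw [Category.assoc, H]⟩

/-- The action of a matrix with entries in `k` on vectors of global sections. -/
def actVec (W : Sch k) (M : Matrix (Fin (n + 1)) (Fin (n + 1)) k) (v : Fin (n + 1) → Γ(W.left, ⊤)) :
    Fin (n + 1) → Γ(W.left, ⊤) := (M.map (strHom W)).mulVec v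

theorem actVec_mul (W : Sch k) (M N : Matrix (Fin (n + 1)) (Fin (n + 1)) k)
    (v : Fin (n + 1) → Γ(W.left, ⊤)) : actVec W (M * N) v = actVec W M (actVec W N v) := by
  simp [actVec, Matrix.map_mul]

theorem actVec_one (W : Sch k) (v : Fin (n + 1) → Γ(W.left, ⊤)) : actVec W 1 v = v := by
  simp [actVec]

theorem pull_actVec {W W' : Sch k} (g : W' ⟶ W) (M : Matrix (Fin (n + 1)) (Fin (n + 1)) k)
    (v : Fin (n + 1) → Γ(W.left, ⊤)) : pull g (actVec W M v) = actVec W' M (pull g v) := by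
  ext i
  simp [actVec, Matrix.mulVec, dotProduct, map_sum, map_mul, strHom_comp]

theorem Unimod.of_mul {R ι : Type*} [CommRing R] [Fintype ι] {v w : ι → R} (N : Matrix ι ι R)
    (h : N.mulVec w = v) (hv : Unimod v) : Unimod w := by
  rw [Unimod, eq_top_iff, ← hv, Ideal.span_le]
  rintro _ ⟨i, rfl⟩
  rw [← h]
  exact Ideal.sum_mem _ fun j _ => Ideal.mul_mem_left _ _ (Ideal.subset_span ⟨j, rfl⟩)

theorem Unimod.actVec {W : Sch k} {M N : Matrix (Fin (n + 1)) (Fin (n + 1)) k} (h : N * M = 1)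
    {v : Fin (n + 1) → Γ(W.left, ⊤)} (hv : Unimod v) : Unimod (actVec W M v) :=
  Unimod.of_mul (N.map (strHom W)) (by
    change Conics.actVec W N (Conics.actVec W M v) = v
    rw [← actVec_mul, h, actVec_one]) hv

theorem mulVec_prop {R ι : Type*} [CommRing R] [Fintype ι] (M : Matrix ι ι R) {v w : ι → R}
    (h : ∀ a b, v a * w b = v b * w a) (a b : ι) :
    M.mulVec v a * M.mulVec w b = M.mulVec v b * M.mulVec w a := by
  simp only [Matrix.mulVec, dotProduct, Finset.sum_mul_sum]
  conv_rhs => rw [Finset.sum_comm]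
  refine Finset.sum_congr rfl fun i _ => Finset.sum_congr rfl fun j _ => ?_
  linear_combination M a i * M b j * h i j

/-- The linear endomorphism of projective space given by an invertible matrix. -/
theorem exists_linear (M N : Matrix (Fin (n + 1)) (Fin (n + 1)) k) (h : N * M = 1) :
    ∃ φ : projSpace k n ⟶ projSpace k n, ∀ (W : Sch k) (v : Fin (n + 1) → Γ(W.left, ⊤))
      (hv : Unimod v), toProj W v hv ≫ φ = toProj W (actVec W M v) (hv.actVec h) := by
  obtain ⟨L, hL⟩ := exists_of_relation (W := projSpace k n) (Y := projSpace k n)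
    (fun T a f => ∃ (v : Fin (n + 1) → Γ(T.left, ⊤)) (hv : Unimod v), a = toProj T v hv ∧
      f = toProj T (actVec T M v) (hv.actVec h)) (fun w => by
        obtain ⟨U, hU, s, hs, -, H⟩ := exists_local_eq_toProj (𝟙 (projSpace k n)) w
        exact ⟨U, hU, _, s, hs, by rw [← H, Category.comp_id], rfl⟩) (by
        rintro T a f f' ⟨v, hv, h1, rfl⟩ ⟨v', hv', h1', rfl⟩
        exact toProj_congr _ _ (mulVec_prop _ ((toProj_eq_iff hv hv').mp (h1.symm.trans h1')))) (by
        rintro T T' a f b ⟨v, hv, rfl, rfl⟩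
        refine ⟨pull b v, hv.pull b, comp_toProj _ _ _, ?_⟩
        rw [comp_toProj]
        congr 1
        exact pull_actVec _ _ _)
  exact ⟨L, fun W v hv => hL _ _ _ ⟨v, hv, rfl, rfl⟩⟩

/-- A linear change of coordinates. -/
theorem HasForm.linear {Y : Sch k} {i : Y ⟶ projSpace k n} {q q' : MvPolynomial (Fin (n + 1)) k}
    (hi : HasForm i q) {M N : Matrix (Fin (n + 1)) (Fin (n + 1)) k} (h : N * M = 1) {l : k}
    (hl : l ≠ 0) (hq : ∀ (W : Sch k) (v : Fin (n + 1) → Γ(W.left, ⊤)),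
      coordHom W (actVec W M v) q' = strHom W l * coordHom W v q) :
    ∃ i' : Y ⟶ projSpace k n, HasForm i' q' ∧ ∀ (W : Sch k) (g : W ⟶ Y) v,
      (Coord i g v → Coord i' g (actVec W M v)) ∧ (Coord i' g v → Coord i g (actVec W N v)) := by
  have h' : M * N = 1 := mul_eq_one_comm.mp h
  obtain ⟨φ, hφ⟩ := exists_linear M N h
  obtain ⟨ψ, hψ⟩ := exists_linear N M h'
  have hloc : ∀ (α : projSpace k n ⟶ projSpace k n), (∀ (W : Sch k) v (hv : Unimod v),
      toProj W v hv ≫ α = toProj W v hv) → α = 𝟙 _ := by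
    intro α hα
    refine hom_ext_of_cover _ _ fun w => ?_
    obtain ⟨U, hU, s, hs, -, H⟩ := exists_local_eq_toProj (𝟙 (projSpace k n)) w
    refine ⟨U, hU, ?_⟩
    rw [H, ← hα _ s hs, ← H, Category.comp_id]
  have h1 : φ ≫ ψ = 𝟙 _ := hloc _ fun W v hv => by
    rw [← Category.assoc, hφ, hψ]
    congr 1
    rw [← actVec_mul, h, actVec_one]
  have h2 : ψ ≫ φ = 𝟙 _ := hloc _ fun W v hv => by
    rw [← Category.assoc, hψ, hφ]
    congr 1
    rw [← actVec_mul, h', actVec_one]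
  have hc := hi.closed
  have hisoφ : IsIso φ := ⟨ψ, h1, h2⟩
  have h3 : ∀ (W : Sch k) (g : W ⟶ Y) v (hv : Unimod v), g ≫ i ≫ φ = toProj W v hv →
      g ≫ i = toProj W (actVec W N v) (hv.actVec h') := fun W g v hv hg => by
    rw [← hψ W v hv, ← hg]
    simp [h1]
  refine ⟨i ≫ φ, ⟨?_, ?_, ?_⟩, ?_⟩
  · have : IsIso φ.left := inferInstanceAs (IsIso ((Over.forget _).map φ))
    exact inferInstanceAs (IsClosedImmersion (i.left ≫ φ.left))
  · intro W g v hv hg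
    have h4 := hq W (actVec W N v)
    rw [hi.coord_eq_zero g _ (h3 W g v hv hg), ← actVec_mul, h', actVec_one, mul_zero] at h4
    exact h4
  · intro W v hv h0
    have h4 := hq W (actVec W N v)
    rw [← actVec_mul, h', actVec_one, h0] at h4
    have hu : IsUnit (strHom W l) := (isUnit_iff_ne_zero.mpr hl).map _
    obtain ⟨g, hg⟩ := hi.exists_lift (hv.actVec h') (hu.mul_right_eq_zero.mp h4.symm)
    refine ⟨g, ?_⟩
    rw [reassoc_of% hg, hφ]
    congr 1
    rw [← actVec_mul, h', actVec_one]
  · refine fun W g v => ⟨?_, ?_⟩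
    · rintro ⟨hv, H⟩
      exact ⟨hv.actVec h, by rw [reassoc_of% H, hφ]⟩
    · rintro ⟨hv, H⟩
      exact ⟨hv.actVec h', h3 W g v hv H⟩

/-- `Spec R` as a `k`-scheme, for a `k`-algebra `R`. -/
def specK (k : Type u) [Field k] (R : Type u) [CommRing R] [Algebra k R] : Sch k :=
  Over.mk (Spec.map (CommRingCat.ofHom (algebraMap k R)))

/-- The ring of global sections of `Spec R`. -/
def secK (k : Type u) [Field k] (R : Type u) [CommRing R] [Algebra k R] :
    R ≃+* Γ((specK k R).left, ⊤) :=
  (Scheme.ΓSpecIso (CommRingCat.of R)).symm.commRingCatIsoToRingEquiv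

theorem strHom_specK (R : Type u) [CommRing R] [Algebra k R] (a : k) :
    strHom (specK k R) a = secK k R (algebraMap k R a) := by
  have := RingHom.congr_fun (congrArg CommRingCat.Hom.hom
    (Scheme.ΓSpecIso_inv_naturality (CommRingCat.ofHom (algebraMap k R)))) a
  exact this.symm

/-- A `k`-algebra homomorphism as a morphism of `k`-schemes. -/
def specMapK {R S : Type u} [CommRing R] [Algebra k R] [CommRing S] [Algebra k S] (f : R →ₐ[k] S) :
    specK k S ⟶ specK k R :=
  Over.homMk (Spec.map (CommRingCat.ofHom f.toRingHom)) (by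
    simp only [specK, Over.mk_hom]
    rw [← Spec.map_comp, ← CommRingCat.ofHom_comp]
    congr 2
    exact f.comp_algebraMap)

theorem specMapK_appTop {R S : Type u} [CommRing R] [Algebra k R] [CommRing S] [Algebra k S]
    (f : R →ₐ[k] S) (a : R) : (specMapK f).left.appTop.hom (secK k R a) = secK k S (f a) :=
  (RingHom.congr_fun (congrArg CommRingCat.Hom.hom
    (Scheme.ΓSpecIso_inv_naturality (CommRingCat.ofHom f.toRingHom))) a).symm

instance (R : Type u) [CommRing R] [Algebra k R] : IsAffine (specK k R).left :=
  inferInstanceAs (IsAffine (Spec _))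

theorem coordHom_specK (R : Type u) [CommRing R] [Algebra k R] (v : Fin (n + 1) → R)
    (q : MvPolynomial (Fin (n + 1)) k) :
    coordHom (specK k R) (fun i => secK k R (v i)) q = secK k R (aeval v q) := by
  have h : strHom (specK k R) = (secK k R : R →+* _).comp (algebraMap k R) :=
    RingHom.ext fun a => strHom_specK R a
  rw [coordHom, coe_eval₂Hom, h, aeval_def]
  exact (hom_eval₂ _ _ _ _).symm

theorem unimod_of_ne_zero {K ι : Type*} [Field K] {v : ι → K} (hv : v ≠ 0) : Unimod v := by
  obtain ⟨j, hj⟩ := Function.ne_iff.mp hv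
  exact unimod_of_isUnit (j := j) (isUnit_iff_ne_zero.mpr hj)

theorem unimod_secK {R : Type u} [CommRing R] [Algebra k R] {v : Fin (n + 1) → R} (hv : Unimod v) :
    Unimod (fun i => secK k R (v i)) :=
  Unimod.map hv (secK k R).toRingHom

theorem homogPoint_eq (K : Type u) [Field K] [Algebra k K] (v : Fin (n + 1) → K) (hv : v ≠ 0) :
    homogPoint k v hv = (toProj (specK k K) (fun i => secK k K (v i))
      (unimod_secK (unimod_of_ne_zero hv))).left := by
  have h : evalAt k v = coordHom (specK k K) (fun i => secK k K (v i)) := by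
    ext a
    · refine Eq.trans ?_ (coordHom_specK K v (MvPolynomial.C a)).symm
      simp [evalAt, secK]
      rfl
    · refine Eq.trans ?_ (coordHom_specK K v (X a)).symm
      simp [evalAt, secK]
      rfl
  unfold homogPoint toProj
  simp only [h]
  rfl

theorem coord_iff_homogPoint {Y : Sch k} {i : Y ⟶ projSpace k n} {K : Type u} [Field K]
    [Algebra k K] (h : pt k K ⟶ Y) (v : Fin (n + 1) → K) (hv : v ≠ 0) :
    Coord (W := specK k K) i h (fun i => secK k K (v i)) ↔ (h ≫ i).left = homogPoint k v hv := by
  rw [homogPoint_eq]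
  constructor
  · rintro ⟨hv, H⟩
    exact congrArg Over.Hom.left H
  · intro H
    exact ⟨_, Over.OverMorphism.ext H⟩

end Relation

/-! ### Affine schemes and coordinate charts -/

section ToSpec
variable {k : Type u} [Field k] {n : ℕ}

/-- The morphism to `Spec R` given by a homomorphism from `R` to the global sections. -/
def toSpecK (W : Sch k) {R : Type u} [CommRing R] [Algebra k R] (f : R →+* Γ(W.left, ⊤))
    (hf : ∀ a, f (algebraMap k R a) = strHom W a) : W ⟶ specK k R :=
  Over.homMk (W.left.toSpecΓ ≫ Spec.map (CommRingCat.ofHom f)) (by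
    simp only [specK, Over.mk_hom]
    rw [Category.assoc, ← Spec.map_comp, ← CommRingCat.ofHom_comp, ← toSpecΓ_strHom]
    congr 3
    ext a
    exact hf a)

theorem toSpecK_appTop (W : Sch k) {R : Type u} [CommRing R] [Algebra k R]
    (f : R →+* Γ(W.left, ⊤)) (hf : ∀ a, f (algebraMap k R a) = strHom W a) (r : R) :
    (toSpecK W f hf).left.appTop.hom (secK k R r) = f r := by
  have h1 : ((Scheme.ΓSpecIso (CommRingCat.of R)).inv ≫
      (W.left.toSpecΓ ≫ Spec.map (CommRingCat.ofHom f)).appTop) = CommRingCat.ofHom f := by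
    simp
  exact RingHom.congr_fun (congrArg CommRingCat.Hom.hom h1) r

theorem specK_hom_ext {W : Sch k} {R : Type u} [CommRing R] [Algebra k R] {g g' : W ⟶ specK k R}
    (h : ∀ r, g.left.appTop.hom (secK k R r) = g'.left.appTop.hom (secK k R r)) : g = g' := by
  ext1
  have h1 := eq_toSpecΓ (R := CommRingCat.of R) g.left
  have h2 := eq_toSpecΓ (R := CommRingCat.of R) g'.left
  refine h1.trans (Eq.trans ?_ h2.symm)
  congr 2
  ext r
  exact h r

theorem specK_strHom {W : Sch k} {R : Type u} [CommRing R] [Algebra k R] (g : W ⟶ specK k R)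
    (a : k) : g.left.appTop.hom (secK k R (algebraMap k R a)) = strHom W a := by
  rw [← strHom_specK, strHom_comp]

theorem coord_ext {Y : Sch k} {i : Y ⟶ projSpace k n} [Mono i] {W : Sch k} {h h' : W ⟶ Y}
    {v : Fin (n + 1) → Γ(W.left, ⊤)} (H : Coord i h v) (H' : Coord i h' v) : h = h' :=
  H.eq_of_prop H' fun _ _ => mul_comm _ _

/-- The open subscheme where the `j`-th homogeneous coordinate does not vanish. -/
def coordOpen {Y W : Sch k} (i : Y ⟶ projSpace k n) (h : W ⟶ Y) (j : Fin (n + 1)) : W.left.Opens :=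
  (h ≫ i).left ⁻¹ᵁ (chart k n j).1

theorem coordOpen_eq {Y W : Sch k} {i : Y ⟶ projSpace k n} {h : W ⟶ Y}
    {v : Fin (n + 1) → Γ(W.left, ⊤)} (H : Coord i h v) (j : Fin (n + 1)) :
    coordOpen i h j = W.left.basicOpen (v j) := by
  obtain ⟨hv, H⟩ := H
  rw [coordOpen, H, preimage_chart_toProj]

theorem mem_coordOpen_comp {Y W W' : Sch k} {i : Y ⟶ projSpace k n} {h : W ⟶ Y} (g : W' ⟶ W)
    (j : Fin (n + 1)) (w : W'.left) : g.left w ∈ coordOpen i h j ↔ w ∈ coordOpen i (g ≫ h) j :=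
  Iff.rfl

theorem mem_coordOpen_of_isUnit {Y W W' : Sch k} {i : Y ⟶ projSpace k n} {h : W ⟶ Y} {g : W' ⟶ W}
    {v : Fin (n + 1) → Γ(W'.left, ⊤)} (H : Coord i (g ≫ h) v) {j : Fin (n + 1)} (hj : IsUnit (v j))
    (w : W'.left) : g.left w ∈ coordOpen i h j := by
  rw [mem_coordOpen_comp, coordOpen_eq H, Scheme.basicOpen_of_isUnit _ hj]
  trivial

/-- On the locus where the `j`-th coordinate does not vanish, it can be normalized to `1`. -/
theorem exists_coord_one {Y W W' : Sch k} (i : Y ⟶ projSpace k n) (h : W ⟶ Y) (g : W' ⟶ W)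
    (j : Fin (n + 1)) (hg : ∀ x, g.left x ∈ coordOpen i h j) :
    ∃ v, v j = 1 ∧ Coord i (g ≫ h) v := by
  obtain ⟨s, hs, h1, h2⟩ := exists_eq_toProj (g ≫ h ≫ i) j hg
  exact ⟨s, h1, hs, by rw [Category.assoc, h2]⟩

theorem coord_one_unique {Y W : Sch k} {i : Y ⟶ projSpace k n} {h : W ⟶ Y} {j : Fin (n + 1)}
    {v v' : Fin (n + 1) → Γ(W.left, ⊤)} (H : Coord i h v) (H' : Coord i h v') (hv : v j = 1)
    (hv' : v' j = 1) : v = v' := by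
  funext a
  have := H.prop H' a j
  rwa [hv, hv', mul_one, one_mul] at this

instance (W : Sch k) (U : W.left.Opens) : IsOpenImmersion (opnι W U).left :=
  inferInstanceAs (IsOpenImmersion U.ι)

instance (W : Sch k) (U : W.left.Opens) : Mono (opnι W U) :=
  Over.mono_of_mono_left _

/-- An affine `k`-scheme is a spectrum. -/
theorem exists_iso_specK (W : Sch k) [IsAffine W.left] :
    ∃ _ : Algebra k Γ(W.left, ⊤), Nonempty (specK k Γ(W.left, ⊤) ≅ W) := by
  let _ := (strHom W).toAlgebra
  refine ⟨inferInstance, ⟨(Over.isoMk W.left.isoSpec ?_).symm⟩⟩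
  exact toSpecΓ_strHom W

/-- Let `V ≅ Spec R` be an open subscheme of `S`. The part of `V × Y` where the `j`-th coordinate of
the hypersurface `Y` does not vanish is the spectrum of the `R`-algebra `A` that is universal for
solutions of the dehomogenized equation. -/
theorem exists_iso_coordOpen {Y : Sch k} {i : Y ⟶ projSpace k n} {q : MvPolynomial (Fin (n + 1)) k}
    (hi : HasForm i q) (j : Fin (n + 1)) (S : Sch k) (V : S.left.Opens) (R A : Type u) [CommRing R]
    [CommRing A] [Algebra k R] [Algebra k A] (u : specK k R ≅ opn S V)
    (ι : R →ₐ[k] A) (s : Fin (n + 1) → A) (hs : s j = 1) (hq : aeval s q = 0)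
    (univ : ∀ (S : Type u) [CommRing S] (ρ : R →+* S) (v : Fin (n + 1) → S), v j = 1 →
      eval₂ (ρ.comp (algebraMap k R)) v q = 0 →
      ∃ f : A →+* S, (∀ r, f (ι r) = ρ r) ∧ ∀ l, f (s l) = v l)
    (uniq : ∀ (S : Type u) [CommRing S] (f f' : A →+* S), (∀ r, f (ι r) = f' (ι r)) →
      (∀ l, f (s l) = f' (s l)) → f = f') :
    ∃ e : specK k A ≅ opn (S ⊗ Y) ((fst S Y).left ⁻¹ᵁ V ⊓ coordOpen i (snd S Y) j),
      Coord i (e.hom ≫ opnι _ _ ≫ snd _ _) (fun l => secK k A (s l)) := by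
  have := hi.mono
  have hsu : Unimod s := unimod_of_isUnit (j := j) (by rw [hs]; exact isUnit_one)
  obtain ⟨y, hy⟩ := exists_coord_of_form hi (unimod_secK (k := k) hsu)
    (by rw [coordHom_specK, hq, map_zero])
  set P := S ⊗ Y
  set O := (fst S Y).left ⁻¹ᵁ V ⊓ coordOpen i (snd S Y) j with hO
  let a0 : specK k A ⟶ P := lift (specMapK ι ≫ u.hom ≫ opnι S V) y
  have ha0 : Coord i (a0 ≫ snd S Y) (fun l => secK k A (s l)) := by
    simpa [a0] using hy
  have ha1 : a0 ≫ fst S Y = specMapK ι ≫ u.hom ≫ opnι S V := lift_fst _ _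
  let a : specK k A ⟶ opn P O := opnLift a0 O fun x =>
    ⟨by
      change (a0 ≫ fst S Y).left x ∈ V
      rw [ha1]
      exact ((specMapK ι ≫ u.hom).left x).2,
    mem_coordOpen_of_isUnit ha0 (by rw [hs, map_one]; exact isUnit_one) x⟩
  have haι : a ≫ opnι P O = a0 := opnLift_ι _ _ _
  obtain ⟨v, hv1, hv⟩ := exists_coord_one i (snd S Y) (opnι P O) j (fun x => x.2.2)
  let c0 : opn P O ⟶ opn S V := opnLift (opnι P O ≫ fst S Y) V (fun x => x.2.1)
  have hc0 : c0 ≫ opnι S V = opnι P O ≫ fst S Y := opnLift_ι _ _ _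
  let c : opn P O ⟶ specK k R := c0 ≫ u.inv
  let ρ : R →+* Γ((opn P O).left, ⊤) := c.left.appTop.hom.comp (secK k R).toRingHom
  have hρ : ρ.comp (algebraMap k R) = strHom (opn P O) := RingHom.ext fun r => specK_strHom c r
  obtain ⟨f, hf1, hf2⟩ := univ Γ((opn P O).left, ⊤) ρ v hv1 (by
    rw [hρ]; exact hv.form_eq_zero hi)
  have hfk : ∀ c, f (algebraMap k A c) = strHom (opn P O) c := by
    intro c
    rw [← ι.commutes, hf1]
    exact RingHom.congr_fun hρ c
  let b : opn P O ⟶ specK k A := toSpecK _ f hfk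
  have hac : a ≫ c = specMapK ι := by
    have h : a ≫ c0 = specMapK ι ≫ u.hom := by
      rw [← cancel_mono (opnι S V), Category.assoc, Category.assoc, hc0, reassoc_of% haι, ha1]
    rw [← Category.assoc, h, Category.assoc, u.hom_inv_id, Category.comp_id]
  have hbc : b ≫ specMapK ι = c := by
    refine specK_hom_ext fun r => ?_
    change b.left.appTop.hom ((specMapK ι).left.appTop.hom (secK k R r)) = ρ r
    rw [specMapK_appTop, toSpecK_appTop, hf1]
  have hab : a ≫ b = 𝟙 _ := by
    refine specK_hom_ext fun r => ?_
    have h1 : ((a ≫ b).left.appTop.hom.comp (secK k A).toRingHom) =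
        (secK k A).toRingHom := by
      refine uniq _ _ _ (fun r => ?_) fun l => ?_
      · change a.left.appTop.hom (b.left.appTop.hom (secK k A (ι r))) = secK k A (ι r)
        rw [toSpecK_appTop, hf1]
        change (a ≫ c).left.appTop.hom (secK k R r) = _
        rw [hac, specMapK_appTop]
      · change a.left.appTop.hom (b.left.appTop.hom (secK k A (s l))) = secK k A (s l)
        rw [toSpecK_appTop, hf2]
        have h2 : Coord i (a0 ≫ snd S Y) (pull a v) := by
          rw [← haι, Category.assoc]; exact hv.pull a
        exact congrFun (coord_one_unique (j := j) h2 ha0 (by simp [hv1]) (by rw [hs, map_one])) l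
    exact (RingHom.congr_fun h1 r).trans (by simp)
  have hba : b ≫ a = 𝟙 _ := by
    rw [← cancel_mono (opnι P O), Category.assoc, haι, Category.id_comp]
    refine CartesianMonoidalCategory.hom_ext _ _ ?_ ?_
    · rw [Category.assoc, ha1, reassoc_of% hbc, Category.assoc, u.inv_hom_id_assoc, hc0]
    · have h2 := ha0.pull b
      have h3 : pull b (fun l => secK k A (s l)) = v := by
        funext l
        exact (toSpecK_appTop _ _ _ _).trans (hf2 l)
      rw [h3] at h2
      rw [Category.assoc]
      exact coord_ext h2 hv
  refine ⟨⟨a, b, hab, hba⟩, ?_⟩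
  change Coord i (a ≫ opnι P O ≫ snd _ _) _
  rw [reassoc_of% haι]
  exact ha0

end ToSpec

/-! ### Quadratic algebras and the charts of a conic -/

section Quadratic

/-- The quadratic algebra `S[θ] / (θ² - e θ - a)`. -/
abbrev QuadAlg {S : Type u} [CommRing S] (e a : S) : Type u := QuadraticAlgebra S a e

namespace QuadAlg
variable {S : Type u} [CommRing S] (e a : S)

/-- The distinguished root of `t² - e t - a`. -/
abbrev θ : QuadAlg e a := ⟨0, 1⟩

theorem θ_sq : θ e a ^ 2 = algebraMap S _ e * θ e a + algebraMap S _ a := by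
  ext <;> simp [pow_two]

theorem eq_rep (x : QuadAlg e a) :
    x = algebraMap S _ x.re + algebraMap S _ x.im * θ e a := by
  ext <;> simp

/-- Ring homomorphisms out of a quadratic algebra. -/
theorem exists_hom {T : Type*} [CommRing T] (f : S →+* T) (t : T)
    (h : t ^ 2 = f e * t + f a) : ∃ g : QuadAlg e a →+* T, (∀ s, g (algebraMap S _ s) = f s) ∧
      g (θ e a) = t := by
  let g : QuadAlg e a →+* T :=
    { toFun := fun x => f x.re + f x.im * t
      map_one' := by simp [QuadraticAlgebra.re_one, QuadraticAlgebra.im_one]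
      map_mul' := fun x y => by
        simp only [QuadraticAlgebra.re_mul, QuadraticAlgebra.im_mul, map_add, map_mul]
        linear_combination -(f x.im * f y.im) * h
      map_zero' := by simp
      map_add' := fun x y => by
        simp only [QuadraticAlgebra.re_add, QuadraticAlgebra.im_add, map_add]
        ring }
  refine ⟨g, fun s => ?_, ?_⟩
  · simp [g]
  · simp [g]

theorem hom_ext' {T : Type*} [CommRing T] {f g : QuadAlg e a →+* T}
    (h : ∀ s, f (algebraMap S _ s) = g (algebraMap S _ s)) (hθ : f (θ e a) = g (θ e a)) :
    f = g := by
  refine RingHom.ext fun x => ?_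
  rw [eq_rep e a x, map_add, map_mul, map_add, map_mul, h, h, hθ]

theorem mem_nonZeroDivisors_of_base {s : S} (hs : s ∈ nonZeroDivisors S) :
    algebraMap S (QuadAlg e a) s ∈ nonZeroDivisors (QuadAlg e a) := by
  rw [mem_nonZeroDivisors_iff_right] at hs ⊢
  intro x hx
  ext
  · refine hs _ ?_
    have := congrArg QuadraticAlgebra.re hx
    simpa using this
  · refine hs _ ?_
    have := congrArg QuadraticAlgebra.im hx
    simpa using this

/-- A quadratic algebra over a reduced ring is reduced when its discriminant is regular. -/
theorem isReduced [IsReduced S] (hD : e ^ 2 + 4 * a ∈ nonZeroDivisors S) :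
    IsReduced (QuadAlg e a) := by
  obtain ⟨σ, hσ1, hσ2⟩ := exists_hom e a (algebraMap S (QuadAlg e a)) (algebraMap S _ e - θ e a) (by
    linear_combination θ_sq e a)
  have hinj : Function.Injective (algebraMap S (QuadAlg e a)) :=
    QuadraticAlgebra.algebraMap_injective
  refine ⟨fun x hx => ?_⟩
  obtain ⟨u, v, rfl⟩ : ∃ u v, x = algebraMap S _ u + algebraMap S _ v * θ e a :=
    ⟨_, _, eq_rep e a x⟩
  have hσx := hx.map σ
  rw [mem_nonZeroDivisors_iff_right] at hD
  have hv : v = 0 := by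
    have h1 : IsNilpotent (algebraMap S (QuadAlg e a) (v ^ 2 * (e ^ 2 + 4 * a))) := by
      have h2 := (Commute.all _ _).isNilpotent_sub hx hσx
      have h3 : algebraMap S (QuadAlg e a) (v ^ 2 * (e ^ 2 + 4 * a)) =
          (algebraMap S _ u + algebraMap S _ v * θ e a -
            σ (algebraMap S _ u + algebraMap S _ v * θ e a)) ^ (1 + 1) := by
        simp only [map_add, map_mul, hσ1, hσ2, map_pow, map_ofNat]
        linear_combination (-(4 : QuadAlg e a) * algebraMap S (QuadAlg e a) v ^ 2) * θ_sq e a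
      rw [h3]
      exact h2.pow_succ 1
    rw [IsNilpotent.map_iff hinj] at h1
    have h4 := h1.eq_zero
    rw [pow_two, mul_assoc] at h4
    have h5 := hD (v * v) (by rw [mul_assoc]; exact h4)
    exact pow_eq_zero_iff two_ne_zero |>.mp (by rwa [pow_two])
  rw [hv, map_zero, zero_mul, add_zero] at hx ⊢
  rw [IsNilpotent.map_iff hinj] at hx
  rw [hx.eq_zero, map_zero]

end QuadAlg
end Quadratic

section Form
variable {k : Type u} [Field k]

/-- The quadratic form `x₀² + e x₀ x₁ - a x₁² - b x₂²`. -/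
def qf (e a b : k) : MvPolynomial (Fin 3) k :=
  X 0 ^ 2 + MvPolynomial.C e * (X 0 * X 1) - MvPolynomial.C a * X 1 ^ 2 - MvPolynomial.C b * X 2 ^ 2

theorem qf_zero (a b : k) : qf 0 a b = diagForm a b := by simp [qf, diagForm]

theorem isHomogeneous_qf (e a b : k) : (qf e a b).IsHomogeneous 2 := by
  have h2 : ∀ (c : k) (i : Fin 3), (MvPolynomial.C c * X i ^ 2 : MvPolynomial (Fin 3) k).IsHomogeneous 2 :=
    fun c i => by simpa using (isHomogeneous_C (Fin 3) c).mul ((isHomogeneous_X k i).pow 2)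
  have h3 : (MvPolynomial.C e * (X 0 * X 1) : MvPolynomial (Fin 3) k).IsHomogeneous 2 := by
    simpa using (isHomogeneous_C (Fin 3) e).mul ((isHomogeneous_X k 0).mul (isHomogeneous_X k 1))
  have h1 : (X 0 ^ 2 : MvPolynomial (Fin 3) k).IsHomogeneous 2 := by
    simpa using (isHomogeneous_X k (0 : Fin 3)).pow 2
  exact ((h1.add h3).sub (h2 a 1)).sub (h2 b 2)

/-- The value of the form `qf` at a vector. -/
def qv {R : Type*} [CommRing R] (e a b : R) (x : Fin 3 → R) : R :=
  x 0 ^ 2 + e * (x 0 * x 1) - a * x 1 ^ 2 - b * x 2 ^ 2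

theorem eval₂_qf {R : Type*} [CommRing R] (f : k →+* R) (v : Fin 3 → R) (e a b : k) :
    eval₂ f v (qf e a b) = qv (f e) (f a) (f b) v := by
  simp [qf, qv]

theorem coordHom_qf (W : Sch k) (v : Fin 3 → Γ(W.left, ⊤)) (e a b : k) :
    coordHom W v (qf e a b) = qv (strHom W e) (strHom W a) (strHom W b) v :=
  eval₂_qf _ _ _ _ _

theorem qv_map {R S : Type*} [CommRing R] [CommRing S] (f : R →+* S) (e a b : R) (x : Fin 3 → R) :
    f (qv e a b x) = qv (f e) (f a) (f b) (fun i => f (x i)) := by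
  simp [qv]

section Charts
variable {Y : Sch k} {i : Y ⟶ projSpace k 2} {e a b : k}
  (R : Type u) [CommRing R] [Algebra k R] {S : Sch k} {V : S.left.Opens}

/-- The image of a scalar in the polynomial ring. -/
abbrev scal (c : k) : Polynomial R := algebraMap k (Polynomial R) c

/-- Over an affine base `Spec R`, the part `x₂ ≠ 0` of a conic is the spectrum of the quadratic
`R[x₁]`-algebra generated by `x₀`. -/
theorem exists_chart₂ (hi : HasForm i (qf e a b)) (u : specK k R ≅ opn S V) :
    Nonempty (specK k (QuadAlg (-(scal R e * Polynomial.X))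
      (scal R a * Polynomial.X ^ 2 + scal R b)) ≅
        opn (S ⊗ Y) ((fst S Y).left ⁻¹ᵁ V ⊓ coordOpen i (snd S Y) 2)) := by
  set l : Polynomial R := -(scal R e * Polynomial.X)
  set w : Polynomial R := scal R a * Polynomial.X ^ 2 + scal R b
  obtain ⟨ε, -⟩ := exists_iso_coordOpen hi 2 S V R (QuadAlg l w) u (IsScalarTower.toAlgHom k R _)
    ![QuadAlg.θ l w, algebraMap (Polynomial R) _ Polynomial.X, 1] rfl (by
      rw [aeval_def, eval₂_qf]
      simp only [qv, Matrix.cons_val]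
      have h := QuadAlg.θ_sq l w
      simp only [IsScalarTower.algebraMap_apply k (Polynomial R) (QuadAlg l w)]
      simp only [l, w, map_neg, map_add, map_mul, map_pow] at h ⊢
      linear_combination h) (by
      intro S _ ρ v hv hq
      rw [eval₂_qf, qv, hv] at hq
      obtain ⟨f, hf1, hf2⟩ := QuadAlg.exists_hom l w (Polynomial.eval₂RingHom ρ (v 1)) (v 0) (by
        simp only [l, w, map_neg, map_add, map_mul, map_pow, Polynomial.coe_eval₂RingHom,
          Polynomial.eval₂_X, Polynomial.algebraMap_apply, Polynomial.eval₂_C]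
        simp only [RingHom.comp_apply] at hq
        linear_combination hq)
      refine ⟨f, fun r => ?_, fun j => ?_⟩
      · rw [IsScalarTower.toAlgHom_apply, IsScalarTower.algebraMap_apply R (Polynomial R), hf1]
        simp
      · fin_cases j
        · exact hf2
        · exact (hf1 _).trans (by simp)
        · exact (map_one f).trans hv.symm) (by
      intro S _ f f' h1 h2
      refine QuadAlg.hom_ext' _ _ (fun s => ?_) (h2 0)
      refine RingHom.congr_fun (f := f.comp (algebraMap (Polynomial R) _))
        (g := f'.comp (algebraMap (Polynomial R) _)) ?_ s
      refine Polynomial.ringHom_ext (fun r => ?_) (h2 1)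
      have := h1 r
      rwa [IsScalarTower.toAlgHom_apply, IsScalarTower.algebraMap_apply R (Polynomial R)] at this)
  exact ⟨ε⟩

/-- Over an affine base `Spec R`, the part `x₁ ≠ 0` of a conic is the spectrum of the quadratic
`R[x₂]`-algebra generated by `x₀`. -/
theorem exists_chart₁ (hi : HasForm i (qf e a b)) (u : specK k R ≅ opn S V) :
    ∃ ε : specK k (QuadAlg (-scal R e) (scal R a + scal R b * Polynomial.X ^ 2)) ≅
        opn (S ⊗ Y) ((fst S Y).left ⁻¹ᵁ V ⊓ coordOpen i (snd S Y) 1),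
      Coord i (ε.hom ≫ opnι _ _ ≫ snd _ _) (fun l => secK k _
        (![QuadAlg.θ (-scal R e) (scal R a + scal R b * Polynomial.X ^ 2), 1,
          algebraMap (Polynomial R) _ Polynomial.X] l)) := by
  set l : Polynomial R := -scal R e
  set w : Polynomial R := scal R a + scal R b * Polynomial.X ^ 2
  obtain ⟨ε, hε⟩ := exists_iso_coordOpen hi 1 S V R (QuadAlg l w) u (IsScalarTower.toAlgHom k R _)
    ![QuadAlg.θ l w, 1, algebraMap (Polynomial R) _ Polynomial.X] rfl (by
      rw [aeval_def, eval₂_qf]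
      simp only [qv, Matrix.cons_val]
      have h := QuadAlg.θ_sq l w
      simp only [IsScalarTower.algebraMap_apply k (Polynomial R) (QuadAlg l w)]
      simp only [l, w, map_neg, map_add, map_mul, map_pow] at h ⊢
      linear_combination h) (by
      intro S _ ρ v hv hq
      rw [eval₂_qf, qv, hv] at hq
      obtain ⟨f, hf1, hf2⟩ := QuadAlg.exists_hom l w (Polynomial.eval₂RingHom ρ (v 2)) (v 0) (by
        simp only [l, w, map_neg, map_add, map_mul, map_pow, Polynomial.coe_eval₂RingHom,
          Polynomial.eval₂_X, Polynomial.algebraMap_apply, Polynomial.eval₂_C]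
        simp only [RingHom.comp_apply] at hq
        linear_combination hq)
      refine ⟨f, fun r => ?_, fun j => ?_⟩
      · rw [IsScalarTower.toAlgHom_apply, IsScalarTower.algebraMap_apply R (Polynomial R), hf1]
        simp
      · fin_cases j
        · exact hf2
        · exact (map_one f).trans hv.symm
        · exact (hf1 _).trans (by simp)) (by
      intro S _ f f' h1 h2
      refine QuadAlg.hom_ext' _ _ (fun s => ?_) (h2 0)
      refine RingHom.congr_fun (f := f.comp (algebraMap (Polynomial R) _))
        (g := f'.comp (algebraMap (Polynomial R) _)) ?_ s
      refine Polynomial.ringHom_ext (fun r => ?_) (h2 2)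
      have := h1 r
      rwa [IsScalarTower.toAlgHom_apply, IsScalarTower.algebraMap_apply R (Polynomial R)] at this)
  exact ⟨ε, hε⟩

end Charts
end Form

/-! ### Regularity of the last coordinate of a conic -/

section Regular
variable {k : Type u} [Field k]

theorem mem_nonZeroDivisors_of_cover {W : Sch k} (a : Γ(W.left, ⊤))
    (h : ∀ w : W.left, ∃ U : W.left.Opens, w ∈ U ∧
      (opnι W U).left.appTop.hom a ∈ nonZeroDivisors Γ((opn W U).left, ⊤)) :
    a ∈ nonZeroDivisors Γ(W.left, ⊤) := by
  rw [mem_nonZeroDivisors_iff_right]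
  intro b hb
  refine section_ext_of_cover _ _ fun w => ?_
  obtain ⟨U, hU, H⟩ := h w
  refine ⟨U, hU, ?_⟩
  rw [mem_nonZeroDivisors_iff_right] at H
  rw [map_zero]
  exact H _ (by rw [← map_mul, hb, map_zero])

/-- Regular functions on an affine scheme stay regular under flat pullback. -/
theorem mem_nonZeroDivisors_of_flat {W T : Sch k} [IsAffine W.left] (f : T ⟶ W) [Flat f.left]
    {a : Γ(W.left, ⊤)} (ha : a ∈ nonZeroDivisors Γ(W.left, ⊤)) :
    f.left.appTop.hom a ∈ nonZeroDivisors Γ(T.left, ⊤) := by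
  refine mem_nonZeroDivisors_of_cover _ fun t => ?_
  obtain ⟨U, hU, hA⟩ := exists_isAffineOpen_mem t
  refine ⟨U, hU, ?_⟩
  set g := opnι T U ≫ f with hg
  have : Flat g.left := inferInstanceAs (Flat ((opnι T U).left ≫ f.left))
  have h1 : g.left.appTop.hom.Flat := by
    have h : g.left.appTop = g.left.appLE ⊤ ⊤ _ := Scheme.Hom.app_eq_appLE g.left
    rw [h]
    exact Scheme.Hom.flat_appLE g.left (isAffineOpen_top _) (isAffineOpen_top _) le_top
  have h2 : g.left.appTop.hom a ∈ nonZeroDivisors Γ((opn T U).left, ⊤) := by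
    rw [mem_nonZeroDivisors_iff_right]
    intro b hb
    algebraize [g.left.appTop.hom]
    have h3 := Module.Flat.isSMulRegular_of_nonZeroDivisors (M := Γ((opn T U).left, ⊤)) ha
    refine h3 ?_
    simp only [smul_zero]
    rw [Algebra.smul_def, mul_comm]
    exact hb
  exact h2

theorem isIso_of_isIso_left {X Y : Sch k} (f : X ⟶ Y) [h : IsIso f.left] : IsIso f := by
  have : IsIso ((Over.forget _).map f) := h
  exact isIso_of_reflects_iso f (Over.forget _)

theorem flat_of_comp_mono {X Y Z : Scheme.{u}} (f : X ⟶ Y) (g : Y ⟶ Z) [Mono g] [Flat (f ≫ g)] :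
    Flat f := by
  have sq : IsPullback (𝟙 X) f (f ≫ g) g :=
    ⟨⟨by simp⟩, ⟨Limits.PullbackCone.IsLimit.mk _ (fun s => s.fst) (fun s => by simp)
      (fun s => by
        rw [← cancel_mono g, Category.assoc, ← s.condition])
      (fun s m h1 h2 => by simpa using h1)⟩⟩
  exact MorphismProperty.of_isPullback sq (by assumption)

theorem flat_opnLift {W' W : Sch k} (h : W' ⟶ W) (U : W.left.Opens) (hU : ∀ x, h.left x ∈ U)
    [hf : Flat h.left] : Flat (opnLift h U hU).left := by
  have : Flat ((opnLift h U hU).left ≫ (opnι W U).left) := by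
    rw [← Over.comp_left, opnLift_ι]; exact hf
  exact flat_of_comp_mono _ (opnι W U).left

variable {Y : Sch k} {i : Y ⟶ projSpace k 2} {e a b : k}

/-- On a conic `x₀² + e x₀ x₁ - a x₁² - b x₂² = 0` the coordinates `x₁`, `x₂` do not vanish
simultaneously. -/
theorem unimod_tail {R : Type*} [CommRing R] {e a b : R} {v : Fin 3 → R} (hv : Unimod v)
    (h : qv e a b v = 0) : Unimod ![v 1, v 2] := by
  rw [Unimod, Ideal.eq_top_iff_one]
  set I := Ideal.span (Set.range ![v 1, v 2]) with hI
  have h1 : v 1 ∈ I := Ideal.subset_span ⟨0, rfl⟩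
  have h2 : v 2 ∈ I := Ideal.subset_span ⟨1, rfl⟩
  have h0 : v 0 ^ 2 ∈ I := by
    have : v 0 ^ 2 = -(e * v 0) * v 1 + a * v 1 * v 1 + b * v 2 * v 2 := by
      unfold qv at h
      linear_combination h
    rw [this]
    exact add_mem (add_mem (I.mul_mem_left _ h1) (I.mul_mem_left _ h1)) (I.mul_mem_left _ h2)
  have hr : Ideal.span (Set.range v) ≤ I.radical := by
    rw [Ideal.span_le]
    rintro _ ⟨j, rfl⟩
    fin_cases j
    · exact ⟨2, h0⟩
    · exact Ideal.le_radical h1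
    · exact Ideal.le_radical h2
  rw [show Ideal.span (Set.range v) = ⊤ from hv, top_le_iff, Ideal.radical_eq_top] at hr
  rw [hr]
  trivial

theorem exists_mem_tail {W : Sch k} {v : Fin 3 → Γ(W.left, ⊤)} (hi : HasForm i (qf e a b))
    {h : W ⟶ Y} (H : Coord i h v) (w : W.left) :
    w ∈ W.left.basicOpen (v 1) ∨ w ∈ W.left.basicOpen (v 2) := by
  have h0 := H.form_eq_zero hi
  rw [coordHom_qf] at h0
  obtain ⟨j, hj⟩ := exists_mem_basicOpen (unimod_tail H.unimod h0) w
  fin_cases j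
  · exact Or.inl hj
  · exact Or.inr hj

theorem exists_mem_coordOpen_tail {W : Sch k} (hi : HasForm i (qf e a b)) (h : W ⟶ Y) (w : W.left) :
    w ∈ coordOpen i h 1 ∨ w ∈ coordOpen i h 2 := by
  obtain ⟨U, hU, s, -, hs⟩ := exists_local_coord i h w
  have := exists_mem_tail hi hs ⟨w, hU⟩
  rw [← coordOpen_eq hs, ← coordOpen_eq hs] at this
  exact this

instance flat_fst (S T : Sch k) : Flat (fst S T).left :=
  inferInstanceAs (Flat (Limits.pullback.fst S.hom T.hom))

/-- Transport of the regularity of `x₂` from a model of the part `x₁ ≠ 0` along a flat morphism. -/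
theorem mem_nonZeroDivisors_of_model {i : Y ⟶ projSpace k 2} {E S T : Sch k} [IsAffine E.left]
    (p : S ⟶ Y) (O : S.left.Opens) (ε : E ≅ opn S O) {s : Fin 3 → Γ(E.left, ⊤)}
    (hs : Coord i (ε.hom ≫ opnι S O ≫ p) s) (hs1 : s 1 = 1)
    (hs2 : s 2 ∈ nonZeroDivisors Γ(E.left, ⊤)) (g : T ⟶ S) [hg : Flat g.left]
    (hgO : ∀ x, g.left x ∈ O) {v : Fin 3 → Γ(T.left, ⊤)} (hv : Coord i (g ≫ p) v)
    (hu : IsUnit (v 1)) : v 2 ∈ nonZeroDivisors Γ(T.left, ⊤) := by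
  have hflat2 := flat_opnLift g O hgO
  have hflat3 : Flat (opnLift g O hgO ≫ ε.inv).left := by
    have h1 : IsIso ε.inv.left := inferInstanceAs (IsIso ((Over.forget _).map ε.inv))
    exact inferInstanceAs (Flat ((opnLift g O hgO).left ≫ ε.inv.left))
  have h1 := hs.pull (opnLift g O hgO ≫ ε.inv)
  have h2 : (opnLift g O hgO ≫ ε.inv) ≫ ε.hom ≫ opnι S O ≫ p = g ≫ p := by
    rw [Category.assoc, ε.inv_hom_id_assoc, ← Category.assoc, opnLift_ι]
  rw [h2] at h1
  have h3 := hv.prop h1 2 1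
  have h4 : pull (opnLift g O hgO ≫ ε.inv) s 1 = 1 := by
    rw [pull_apply, hs1, map_one]
  rw [h4, mul_one] at h3
  rw [h3]
  exact mul_mem hu.mem_nonZeroDivisors (mem_nonZeroDivisors_of_flat _ hs2)

/-- A model of the part `x₁ ≠ 0` of a conic, on which `x₂` is a variable of a polynomial ring over which
the coordinate ring is free, hence regular. -/
theorem exists_chart_model (hi : HasForm i (qf e a b)) :
    ∃ (E S : Sch k) (_ : IsAffine E.left) (p : S ⟶ Y) (_ : IsIso p) (O : S.left.Opens)
      (_ : coordOpen i p 1 ≤ O) (ε : E ≅ opn S O)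
      (s : Fin 3 → Γ(E.left, ⊤)), Coord i (ε.hom ≫ opnι S O ≫ p) s ∧ s 1 = 1 ∧
        s 2 ∈ nonZeroDivisors Γ(E.left, ⊤) := by
  have hterm : IsIso (snd (specK k k) Y).left := by
    have : IsIso (specK k k).hom := by
      change IsIso (Spec.map (𝟙 (CommRingCat.of k)))
      infer_instance
    exact inferInstanceAs (IsIso (Limits.pullback.snd (specK k k).hom Y.hom))
  have htop : IsIso (opnι (specK k k) ⊤) := by
    have : IsIso (opnι (specK k k) ⊤).left :=
      inferInstanceAs (IsIso (Scheme.topIso (specK k k).left).hom)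
    exact isIso_of_isIso_left _
  obtain ⟨ε, hε⟩ := exists_chart₁ k hi (asIso (opnι (specK k k) ⊤)).symm
  refine ⟨_, _, inferInstanceAs (IsAffine (Spec _)), _, isIso_of_isIso_left _,
    (fst (specK k k) Y).left ⁻¹ᵁ ⊤ ⊓ coordOpen i (snd (specK k k) Y) 1,
    fun x hx => And.intro trivial hx, ε, _, hε, ?_, ?_⟩
  · simp only [Matrix.cons_val, map_one]
  · have h5 : (Polynomial.X : Polynomial k) ∈ nonZeroDivisors (Polynomial k) :=
      mem_nonZeroDivisors_of_ne_zero Polynomial.X_ne_zero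
    have h6 := QuadAlg.mem_nonZeroDivisors_of_base (-scal k e)
      (scal k a + scal k b * Polynomial.X ^ 2) h5
    exact (MulEquivClass.map_nonZeroDivisors (secK k (QuadAlg (-scal k e)
      (scal k a + scal k b * Polynomial.X ^ 2)))).le ⟨_, h6, rfl⟩

/-- The last coordinate of a conic is regular; more generally this holds after flat pullback. -/
theorem coord_two_mem_nonZeroDivisors (hi : HasForm i (qf e a b)) {W : Sch k} (h : W ⟶ Y)
    [Flat h.left] {v : Fin 3 → Γ(W.left, ⊤)} (H : Coord i h v) :
    v 2 ∈ nonZeroDivisors Γ(W.left, ⊤) := by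
  refine mem_nonZeroDivisors_of_cover _ fun w => ?_
  rcases exists_mem_tail hi H w with hw | hw
  swap
  · exact ⟨_, hw, (isUnit_pull_basicOpen W _ _ le_rfl).mem_nonZeroDivisors⟩
  refine ⟨_, hw, ?_⟩
  have hu1 : IsUnit (pull (opnι W (W.left.basicOpen (v 1))) v 1) :=
    isUnit_pull_basicOpen W _ _ le_rfl
  obtain ⟨E, S, _, p, _, O, hO, ε, s, hs, hs1, hs2⟩ := exists_chart_model hi
  have hgs : (opnι W (W.left.basicOpen (v 1)) ≫ h ≫ inv p) ≫ p =
      opnι W (W.left.basicOpen (v 1)) ≫ h := by simp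
  have hv := H.pull (opnι W (W.left.basicOpen (v 1)))
  rw [← hgs] at hv
  refine mem_nonZeroDivisors_of_model p O ε hs hs1 hs2 _ (hg := ?_)
    (fun x => hO (mem_coordOpen_of_isUnit hv hu1 x)) hv hu1
  have h1 : IsIso (inv p).left := inferInstanceAs (IsIso ((Over.forget _).map (inv p)))
  exact inferInstanceAs
    (Flat ((opnι W (W.left.basicOpen (v 1))).left ≫ h.left ≫ (inv p).left))

end Regular

/-! ### Reducedness of products and schematic dominance -/

section Reduced
variable {k : Type u} [Field k]

theorem isReduced_of_cover {W : Scheme.{u}}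
    (h : ∀ w : W, ∃ (Y : Scheme.{u}) (f : Y ⟶ W), IsOpenImmersion f ∧ IsReduced Y ∧
      w ∈ Set.range f) : IsReduced W := by
  have : ∀ w : W, _root_.IsReduced (W.presheaf.stalk w) := by
    intro w
    obtain ⟨Y, f, hf, hY, y, rfl⟩ := h w
    exact isReduced_of_injective _
      (ConcreteCategory.bijective_of_isIso (C := CommRingCat) (f.stalkMap y)).1
  exact isReduced_of_isReduced_stalk W

theorem mem_nonZeroDivisors_of_isUnit_coeff {R : Type u} [CommRing R] {p : Polynomial R} (n : ℕ)
    (h : IsUnit (p.coeff n)) : p ∈ nonZeroDivisors (Polynomial R) := by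
  refine Polynomial.mem_nonZeroDivisors_iff.mpr fun r hr => ?_
  have := congrArg (Polynomial.coeff · n) hr
  simpa [h.mul_left_eq_zero] using this

/-- The discriminant of the chart `x₁ ≠ 0` of a conic is regular, as its constant term is a unit. -/
theorem discr_mem_nonZeroDivisors₁ {R : Type u} [CommRing R] [Algebra k R] {e a : k} (b : k)
    (hD : e ^ 2 + 4 * a ≠ 0) :
    (-scal R e) ^ 2 + 4 * (scal R a + scal R b * Polynomial.X ^ 2) ∈
      nonZeroDivisors (Polynomial R) := by
  have key : (-scal R e) ^ 2 + 4 * (scal R a + scal R b * Polynomial.X ^ 2) =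
      Polynomial.C (algebraMap k R (e ^ 2 + 4 * a)) +
        Polynomial.C (algebraMap k R (4 * b)) * Polynomial.X ^ 2 := by
    simp only [Polynomial.algebraMap_apply, map_add, map_mul, map_pow, map_ofNat]
    ring
  rw [key]
  refine mem_nonZeroDivisors_of_isUnit_coeff 0 ?_
  rw [Polynomial.coeff_add, Polynomial.coeff_C_zero, Polynomial.coeff_C_mul,
    Polynomial.coeff_X_pow, if_neg (by norm_num), mul_zero, add_zero]
  exact (isUnit_iff_ne_zero.mpr hD).map _

/-- The discriminant of the chart `x₂ ≠ 0` of a conic is regular, as its leading coefficient is a unit. -/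
theorem discr_mem_nonZeroDivisors₂ {R : Type u} [CommRing R] [Algebra k R] {e a : k} (b : k)
    (hD : e ^ 2 + 4 * a ≠ 0) :
    (-(scal R e * Polynomial.X)) ^ 2 + 4 * (scal R a * Polynomial.X ^ 2 + scal R b) ∈
      nonZeroDivisors (Polynomial R) := by
  have key : (-(scal R e * Polynomial.X)) ^ 2 + 4 * (scal R a * Polynomial.X ^ 2 + scal R b) =
      Polynomial.C (algebraMap k R (4 * b)) +
        Polynomial.C (algebraMap k R (e ^ 2 + 4 * a)) * Polynomial.X ^ 2 := by
    simp only [Polynomial.algebraMap_apply, map_add, map_mul, map_pow, map_ofNat]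
    ring
  rw [key]
  refine mem_nonZeroDivisors_of_isUnit_coeff 2 ?_
  rw [Polynomial.coeff_add, Polynomial.coeff_C, if_neg (by norm_num), Polynomial.coeff_C_mul,
    Polynomial.coeff_X_pow, if_pos rfl, mul_one, zero_add]
  exact (isUnit_iff_ne_zero.mpr hD).map _

instance isReduced_polynomial {R : Type*} [CommRing R] [_root_.IsReduced R] :
    _root_.IsReduced (Polynomial R) where
  eq_zero p hp := by
    ext n
    exact (Polynomial.isNilpotent_iff.mp hp n).eq_zero

variable {Y : Sch k} {i : Y ⟶ projSpace k 2} {e a b : k}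

/-- The product of a reduced scheme and a smooth conic is reduced. -/
theorem isReduced_tensor (hi : HasForm i (qf e a b)) (hD : e ^ 2 + 4 * a ≠ 0) (S : Sch k)
    [IsReduced S.left] : IsReduced (S ⊗ Y).left := by
  refine isReduced_of_cover fun p => ?_
  obtain ⟨V, hV, hVa⟩ := exists_isAffineOpen_mem ((fst S Y).left p)
  have : IsAffine (opn S V).left := hVa
  obtain ⟨_, ⟨u⟩⟩ := exists_iso_specK (opn S V)
  have hR : _root_.IsReduced Γ((opn S V).left, ⊤) := by
    have : IsReduced (opn S V).left := isReduced_of_isOpenImmersion (opnι S V).left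
    infer_instance
  have aux : ∀ {E : Sch k} {O : (S ⊗ Y).left.Opens} (ε : E ≅ opn (S ⊗ Y) O), IsReduced E.left →
      p ∈ O → ∃ (Y' : Scheme.{u}) (f : Y' ⟶ (S ⊗ Y).left), IsOpenImmersion f ∧ IsReduced Y' ∧
      p ∈ Set.range f := by
    intro E O ε hE hp
    refine ⟨_, (opnι (S ⊗ Y) O).left, inferInstance, ?_, ⟨⟨p, hp⟩, rfl⟩⟩
    have : IsIso ε.inv.left := inferInstanceAs (IsIso ((Over.forget _).map ε.inv))
    exact isReduced_of_isOpenImmersion ε.inv.left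
  rcases exists_mem_coordOpen_tail hi (snd S Y) p with hp | hp
  · obtain ⟨ε, -⟩ := exists_chart₁ _ hi u
    refine aux ε ?_ ⟨hV, hp⟩
    have := QuadAlg.isReduced _ _ (discr_mem_nonZeroDivisors₁
      (R := Γ((opn S V).left, ⊤)) b hD)
    exact inferInstanceAs (IsReduced (Spec _))
  · obtain ⟨ε⟩ := exists_chart₂ _ hi u
    refine aux ε ?_ ⟨hV, hp⟩
    have := QuadAlg.isReduced _ _ (discr_mem_nonZeroDivisors₂
      (R := Γ((opn S V).left, ⊤)) b hD)
    exact inferInstanceAs (IsReduced (Spec _))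

end Reduced

section Dominant
variable {k : Type u} [Field k]

theorem isSchemeTheoreticallyDominant_basicOpen {T : Scheme.{u}} [IsAffine T] {s : Γ(T, ⊤)}
    (hs : s ∈ nonZeroDivisors Γ(T, ⊤)) : IsSchemeTheoreticallyDominant (T.basicOpen s).ι := by
  refine ⟨Scheme.IdealSheafData.ext_of_isAffine (le_antisymm (fun a ha => ?_) bot_le)⟩
  rw [mem_ker_ideal] at ha
  have hle : T.basicOpen s ≤ (T.basicOpen s).ι ''ᵁ ⊤ := by rw [Scheme.Opens.ι_image_top]
  have h1 := ConcreteCategory.congr_hom (T.presheaf.map_comp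
    (homOfLE (le_top : (T.basicOpen s).ι ''ᵁ ⊤ ≤ ⊤)).op (homOfLE hle).op) a
  obtain ⟨n, hn⟩ := exists_pow_mul_eq_zero_of_res_basicOpen_eq_zero_of_isAffineOpen T
    (isAffineOpen_top T) a s (h1.trans
      ((congrArg (T.presheaf.map (homOfLE hle).op).hom ha).trans (map_zero _)))
  exact (mul_right_mem_nonZeroDivisors_eq_zero_iff (pow_mem hs n)).mp ((mul_comm _ _).trans hn)

variable {n : ℕ} {Y : Sch k}

instance quasiCompact_coordOpen (i : Y ⟶ projSpace k n) {W : Sch k} (h : W ⟶ Y) (j : Fin (n + 1)) :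
    QuasiCompact (opnι W (coordOpen i h j)).left := by
  have h2 : QuasiCompact (chart k n j).1.ι := by
    have : IsAffine ((chart k n j).1 : Scheme.{u}) := (chart k n j).2
    have : QuasiCompact ((chart k n j).1.ι ≫ (projSpace k n).hom) := inferInstance
    exact QuasiCompact.of_comp _ (projSpace k n).hom
  exact MorphismProperty.of_isPullback (isPullback_morphismRestrict (h ≫ i).left (chart k n j).1) h2

/-- The complement of `x₂ = 0` is dense, also after a flat pullback. -/
theorem isDominant_coordOpen {i : Y ⟶ projSpace k 2} {e a b : k} (hi : HasForm i (qf e a b))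
    {W : Sch k} (h : W ⟶ Y) [Flat h.left] [IsReduced W.left] :
    IsDominant (opnι W (coordOpen i h 2)).left := by
  refine AlgebraicGeometry.Opens.isDominant_ι ?_
  rw [dense_iff_inter_open]
  rintro V hV ⟨w, hw⟩
  by_contra hne
  rw [Set.not_nonempty_iff_eq_empty] at hne
  let V' : W.left.Opens := ⟨V, hV⟩
  obtain ⟨U, hU, s, -, hs⟩ := exists_local_coord i (opnι W V' ≫ h) ⟨w, hw⟩
  set g := opnι (opn W V') U ≫ opnι W V' ≫ h with hg
  have hred : IsReduced (opn (opn W V') U).left :=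
    isReduced_of_isOpenImmersion ((opnι (opn W V') U).left ≫ (opnι W V').left)
  have hflat : Flat g.left :=
    inferInstanceAs (Flat ((opnι (opn W V') U).left ≫ (opnι W V').left ≫ h.left))
  -- On `V` the last coordinate would be nilpotent as well as regular.
  have h1 := coord_two_mem_nonZeroDivisors hi g hs
  have h2 : (opn (opn W V') U).left.basicOpen (s 2) = ⊥ := by
    rw [← coordOpen_eq hs, eq_bot_iff]
    intro x hx
    have : x.1.1 ∈ V ∩ coordOpen i h 2 := ⟨x.1.2, hx⟩
    rw [hne] at this
    exact this
  have h3 := (basicOpen_eq_bot_iff _).mp h2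
  have h4 : (1 : Γ((opn (opn W V') U).left, ⊤)) = 0 := by
    rw [h3] at h1
    exact (mem_nonZeroDivisors_iff_right.mp h1 1 (mul_zero _))
  have h5 : (⟨⟨w, hw⟩, hU⟩ : (opn (opn W V') U).left) ∈
      (opn (opn W V') U).left.basicOpen (s 2) := by
    rw [h3, ← h4, Scheme.basicOpen_of_isUnit _ isUnit_one]
    trivial
  rw [h2] at h5
  exact h5

instance isSchemeTheoreticallyDominant_toImage {X Y : Scheme.{u}} (f : X ⟶ Y) [QuasiCompact f] :
    IsSchemeTheoreticallyDominant f.toImage := by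
  refine ⟨Scheme.IdealSheafData.ext_of_iSup_eq_top
    (fun U : Y.affineOpens => ⟨f.imageι ⁻¹ᵁ U.1, U.2.preimage f.imageι⟩) ?_ fun U => ?_⟩
  · rw [← Scheme.Hom.preimage_iSup, iSup_affineOpens_eq_top, Scheme.Hom.preimage_top]
  · rw [Scheme.Hom.ker_apply, Scheme.IdealSheafData.ideal_bot]
    exact (RingHom.injective_iff_ker_eq_bot _).mp (f.toImage_app_injective U)

/-- A morphism factors through a closed immersion as soon as its composite with a scheme theoretically
dominant morphism does. -/
theorem exists_lift_of_dominant {T' T Z Y : Scheme.{u}} (f : T' ⟶ T)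
    [IsSchemeTheoreticallyDominant f] (j : Z ⟶ Y) [IsClosedImmersion j] (g : T ⟶ Y) (g' : T' ⟶ Z)
    (h : f ≫ g = g' ≫ j) : ∃ l : T ⟶ Z, l ≫ j = g := by
  refine ⟨IsClosedImmersion.lift j g ?_, IsClosedImmersion.lift_fac _ _ _⟩
  have h1 : (f ≫ g).ker = g.ker := by
    rw [Scheme.Hom.ker_comp, f.ker_eq_bot, Scheme.IdealSheafData.map_bot]
  rw [← h1, h]
  exact Scheme.Hom.le_ker_comp _ _

end Dominant

/-! ### Multiplication with respect to a norm form -/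

section Mul
variable {R : Type*} [CommRing R]

/-- The product of the norm-form coordinates of two points: if `θ² = eθ + a`, then
`(x₀ + θ x₁)(y₀ + θ y₁) = m₀ + θ m₁`, and `m₂ = x₂ y₂`. -/
def mulVec₂ (e a : R) (x y : Fin 3 → R) : Fin 3 → R :=
  ![x 0 * y 0 + a * (x 1 * y 1), x 0 * y 1 + x 1 * y 0 + e * (x 1 * y 1), x 2 * y 2]

/-- The conjugate `x̄₀ + θ x̄₁` of `x₀ + θ x₁`. -/
def conjVec (e : R) (x : Fin 3 → R) : Fin 3 → R := ![x 0 + e * x 1, -x 1, x 2]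

/-- Division of the last coordinate by `b`. -/
def scaleVec (b' : R) (y : Fin 3 → R) : Fin 3 → R := ![y 0, y 1, b' * y 2]

theorem qv_mulVec₂ {e a b c : R} {x y : Fin 3 → R} (hx : qv e a b x = 0) (hy : qv e a c y = 0) :
    qv e a (b * c) (mulVec₂ e a x y) = 0 := by
  simp only [qv, mulVec₂, Matrix.cons_val] at *
  linear_combination (y 0 ^ 2 + e * (y 0 * y 1) - a * y 1 ^ 2) * hx + b * x 2 ^ 2 * hy

theorem mulVec₂_map {S : Type*} [CommRing S] (f : R →+* S) (e a : R) (x y : Fin 3 → R)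
    (j : Fin 3) : f (mulVec₂ e a x y j) = mulVec₂ (f e) (f a) (fun l => f (x l)) (fun l => f (y l)) j := by
  fin_cases j <;> simp [mulVec₂]

theorem mulVec₂_smul (e a s t : R) (x y : Fin 3 → R) (j : Fin 3) :
    mulVec₂ e a (s • x) (t • y) j = s * t * mulVec₂ e a x y j := by
  fin_cases j <;> simp [mulVec₂] <;> ring

/-- Multiplication with the conjugate inverts multiplication. -/
theorem mulVec₂_conjVec {e a b b' : R} (hb : b * b' = 1) {x : Fin 3 → R} (hx : qv e a b x = 0)
    (y : Fin 3 → R) (j : Fin 3) :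
    mulVec₂ e a (conjVec e x) (mulVec₂ e a x y) j = b * x 2 ^ 2 * scaleVec b' y j := by
  simp only [qv] at hx
  fin_cases j
  · simp [mulVec₂, conjVec, scaleVec]
    linear_combination y 0 * hx
  · simp [mulVec₂, conjVec, scaleVec]
    linear_combination y 1 * hx
  · simp [mulVec₂, conjVec, scaleVec]
    linear_combination - x 2 ^ 2 * y 2 * hb

/-- If `x₂` is invertible, then the product of `x` and `y` vanishes nowhere, as `y` can be recovered from
it by `mulVec₂_conjVec`. -/
theorem unimod_mulVec₂ {e a b b' : R} (hb : b * b' = 1) {x : Fin 3 → R} (hx : qv e a b x = 0)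
    (hu : IsUnit (x 2)) {y : Fin 3 → R} (hy : Unimod y) : Unimod (mulVec₂ e a x y) := by
  have hub : IsUnit (b * x 2 ^ 2) := (IsUnit.of_mul_eq_one _ hb).mul (hu.pow 2)
  rw [Unimod, eq_top_iff, ← hy, Ideal.span_le]
  set I := Ideal.span (Set.range (mulVec₂ e a x y)) with hI
  have hm : ∀ j, mulVec₂ e a x y j ∈ I := fun j => Ideal.subset_span ⟨j, rfl⟩
  have h1 : ∀ j, mulVec₂ e a (conjVec e x) (mulVec₂ e a x y) j ∈ I := by
    intro j
    fin_cases j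
    · exact add_mem (I.mul_mem_left _ (hm 0)) (I.mul_mem_left _ (I.mul_mem_left _ (hm 1)))
    · exact add_mem (add_mem (I.mul_mem_left _ (hm 1)) (I.mul_mem_left _ (hm 0)))
        (I.mul_mem_left _ (I.mul_mem_left _ (hm 1)))
    · exact I.mul_mem_left _ (hm 2)
  have h2 : ∀ j, scaleVec b' y j ∈ I := fun j => by
    have := h1 j
    rw [mulVec₂_conjVec hb hx] at this
    exact (Ideal.unit_mul_mem_iff_mem I hub).mp this
  rintro _ ⟨j, rfl⟩
  fin_cases j
  · exact h2 0
  · exact h2 1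
  · have := I.mul_mem_left b (h2 2)
    rwa [show b * scaleVec b' y 2 = y 2 by simp [scaleVec, ← mul_assoc, hb]] at this

theorem mulVec₂_prop {e a : R} {x w w' : Fin 3 → R} (h : ∀ p q, w p * w' q = w q * w' p) (p q) :
    mulVec₂ e a x w p * mulVec₂ e a x w' q = mulVec₂ e a x w q * mulVec₂ e a x w' p := by
  have key : ∀ v, mulVec₂ e a x v =
      Matrix.mulVec !![x 0, a * x 1, 0; x 1, x 0 + e * x 1, 0; 0, 0, x 2] v := by
    intro v
    ext j
    fin_cases j <;> simp [mulVec₂, Matrix.mulVec, dotProduct, Fin.sum_univ_three] <;> ring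
  rw [key, key]
  exact mulVec_prop _ h p q

theorem scaleVec_prop {b : R} {w w' : Fin 3 → R} (h : ∀ p q, w p * w' q = w q * w' p) (p q) :
    scaleVec b w p * scaleVec b w' q = scaleVec b w q * scaleVec b w' p := by
  have key : ∀ v, scaleVec b v = Matrix.mulVec (Matrix.diagonal ![1, 1, b]) v := by
    intro v
    ext j
    fin_cases j <;> simp [scaleVec, Matrix.mulVec_diagonal]
  rw [key, key]
  exact mulVec_prop _ h p q

/-- If `z` is proportional to the product of `x` and `y`, then `y` is proportional to the product
of the conjugate of `x` and `z`. -/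
theorem swap_prop {e a b b' : R} (hb : b * b' = 1) {x : Fin 3 → R} (hx : qv e a b x = 0)
    (hu : IsUnit (x 2)) {y z : Fin 3 → R}
    (h : ∀ p q, z p * mulVec₂ e a x y q = z q * mulVec₂ e a x y p) (p q) :
    scaleVec b' y p * mulVec₂ e a (conjVec e x) z q =
      scaleVec b' y q * mulVec₂ e a (conjVec e x) z p := by
  have hub : IsUnit (b * x 2 ^ 2) := (IsUnit.of_mul_eq_one _ hb).mul (hu.pow 2)
  have h1 := mulVec₂_prop (e := e) (a := a) (x := conjVec e x) h q p
  rw [mulVec₂_conjVec hb hx, mulVec₂_conjVec hb hx] at h1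
  refine hub.mul_left_cancel ?_
  linear_combination h1

/-- The converse of `swap_prop`, which follows by applying it to the conjugate of `x`. -/
theorem swap_prop' {e a b b' : R} (hb : b * b' = 1) {x : Fin 3 → R} (hx : qv e a b x = 0)
    (hu : IsUnit (x 2)) {y z : Fin 3 → R}
    (h : ∀ p q, scaleVec b' y p * mulVec₂ e a (conjVec e x) z q =
      scaleVec b' y q * mulVec₂ e a (conjVec e x) z p) (p q) :
    z p * mulVec₂ e a x y q = z q * mulVec₂ e a x y p := by
  have hx' : qv e a b (conjVec e x) = 0 := by
    rw [← hx]
    simp [qv, conjVec]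
    ring
  have h1 := swap_prop hb hx' (by simpa [conjVec] using hu) h
  have h2 : conjVec e (conjVec e x) = x := by
    ext j
    fin_cases j <;> simp [conjVec]
  rw [h2] at h1
  have h3 : ∀ p q, scaleVec b' z p * scaleVec b' (mulVec₂ e a x y) q =
      scaleVec b' z q * scaleVec b' (mulVec₂ e a x y) p := by
    intro p q
    have := h1 p q
    have h4 : mulVec₂ e a x (scaleVec b' y) = scaleVec b' (mulVec₂ e a x y) := by
      ext j
      fin_cases j <;> simp [mulVec₂, scaleVec]
      ring
    rwa [h4] at this
  have h5 : ∀ v : Fin 3 → R, scaleVec b (scaleVec b' v) = v := by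
    intro v
    ext j
    fin_cases j <;> simp [scaleVec, ← mul_assoc, hb]
  have := scaleVec_prop (b := b) h3 p q
  rwa [h5, h5] at this

theorem Unimod.exists_smul {ι : Type*} [Fintype ι] {v w : ι → R} (hv : Unimod v)
    (h : ∀ p q, v p * w q = v q * w p) : ∃ l : R, w = l • v := by
  obtain ⟨c, hc⟩ := (Ideal.mem_span_range_iff_exists_fun).mp
    (show (1 : R) ∈ Ideal.span (Set.range v) by rw [show Ideal.span (Set.range v) = ⊤ from hv]; trivial)
  refine ⟨∑ i, c i * w i, funext fun j => ?_⟩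
  rw [Pi.smul_apply, smul_eq_mul, Finset.sum_mul, ← one_mul (w j), ← hc, Finset.sum_mul]
  exact Finset.sum_congr rfl fun i _ => by linear_combination c i * h i j

theorem Unimod.isUnit_of_smul {ι : Type*} {v : ι → R} {l : R} (hw : Unimod (l • v)) : IsUnit l := by
  rw [← Ideal.span_singleton_eq_top, eq_top_iff, ← hw, Ideal.span_le]
  rintro _ ⟨i, rfl⟩
  exact Ideal.mem_span_singleton'.mpr ⟨v i, mul_comm _ _⟩

end Mul

/-! ### The product map of a triple of conics -/

section Triple
variable {k : Type u} [Field k]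

/-- Three conics in normal form with respect to the same quadratic algebra `θ² = eθ + a`, the last
one being the product of the first two. -/
structure ConicTriple (e a b c : k) (C₁ C₂ C : Sch k) where
  i₁ : C₁ ⟶ projSpace k 2
  i₂ : C₂ ⟶ projSpace k 2
  i : C ⟶ projSpace k 2
  form₁ : HasForm i₁ (qf e a b)
  form₂ : HasForm i₂ (qf e a c)
  form : HasForm i (qf e a (b * c))
  hb : b ≠ 0
  hc : c ≠ 0
  discr : e ^ 2 + 4 * a ≠ 0

/-- The product of two coordinate vectors over `W`. -/
def mv (W : Sch k) (e a : k) (x y : Fin 3 → Γ(W.left, ⊤)) : Fin 3 → Γ(W.left, ⊤) :=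
  mulVec₂ (strHom W e) (strHom W a) x y

theorem pull_mv {W W' : Sch k} (g : W' ⟶ W) (e a : k) (x y : Fin 3 → Γ(W.left, ⊤)) :
    pull g (mv W e a x y) = mv W' e a (pull g x) (pull g y) := by
  funext j
  have := mulVec₂_map g.left.appTop.hom (strHom W e) (strHom W a) x y j
  rw [strHom_comp, strHom_comp] at this
  exact this

theorem Unimod.smul {R ι : Type*} [CommRing R] {v : ι → R} (hv : Unimod v) {l : R}
    (hl : IsUnit l) : Unimod (l • v) := by
  rw [Unimod, eq_top_iff, ← hv, Ideal.span_le]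
  rintro _ ⟨j, rfl⟩
  exact (Ideal.unit_mul_mem_iff_mem _ hl).mp (Ideal.subset_span ⟨j, rfl⟩)

theorem Coord.exists_smul {n : ℕ} {Y W : Sch k} {i : Y ⟶ projSpace k n} {h : W ⟶ Y}
    {v v' : Fin (n + 1) → Γ(W.left, ⊤)} (H : Coord i h v) (H' : Coord i h v') :
    ∃ l : Γ(W.left, ⊤), IsUnit l ∧ v' = l • v := by
  obtain ⟨l, rfl⟩ := H.unimod.exists_smul (H.prop H')
  exact ⟨l, H'.unimod.isUnit_of_smul, rfl⟩

theorem isUnit_of_mem_coordOpen {n : ℕ} {Y W T : Sch k} {i : Y ⟶ projSpace k n} {x : W ⟶ Y}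
    {j : Fin (n + 1)} (h : ∀ w : W.left, w ∈ coordOpen i x j) {g : T ⟶ W}
    {u : Fin (n + 1) → Γ(T.left, ⊤)} (hu : Coord i (g ≫ x) u) : IsUnit (u j) := by
  obtain ⟨u', hu1, hu'⟩ := exists_coord_one i x g j fun s => h _
  obtain ⟨l, hl, rfl⟩ := hu'.exists_smul hu
  rw [Pi.smul_apply, hu1, smul_eq_mul, mul_one]
  exact hl

theorem exists_local_coords {n : ℕ} {C₁ C₂ : Sch k} (i₁ : C₁ ⟶ projSpace k n)
    (i₂ : C₂ ⟶ projSpace k n) {W : Sch k} (x : W ⟶ C₁) (y : W ⟶ C₂) (w : W.left) :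
    ∃ U : W.left.Opens, w ∈ U ∧ ∃ u v,
      Coord i₁ (opnι W U ≫ x) u ∧ Coord i₂ (opnι W U ≫ y) v := by
  obtain ⟨U, hU, u, -, hu⟩ := exists_local_coord i₁ x w
  obtain ⟨V, hV, v, -, hv⟩ := exists_local_coord i₂ y w
  obtain ⟨f, hf⟩ : ∃ f : opn W (U ⊓ V) ⟶ opn W U, f ≫ opnι W U = opnι W (U ⊓ V) :=
    ⟨opnLift (opnι W _) U fun x => x.2.1, opnLift_ι _ _ _⟩
  obtain ⟨g, hg⟩ : ∃ g : opn W (U ⊓ V) ⟶ opn W V, g ≫ opnι W V = opnι W (U ⊓ V) :=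
    ⟨opnLift (opnι W _) V fun x => x.2.2, opnLift_ι _ _ _⟩
  refine ⟨U ⊓ V, ⟨hU, hV⟩, Conics.pull f u, Conics.pull g v, ?_, ?_⟩
  · have := hu.pull f
    rwa [← Category.assoc, hf] at this
  · have := hv.pull g
    rwa [← Category.assoc, hg] at this

namespace ConicTriple
variable {e a b c : k} {C₁ C₂ C : Sch k} (t : ConicTriple e a b c C₁ C₂ C)

/-- The point `z` of `C` is proportional to the product of the points `x` of `C₁` and `y` of `C₂`,
with no condition where that product vanishes. -/
def Rel {W : Sch k} (x : W ⟶ C₁) (y : W ⟶ C₂) (z : W ⟶ C) : Prop :=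
  ∀ (T : Sch k) (g : T ⟶ W) (u v w : Fin 3 → Γ(T.left, ⊤)), Coord t.i₁ (g ≫ x) u →
    Coord t.i₂ (g ≫ y) v → Coord t.i (g ≫ z) w →
      ∀ p q, w p * mv T e a u v q = w q * mv T e a u v p

theorem Rel.pull {t : ConicTriple e a b c C₁ C₂ C} {W W' : Sch k} {x : W ⟶ C₁} {y : W ⟶ C₂}
    {z : W ⟶ C} (h : t.Rel x y z) (g : W' ⟶ W) : t.Rel (g ≫ x) (g ≫ y) (g ≫ z) :=
  fun T f u v w hu hv hw => h T (f ≫ g) u v w (by rwa [Category.assoc]) (by rwa [Category.assoc])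
    (by rwa [Category.assoc])

theorem Rel.of_coord {W : Sch k} {x : W ⟶ C₁} {y : W ⟶ C₂} {z : W ⟶ C}
    {u v w : Fin 3 → Γ(W.left, ⊤)} (hu : Coord t.i₁ x u) (hv : Coord t.i₂ y v)
    (hw : Coord t.i z w) (h : ∀ p q, w p * mv W e a u v q = w q * mv W e a u v p) :
    t.Rel x y z := by
  intro T g u' v' w' hu' hv' hw' p q
  obtain ⟨r, -, rfl⟩ := (hu.pull g).exists_smul hu'
  obtain ⟨s, -, rfl⟩ := (hv.pull g).exists_smul hv'
  obtain ⟨l, -, rfl⟩ := (hw.pull g).exists_smul hw'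
  have h1 := congrArg g.left.appTop.hom (h p q)
  rw [map_mul, map_mul] at h1
  have h2 : ∀ j, g.left.appTop.hom (mv W e a u v j) = mv T e a (Conics.pull g u) (Conics.pull g v) j :=
    fun j => congrFun (pull_mv g e a u v) j
  rw [h2, h2] at h1
  have h3 : ∀ j, mv T e a (r • Conics.pull g u) (s • Conics.pull g v) j = _ :=
    fun j => mulVec₂_smul _ _ _ _ _ _ j
  rw [h3, h3]
  simp only [Pi.smul_apply, smul_eq_mul]
  change _ = _ at h1
  simp only [mv] at h1 ⊢
  simp only [pull_apply]
  linear_combination l * (r * s) * h1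

theorem Rel.of_cover {W : Sch k} {x : W ⟶ C₁} {y : W ⟶ C₂} {z : W ⟶ C}
    (h : ∀ w : W.left, ∃ U : W.left.Opens, w ∈ U ∧
      t.Rel (opnι W U ≫ x) (opnι W U ≫ y) (opnι W U ≫ z)) : t.Rel x y z := by
  intro T g u v w hu hv hw p q
  refine section_ext_of_cover _ _ fun s => ?_
  obtain ⟨U, hU, H⟩ := h (g.left s)
  refine ⟨g.left ⁻¹ᵁ U, hU, ?_⟩
  have hg := opnMap_ι g U (g.left ⁻¹ᵁ U) le_rfl
  set r := opnMap g U (g.left ⁻¹ᵁ U) le_rfl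
  set j := opnι T (g.left ⁻¹ᵁ U)
  have hx : ∀ {Z : Sch k} (f : W ⟶ Z), r ≫ opnι W U ≫ f = j ≫ g ≫ f := fun f => by
    rw [← Category.assoc, hg, Category.assoc]
  have := H _ r (Conics.pull j u) (Conics.pull j v) (Conics.pull j w) (by rw [hx]; exact hu.pull j)
    (by rw [hx]; exact hv.pull j) (by rw [hx]; exact hw.pull j) p q
  rw [← pull_mv] at this
  simpa only [pull_apply, map_mul] using! this

theorem qv_mv {W : Sch k} {x : W ⟶ C₁} {y : W ⟶ C₂} {u v : Fin 3 → Γ(W.left, ⊤)}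
    (hu : Coord t.i₁ x u) (hv : Coord t.i₂ y v) :
    coordHom W (mv W e a u v) (qf e a (b * c)) = 0 := by
  have h1 := hu.form_eq_zero t.form₁
  have h2 := hv.form_eq_zero t.form₂
  rw [coordHom_qf] at h1 h2 ⊢
  rw [map_mul]
  exact qv_mulVec₂ h1 h2

/-- The product of the points `x` and `y` does not vanish anywhere. -/
def Regular {W : Sch k} (x : W ⟶ C₁) (y : W ⟶ C₂) : Prop :=
  ∀ (T : Sch k) (g : T ⟶ W) (u v : Fin 3 → Γ(T.left, ⊤)), Coord t.i₁ (g ≫ x) u →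
    Coord t.i₂ (g ≫ y) v → Unimod (mv T e a u v)

theorem Regular.pull {t : ConicTriple e a b c C₁ C₂ C} {W W' : Sch k} {x : W ⟶ C₁} {y : W ⟶ C₂}
    (h : t.Regular x y) (g : W' ⟶ W) : t.Regular (g ≫ x) (g ≫ y) :=
  fun T f u v hu hv => h T (f ≫ g) u v (by rwa [Category.assoc]) (by rwa [Category.assoc])

theorem regular_of_mem {W : Sch k} (x : W ⟶ C₁) (y : W ⟶ C₂)
    (h : ∀ w : W.left, w ∈ coordOpen t.i₁ x 2) : t.Regular x y := by
  intro T g u v hu hv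
  have h1 := hu.form_eq_zero t.form₁
  rw [coordHom_qf] at h1
  refine unimod_mulVec₂ (b' := strHom T b⁻¹) ?_ h1 ?_ hv.unimod
  · rw [← map_mul, mul_inv_cancel₀ t.hb, map_one]
  · exact isUnit_of_mem_coordOpen h hu

theorem Regular.of_coord {W : Sch k} {x : W ⟶ C₁} {y : W ⟶ C₂} {u v : Fin 3 → Γ(W.left, ⊤)}
    (hu : Coord t.i₁ x u) (hv : Coord t.i₂ y v) (h : Unimod (mv W e a u v)) : t.Regular x y := by
  intro T g u' v' hu' hv'
  obtain ⟨r, hr, rfl⟩ := (hu.pull g).exists_smul hu'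
  obtain ⟨s, hs, rfl⟩ := (hv.pull g).exists_smul hv'
  have h1 := h.pull g
  rw [pull_mv] at h1
  have h2 : mv T e a (r • Conics.pull g u) (s • Conics.pull g v) =
      (r * s) • mv T e a (Conics.pull g u) (Conics.pull g v) :=
    funext fun j => mulVec₂_smul _ _ _ _ _ _ j
  rw [h2]
  exact h1.smul (hr.mul hs)

theorem Rel.unique {t : ConicTriple e a b c C₁ C₂ C} {W : Sch k} {x : W ⟶ C₁} {y : W ⟶ C₂}
    {z z' : W ⟶ C} (hr : t.Regular x y) (h : t.Rel x y z) (h' : t.Rel x y z') : z = z' := by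
  have := t.form.mono
  refine hom_ext_of_cover _ _ fun s => ?_
  obtain ⟨U, hU, u, v, hu, hv⟩ := exists_local_coords t.i₁ t.i₂ x y s
  refine ⟨U, hU, ?_⟩
  have hm := hr _ _ _ _ hu hv
  obtain ⟨z₀, hz₀⟩ := exists_coord_of_form t.form hm (t.qv_mv hu hv)
  have key : ∀ z, t.Rel x y z → opnι W U ≫ z = z₀ := by
    intro z hz
    refine hom_ext_of_cover _ _ fun r => ?_
    obtain ⟨V, hV, w, -, hw⟩ := exists_local_coord t.i (opnι W U ≫ z) r
    refine ⟨V, hV, ?_⟩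
    refine hw.eq_of_prop (hz₀.pull _) ?_
    rw [pull_mv]
    have hu' := hu.pull (opnι _ V)
    have hv' := hv.pull (opnι _ V)
    exact hz _ (opnι _ V ≫ opnι W U) _ _ _ (by simpa only [Category.assoc] using hu')
      (by simpa only [Category.assoc] using hv') (by simpa only [Category.assoc] using hw)
  rw [key z h, key z' h']

theorem Regular.exists_rel {t : ConicTriple e a b c C₁ C₂ C} {W : Sch k} {x : W ⟶ C₁} {y : W ⟶ C₂}
    (hr : t.Regular x y) : ∃ z, t.Rel x y z := by
  obtain ⟨z, hz⟩ := exists_of_relation (W := W) (Y := C) (fun T g z => t.Rel (g ≫ x) (g ≫ y) z)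
    (fun s => by
      obtain ⟨U, hU, u, v, hu, hv⟩ := exists_local_coords t.i₁ t.i₂ x y s
      obtain ⟨z₀, hz₀⟩ := exists_coord_of_form t.form (hr _ _ _ _ hu hv) (t.qv_mv hu hv)
      exact ⟨U, hU, z₀, Rel.of_coord t hu hv hz₀ fun p q => mul_comm _ _⟩)
    (fun T g f f' h h' => Rel.unique (hr.pull g) h h')
    (fun T T' g f r h => by simpa only [Category.assoc] using h.pull r)
  refine ⟨z, Rel.of_cover t fun s => ?_⟩
  obtain ⟨U, hU, u, v, hu, hv⟩ := exists_local_coords t.i₁ t.i₂ x y s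
  obtain ⟨z₀, hz₀⟩ := exists_coord_of_form t.form (hr _ _ _ _ hu hv) (t.qv_mv hu hv)
  have h1 := Rel.of_coord t hu hv hz₀ fun p q => mul_comm _ _
  exact ⟨U, hU, by rwa [hz _ _ _ h1]⟩

/-- The triple obtained by exchanging the last two conics. -/
theorem exists_swap : ∃ t' : ConicTriple e a b (b * c) C₁ C C₂,
    (∀ {W : Sch k} (x : W ⟶ C₁), coordOpen t'.i₁ x 2 = coordOpen t.i₁ x 2) ∧
    ∀ {W : Sch k} (x : W ⟶ C₁) (y : W ⟶ C₂) (z : W ⟶ C),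
      (∀ w : W.left, w ∈ coordOpen t.i₁ x 2) → (t'.Rel x z y ↔ t.Rel x y z) := by
  let M : Matrix (Fin 3) (Fin 3) k := !![1, e, 0; 0, -1, 0; 0, 0, 1]
  have hM : M * M = 1 := by
    ext p q
    fin_cases p <;> fin_cases q <;> simp [M, Matrix.mul_apply, Fin.sum_univ_three]
  let N : Matrix (Fin 3) (Fin 3) k := Matrix.diagonal ![1, 1, b⁻¹]
  let N' : Matrix (Fin 3) (Fin 3) k := Matrix.diagonal ![1, 1, b]
  have hN : N' * N = 1 := by
    ext p q
    fin_cases p <;> fin_cases q <;> simp [N, N', t.hb]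
  have hbb : ∀ W : Sch k, strHom W b * strHom W b⁻¹ = 1 := fun W => by
    rw [← map_mul, mul_inv_cancel₀ t.hb, map_one]
  have actM : ∀ (W : Sch k) v, actVec W M v = conjVec (strHom W e) v := by
    intro W v
    ext j
    fin_cases j <;> simp [actVec, conjVec, M, Matrix.mulVec, dotProduct, Fin.sum_univ_three]
  have actN : ∀ (W : Sch k) v, actVec W N v = scaleVec (strHom W b⁻¹) v := by
    intro W v
    ext j
    fin_cases j <;> simp [actVec, scaleVec, N, Matrix.mulVec, dotProduct, Fin.sum_univ_three]
  obtain ⟨i₁', form₁', h₁'⟩ := t.form₁.linear (q' := qf e a b) hM one_ne_zero fun W v => by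
    rw [actM, coordHom_qf, coordHom_qf, map_one]
    simp [qv, conjVec]
    ring
  obtain ⟨i₂', form₂', h₂'⟩ := t.form₂.linear (q' := qf e a (b * (b * c))) hN one_ne_zero
    fun W v => by
      rw [actN, coordHom_qf, coordHom_qf, map_one, map_mul, map_mul]
      simp only [qv, scaleVec, Matrix.cons_val]
      linear_combination -strHom W c * v 2 ^ 2 * (1 + strHom W b * strHom W b⁻¹) * hbb W
  let t' : ConicTriple e a b (b * c) C₁ C C₂ :=
    ⟨i₁', t.i, i₂', form₁', t.form, form₂', t.hb, mul_ne_zero t.hb t.hc, t.discr⟩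
  refine ⟨t', ?_, ?_⟩
  · intro W x
    ext w
    obtain ⟨U, hU, s, -, hs⟩ := exists_local_coord t.i₁ x w
    have h1 := (h₁' _ _ _).1 hs
    rw [actM] at h1
    have h2 : (⟨w, hU⟩ : (opn W U).left) ∈ coordOpen t'.i₁ (opnι W U ≫ x) 2 ↔
        (⟨w, hU⟩ : (opn W U).left) ∈ coordOpen t.i₁ (opnι W U ≫ x) 2 := by
      rw [coordOpen_eq h1, coordOpen_eq hs]
      rfl
    exact h2
  · intro W x y z hx
    constructor
    · intro H T g u v w hu hv hw
      have := H T g _ _ _ ((h₁' _ _ _).1 hu) hw ((h₂' _ _ _).1 hv)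
      rw [actM, actN] at this
      refine swap_prop' (hbb T) ?_ ?_ this
      · have := hu.form_eq_zero t.form₁
        rwa [coordHom_qf] at this
      · exact isUnit_of_mem_coordOpen hx hu
    · intro H T g u w v hu hw hv
      have hu0 := (h₁' _ _ _).2 hu
      have hv0 := (h₂' _ _ _).2 hv
      have h1 := H T g _ _ _ hu0 hv0 hw
      have h2 : conjVec (strHom T e) (actVec T M u) = u := by
        rw [← actM, ← actVec_mul, hM, actVec_one]
      have h3 : scaleVec (strHom T b⁻¹) (actVec T N' v) = v := by
        rw [← actN, ← actVec_mul, mul_eq_one_comm.mp hN, actVec_one]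
      have h4 := hu0.form_eq_zero t.form₁
      rw [coordHom_qf] at h4
      have h5 := swap_prop (hbb T) h4 (isUnit_of_mem_coordOpen hx hu0) h1
      rw [h2, h3] at h5
      exact h5

end ConicTriple
end Triple

/-! ### Properness and the Segre embedding -/

section Proper
variable {k : Type u} [Field k]

instance isProper_projSpace (n : ℕ) : IsProper (projSpace k n).hom := by
  have : IsScalarTower k (gr k n 0) (MvPolynomial (Fin (n + 1)) k) :=
    ⟨fun x y z => by
      rw [Algebra.smul_def (x • y) z, Algebra.smul_def y z, ← smul_mul_assoc]; rfl⟩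
  have hft : Algebra.FiniteType (gr k n 0) (MvPolynomial (Fin (n + 1)) k) :=
    Algebra.FiniteType.of_restrictScalars_finiteType k _ _
  have h1 : IsProper (Proj.toSpecZero (gr k n)) := inferInstance
  have h2 : IsClosedImmersion (Spec.map (CommRingCat.ofHom (algebraMap k (gr k n 0)))) := by
    refine IsClosedImmersion.spec_of_surjective _ fun x => ?_
    obtain ⟨x, hx⟩ := x
    refine ⟨coeff 0 x, Subtype.ext ?_⟩
    have := totalDegree_eq_zero_iff_eq_C.mp (Nat.le_zero.mp
      ((mem_homogeneousSubmodule _ _).mp hx).totalDegree_le)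
    exact this.symm
  exact inferInstanceAs (IsProper (Proj.toSpecZero (gr k n) ≫ Spec.map _))

theorem isProper_of_closed {n : ℕ} {Y : Sch k} (i : Y ⟶ projSpace k n) [IsClosedImmersion i.left] :
    IsProper Y.hom := by
  rw [← Over.w i]
  infer_instance

theorem isProper_tensor {X Y : Sch k} [IsProper X.hom] [IsProper Y.hom] : IsProper (X ⊗ Y).hom := by
  have h1 : IsProper (Limits.pullback.fst X.hom Y.hom) := inferInstance
  exact inferInstanceAs (IsProper (Limits.pullback.fst X.hom Y.hom ≫ X.hom))

/-- A monomorphism from a proper scheme to a separated one is a closed immersion. -/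
theorem isClosedImmersion_of_mono {X Y : Sch k} (f : X ⟶ Y) [Mono f] [IsProper X.hom]
    [IsSeparated Y.hom] : IsClosedImmersion f.left := by
  have h1 : IsProper (f.left ≫ Y.hom) := by rw [Over.w]; infer_instance
  have h2 : IsProper f.left := IsProper.of_comp f.left Y.hom
  exact (IsClosedImmersion.iff_isProper_and_mono _).mpr ⟨h2, inferInstance⟩

/-- The Segre coordinates of a pair of points. -/
def segreVec {R : Type*} [CommRing R] (u v : Fin 3 → R) (j : Fin (8 + 1)) : R :=
  u ((finProdFinEquiv (m := 3) (n := 3)).symm j).1 *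
    v ((finProdFinEquiv (m := 3) (n := 3)).symm j).2

theorem segreVec_apply {R : Type*} [CommRing R] (u v : Fin 3 → R) (p q : Fin 3) :
    segreVec u v (finProdFinEquiv (m := 3) (n := 3) (p, q)) = u p * v q := by
  simp [segreVec]

theorem pull_segreVec {W W' : Sch k} (g : W' ⟶ W) (u v : Fin 3 → Γ(W.left, ⊤)) :
    pull g (segreVec u v) = segreVec (pull g u) (pull g v) := by
  funext j
  simp [segreVec]

theorem Unimod.eq_zero {R ι : Type*} [CommRing R] {v : ι → R} (hv : Unimod v) {r : R}
    (h : ∀ j, r * v j = 0) : r = 0 := by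
  have h1 : Ideal.span (Set.range v) ≤ LinearMap.ker (LinearMap.mulLeft R r) := by
    rw [Ideal.span_le]
    rintro _ ⟨j, rfl⟩
    exact h j
  have h2 := h1 (show (1 : R) ∈ _ by rw [show Ideal.span (Set.range v) = ⊤ from hv]; trivial)
  simpa using h2

theorem Unimod.segreVec {R : Type*} [CommRing R] {u v : Fin 3 → R} (hu : Unimod u)
    (hv : Unimod v) : Unimod (segreVec u v) := by
  have h : Ideal.span (Set.range u) * Ideal.span (Set.range v) = ⊤ := by
    rw [show Ideal.span (Set.range u) = ⊤ from hu, show Ideal.span (Set.range v) = ⊤ from hv,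
      Ideal.top_mul]
  rw [Unimod, eq_top_iff, ← h, Ideal.span_mul_span', Ideal.span_le]
  rintro _ ⟨_, ⟨p, rfl⟩, _, ⟨q, rfl⟩, rfl⟩
  exact Ideal.subset_span ⟨_, segreVec_apply u v p q⟩

theorem prop_of_segreVec {R : Type*} [CommRing R] {u v u' v' : Fin 3 → R} (hu : Unimod u)
    (hv : Unimod v) (hu' : Unimod u') (hv' : Unimod v')
    (h : ∀ p q, segreVec u v p * segreVec u' v' q = segreVec u v q * segreVec u' v' p) :
    (∀ p q, u p * u' q = u q * u' p) ∧ ∀ p q, v p * v' q = v q * v' p := by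
  obtain ⟨l, hl⟩ := (hu.segreVec hv).exists_smul h
  have hl' : ∀ p q, u' p * v' q = l * (u p * v q) := fun p q => by
    rw [← segreVec_apply u v, ← segreVec_apply u' v', hl]; rfl
  refine ⟨fun p q => ?_, fun p q => ?_⟩
  · refine sub_eq_zero.mp (hv.eq_zero fun j => hv'.eq_zero fun j' => ?_)
    linear_combination u p * v j * hl' q j' - u q * v j * hl' p j'
  · refine sub_eq_zero.mp (hu.eq_zero fun j => hu'.eq_zero fun j' => ?_)
    linear_combination v p * u j * hl' j' q - v q * u j * hl' j' p

/-- The Segre embedding of a product of two plane curves. -/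
theorem exists_segre {Y₁ Y₂ : Sch k} (i₁ : Y₁ ⟶ projSpace k 2) (i₂ : Y₂ ⟶ projSpace k 2)
    [h₁ : IsClosedImmersion i₁.left] [h₂ : IsClosedImmersion i₂.left] :
    ∃ s : Y₁ ⊗ Y₂ ⟶ projSpace k 8, IsClosedImmersion s.left := by
  have hm₁ : Mono i₁ := mono_of_closed i₁
  have hm₂ : Mono i₂ := mono_of_closed i₂
  have hp₁ := isProper_of_closed i₁
  have hp₂ := isProper_of_closed i₂
  have hp := isProper_tensor (X := Y₁) (Y := Y₂)
  obtain ⟨s, hs⟩ := exists_of_relation (W := Y₁ ⊗ Y₂) (Y := projSpace k 8)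
    (fun T g z => ∃ (u v : Fin 3 → Γ(T.left, ⊤)) (hu : Coord i₁ (g ≫ fst _ _) u)
      (hv : Coord i₂ (g ≫ snd _ _) v), z = toProj T (segreVec u v) (hu.unimod.segreVec hv.unimod))
    (fun w => by
      obtain ⟨U, hU, u, v, hu, hv⟩ := exists_local_coords i₁ i₂ (fst Y₁ Y₂) (snd Y₁ Y₂) w
      exact ⟨U, hU, _, u, v, hu, hv, rfl⟩)
    (by
      rintro T g f f' ⟨u, v, hu, hv, rfl⟩ ⟨u', v', hu', hv', rfl⟩
      refine toProj_congr _ _ ?_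
      obtain ⟨l, -, rfl⟩ := hu.exists_smul hu'
      obtain ⟨m, -, rfl⟩ := hv.exists_smul hv'
      intro p q
      simp only [segreVec, Pi.smul_apply, smul_eq_mul]
      ring)
    (by
      rintro T T' g f r ⟨u, v, hu, hv, rfl⟩
      refine ⟨pull r u, pull r v, by simpa using hu.pull r, by simpa using hv.pull r, ?_⟩
      rw [comp_toProj]
      congr 1
      exact pull_segreVec _ _ _)
  have hmono : Mono s := by
    refine ⟨fun {T} f g hfg => hom_ext_of_cover _ _ fun r => ?_⟩
    obtain ⟨U, hU, u, v, hu, hv⟩ := exists_local_coords i₁ i₂ (f ≫ fst _ _) (f ≫ snd _ _) r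
    refine ⟨U, hU, hom_ext_of_cover _ _ fun r' => ?_⟩
    obtain ⟨V, hV, u', v', hu', hv'⟩ := exists_local_coords i₁ i₂
      (opnι T U ≫ g ≫ fst _ _) (opnι T U ≫ g ≫ snd _ _) r'
    refine ⟨V, hV, ?_⟩
    set j := opnι (opn T U) V ≫ opnι T U
    have hu := hu.pull (opnι (opn T U) V)
    have hv := hv.pull (opnι (opn T U) V)
    simp only [← Category.assoc] at hu hv hu' hv' ⊢
    have h1 := hs _ _ _ ⟨_, _, hu, hv, rfl⟩
    have h2 := hs _ _ _ ⟨_, _, hu', hv', rfl⟩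
    simp only [Category.assoc] at h1 h2
    rw [hfg, h2] at h1
    have h3 := (toProj_eq_iff _ _).mp h1
    obtain ⟨h4, h5⟩ := prop_of_segreVec hu.unimod hv.unimod hu'.unimod hv'.unimod
      fun p q => by linear_combination h3 q p
    exact CartesianMonoidalCategory.hom_ext _ _ (hu.eq_of_prop hu' h4) (hv.eq_of_prop hv' h5)
  exact ⟨s, isClosedImmersion_of_mono s⟩

end Proper

/-! ### The birational equivalence -/

section Birational
variable {k : Type u} [Field k]

namespace ConicTriple
variable {e a b c : k} {C₁ C₂ C : Sch k} (t : ConicTriple e a b c C₁ C₂ C)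

/-- Where `x₂` does not vanish, multiplication by `x` identifies (open subschemes of) products with
`C₂` and with `C`. -/
theorem exists_iso_of_lift {S P P' : Sch k} (τ : S ⟶ C₁) (j : P ⟶ S ⊗ C₂) (j' : P' ⟶ S ⊗ C)
    [Mono j] [Mono j'] (hP : ∀ w, w ∈ coordOpen t.i₁ (j ≫ fst _ _ ≫ τ) 2)
    (hP' : ∀ w, w ∈ coordOpen t.i₁ (j' ≫ fst _ _ ≫ τ) 2)
    (l : ∀ {T : Sch k} (h : T ⟶ S ⊗ C₂), (∀ w, w ∈ coordOpen t.i₁ (h ≫ fst _ _ ≫ τ) 2) →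
      ∃ g : T ⟶ P, g ≫ j = h)
    (l' : ∀ {T : Sch k} (h : T ⟶ S ⊗ C), (∀ w, w ∈ coordOpen t.i₁ (h ≫ fst _ _ ≫ τ) 2) →
      ∃ g : T ⟶ P', g ≫ j' = h) :
    ∃ ε : P ≅ P', ε.hom ≫ j' ≫ fst _ _ = j ≫ fst _ _ ∧
      t.Rel (j ≫ fst _ _ ≫ τ) (j ≫ snd _ _) (ε.hom ≫ j' ≫ snd _ _) := by
  obtain ⟨t', ht₁, ht⟩ := t.exists_swap
  obtain ⟨z, hz⟩ := (t.regular_of_mem (j ≫ fst _ _ ≫ τ) (j ≫ snd _ _) hP).exists_rel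
  obtain ⟨y, hy⟩ := (t'.regular_of_mem (j' ≫ fst _ _ ≫ τ) (j' ≫ snd _ _)
    (by rw [ht₁]; exact hP')).exists_rel
  obtain ⟨f, hf⟩ := l' (lift (j ≫ fst _ _) z) (by
    rw [lift_fst_assoc, Category.assoc]; exact hP)
  obtain ⟨g, hg⟩ := l (lift (j' ≫ fst _ _) y) (by
    rw [lift_fst_assoc, Category.assoc]; exact hP')
  have hf₁ : f ≫ j' ≫ fst _ _ = j ≫ fst _ _ := by rw [reassoc_of% hf, lift_fst]
  have hf₂ : f ≫ j' ≫ snd _ _ = z := by rw [reassoc_of% hf, lift_snd]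
  have hg₁ : g ≫ j ≫ fst _ _ = j' ≫ fst _ _ := by rw [reassoc_of% hg, lift_fst]
  have hg₂ : g ≫ j ≫ snd _ _ = y := by rw [reassoc_of% hg, lift_snd]
  have hfg : f ≫ g = 𝟙 _ := by
    rw [← cancel_mono j]
    refine CartesianMonoidalCategory.hom_ext _ _ ?_ ?_
    · simp only [Category.assoc, Category.id_comp, hg₁, hf₁]
    · simp only [Category.assoc, Category.id_comp, hg₂]
      have h1 := hy.pull f
      rw [reassoc_of% hf₁, hf₂] at h1
      exact Rel.unique (t := t') (t'.regular_of_mem _ _ (by rw [ht₁]; exact hP)) h1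
        ((ht _ _ _ hP).mpr hz)
  have hgf : g ≫ f = 𝟙 _ := by
    rw [← cancel_mono j']
    refine CartesianMonoidalCategory.hom_ext _ _ ?_ ?_
    · simp only [Category.assoc, Category.id_comp, hg₁, hf₁]
    · simp only [Category.assoc, Category.id_comp, hf₂]
      have h1 := hz.pull g
      rw [reassoc_of% hg₁, hg₂] at h1
      exact Rel.unique (t.regular_of_mem _ _ hP') h1 ((ht _ _ _ hP').mp hy)
  refine ⟨⟨f, g, hfg, hgf⟩, hf₁, ?_⟩
  rw [hf₂]
  exact hz

/-- Over the complement of `x₂ = 0` in `C₁`, multiplication identifies `C₁ × C₂` with `C₁ × C`. -/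
theorem exists_iso_good :
    ∃ ε : opn (C₁ ⊗ C₂) (coordOpen t.i₁ (fst C₁ C₂) 2) ≅ opn (C₁ ⊗ C) (coordOpen t.i₁ (fst C₁ C) 2),
      ε.hom ≫ opnι _ _ ≫ fst _ _ = opnι _ _ ≫ fst _ _ ∧
      t.Rel (opnι _ _ ≫ fst _ _) (opnι _ _ ≫ snd _ _) (ε.hom ≫ opnι _ _ ≫ snd _ _) := by
  have := t.exists_iso_of_lift (𝟙 C₁) (opnι (C₁ ⊗ C₂) (coordOpen t.i₁ (fst C₁ C₂) 2))
    (opnι (C₁ ⊗ C) (coordOpen t.i₁ (fst C₁ C) 2)) (by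
      rw [Category.comp_id]; exact fun w => w.2) (by rw [Category.comp_id]; exact fun w => w.2)
    (fun h hw => ⟨opnLift h _ (by rwa [Category.comp_id] at hw), opnLift_ι _ _ _⟩)
    (fun h hw => ⟨opnLift h _ (by rwa [Category.comp_id] at hw), opnLift_ι _ _ _⟩)
  simpa only [Category.comp_id] using this

end ConicTriple

theorem isReduced_of_form {Y : Sch k} {i : Y ⟶ projSpace k 2} {e a b : k}
    (hi : HasForm i (qf e a b)) (hD : e ^ 2 + 4 * a ≠ 0) : IsReduced Y.left := by
  have h1 : IsReduced (specK k k).left := inferInstanceAs (IsReduced (Spec _))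
  have h2 := isReduced_tensor hi hD (specK k k)
  have : IsIso (specK k k).hom := by
    change IsIso (Spec.map (𝟙 (CommRingCat.of k)))
    infer_instance
  have h3 : IsIso (snd (specK k k) Y).left :=
    inferInstanceAs (IsIso (Limits.pullback.snd (specK k k).hom Y.hom))
  exact isReduced_of_isOpenImmersion (inv (snd (specK k k) Y).left)

theorem isReduced_prod {Y₁ Y₂ : Sch k} {i₁ : Y₁ ⟶ projSpace k 2} {i₂ : Y₂ ⟶ projSpace k 2}
    {e a b c : k} (h₁ : HasForm i₁ (qf e a b)) (h₂ : HasForm i₂ (qf e a c))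
    (hD : e ^ 2 + 4 * a ≠ 0) : IsReduced (Y₁ ⊗ Y₂).left := by
  have := isReduced_of_form h₁ hD
  exact isReduced_tensor h₂ hD Y₁

/-- The product of two conics is a reduced quasi-projective scheme. -/
theorem isQuasiProjVar_prod {Y₁ Y₂ : Sch k} {i₁ : Y₁ ⟶ projSpace k 2} {i₂ : Y₂ ⟶ projSpace k 2}
    {e a b c : k} (h₁ : HasForm i₁ (qf e a b)) (h₂ : HasForm i₂ (qf e a c))
    (hD : e ^ 2 + 4 * a ≠ 0) : IsQuasiProjVar (Y₁ ⊗ Y₂) := by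
  have := h₁.closed
  have := h₂.closed
  obtain ⟨s, hs⟩ := exists_segre i₁ i₂
  exact ⟨isReduced_prod h₁ h₂ hD, 8, s, inferInstance⟩

theorem IsQuasiProjVar.of_isImmersion {X Y : Sch k} (hX : IsQuasiProjVar X) (f : Y ⟶ X)
    [IsImmersion f.left] (hY : IsReduced Y.left) : IsQuasiProjVar Y := by
  obtain ⟨-, n, i, hi⟩ := hX
  exact ⟨hY, n, f ≫ i, inferInstanceAs (IsImmersion (f.left ≫ i.left))⟩

/-- If `X` and `X'` have isomorphic open subschemes with isomorphic reduced complements, then they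
have the same class. -/
theorem K₀.cls_eq {X X' Y U : Sch k} (hX : IsQuasiProjVar X) (hX' : IsQuasiProjVar X')
    (hY : IsReduced Y.left) (hU : IsReduced U.left) (i : Y ⟶ X) (j : U ⟶ X) (i' : Y ⟶ X') (j' : U ⟶ X')
    [hi : IsClosedImmersion i.left] [hj : IsOpenImmersion j.left] [hi' : IsClosedImmersion i'.left]
    [hj' : IsOpenImmersion j'.left] (hij : Set.range j.left = (Set.range i.left)ᶜ)
    (hij' : Set.range j'.left = (Set.range i'.left)ᶜ) :
    K₀.cls ⟨X, hX⟩ = K₀.cls ⟨X', hX'⟩ := by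
  have hY' := hX.of_isImmersion i hY
  have hU' := hX.of_isImmersion j hU
  have key : ∀ (Z : Var k) (i : Y ⟶ Z.1) (j : U ⟶ Z.1), IsClosedImmersion i.left →
      IsOpenImmersion j.left → Set.range j.left = (Set.range i.left)ᶜ →
      K₀.cls Z = K₀.cls ⟨Y, hY'⟩ + K₀.cls ⟨U, hU'⟩ := by
    intro Z i j hi hj hij
    refine (QuotientAddGroup.eq_iff_sub_mem).mpr (AddSubgroup.subset_closure ?_)
    exact GrothendieckRel.scissor Z ⟨Y, hY'⟩ ⟨U, hU'⟩ i j hi hj hij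
  rw [key ⟨X, hX⟩ i j hi hj hij, key ⟨X', hX'⟩ i' j' hi' hj' hij']

namespace ConicTriple
variable {e a b c : k} {C₁ C₂ C : Sch k} (t : ConicTriple e a b c C₁ C₂ C)

theorem birationalOver (t : ConicTriple e a b c C₁ C₂ C) :
    Scheme.BirationalOver (C₁ ⊗ C₂).hom (C₁ ⊗ C).hom := by
  have h1 := isReduced_prod t.form₁ t.form₂ t.discr
  have h2 := isReduced_prod t.form₁ t.form t.discr
  obtain ⟨ε, -, -⟩ := t.exists_iso_good
  have d1 := isDominant_coordOpen t.form₁ (fst C₁ C₂)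
  have d2 := isDominant_coordOpen t.form₁ (fst C₁ C)
  have b1 := Scheme.Hom.birationalOver (opnι (C₁ ⊗ C₂) _).left (C₁ ⊗ C₂).hom _
    (Over.w (opnι (C₁ ⊗ C₂) (coordOpen t.i₁ (fst C₁ C₂) 2)))
  have b2 := Scheme.Hom.birationalOver (opnι (C₁ ⊗ C) _).left (C₁ ⊗ C).hom _
    (Over.w (opnι (C₁ ⊗ C) (coordOpen t.i₁ (fst C₁ C) 2)))
  have hε : IsIso ε.hom.left := inferInstanceAs (IsIso ((Over.forget _).map ε.hom))
  have b3 := Scheme.Hom.birationalOver ε.hom.left _ _ (Over.w ε.hom)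
  exact b1.symm.trans (b3.trans b2)

end ConicTriple
end Birational

/-! ### The degree two point and the Grothendieck ring -/

section QuadPt
variable {k : Type u} [Field k]

/-- The scheme `Spec k[θ]`, where `θ² = eθ + a`. -/
abbrev quadPt (e a : k) : Sch k := specK k (QuadAlg e a)

/-- The function `θ` on `quadPt`. -/
def quadθ (e a : k) : Γ((quadPt e a).left, ⊤) := secK k (QuadAlg e a) (QuadAlg.θ e a)

theorem quadθ_sq (e a : k) :
    quadθ e a ^ 2 = strHom (quadPt e a) e * quadθ e a + strHom (quadPt e a) a := by
  rw [strHom_specK, strHom_specK, quadθ, ← map_pow, QuadAlg.θ_sq, map_add, map_mul]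

theorem exists_quadPt_hom {e a : k} {W : Sch k} {s : Γ(W.left, ⊤)}
    (hs : s ^ 2 = strHom W e * s + strHom W a) :
    ∃ p : W ⟶ quadPt e a, p.left.appTop.hom (quadθ e a) = s := by
  obtain ⟨f, hf, hfθ⟩ := QuadAlg.exists_hom e a (strHom W) s hs
  exact ⟨toSpecK W f hf, (toSpecK_appTop W f hf _).trans hfθ⟩

theorem quadPt_hom_ext {e a : k} {W : Sch k} {p p' : W ⟶ quadPt e a}
    (h : p.left.appTop.hom (quadθ e a) = p'.left.appTop.hom (quadθ e a)) : p = p' := by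
  refine specK_hom_ext fun r => ?_
  refine RingHom.congr_fun (f := p.left.appTop.hom.comp (secK k (QuadAlg e a)).toRingHom)
    (g := p'.left.appTop.hom.comp (secK k (QuadAlg e a)).toRingHom) ?_ r
  refine QuadAlg.hom_ext' _ _ (fun s => ?_) h
  exact (specK_strHom p s).trans (specK_strHom p' s).symm

instance isFinite_quadPt (e a : k) : IsFinite (quadPt e a).hom := by
  refine (IsFinite.SpecMap_iff _).mpr ?_
  exact RingHom.finite_algebraMap.mpr inferInstance

theorem isReduced_quadPt {e a : k} (hD : e ^ 2 + 4 * a ≠ 0) : IsReduced (quadPt e a).left := by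
  have := QuadAlg.isReduced e a (mem_nonZeroDivisors_of_ne_zero hD)
  exact inferInstanceAs (IsReduced (Spec _))

variable {Y : Sch k} {i : Y ⟶ projSpace k 2} {e a b : k}

/-- The degree two point `(-θ : 1 : 0)` of a conic in normal form. -/
theorem exists_quadPt_coord (hi : HasForm i (qf e a b)) :
    ∃ ξ : quadPt e a ⟶ Y, Coord i ξ ![-quadθ e a, 1, 0] := by
  refine exists_coord_of_form hi (unimod_of_isUnit (j := 1) isUnit_one) ?_
  rw [coordHom_qf]
  simp only [qv, Matrix.cons_val]
  linear_combination quadθ_sq e a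

/-- The conjugate degree two point `(θ - e : 1 : 0)` of a conic in normal form. -/
theorem exists_quadPt_coord_conj (hi : HasForm i (qf e a b)) :
    ∃ ξ : quadPt e a ⟶ Y, Coord i ξ ![quadθ e a - strHom _ e, 1, 0] := by
  refine exists_coord_of_form hi (unimod_of_isUnit (j := 1) isUnit_one) ?_
  rw [coordHom_qf]
  simp only [qv, Matrix.cons_val]
  linear_combination quadθ_sq e a

/-- A conic in normal form has a point with `x₂ ≠ 0` over the quadratic algebra. -/
theorem exists_quadPt_coord_one (hi : HasForm i (qf e a b)) (hD : e ^ 2 + 4 * a ≠ 0) :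
    ∃ τ : quadPt e a ⟶ Y, ∀ w, w ∈ coordOpen i τ 2 := by
  set θ := quadθ e a
  set s := strHom (quadPt e a)
  have hθ : θ ^ 2 = s e * θ + s a := quadθ_sq e a
  have hs : s (e ^ 2 + 4 * a) * s (e ^ 2 + 4 * a)⁻¹ = 1 := by
    rw [← map_mul, mul_inv_cancel₀ hD, map_one]
  have hs' : (s e ^ 2 + 4 * s a) * s (e ^ 2 + 4 * a)⁻¹ = 1 := by
    simpa only [map_add, map_mul, map_pow, map_ofNat] using hs
  -- `x₀ + x₁ θ = b` and `x₀ + x₁ (e - θ) = 1`.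
  let r := (s b - 1) * (2 * θ - s e) * s (e ^ 2 + 4 * a)⁻¹
  have hr : r * (2 * θ - s e) = s b - 1 := by
    simp only [r]
    linear_combination 4 * (s b - 1) * s (e ^ 2 + 4 * a)⁻¹ * hθ + (s b - 1) * hs'
  have hu : IsUnit ((![s b - r * θ, r, 1] : Fin 3 → Γ((quadPt e a).left, ⊤)) 2) := isUnit_one
  obtain ⟨τ, hτ⟩ := exists_coord_of_form hi (v := ![s b - r * θ, r, 1]) (unimod_of_isUnit hu) (by
    rw [coordHom_qf]
    simp only [qv, Matrix.cons_val]
    change (s b - r * θ) ^ 2 + s e * ((s b - r * θ) * r) - s a * r ^ 2 - s b * 1 ^ 2 = 0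
    linear_combination r ^ 2 * hθ - s b * hr)
  refine ⟨τ, fun w => ?_⟩
  rw [coordOpen_eq hτ, Scheme.basicOpen_of_isUnit _ hu]
  trivial

theorem quadPt_mono {ξ : quadPt e a ⟶ Y} {s : Γ((quadPt e a).left, ⊤)}
    (hs : s = -quadθ e a ∨ s = quadθ e a - strHom _ e) (hξ : Coord i ξ ![s, 1, 0]) : Mono ξ := by
  refine ⟨fun {T} p p' h => quadPt_hom_ext ?_⟩
  have h1 := hξ.pull p
  rw [h] at h1
  have h2 := h1.prop (hξ.pull p') 0 1
  simp only [pull_apply, Matrix.cons_val, map_one, mul_one, one_mul] at h2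
  rcases hs with rfl | rfl
  · rwa [map_neg, map_neg, neg_inj] at h2
  · rwa [map_sub, map_sub, strHom_comp, strHom_comp, sub_left_inj] at h2

/-- A point of a conic with `x₂ = 0` factors through the degree two point. -/
theorem exists_fac_quadPt (hi : HasForm i (qf e a b)) {ξ : quadPt e a ⟶ Y}
    (hξ : Coord i ξ ![-quadθ e a, 1, 0]) {T : Sch k} {x : T ⟶ Y} {u : Fin 3 → Γ(T.left, ⊤)}
    (hu : Coord i x u) (h2 : u 2 = 0) : ∃ p, p ≫ ξ = x := by
  have := hi.mono
  have h0 := hu.form_eq_zero hi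
  rw [coordHom_qf] at h0
  have h1 : IsUnit (u 1) := by
    have h3 := unimod_tail hu.unimod h0
    rw [← Ideal.span_singleton_eq_top, eq_top_iff, ← show Ideal.span _ = ⊤ from h3, Ideal.span_le]
    rintro _ ⟨j, rfl⟩
    fin_cases j
    · exact Ideal.mem_span_singleton_self _
    · exact h2 ▸ zero_mem _
  obtain ⟨r, hr⟩ := h1.exists_right_inv
  simp only [qv, h2] at h0
  obtain ⟨p, hp⟩ := exists_quadPt_hom (W := T) (e := e) (a := a) (s := -(u 0 * r)) (by
    linear_combination r ^ 2 * h0 + strHom T a * (u 1 * r + 1) * hr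
      - strHom T e * u 0 * r * hr)
  refine ⟨p, (hξ.pull p).eq_of_prop hu ?_⟩
  have hv0 : pull p ![-quadθ e a, 1, 0] 0 = u 0 * r := by
    simp only [pull_apply, Matrix.cons_val, map_neg, hp, neg_neg]
  have hv1 : pull p ![-quadθ e a, 1, 0] 1 = 1 := by
    simp only [pull_apply, Matrix.cons_val, map_one]
  have hv2 : pull p ![-quadθ e a, 1, 0] 2 = 0 := by
    simp only [pull_apply, Matrix.cons_val, map_zero]
  intro p q
  fin_cases p <;> fin_cases q <;> simp only [Fin.zero_eta, Fin.mk_one, Fin.reduceFinMk, hv0, hv1, hv2, h2]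
  · linear_combination u 0 * hr
  · ring
  · linear_combination -u 0 * hr
  all_goals ring

/-- The fibre of a product over the degree two point `x₂ = 0` is the complement of the locus
`x₂ ≠ 0`. -/
theorem range_fibre {Y : Sch k} {i : Y ⟶ projSpace k 2} (hi : HasForm i (qf e a b))
    {ξ : quadPt e a ⟶ Y} (hξ : Coord i ξ ![-quadθ e a, 1, 0]) (Y' : Sch k) :
    Set.range (opnι (Y ⊗ Y') (coordOpen i (fst Y Y') 2)).left =
      (Set.range (lift (fst (quadPt e a) Y' ≫ ξ) (snd _ _)).left)ᶜ := by
  set f := lift (fst (quadPt e a) Y' ≫ ξ) (snd _ _)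
  rw [show Set.range (opnι (Y ⊗ Y') (coordOpen i (fst Y Y') 2)).left = coordOpen i (fst Y Y') 2 from
    Scheme.Opens.range_ι _]
  ext w
  refine ⟨?_, fun hw => ?_⟩
  · rintro hw ⟨p, rfl⟩
    have h1 : p ∈ coordOpen i (f ≫ fst _ _) 2 := hw
    have h2 : Coord i (f ≫ fst _ _) (pull (fst (quadPt e a) Y') ![-quadθ e a, 1, 0]) := by
      rw [lift_fst]
      exact hξ.pull (fst _ _)
    rw [coordOpen_eq h2] at h1
    simp at h1
  · by_contra hw'
    refine hw ?_
    let X := Y ⊗ Y'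
    let T : Sch k := Over.mk (X.left.fromSpecResidueField w ≫ X.hom)
    let g : T ⟶ X := Over.homMk (X.left.fromSpecResidueField w) rfl
    have hTr : IsReduced T.left := inferInstanceAs (IsReduced (Spec _))
    have hg : ∀ r : T.left, g.left r = w := fun r => by
      have : g.left r ∈ Set.range (X.left.fromSpecResidueField w) := ⟨r, rfl⟩
      rwa [Scheme.range_fromSpecResidueField] at this
    have r : T.left := IsLocalRing.closedPoint (X.left.residueField w)
    obtain ⟨U, hU, u, -, hu⟩ := exists_local_coord i (g ≫ fst _ _) r
    have hred : IsReduced (opn T U).left := isReduced_of_isOpenImmersion (opnι T U).left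
    have h2 : (opn T U).left.basicOpen (u 2) = ⊥ := by
      rw [← coordOpen_eq hu, eq_bot_iff]
      intro s hs
      have : g.left ((opnι T U).left s) ∈ coordOpen i (fst Y Y') 2 := hs
      rw [hg] at this
      exact hw' this
    obtain ⟨p, hp⟩ := exists_fac_quadPt hi hξ hu ((basicOpen_eq_bot_iff _).mp h2)
    have h3 : lift p (opnι T U ≫ g ≫ snd _ _) ≫ f = opnι T U ≫ g := by
      refine CartesianMonoidalCategory.hom_ext _ _ ?_ ?_
      · simp [f, hp]
      · simp [f]
    have h4 : (opnι T U ≫ g).left ⟨r, hU⟩ = w := hg r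
    rw [← h3] at h4
    exact ⟨_, h4⟩

theorem isClosedImmersion_fibre {Y : Sch k} {i : Y ⟶ projSpace k 2} (hi : HasForm i (qf e a b))
    {ξ : quadPt e a ⟶ Y} (hξ : Coord i ξ ![-quadθ e a, 1, 0]) (Y' : Sch k) [IsProper Y'.hom] :
    IsClosedImmersion (lift (fst (quadPt e a) Y' ≫ ξ) (snd _ _)).left := by
  have hm := quadPt_mono (Or.inl rfl) hξ
  have hc := hi.closed
  have h1 := isProper_of_closed i
  have h2 := isProper_tensor (X := Y) (Y := Y')
  have h3 := isProper_tensor (X := quadPt e a) (Y := Y')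
  have hmono : Mono (lift (fst (quadPt e a) Y' ≫ ξ) (snd _ _)) := by
    refine ⟨fun {T} p p' h => CartesianMonoidalCategory.hom_ext _ _ ?_ ?_⟩
    · rw [← cancel_mono ξ]
      simpa using congrArg (· ≫ fst _ _) h
    · simpa using congrArg (· ≫ snd _ _) h
  exact isClosedImmersion_of_mono _

/-- Where `x₂ ≠ 0`, multiplication identifies `C₁ × C₂` with `C₁ × C`. The remaining parts are the products
of the degree two point `x₂ = 0` with `C₂` and with `C`; these are identified by multiplication with
another point `τ` of `C₁`, defined over the same quadratic algebra. -/
theorem ConicTriple.cls_eq {c : k} {C₁ C₂ C : Sch k} (t : ConicTriple e a b c C₁ C₂ C)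
    (h₂ : IsQuasiProjVar (C₁ ⊗ C₂)) (h : IsQuasiProjVar (C₁ ⊗ C)) :
    K₀.cls ⟨C₁ ⊗ C₂, h₂⟩ = K₀.cls ⟨C₁ ⊗ C, h⟩ := by
  obtain ⟨ξ, hξ⟩ := exists_quadPt_coord t.form₁
  obtain ⟨τ, hτ⟩ := exists_quadPt_coord_one t.form₁ t.discr
  obtain ⟨ε, -, -⟩ := t.exists_iso_good
  obtain ⟨δ, -, -⟩ := t.exists_iso_of_lift τ (𝟙 (quadPt e a ⊗ C₂)) (𝟙 (quadPt e a ⊗ C))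
    (fun w => hτ _) (fun w => hτ _) (fun h _ => ⟨h, Category.comp_id _⟩)
    (fun h _ => ⟨h, Category.comp_id _⟩)
  have hc₂ := t.form₂.closed
  have hc := t.form.closed
  have p₂ := isProper_of_closed t.i₂
  have p := isProper_of_closed t.i
  have hr := isReduced_quadPt t.discr
  have hr₁ := h₂.1
  have r₁ := isReduced_tensor t.form₂ t.discr (quadPt e a)
  have r₂ : IsReduced (opn (C₁ ⊗ C₂) (coordOpen t.i₁ (fst C₁ C₂) 2)).left :=
    isReduced_of_isOpenImmersion (opnι _ _).left
  have c₁ := isClosedImmersion_fibre t.form₁ hξ C₂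
  have c₂ := isClosedImmersion_fibre t.form₁ hξ C
  have e₁ : IsIso δ.hom.left := inferInstanceAs (IsIso ((Over.forget _).map δ.hom))
  have e₂ : IsIso ε.hom.left := inferInstanceAs (IsIso ((Over.forget _).map ε.hom))
  refine K₀.cls_eq h₂ h r₁ r₂ (lift (fst (quadPt e a) C₂ ≫ ξ) (snd _ _)) (opnι _ _)
    (δ.hom ≫ lift (fst (quadPt e a) C ≫ ξ) (snd _ _)) (ε.hom ≫ opnι _ _)
    (hj' := inferInstanceAs (IsOpenImmersion (ε.hom.left ≫ (opnι _ _).left)))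
    (hi' := inferInstanceAs (IsClosedImmersion (δ.hom.left ≫ (lift (fst (quadPt e a) C ≫ ξ) _).left)))
    (range_fibre t.form₁ hξ C₂) ?_
  have s₁ : Function.Surjective δ.hom.left := δ.hom.left.surjective
  have s₂ : Function.Surjective ε.hom.left := ε.hom.left.surjective
  have q₁ : Set.range (δ.hom ≫ lift (fst (quadPt e a) C ≫ ξ) (snd _ _)).left =
      Set.range (lift (fst (quadPt e a) C ≫ ξ) (snd _ _)).left := by
    ext w
    exact ⟨fun ⟨v, hv⟩ => ⟨_, hv⟩, fun ⟨v, hv⟩ => by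
      obtain ⟨v', rfl⟩ := s₁ v; exact ⟨v', hv⟩⟩
  have q₂ : Set.range (ε.hom ≫ opnι (C₁ ⊗ C) (coordOpen t.i₁ (fst C₁ C) 2)).left =
      Set.range (opnι (C₁ ⊗ C) (coordOpen t.i₁ (fst C₁ C) 2)).left := by
    ext w
    exact ⟨fun ⟨v, hv⟩ => ⟨_, hv⟩, fun ⟨v, hv⟩ => by
      obtain ⟨v', rfl⟩ := s₂ v; exact ⟨v', hv⟩⟩
  rw [q₁, q₂]
  exact range_fibre t.form₁ hξ C

end QuadPt

/-! ### The ideal of the conjugate pair -/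

section BlowupAlgebra
variable {R : Type*} [CommRing R] {e a b c : R} {u v : Fin 3 → R}

/-- The ideal of the conjugate pair of points in terms of coordinates. -/
def pairIdeal (e a : R) (u v : Fin 3 → R) : Ideal R :=
  Ideal.span {u 2, v 2, mulVec₂ e a u v 0, mulVec₂ e a u v 1}

theorem pairIdeal_mem : u 2 ∈ pairIdeal e a u v ∧ v 2 ∈ pairIdeal e a u v ∧
    mulVec₂ e a u v 0 ∈ pairIdeal e a u v ∧ mulVec₂ e a u v 1 ∈ pairIdeal e a u v :=
  ⟨Ideal.subset_span (by simp), Ideal.subset_span (by simp), Ideal.subset_span (by simp),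
    Ideal.subset_span (by simp)⟩

theorem Unimod.mem {ι : Type*} [Fintype ι] {v : ι → R} (hv : Unimod v) {J : Ideal R} {r : R}
    (h : ∀ j, v j * r ∈ J) : r ∈ J := by
  obtain ⟨c, hc⟩ := Ideal.mem_span_range_iff_exists_fun.mp
    (show (1 : R) ∈ Ideal.span (Set.range v) by
      rw [show Ideal.span (Set.range v) = ⊤ from hv]; trivial)
  rw [← one_mul r, ← hc, Finset.sum_mul]
  exact sum_mem fun j _ => by rw [mul_assoc]; exact J.mul_mem_left _ (h j)

/-- The conjugate of `u` times the product of `u` and `v` is `v`, up to the factor `bu₂²`. -/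
theorem sq_mem_span_mulVec₂ {b' : R} (hb : b * b' = 1) (hu : qv e a b u = 0) (hv : Unimod v) :
    u 2 ^ 2 ∈ Ideal.span (Set.range (mulVec₂ e a u v)) := by
  set J := Ideal.span (Set.range (mulVec₂ e a u v)) with hJ
  have hm : ∀ j, mulVec₂ e a u v j ∈ J := fun j => Ideal.subset_span ⟨j, rfl⟩
  have h1 : ∀ j, mulVec₂ e a (conjVec e u) (mulVec₂ e a u v) j ∈ J := by
    intro j
    fin_cases j
    · exact add_mem (J.mul_mem_left _ (hm 0)) (J.mul_mem_left _ (J.mul_mem_left _ (hm 1)))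
    · exact add_mem (add_mem (J.mul_mem_left _ (hm 1)) (J.mul_mem_left _ (hm 0)))
        (J.mul_mem_left _ (J.mul_mem_left _ (hm 1)))
    · exact J.mul_mem_left _ (hm 2)
  simp only [mulVec₂_conjVec hb hu] at h1
  refine hv.mem fun j => ?_
  fin_cases j
  · have := J.mul_mem_left b' (h1 0)
    rwa [show b' * (b * u 2 ^ 2 * scaleVec b' v 0) = v 0 * u 2 ^ 2 by
      simp only [scaleVec, Matrix.cons_val]; linear_combination u 2 ^ 2 * v 0 * hb] at this
  · have := J.mul_mem_left b' (h1 1)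
    rwa [show b' * (b * u 2 ^ 2 * scaleVec b' v 1) = v 1 * u 2 ^ 2 by
      simp only [scaleVec, Matrix.cons_val]; linear_combination u 2 ^ 2 * v 1 * hb] at this
  · have := h1 2
    rwa [show (b * u 2 ^ 2 * scaleVec b' v 2) = v 2 * u 2 ^ 2 by
      simp only [scaleVec, Matrix.cons_val]; linear_combination u 2 ^ 2 * v 2 * hb] at this

theorem mulVec₂_comm (x y : Fin 3 → R) : mulVec₂ e a x y = mulVec₂ e a y x := by
  funext j
  fin_cases j <;> simp [mulVec₂] <;> ring

/-- The square of the ideal of the conjugate pair of points is generated by the coordinates of the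
product map. -/
theorem pairIdeal_mul {b' c' d' : R} (hb : b * b' = 1) (hc : c * c' = 1)
    (hd : (e ^ 2 + 4 * a) * d' = 1) (hu : qv e a b u = 0) (hv : qv e a c v = 0) (uu : Unimod u)
    (uv : Unimod v) :
    pairIdeal e a u v * pairIdeal e a u v = Ideal.span (Set.range (mulVec₂ e a u v)) := by
  set I := pairIdeal e a u v with hI
  set m := mulVec₂ e a u v with hm
  set J := Ideal.span (Set.range m) with hJ
  have mJ : ∀ j, m j ∈ J := fun j => Ideal.subset_span ⟨j, rfl⟩
  have m2 : m 2 = u 2 * v 2 := rfl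
  have hu2 : u 2 ^ 2 ∈ J := sq_mem_span_mulVec₂ hb hu uv
  have hv2 : v 2 ^ 2 ∈ J := by
    have := sq_mem_span_mulVec₂ hc hv uu
    rwa [mulVec₂_comm] at this
  obtain ⟨iu, iv, i0, i1⟩ : u 2 ∈ I ∧ v 2 ∈ I ∧ m 0 ∈ I ∧ m 1 ∈ I := pairIdeal_mem
  refine le_antisymm ?_ ?_
  · rw [hI, pairIdeal, Ideal.span_mul_span', Ideal.span_le]
    have e1 : u 2 * v 2 ∈ J := mJ 2
    have e2 : v 2 * u 2 ∈ J := mul_comm (u 2) (v 2) ▸ e1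
    rintro _ ⟨x, hx, y, hy, rfl⟩
    change x * y ∈ J
    simp only [Set.mem_insert_iff, Set.mem_singleton_iff] at hx hy
    rcases hx with rfl | rfl | rfl | rfl
    · rcases hy with rfl | rfl | rfl | rfl
      · rwa [← pow_two]
      · exact e1
      · exact J.mul_mem_left _ (mJ 0)
      · exact J.mul_mem_left _ (mJ 1)
    · rcases hy with rfl | rfl | rfl | rfl
      · exact e2
      · rwa [← pow_two]
      · exact J.mul_mem_left _ (mJ 0)
      · exact J.mul_mem_left _ (mJ 1)
    · exact J.mul_mem_right _ (mJ 0)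
    · exact J.mul_mem_right _ (mJ 1)
  · have tu := unimod_tail uu hu
    have tv := unimod_tail uv hv
    -- Since `u₂, v₂ ∈ I`, membership in `I²` can be tested after multiplication with `u₁v₁`; up to the
    -- discriminant, `u₁v₁m₀` and `u₁v₁m₁` are combinations of products of generators.
    have key : ∀ r ∈ I, u 1 * (v 1 * r) ∈ I * I → r ∈ I * I := by
      intro r hr h
      refine tv.mem fun j => tu.mem fun j' => ?_
      fin_cases j
      · fin_cases j'
        · exact h
        · exact Ideal.mul_mem_mul iu (I.mul_mem_left _ hr)
      · exact Ideal.mul_mem_left _ _ (Ideal.mul_mem_mul iv hr)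
    have sq : ∀ {x y}, x ∈ I → y ∈ I → ∀ r s : R, r * (x * y) * s ∈ I * I := fun hx hy r s =>
      Ideal.mul_mem_right _ _ (Ideal.mul_mem_left _ _ (Ideal.mul_mem_mul hx hy))
    simp only [qv] at hu hv
    rw [hJ, Ideal.span_le]
    rintro _ ⟨j, rfl⟩
    fin_cases j
    · refine key _ i0 ?_
      have : u 1 * (v 1 * m 0) = 1 * (m 0 * m 0) * d' + a * (m 1 * m 1) * d'
          - c * (v 2 * v 2) * (d' * (u 0 ^ 2 + a * u 1 ^ 2))
          - b * (u 2 * u 2) * (d' * (v 0 ^ 2 + a * v 1 ^ 2))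
          + b * c * u 2 ^ 2 * (v 2 * v 2) * d' := by
        have h := show (e ^ 2 + 4 * a) * (u 1 * (v 1 * m 0)) = m 0 ^ 2 + a * m 1 ^ 2
            - c * v 2 ^ 2 * (u 0 ^ 2 + a * u 1 ^ 2) - b * u 2 ^ 2 * (v 0 ^ 2 + a * v 1 ^ 2)
            + b * c * u 2 ^ 2 * v 2 ^ 2 by
          simp only [hm, mulVec₂, Matrix.cons_val]
          linear_combination -(u 0 ^ 2 + a * u 1 ^ 2) * hv - (v 0 ^ 2 + a * v 1 ^ 2) * hu
            + (v 0 ^ 2 + e * (v 0 * v 1) - a * v 1 ^ 2) * hu + b * u 2 ^ 2 * hv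
        linear_combination d' * h - (u 1 * (v 1 * m 0)) * hd
      change u 1 * (v 1 * m 0) ∈ I * I
      rw [this]
      exact add_mem (sub_mem (sub_mem (add_mem (sq i0 i0 _ _) (sq i1 i1 _ _)) (sq iv iv _ _))
        (sq iu iu _ _)) (sq iv iv _ _)
    · refine key _ i1 ?_
      have : u 1 * (v 1 * m 1) = 2 * (m 0 * m 1) * d' + e * (m 1 * m 1) * d'
          - c * (v 2 * v 2) * (d' * (2 * (u 0 * u 1) + e * u 1 ^ 2))
          - b * (u 2 * u 2) * (d' * (2 * (v 0 * v 1) + e * v 1 ^ 2)) := by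
        have h := show (e ^ 2 + 4 * a) * (u 1 * (v 1 * m 1)) = 2 * (m 0 * m 1) + e * m 1 ^ 2
            - c * v 2 ^ 2 * (2 * (u 0 * u 1) + e * u 1 ^ 2)
            - b * u 2 ^ 2 * (2 * (v 0 * v 1) + e * v 1 ^ 2) by
          simp only [hm, mulVec₂, Matrix.cons_val]
          linear_combination -(2 * (u 0 * u 1) + e * u 1 ^ 2) * hv
            - (2 * (v 0 * v 1) + e * v 1 ^ 2) * hu
        linear_combination d' * h - (u 1 * (v 1 * m 1)) * hd
      change u 1 * (v 1 * m 1) ∈ I * I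
      rw [this]
      exact sub_mem (sub_mem (add_mem (sq i0 i1 _ _) (sq i1 i1 _ _)) (sq iv iv _ _)) (sq iu iu _ _)
    · exact Ideal.mul_mem_mul iu iv

/-- If the square of an ideal is generated by a regular element, then the ideal is locally
generated by a regular element. -/
theorem exists_local_generator {I : Ideal R} {h : R} (hh : h ∈ nonZeroDivisors R)
    (hI : I * I = Ideal.span {h}) (p : Ideal R) (hp : p ≠ ⊤) :
    ∃ x ∈ I, ∃ y r, r ∉ p ∧ x * y = h * r ∧ ∀ z ∈ I, ∃ s, z * r = s * x := by
  have key : ∃ x ∈ I, ∃ y ∈ I, ∃ r, r ∉ p ∧ x * y = h * r := by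
    by_contra! H
    have h1 : I * I ≤ Ideal.span {h} * p := Ideal.mul_le.mpr fun x hx y hy => by
      obtain ⟨r, hr⟩ := Ideal.mem_span_singleton'.mp (hI ▸ Ideal.mul_mem_mul hx hy)
      have hrp : r ∈ p := by
        by_contra hrp
        exact H x hx y hy r hrp (by rw [← hr, mul_comm])
      rw [← hr, mul_comm r h]
      exact Ideal.mul_mem_mul (Ideal.mem_span_singleton_self h) hrp
    have h2 : h ∈ Ideal.span {h} * p := h1 (hI ▸ Ideal.mem_span_singleton_self h)
    obtain ⟨s, hs, hsh⟩ := Ideal.mem_span_singleton_mul.mp h2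
    refine hp ((Ideal.eq_top_iff_one _).mpr ?_)
    rwa [← show s = 1 from (mul_cancel_left_mem_nonZeroDivisors hh).mp (by rw [hsh, mul_one])]
  obtain ⟨x, hx, y, hy, r, hr, hxy⟩ := key
  refine ⟨x, hx, y, r, hr, hxy, fun z hz => ?_⟩
  obtain ⟨s, hs⟩ := Ideal.mem_span_singleton'.mp (hI ▸ Ideal.mul_mem_mul hz hy)
  refine ⟨s, (mul_cancel_left_mem_nonZeroDivisors hh).mp ?_⟩
  linear_combination z * (-hxy) - x * hs

/-- The coordinates of the product map, divided by the square of a generator of the ideal. -/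
theorem exists_quotient_vec {I : Ideal R} {m : Fin 3 → R} {f : R} (hf : f ∈ nonZeroDivisors R)
    (hI : I = Ideal.span {f}) (hm : I * I = Ideal.span (Set.range m)) (hq : qv e a b m = 0) :
    ∃ n : Fin 3 → R, m = f ^ 2 • n ∧ Unimod n ∧ qv e a b n = 0 := by
  have h1 : Ideal.span {f ^ 2} = Ideal.span (Set.range m) := by
    rw [← hm, hI, Ideal.span_singleton_mul_span_singleton, pow_two]
  have h2 : ∀ j, ∃ n, m j = f ^ 2 * n := fun j => by
    obtain ⟨n, hn⟩ := Ideal.mem_span_singleton'.mp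
      (show m j ∈ Ideal.span {f ^ 2} by rw [h1]; exact Ideal.subset_span ⟨j, rfl⟩)
    exact ⟨n, by rw [← hn, mul_comm]⟩
  choose n hn using h2
  have hmn : m = f ^ 2 • n := funext hn
  refine ⟨n, hmn, ?_, ?_⟩
  · obtain ⟨c, hc⟩ := Ideal.mem_span_range_iff_exists_fun.mp
      (show f ^ 2 ∈ Ideal.span (Set.range m) by
        rw [← h1]; exact Ideal.mem_span_singleton_self (f ^ 2))
    refine (Ideal.eq_top_iff_one _).mpr (Ideal.mem_span_range_iff_exists_fun.mpr ⟨c, ?_⟩)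
    refine (mul_cancel_left_mem_nonZeroDivisors (pow_mem hf 2)).mp ?_
    rw [mul_one, Finset.mul_sum]
    refine Eq.trans (Finset.sum_congr rfl fun j _ => ?_) hc
    rw [hn]
    ring
  · refine (mul_right_mem_nonZeroDivisors_eq_zero_iff (pow_mem hf 4)).mp ?_
    rw [← hq, hmn]
    simp [qv]
    ring

end BlowupAlgebra

/-! ### Effective Cartier divisors -/

theorem RingHom.Flat.map_mem_nonZeroDivisors {R S : Type*} [CommRing R] [CommRing S] {φ : R →+* S}
    (h : φ.Flat) {a : R} (ha : a ∈ nonZeroDivisors R) : φ a ∈ nonZeroDivisors S := by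
  rw [mem_nonZeroDivisors_iff_right]
  intro b hb
  algebraize [φ]
  have h3 := Module.Flat.isSMulRegular_of_nonZeroDivisors (M := S) ha
  refine h3 ?_
  simp only [smul_zero]
  rw [Algebra.smul_def, mul_comm]
  exact hb

theorem isSchemeTheoreticallyDominant_morphismRestrict {G B : Scheme.{u}} (γ : G ⟶ B)
    [IsSchemeTheoreticallyDominant γ] [QuasiCompact γ] (U : B.Opens) :
    IsSchemeTheoreticallyDominant (γ ∣_ U) :=
  .of_isPullback (isPullback_morphismRestrict γ U).flip

section Cartier
variable {k : Type u} [Field k]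

theorem ideal_comap_opnι {X : Sch k} (I : X.left.IdealSheafData) (U : X.left.Opens)
    [IsAffine (opn X U).left] :
    (I.comap (opnι X U).left).ideal ⟨⊤, isAffineOpen_top _⟩ =
      I.ideal ⟨(opnι X U).left ''ᵁ ⊤, (isAffineOpen_top _).image_of_isOpenImmersion _⟩ := by
  rw [Scheme.IdealSheafData.ideal_comap_of_isOpenImmersion]
  have h1 : ((opnι X U).left.appIso ⊤).inv = 𝟙 _ := by
    change (U.ι.appIso ⊤).inv = _
    rw [Scheme.Opens.ι_appIso]
    rfl
  have h2 := congrArg CommRingCat.Hom.hom h1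
  rw [h2]
  exact Ideal.comap_id _

/-- Being an effective Cartier divisor is a local property. -/
theorem isEffectiveCartier_of_local {X : Sch k} {I : X.left.IdealSheafData}
    (h : ∀ w : X.left, ∃ (U : X.left.Opens) (_ : IsAffine (opn X U).left), w ∈ U ∧
      ∃ f ∈ nonZeroDivisors Γ((opn X U).left, ⊤),
        (I.comap (opnι X U).left).ideal ⟨⊤, isAffineOpen_top _⟩ = Ideal.span {f}) :
    IsEffectiveCartier I := by
  intro w
  obtain ⟨U, hA, hw, f, hf, H⟩ := h w
  refine ⟨⟨(opnι X U).left ''ᵁ ⊤, (isAffineOpen_top _).image_of_isOpenImmersion _⟩,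
    ⟨⟨w, hw⟩, trivial, rfl⟩, f, hf, ?_⟩
  exact (ideal_comap_opnι I U).symm.trans H

/-- An effective Cartier divisor has equations on arbitrarily small affine open neighbourhoods. -/
theorem IsEffectiveCartier.exists_local {X : Sch k} {I : X.left.IdealSheafData}
    (h : IsEffectiveCartier I) (w : X.left) (N : X.left.Opens) (hN : w ∈ N) :
    ∃ (U : X.left.Opens) (_ : IsAffine (opn X U).left), w ∈ U ∧ U ≤ N ∧
      ∃ f ∈ nonZeroDivisors Γ((opn X U).left, ⊤),
        (I.comap (opnι X U).left).ideal ⟨⊤, isAffineOpen_top _⟩ = Ideal.span {f} := by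
  obtain ⟨V, hw, f, hf, H⟩ := h w
  obtain ⟨U, hU, hwU, hUV⟩ : ∃ U : X.left.Opens, IsAffineOpen U ∧ w ∈ U ∧ U ≤ V.1 ⊓ N := by
    obtain ⟨U, hU, h⟩ := TopologicalSpace.Opens.isBasis_iff_nbhd.mp
      X.left.isBasis_affineOpens (show w ∈ V.1 ⊓ N from ⟨hw, hN⟩)
    exact ⟨U, hU, h⟩
  have hA : IsAffine (opn X U).left := hU
  let U' : X.left.affineOpens :=
    ⟨(opnι X U).left ''ᵁ ⊤, (isAffineOpen_top _).image_of_isOpenImmersion _⟩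
  have hle : U' ≤ V := by
    change U.ι ''ᵁ ⊤ ≤ V.1
    rw [Scheme.Opens.ι_image_top]
    exact hUV.trans inf_le_left
  refine ⟨U, hA, hwU, hUV.trans inf_le_right,
    (X.left.presheaf.map (homOfLE hle).op).hom f, ?_, ?_⟩
  · refine RingHom.Flat.map_mem_nonZeroDivisors (φ := (X.left.presheaf.map (homOfLE hle).op).hom) ?_ hf
    have h1 := Flat.flat_appLE (𝟙 X.left) V.2 U'.2 hle
    have h2 : Scheme.Hom.appLE (𝟙 X.left) V.1 U'.1 hle = X.left.presheaf.map (homOfLE hle).op := by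
      simp only [Scheme.Hom.appLE, Scheme.Hom.id_app]
      exact Category.id_comp _
    rwa [h2] at h1
  · have h3 := I.map_ideal hle
    rw [H, Ideal.map_span, Set.image_singleton] at h3
    exact (ideal_comap_opnι I U).trans h3.symm

/-- A function on an open subscheme vanishes as soon as its pullback along a scheme theoretically
dominant morphism does. -/
theorem eq_zero_of_dominant {G B : Sch k} (γ : G ⟶ B) [IsSchemeTheoreticallyDominant γ.left]
    [QuasiCompact γ.left] (U : B.left.Opens) {a : Γ((opn B U).left, ⊤)}
    (h : (opnMap γ U (γ.left ⁻¹ᵁ U) le_rfl).left.appTop.hom a = 0) : a = 0 := by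
  have h1 : (opnMap γ U (γ.left ⁻¹ᵁ U) le_rfl).left = γ.left ∣_ U :=
    Scheme.Hom.resLE_eq_morphismRestrict _
  have h2 : IsSchemeTheoreticallyDominant (opnMap γ U (γ.left ⁻¹ᵁ U) le_rfl).left := by
    rw [h1]
    exact isSchemeTheoreticallyDominant_morphismRestrict γ.left U
  have h3 : QuasiCompact (opnMap γ U (γ.left ⁻¹ᵁ U) le_rfl).left := by
    rw [h1]
    exact MorphismProperty.of_isPullback (isPullback_morphismRestrict γ.left U).flip ‹_›
  exact (opnMap γ U (γ.left ⁻¹ᵁ U) le_rfl).left.app_injective ⊤ (h.trans (map_zero _).symm)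

end Cartier

section Ideal
variable {k : Type u} [Field k] {e a b c : k} {C₁ C₂ C : Sch k}

theorem appTop_eq_zero_of_mem {X Y : Sch k} (f : Y ⟶ X) [IsAffine X.left] [QuasiCompact f.left]
    {J : Ideal Γ(X.left, ⊤)} (h : J = f.left.ker.ideal ⟨⊤, isAffineOpen_top _⟩)
    (r : Γ(X.left, ⊤)) : r ∈ J ↔ f.left.appTop.hom r = 0 := by
  rw [h, mem_ker_ideal]
  rfl

/-- The ideal of the conjugate pair of points of `C₁ × C₂`, pulled back to an affine scheme. -/
theorem ConicTriple.comap_ker (t : ConicTriple e a b c C₁ C₂ C) {ξ : quadPt e a ⟶ C₁}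
    {η : quadPt e a ⟶ C₂} (hξ : Coord t.i₁ ξ ![-quadθ e a, 1, 0])
    (hη : Coord t.i₂ η ![quadθ e a - strHom _ e, 1, 0]) [IsClosedImmersion (lift ξ η).left]
    {T : Sch k} [IsAffine T.left] {g : T ⟶ C₁ ⊗ C₂} {u v : Fin 3 → Γ(T.left, ⊤)}
    (hu : Coord t.i₁ (g ≫ fst _ _) u) (hv : Coord t.i₂ (g ≫ snd _ _) v) :
    ((lift ξ η).left.ker.comap g.left).ideal ⟨⊤, isAffineOpen_top _⟩ =
      pairIdeal (strHom T e) (strHom T a) u v := by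
  set ζ := lift ξ η with hζ
  have hm₁ := t.form₁.mono
  have hm₂ := t.form₂.mono
  refine le_antisymm ?_ ?_
  · let K : T.left.IdealSheafData := .ofIdealTop (pairIdeal (strHom T e) (strHom T a) u v)
    have hK : K.ideal ⟨⊤, isAffineOpen_top _⟩ = pairIdeal (strHom T e) (strHom T a) u v := by
      have := (Scheme.IdealSheafData.equivOfIsAffine (X := T.left)).apply_symm_apply
        (pairIdeal (strHom T e) (strHom T a) u v)
      exact this
    let h : closedSub K ⟶ T := Over.homMk K.subschemeι
    have : IsClosedImmersion h.left := inferInstanceAs (IsClosedImmersion K.subschemeι)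
    have hz : ∀ r ∈ pairIdeal (strHom T e) (strHom T a) u v, h.left.appTop.hom r = 0 := by
      intro r hr
      refine (appTop_eq_zero_of_mem h (hK.symm.trans ?_) r).mp hr
      exact congrArg (fun J : T.left.IdealSheafData => J.ideal ⟨⊤, isAffineOpen_top _⟩)
        K.ker_subschemeι.symm
    obtain ⟨z1, z2, -, z3⟩ := pairIdeal_mem (e := strHom T e) (a := strHom T a) (u := u) (v := v)
    replace z1 := hz _ z1
    replace z2 := hz _ z2
    replace z3 := hz _ z3
    have hu' := hu.pull h
    have hv' := hv.pull h
    obtain ⟨p, hp⟩ := exists_fac_quadPt t.form₁ hξ hu' z1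
    have hpη : p ≫ η = h ≫ g ≫ snd _ _ := by
      refine (hη.pull p).eq_of_prop hv' ?_
      have h1 := hξ.pull p
      rw [hp] at h1
      obtain ⟨l, hl, hul⟩ := h1.exists_smul hu'
      have h2 : ∀ j, h.left.appTop.hom (mv T e a u v j) = mv _ e a (pull h u) (pull h v) j :=
        fun j => congrFun (pull_mv h e a u v) j
      have h3 := (h2 1).symm.trans z3
      set θ := p.left.appTop.hom (quadθ e a) with hθ
      have w0 : pull h u 0 = -(l * θ) := by rw [hul]; simp [hθ]
      have w1 : pull h u 1 = l := by rw [hul]; simp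
      have h4 : pull h v 0 = (θ - strHom _ e) * pull h v 1 := by
        refine hl.mul_left_cancel ?_
        simp only [mv, mulVec₂, Matrix.cons_val, w0, w1] at h3
        linear_combination h3
      have v0 : pull p ![quadθ e a - strHom _ e, 1, 0] 0 = θ - strHom _ e := by
        simp only [pull_apply, Matrix.cons_val, map_sub, strHom_comp, hθ]
      have v1 : pull p ![quadθ e a - strHom _ e, 1, 0] 1 = 1 := by
        simp only [pull_apply, Matrix.cons_val, map_one]
      have v2 : pull p ![quadθ e a - strHom _ e, 1, 0] 2 = 0 := by
        simp only [pull_apply, Matrix.cons_val, map_zero]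
      have v2' : pull h v 2 = 0 := z2
      intro r s
      fin_cases r <;> fin_cases s <;>
        simp only [Fin.zero_eta, Fin.mk_one, Fin.reduceFinMk, v0, v1, v2, v2', h4] <;> ring
    have hle : ζ.left.ker ≤ (h ≫ g).left.ker := by
      have : h ≫ g = p ≫ ζ := by
        refine CartesianMonoidalCategory.hom_ext _ _ ?_ ?_
        · simp [hζ, hp]
        · simp [hζ, hpη]
      rw [this]
      exact Scheme.Hom.le_ker_comp p.left ζ.left
    have h4 : ζ.left.ker.comap g.left ≤ K := by
      rw [← Scheme.IdealSheafData.le_map_iff_comap_le]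
      exact hle
    rw [← hK]
    exact h4 _
  · set K := ζ.left.ker.comap g.left with hK
    let h : closedSub K ⟶ T := Over.homMk K.subschemeι
    have : IsClosedImmersion h.left := inferInstanceAs (IsClosedImmersion K.subschemeι)
    have hle : ζ.left.ker ≤ (h ≫ g).left.ker :=
      Scheme.IdealSheafData.le_map_iff_comap_le.mpr le_rfl
    obtain ⟨p, hp⟩ : ∃ p : closedSub K ⟶ quadPt e a, p ≫ ζ = h ≫ g := by
      have hl := IsClosedImmersion.lift_fac ζ.left (h ≫ g).left hle
      refine ⟨Over.homMk (IsClosedImmersion.lift ζ.left _ hle) ?_, Over.OverMorphism.ext hl⟩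
      rw [← Over.w ζ, reassoc_of% hl, Over.w]
    have h1 := hξ.pull p
    have h2 := hη.pull p
    rw [show p ≫ ξ = h ≫ g ≫ fst _ _ by rw [← Category.assoc, ← hp]; simp [hζ]] at h1
    rw [show p ≫ η = h ≫ g ≫ snd _ _ by rw [← Category.assoc, ← hp]; simp [hζ]] at h2
    have hz : ∀ r, h.left.appTop.hom r = 0 → r ∈ K.ideal ⟨⊤, isAffineOpen_top _⟩ := by
      intro r hr
      refine (appTop_eq_zero_of_mem h ?_ r).mpr hr
      exact congrArg (fun J : T.left.IdealSheafData => J.ideal ⟨⊤, isAffineOpen_top _⟩)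
        K.ker_subschemeι.symm
    obtain ⟨l, -, hl⟩ := h1.exists_smul (hu.pull h)
    obtain ⟨m, -, hm⟩ := h2.exists_smul (hv.pull h)
    set θ := p.left.appTop.hom (quadθ e a) with hθ
    have hθ2 : θ ^ 2 = strHom _ e * θ + strHom _ a := by
      have := congrArg p.left.appTop.hom (quadθ_sq e a)
      simpa only [map_pow, map_add, map_mul, strHom_comp] using this
    have u0 : pull h u 0 = -(l * θ) := by rw [hl]; simp [hθ]
    have u1 : pull h u 1 = l := by rw [hl]; simp
    have v0 : pull h v 0 = m * (θ - strHom _ e) := by rw [hm]; simp [hθ, strHom_comp]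
    have v1 : pull h v 1 = m := by rw [hm]; simp
    have h3 : ∀ j, h.left.appTop.hom (mv T e a u v j) = mv _ e a (pull h u) (pull h v) j :=
      fun j => congrFun (pull_mv h e a u v) j
    rw [pairIdeal, Ideal.span_le]
    rintro r (rfl | rfl | rfl | rfl)
    · exact hz _ (show pull h u 2 = 0 by rw [hl]; simp)
    · exact hz _ (show pull h v 2 = 0 by rw [hm]; simp)
    · refine hz _ ((h3 0).trans ?_)
      simp only [mv, mulVec₂, Matrix.cons_val, u0, u1, v0, v1]
      linear_combination -(l * m) * hθ2
    · refine hz _ ((h3 1).trans ?_)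
      simp only [mv, mulVec₂, Matrix.cons_val, u0, u1, v0, v1]
      ring

end Ideal

/-! ### The closure of the graph as a blow-up -/

section Restrict
variable {k : Type u} [Field k] {n : ℕ}

theorem exists_opn_le {W : Sch k} {U V : W.left.Opens} (h : U ≤ V) :
    ∃ f : opn W U ⟶ opn W V, f ≫ opnι W V = opnι W U ∧ Flat f.left := by
  have hx : ∀ x, (opnι W U).left x ∈ V := fun x => h x.2
  have : Flat (opnι W U).left := Flat.instOfIsOpenImmersion U.ι
  exact ⟨opnLift (opnι W U) V hx, opnLift_ι _ _ _, flat_opnLift _ _ hx⟩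

theorem Coord.restrict {Y W T S : Sch k} {i : Y ⟶ projSpace k n} {x : W ⟶ Y} {g : S ⟶ W}
    {g' : T ⟶ W} {v : Fin (n + 1) → Γ(S.left, ⊤)} (H : Coord i (g ≫ x) v) {f : T ⟶ S}
    (hf : f ≫ g = g') : Coord i (g' ≫ x) (Conics.pull f v) := by
  have := H.pull f
  rwa [← Category.assoc, hf] at this

theorem exists_affine_coords {C₁ C₂ : Sch k} (i₁ : C₁ ⟶ projSpace k n) (i₂ : C₂ ⟶ projSpace k n)
    {W : Sch k} (x : W ⟶ C₁) (y : W ⟶ C₂) (w : W.left) (N : W.left.Opens) (hN : w ∈ N) :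
    ∃ (U : W.left.Opens) (_ : IsAffine (opn W U).left), w ∈ U ∧ U ≤ N ∧ ∃ u v,
      Coord i₁ (opnι W U ≫ x) u ∧ Coord i₂ (opnι W U ≫ y) v := by
  obtain ⟨U₀, hU₀, u, v, hu, hv⟩ := exists_local_coords i₁ i₂ x y w
  obtain ⟨U, hU, h⟩ := TopologicalSpace.Opens.isBasis_iff_nbhd.mp
    W.left.isBasis_affineOpens (show w ∈ U₀ ⊓ N from ⟨hU₀, hN⟩)
  obtain ⟨f, hf, -⟩ := exists_opn_le (h.2.trans inf_le_left)
  exact ⟨U, hU, h.1, h.2.trans inf_le_right, _, _, hu.restrict hf, hv.restrict hf⟩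

theorem exists_mem_coordOpen {Y W : Sch k} (i : Y ⟶ projSpace k n) (x : W ⟶ Y) (w : W.left) :
    ∃ j, w ∈ coordOpen i x j := exists_mem_chart _

theorem isUnit_of_forall_mem_basicOpen {W T : Sch k} (f : T ⟶ W) {a : Γ(W.left, ⊤)}
    (h : ∀ s, f.left s ∈ W.left.basicOpen a) : IsUnit (f.left.appTop.hom a) := by
  have h1 := (isUnit_pull_basicOpen W a _ le_rfl).map
    (opnLift f (W.left.basicOpen a) h).left.appTop.hom
  have h2 : pull (opnLift f (W.left.basicOpen a) h) (pull (opnι W _) ![a]) 0 = pull f ![a] 0 := by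
    rw [← pull_comp, opnLift_ι]
  have h3 : IsUnit (pull f ![a] 0) := by rw [← h2]; exact h1
  exact h3

theorem exists_ideal_mem_basicOpen {X : Scheme.{u}} (s : X) :
    ∃ P : Ideal Γ(X, ⊤), P ≠ ⊤ ∧ ∀ r, r ∉ P → s ∈ X.basicOpen r := by
  refine ⟨(IsLocalRing.maximalIdeal _).comap (X.presheaf.germ ⊤ s trivial).hom,
    Ideal.comap_ne_top _ (IsLocalRing.maximalIdeal.isMaximal _).ne_top, fun r hr => ?_⟩
  rw [Scheme.mem_basicOpen X r s (show s ∈ (⊤ : X.Opens) from trivial)]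
  by_contra h
  exact hr h

theorem pairIdeal_map {R S : Type*} [CommRing R] [CommRing S] (φ : R →+* S) (e a : R)
    (u v : Fin 3 → R) : (pairIdeal e a u v).map φ = pairIdeal (φ e) (φ a) (φ ∘ u) (φ ∘ v) := by
  have h := fun j => mulVec₂_map φ e a u v j
  rw [pairIdeal, Ideal.map_span, pairIdeal]
  simp only [Set.image_insert_eq, Set.image_singleton, h]
  rfl

theorem span_range_of_isUnit {R : Type*} [CommRing R] {m w : Fin 3 → R} {j : Fin 3}
    (hw : IsUnit (w j)) (h : ∀ p q, w p * m q = w q * m p) :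
    Ideal.span (Set.range m) = Ideal.span {m j} := by
  refine le_antisymm (Ideal.span_le.mpr ?_)
    (Ideal.span_mono (Set.singleton_subset_iff.mpr ⟨j, rfl⟩))
  rintro _ ⟨q, rfl⟩
  refine (Ideal.unit_mul_mem_iff_mem _ hw).mp ?_
  rw [h j q]
  exact Ideal.mul_mem_left _ _ (Ideal.mem_span_singleton_self _)

theorem Unimod.isUnit_of_rel {R : Type*} [CommRing R] {m w : Fin 3 → R} {j : Fin 3}
    (hm : Unimod m) (hw : IsUnit (w j)) (h : ∀ p q, w p * m q = w q * m p) : IsUnit (m j) := by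
  have := span_range_of_isUnit hw h
  rw [show Ideal.span (Set.range m) = ⊤ from hm] at this
  exact Ideal.span_singleton_eq_top.mp this.symm

end Restrict

namespace ConicTriple
variable {k : Type u} [Field k] {e a b c : k} {C₁ C₂ C : Sch k} (t : ConicTriple e a b c C₁ C₂ C)

theorem pairIdeal_mul {W : Sch k} {x : W ⟶ C₁} {y : W ⟶ C₂} {u v : Fin 3 → Γ(W.left, ⊤)}
    (hu : Coord t.i₁ x u) (hv : Coord t.i₂ y v) :
    pairIdeal (strHom W e) (strHom W a) u v * pairIdeal (strHom W e) (strHom W a) u v =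
      Ideal.span (Set.range (mv W e a u v)) := by
  have h1 := hu.form_eq_zero t.form₁
  have h2 := hv.form_eq_zero t.form₂
  rw [coordHom_qf] at h1 h2
  refine Conics.pairIdeal_mul (b' := strHom W b⁻¹) (c' := strHom W c⁻¹)
    (d' := strHom W (e ^ 2 + 4 * a)⁻¹) ?_ ?_ ?_ h1 h2 hu.unimod hv.unimod
  · rw [← map_mul, mul_inv_cancel₀ t.hb, map_one]
  · rw [← map_mul, mul_inv_cancel₀ t.hc, map_one]
  · have : strHom W (e ^ 2 + 4 * a) * strHom W (e ^ 2 + 4 * a)⁻¹ = 1 := by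
      rw [← map_mul, mul_inv_cancel₀ t.discr, map_one]
    simpa only [map_add, map_mul, map_pow, map_ofNat] using this

/-- The relation is a closed condition: it can be tested after a scheme theoretically dominant morphism. -/
theorem Rel.of_dominant {G B : Sch k} (γ : G ⟶ B) [IsSchemeTheoreticallyDominant γ.left]
    [QuasiCompact γ.left] {x : B ⟶ C₁} {y : B ⟶ C₂} {z : B ⟶ C}
    (h : t.Rel (γ ≫ x) (γ ≫ y) (γ ≫ z)) : t.Rel x y z := by
  refine Rel.of_cover t fun s => ?_
  obtain ⟨V, hV, w, -, hw⟩ := exists_local_coord t.i z s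
  obtain ⟨U, -, hU, hUV, u, v, hu, hv⟩ := exists_affine_coords t.i₁ t.i₂ x y s V hV
  obtain ⟨f, hf, -⟩ := exists_opn_le hUV
  have hw' := hw.restrict hf
  refine ⟨U, hU, Rel.of_coord t hu hv hw' fun p q => ?_⟩
  rw [← sub_eq_zero]
  refine eq_zero_of_dominant γ U ?_
  have hg := opnMap_ι γ U (γ.left ⁻¹ᵁ U) le_rfl
  set r := opnMap γ U (γ.left ⁻¹ᵁ U) le_rfl
  have hx : ∀ {Z : Sch k} (f : B ⟶ Z), r ≫ opnι B U ≫ f = opnι G (γ.left ⁻¹ᵁ U) ≫ γ ≫ f :=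
    fun f => by rw [← Category.assoc, hg, Category.assoc]
  have h1 := hu.pull r
  have h2 := hv.pull r
  have h3 := hw'.pull r
  rw [hx] at h1 h2 h3
  have h4 := h _ _ _ _ _ h1 h2 h3 p q
  rw [← pull_mv] at h4
  rw [map_sub, map_mul, map_mul]
  exact sub_eq_zero.mpr h4

/-- On the closure of the graph of the product map, the ideal `I` of the conjugate pair of points is
that of an effective Cartier divisor. Indeed `I²` is generated by the coordinates of the product;
these are proportional to the coordinates of the point `z` of `C`, so that `I²` is principal. -/
theorem isEffectiveCartier_pair {ξ : quadPt e a ⟶ C₁}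
    {η : quadPt e a ⟶ C₂} (hξ : Coord t.i₁ ξ ![-quadθ e a, 1, 0])
    (hη : Coord t.i₂ η ![quadθ e a - strHom _ e, 1, 0]) [IsClosedImmersion (lift ξ η).left]
    {G B : Sch k} (γ : G ⟶ B) [IsSchemeTheoreticallyDominant γ.left]
    [QuasiCompact γ.left] {β : B ⟶ C₁ ⊗ C₂} {z : B ⟶ C}
    (hr : t.Rel (β ≫ fst _ _) (β ≫ snd _ _) z)
    (hG : ∀ w, w ∈ coordOpen t.i₁ (γ ≫ β ≫ fst _ _) 2) :
    IsEffectiveCartier ((lift ξ η).left.ker.comap β.left) := by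
  refine isEffectiveCartier_of_local fun s => ?_
  obtain ⟨j, hj⟩ := exists_mem_coordOpen t.i z s
  obtain ⟨V, hV, w, -, hw⟩ := exists_local_coord t.i z s
  obtain ⟨U, hUA, hU, hUV, u, v, hu, hv⟩ := exists_affine_coords t.i₁ t.i₂ (β ≫ fst _ _)
    (β ≫ snd _ _) s (V ⊓ coordOpen t.i z j) ⟨hV, hj⟩
  obtain ⟨f, hf, -⟩ := exists_opn_le (hUV.trans inf_le_left)
  have hw' := hw.restrict hf
  have hjU : ∀ s : (opn B U).left, s ∈ coordOpen t.i (opnι B U ≫ z) j := fun s => (hUV s.2).2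
  have hwj : ∀ {T : Sch k} (g : T ⟶ opn B U) {w'}, Coord t.i (g ≫ opnι B U ≫ z) w' →
      IsUnit (w' j) := fun g _ h => isUnit_of_mem_coordOpen hjU h
  set m := mv (opn B U) e a u v with hm
  have hrel : ∀ p q, pull f w p * m q = pull f w q * m p :=
    hr _ _ _ _ _ hu hv hw'
  have hII := t.pairIdeal_mul hu hv
  rw [span_range_of_isUnit (hwj (𝟙 _) (by rwa [Category.id_comp])) hrel] at hII
  -- `m j` is regular, because it is invertible on the dense part where `x₂ ≠ 0`
  have hreg : m j ∈ nonZeroDivisors Γ((opn B U).left, ⊤) := by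
    rw [mem_nonZeroDivisors_iff_right]
    intro r hrm
    refine eq_zero_of_dominant γ U ?_
    have hg := opnMap_ι γ U (γ.left ⁻¹ᵁ U) le_rfl
    set ρ := opnMap γ U (γ.left ⁻¹ᵁ U) le_rfl
    have hx : ∀ {Z : Sch k} (f : B ⟶ Z), ρ ≫ opnι B U ≫ f = opnι G (γ.left ⁻¹ᵁ U) ≫ γ ≫ f :=
      fun f => by rw [← Category.assoc, hg, Category.assoc]
    have h1 := hu.pull ρ
    have h2 := hv.pull ρ
    have h3 := hwj ρ (hw'.pull ρ)
    rw [hx] at h1 h2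
    have h4 := t.regular_of_mem (γ ≫ β ≫ fst _ _) (γ ≫ β ≫ snd _ _) hG _ _ _ _ h1 h2
    rw [← pull_mv] at h4
    have h5 : IsUnit (pull ρ m j) := h4.isUnit_of_rel h3 fun p q => by
      have := congrArg ρ.left.appTop.hom (hrel p q)
      rwa [map_mul, map_mul] at this
    have h6 := congrArg ρ.left.appTop.hom hrm
    rw [map_mul, map_zero] at h6
    exact h5.mul_left_eq_zero.mp h6
  obtain ⟨P, hPt, hP⟩ := exists_ideal_mem_basicOpen (X := (opn B U).left) ⟨s, hU⟩
  obtain ⟨x₀, hx₀, y₀, r, hrP, hxy, hz⟩ :=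
    exists_local_generator hreg hII P hPt
  obtain ⟨U', hU', h⟩ := TopologicalSpace.Opens.isBasis_iff_nbhd.mp
    B.left.isBasis_affineOpens (show s ∈ (opnι B U).left ''ᵁ (opn B U).left.basicOpen r from
      ⟨⟨s, hU⟩, hP r hrP, rfl⟩)
  have hA : IsAffine (opn B U').left := hU'
  have hle : U' ≤ U := by
    rintro q hq
    obtain ⟨q', -, rfl⟩ := h.2 hq
    exact q'.2
  obtain ⟨g, hg, hgf⟩ := exists_opn_le hle
  have hru : IsUnit (g.left.appTop.hom r) := by
    refine isUnit_of_forall_mem_basicOpen g fun q => ?_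
    obtain ⟨q', hq', hqq⟩ := h.2 q.2
    have h1 : (opnι B U).left (g.left q) = (opnι B U').left q := by
      rw [← hg]; rfl
    have h2 : g.left q = q' := Subtype.ext (h1.trans hqq.symm)
    rw [h2]
    exact hq'
  refine ⟨U', hA, h.1, g.left.appTop.hom x₀, ?_, ?_⟩
  · have h1 := mem_nonZeroDivisors_of_flat g hreg
    have h2 := congrArg g.left.appTop.hom hxy
    rw [map_mul, map_mul] at h2
    have h3 : g.left.appTop.hom x₀ * g.left.appTop.hom y₀ ∈ nonZeroDivisors _ := by
      rw [h2]
      exact mul_mem h1 hru.mem_nonZeroDivisors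
    exact (mul_mem_nonZeroDivisors.mp h3).1
  · rw [← Scheme.IdealSheafData.comap_comp]
    have h1 := t.comap_ker hξ hη (g := opnι B U' ≫ β) (by
      rw [Category.assoc]; exact hu.restrict hg) (by rw [Category.assoc]; exact hv.restrict hg)
    refine h1.trans ?_
    have h2 := pairIdeal_map g.left.appTop.hom (strHom _ e) (strHom _ a) u v
    rw [strHom_comp, strHom_comp] at h2
    refine h2.symm.trans (le_antisymm ?_ ?_)
    · rw [Ideal.map_le_iff_le_comap]
      intro r' hr'
      obtain ⟨s', hs'⟩ := hz r' hr'
      have h3 := congrArg g.left.appTop.hom hs'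
      rw [map_mul, map_mul] at h3
      refine Ideal.mem_comap.mpr ((Ideal.mul_unit_mem_iff_mem _ hru).mp ?_)
      rw [h3]
      exact Ideal.mul_mem_left _ _ (Ideal.mem_span_singleton_self _)
    · rw [Ideal.span_singleton_le_iff_mem]
      exact Ideal.mem_map_of_mem _ hx₀

end ConicTriple

theorem mono_opnι {k : Type u} [Field k] (W : Sch k) (U : W.left.Opens) : Mono (opnι W U) := by
  have : Mono (opnι W U).left := inferInstanceAs (Mono U.ι)
  exact Over.mono_of_mono_left (opnι W U)

namespace ConicTriple
variable {k : Type u} [Field k] {e a b c : k} {C₁ C₂ C : Sch k} (t : ConicTriple e a b c C₁ C₂ C)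

/-- Where the conjugate pair of points is an effective Cartier divisor with equation `f`, the
product map divided by `f²` extends to a morphism, which is the only one that is proportional to
the product map; away from `f = 0` the product map does not vanish. -/
theorem exists_local_rel {ξ : quadPt e a ⟶ C₁}
    {η : quadPt e a ⟶ C₂} (hξ : Coord t.i₁ ξ ![-quadθ e a, 1, 0])
    (hη : Coord t.i₂ η ![quadθ e a - strHom _ e, 1, 0]) [IsClosedImmersion (lift ξ η).left]
    {W : Sch k} {g : W ⟶ C₁ ⊗ C₂} (hI : IsEffectiveCartier ((lift ξ η).left.ker.comap g.left))
    (w : W.left) :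
    ∃ (U : W.left.Opens) (_ : IsAffine (opn W U).left), w ∈ U ∧ ∃ z₀ : opn W U ⟶ C,
      t.Rel (opnι W U ≫ g ≫ fst _ _) (opnι W U ≫ g ≫ snd _ _) z₀ ∧
      (∀ (T : Sch k) (h : T ⟶ opn W U) (_ : Flat h.left) (z : T ⟶ C),
        t.Rel (h ≫ opnι W U ≫ g ≫ fst _ _) (h ≫ opnι W U ≫ g ≫ snd _ _) z → z = h ≫ z₀) ∧
      ∃ f ∈ nonZeroDivisors Γ((opn W U).left, ⊤),
        t.Regular (opnι _ ((opn W U).left.basicOpen f) ≫ opnι W U ≫ g ≫ fst _ _)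
          (opnι _ ((opn W U).left.basicOpen f) ≫ opnι W U ≫ g ≫ snd _ _) := by
  have hmono := t.form.mono
  obtain ⟨V, -, hV, -, u₀, v₀, hu₀, hv₀⟩ := exists_affine_coords t.i₁ t.i₂ (g ≫ fst _ _)
    (g ≫ snd _ _) w ⊤ trivial
  obtain ⟨U, hA, hU, hUV, f, hf, hIf⟩ := hI.exists_local w V hV
  obtain ⟨r, hr, -⟩ := exists_opn_le hUV
  have hu := hu₀.restrict hr
  have hv := hv₀.restrict hr
  set u := Conics.pull r u₀
  set v := Conics.pull r v₀
  rw [← Scheme.IdealSheafData.comap_comp] at hIf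
  have h1 := t.comap_ker hξ hη (g := opnι W U ≫ g) (by rwa [Category.assoc])
    (by rwa [Category.assoc])
  have hq := t.qv_mv hu hv
  rw [coordHom_qf] at hq
  obtain ⟨n, hmn, hn, hnq⟩ := exists_quotient_vec hf (h1.symm.trans hIf) (t.pairIdeal_mul hu hv) hq
  obtain ⟨z₀, hz₀⟩ := exists_coord_of_form t.form hn (by rw [coordHom_qf]; exact hnq)
  have hmn' : ∀ j, mv _ e a u v j = f ^ 2 * n j := fun j => congrFun hmn j
  refine ⟨U, hA, hU, z₀, Rel.of_coord t hu hv hz₀ fun p q => ?_, ?_, f, hf, ?_⟩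
  · rw [hmn', hmn']
    ring
  · intro T h hflat z hz
    refine hom_ext_of_cover _ _ fun s => ?_
    obtain ⟨X, hX, w, -, hw⟩ := exists_local_coord t.i z s
    refine ⟨X, hX, ?_⟩
    set j := opnι T X ≫ h with hj
    have : Flat (opnι T X).left := Flat.instOfIsOpenImmersion X.ι
    have hjf : Flat j.left := inferInstanceAs (Flat ((opnι T X).left ≫ h.left))
    have hn' := hz₀.pull j
    rw [hj, Category.assoc] at hn'
    refine hw.eq_of_prop hn' fun p q => ?_
    have hu' := hu.pull j
    have hv' := hv.pull j
    rw [hj, Category.assoc] at hu' hv'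
    have h2 := hz _ (opnι T X) _ _ _ hu' hv' hw p q
    rw [← pull_mv, ← hj] at h2
    have h3 : ∀ p, Conics.pull j (mv (opn W U) e a u v) p =
        j.left.appTop.hom f ^ 2 * Conics.pull j n p := fun p => by
      rw [pull_apply, hmn', map_mul, map_pow]
      rfl
    rw [h3, h3] at h2
    refine (mul_cancel_left_mem_nonZeroDivisors
      (pow_mem (mem_nonZeroDivisors_of_flat j hf) 2)).mp ?_
    rw [← hj]
    linear_combination h2
  · set j := opnι _ ((opn W U).left.basicOpen f)
    refine Regular.of_coord t (hu.pull j) (hv.pull j) ?_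
    rw [← pull_mv, hmn]
    have h2 : IsUnit (j.left.appTop.hom f) := isUnit_pull_basicOpen _ _ _ le_rfl
    have h3 : Conics.pull j (f ^ 2 • n) = j.left.appTop.hom f ^ 2 • Conics.pull j n := by
      funext p
      simp only [pull_apply, Pi.smul_apply, smul_eq_mul, map_mul, map_pow]
    rw [h3]
    exact (hn.pull j).smul (h2.pow 2)

/-- A regular point of `C₁ × C₂` has a regular neighbourhood. -/
theorem Regular.exists_open {S : Sch k} {x : S ⟶ C₁} {y : S ⟶ C₂} (h : t.Regular x y)
    (s : S.left) : ∃ N : (C₁ ⊗ C₂).left.Opens, (lift x y).left s ∈ N ∧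
      t.Regular (opnι _ N ≫ fst C₁ C₂) (opnι _ N ≫ snd C₁ C₂) := by
  set g := lift x y with hg
  have hgx : g ≫ fst C₁ C₂ = x := lift_fst _ _
  have hgy : g ≫ snd C₁ C₂ = y := lift_snd _ _
  obtain ⟨U, hU, u, v, hu, hv⟩ := exists_local_coords t.i₁ t.i₂ (fst C₁ C₂) (snd C₁ C₂) (g.left s)
  have hr := opnMap_ι g U (g.left ⁻¹ᵁ U) le_rfl
  set r := opnMap g U (g.left ⁻¹ᵁ U) le_rfl
  have h1 := hu.pull r
  have h2 := hv.pull r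
  rw [reassoc_of% hr, hgx] at h1
  rw [reassoc_of% hr, hgy] at h2
  have h3 := h _ _ _ _ h1 h2
  rw [← pull_mv] at h3
  obtain ⟨j, hj⟩ := exists_mem_basicOpen h3 ⟨s, hU⟩
  set m := mv _ e a u v
  have h4 : (⟨g.left s, hU⟩ : (opn (C₁ ⊗ C₂) U).left) ∈ (opn (C₁ ⊗ C₂) U).left.basicOpen (m j) := by
    have h5 := Scheme.preimage_basicOpen_top r.left (m j)
    change _ ∈ _ at hj
    have h6 : (⟨s, hU⟩ : (opn S (g.left ⁻¹ᵁ U)).left) ∈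
      r.left ⁻¹ᵁ ((opn (C₁ ⊗ C₂) U).left.basicOpen (m j)) := by rw [h5]; exact hj
    have h7 : r.left ⟨s, hU⟩ = ⟨g.left s, hU⟩ := Subtype.ext
      (congrArg (fun f : opn S (g.left ⁻¹ᵁ U) ⟶ C₁ ⊗ C₂ => f.left ⟨s, hU⟩) hr)
    rw [← h7]
    exact h6
  refine ⟨(opnι _ U).left ''ᵁ (opn _ U).left.basicOpen (m j), ⟨_, h4, rfl⟩, ?_⟩
  obtain ⟨f, hf, -⟩ := exists_opn_le (W := C₁ ⊗ C₂)
    (U := (opnι _ U).left ''ᵁ (opn _ U).left.basicOpen (m j)) (V := U) (by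
      rintro _ ⟨q, -, rfl⟩; exact q.2)
  refine Regular.of_coord t (hu.restrict hf) (hv.restrict hf) ?_
  rw [← pull_mv]
  refine unimod_of_isUnit (j := j) (isUnit_of_forall_mem_basicOpen f fun q => ?_)
  obtain ⟨q', hq', hqq⟩ := q.2
  have h5 : (opnι _ U).left (f.left q) = (opnι _ _).left q := by
    rw [← hf]; rfl
  have h6 : f.left q = q' := Subtype.ext (h5.trans hqq.symm)
  rw [h6]
  exact hq'

/-- The graph of the product map contains the graph over every regular point. -/
theorem exists_lift_of_regular {G B : Sch k} (γ : G ⟶ B) {β : B ⟶ C₁ ⊗ C₂} {z : B ⟶ C}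
    [IsClosedImmersion (lift β z).left]
    (hr : t.Rel (β ≫ fst _ _) (β ≫ snd _ _) z)
    (hlift : ∀ (T : Sch k) (x : T ⟶ C₁) (y : T ⟶ C₂), (∀ w, w ∈ coordOpen t.i₁ x 2) →
      ∃ l : T ⟶ G, l ≫ γ ≫ β = lift x y)
    {S : Sch k} {x : S ⟶ C₁} {y : S ⟶ C₂} {z' : S ⟶ C} (h : t.Regular x y) (hz : t.Rel x y z') :
    ∃ l : S ⟶ B, l ≫ lift β z = lift (lift x y) z' := by
  have hm := mono_of_closed (lift β z)
  refine exists_lift_of_cover (lift β z) _ fun s => ?_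
  obtain ⟨N, hN, hNr⟩ := Regular.exists_open t h s
  obtain ⟨zN, hzN⟩ := hNr.exists_rel
  have hred : IsReduced (C₁ ⊗ C₂).left := isReduced_prod t.form₁ t.form₂ t.discr
  have hredN : IsReduced (opn _ N).left := isReduced_of_isOpenImmersion (opnι _ N).left
  have hflN : Flat (opnι _ N).left := Flat.instOfIsOpenImmersion N.ι
  have hfl : Flat (opnι _ N ≫ fst C₁ C₂).left :=
    inferInstanceAs (Flat ((opnι _ N).left ≫ (fst C₁ C₂).left))
  have hdom := isDominant_coordOpen t.form₁ (opnι _ N ≫ fst C₁ C₂)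
  have hsd := IsSchemeTheoreticallyDominant.of_isDominant
    (opnι (opn _ N) (coordOpen t.i₁ (opnι _ N ≫ fst C₁ C₂) 2)).left
  set j := opnι (opn _ N) (coordOpen t.i₁ (opnι _ N ≫ fst C₁ C₂) 2)
  obtain ⟨l, hl⟩ := hlift _ (j ≫ opnι _ N ≫ fst C₁ C₂) (j ≫ opnι _ N ≫ snd C₁ C₂) fun w => w.2
  have hβ : (l ≫ γ) ≫ β = j ≫ opnι _ N := by
    rw [Category.assoc, hl]
    refine CartesianMonoidalCategory.hom_ext _ _ ?_ ?_ <;> simp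
  generalize l ≫ γ = q at hβ
  have h1 : q ≫ z = j ≫ zN := by
    have h2 := hr.pull q
    rw [reassoc_of% hβ, reassoc_of% hβ] at h2
    exact Rel.unique (hNr.pull j) h2 (hzN.pull j)
  have h3 : j ≫ lift (opnι _ N) zN = q ≫ lift β z := by
    refine CartesianMonoidalCategory.hom_ext _ _ ?_ ?_ <;> simp [hβ, h1]
  obtain ⟨L, hL⟩ := exists_lift_of_dominant j.left (lift β z).left (lift (opnι _ N) zN).left
    q.left (congrArg Over.Hom.left h3)
  set g := lift x y with hg
  have hgx : g ≫ fst C₁ C₂ = x := lift_fst _ _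
  have hgy : g ≫ snd C₁ C₂ = y := lift_snd _ _
  have hρ := opnMap_ι g N (g.left ⁻¹ᵁ N) le_rfl
  set ρ := opnMap g N (g.left ⁻¹ᵁ N) le_rfl
  let L' : opn (C₁ ⊗ C₂) N ⟶ B := Over.homMk L (by rw [← Over.w (lift β z), reassoc_of% hL, Over.w])
  have hL' : L' ≫ lift β z = lift (opnι _ N) zN := Over.OverMorphism.ext hL
  refine ⟨g.left ⁻¹ᵁ N, hN, ρ ≫ L', ?_⟩
  rw [Category.assoc, hL']
  refine CartesianMonoidalCategory.hom_ext _ _ ?_ ?_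
  · simp [hρ]
  · rw [Category.assoc, lift_snd, Category.assoc, lift_snd]
    refine Rel.unique (t := t) (x := opnι _ (g.left ⁻¹ᵁ N) ≫ x) (y := opnι _ (g.left ⁻¹ᵁ N) ≫ y)
      (h.pull _) ?_ (hz.pull _)
    have h5 := hzN.pull ρ
    rw [reassoc_of% hρ, reassoc_of% hρ, hgx, hgy] at h5
    exact h5

/-- The closure of the graph of the product map is the blow-up of the conjugate pair of points. -/
theorem isBlowup {ξ : quadPt e a ⟶ C₁}
    {η : quadPt e a ⟶ C₂} (hξ : Coord t.i₁ ξ ![-quadθ e a, 1, 0])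
    (hη : Coord t.i₂ η ![quadθ e a - strHom _ e, 1, 0]) [IsClosedImmersion (lift ξ η).left]
    {G B : Sch k} (γ : G ⟶ B) [IsSchemeTheoreticallyDominant γ.left]
    [QuasiCompact γ.left] {β : B ⟶ C₁ ⊗ C₂} {z : B ⟶ C} [IsClosedImmersion (lift β z).left]
    (hG : ∀ w, w ∈ coordOpen t.i₁ (γ ≫ β ≫ fst _ _) 2)
    (hr : t.Rel (γ ≫ β ≫ fst _ _) (γ ≫ β ≫ snd _ _) (γ ≫ z))
    (hlift : ∀ (T : Sch k) (x : T ⟶ C₁) (y : T ⟶ C₂), (∀ w, w ∈ coordOpen t.i₁ x 2) →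
      ∃ l : T ⟶ G, l ≫ γ ≫ β = lift x y) :
    IsBlowup (lift ξ η).left.ker β.left := by
  have hm := mono_of_closed (lift β z)
  have hrB := Rel.of_dominant t γ hr
  refine ⟨t.isEffectiveCartier_pair hξ hη γ hrB hG, ?_⟩
  suffices H : ∀ (W : Sch k) (g : W ⟶ C₁ ⊗ C₂),
      IsEffectiveCartier ((lift ξ η).left.ker.comap g.left) → ∃! h : W ⟶ B, h ≫ β = g by
    intro W g hI
    obtain ⟨h, hh, huniq⟩ := H (Over.mk (g ≫ (C₁ ⊗ C₂).hom)) (Over.homMk g) hI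
    refine ⟨h.left, congrArg Over.Hom.left hh, fun h' hh' => ?_⟩
    have h1 : h' ≫ B.hom = g ≫ (C₁ ⊗ C₂).hom := by rw [← Over.w β, reassoc_of% hh']
    exact congrArg Over.Hom.left (huniq (Over.homMk h' h1) (Over.OverMorphism.ext hh'))
  intro W g hI
  choose U hA hU z₀ hz₀ huniq f hf hreg using t.exists_local_rel hξ hη hI
  -- the local extensions of the product map agree, since intersections are flat
  obtain ⟨zW, hzW⟩ := exists_glue U hU z₀ fun x y T p q hpq => by
    obtain ⟨f₁, hf₁, hfl₁⟩ := exists_opn_le (W := W) (U := U x ⊓ U y) (V := U x) inf_le_left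
    obtain ⟨f₂, hf₂, hfl₂⟩ := exists_opn_le (W := W) (U := U x ⊓ U y) (V := U y) inf_le_right
    have h1 : f₁ ≫ z₀ x = f₂ ≫ z₀ y := by
      refine huniq y _ f₂ hfl₂ _ ?_
      rw [reassoc_of% hf₂, reassoc_of% hf₂, ← reassoc_of% hf₁, ← reassoc_of% hf₁]
      exact (hz₀ x).pull f₁
    have hmem : ∀ s, (p ≫ opnι W (U x)).left s ∈ U x ⊓ U y := fun s =>
      ⟨(p.left s).2, by rw [hpq]; exact (q.left s).2⟩
    have h2 := opnLift_ι (p ≫ opnι W (U x)) (U x ⊓ U y) hmem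
    set r := opnLift (p ≫ opnι W (U x)) (U x ⊓ U y) hmem
    have mx := mono_opnι W (U x)
    have my := mono_opnι W (U y)
    have h3 : r ≫ f₁ = p := by
      rw [← cancel_mono (opnι W (U x)), Category.assoc, hf₁, h2]
    have h4 : r ≫ f₂ = q := by
      rw [← cancel_mono (opnι W (U y)), Category.assoc, hf₂, h2, hpq]
    rw [← h3, ← h4, Category.assoc, Category.assoc, h1]
  have key : ∀ z' : W ⟶ C, t.Rel (g ≫ fst _ _) (g ≫ snd _ _) z' → z' = zW := by
    intro z' hz'
    refine hom_ext_of_cover _ _ fun w => ⟨U w, hU w, ?_⟩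
    rw [hzW, ← Category.id_comp (z₀ w)]
    have : Flat (Over.Hom.left (𝟙 (opn W (U w)))) :=
      inferInstanceAs (Flat (𝟙 (Over.left (opn W (U w)))))
    refine huniq w _ (𝟙 _) this _ ?_
    rw [Category.id_comp, Category.id_comp]
    exact hz'.pull _
  -- The extension lands in the closure of the graph, as it lands in the graph where the equation of
  -- the conjugate pair is invertible, which is a dense part.
  obtain ⟨h, hh⟩ : ∃ h : W ⟶ B, h ≫ lift β z = lift g zW := by
    refine exists_lift_of_cover (lift β z) _ fun w => ?_
    set j := opnι _ ((opn W (U w)).left.basicOpen (f w)) with hj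
    have hA' := hA w
    have hd : IsSchemeTheoreticallyDominant j.left :=
      isSchemeTheoreticallyDominant_basicOpen (hf w)
    obtain ⟨l, hl⟩ := t.exists_lift_of_regular γ hrB hlift (hreg w) ((hz₀ w).pull j)
    have h1 : j ≫ lift (opnι W (U w) ≫ g) (z₀ w) = l ≫ lift β z := by
      rw [hl]
      refine CartesianMonoidalCategory.hom_ext _ _ ?_ ?_
      · refine CartesianMonoidalCategory.hom_ext _ _ ?_ ?_ <;> simp [hj]
      · simp [hj]
    obtain ⟨L, hL⟩ := exists_lift_of_dominant j.left (lift β z).left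
      (lift (opnι W (U w) ≫ g) (z₀ w)).left l.left (congrArg Over.Hom.left h1)
    refine ⟨U w, hU w, Over.homMk L (by rw [← Over.w (lift β z), reassoc_of% hL, Over.w]), ?_⟩
    refine Eq.trans (Over.OverMorphism.ext hL : _ = lift (opnι W (U w) ≫ g) (z₀ w)) ?_
    refine CartesianMonoidalCategory.hom_ext _ _ ?_ ?_
    · simp
    · simp [hzW]
  have hβ : ∀ h' : W ⟶ B, h' ≫ lift β z = lift g zW → h' ≫ β = g := fun h' hh' => by
    simpa using congrArg (· ≫ fst _ _) hh'
  refine ⟨h, hβ h hh, fun h' hh' => ?_⟩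
  rw [← cancel_mono (lift β z), hh]
  refine CartesianMonoidalCategory.hom_ext _ _ ?_ ?_
  · simpa using hh'
  · have h1 := hrB.pull h'
    rw [reassoc_of% hh', reassoc_of% hh'] at h1
    simpa using key _ h1

end ConicTriple

section Closed
variable {k : Type u} [Field k]

theorem isIso_toImage {X Y : Scheme.{u}} (f : Y ⟶ X) [IsClosedImmersion f] : IsIso f.toImage :=
  inferInstance

theorem nonempty_closedSub_iso {X Y : Sch k} (f : Y ⟶ X) [IsClosedImmersion f.left] :
    Nonempty (closedSub f.left.ker ≅ Y) :=
  ⟨(Over.isoMk (@asIso _ _ _ _ f.left.toImage (isIso_toImage f.left)) (by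
    change f.left.toImage ≫ f.left.imageι ≫ X.hom = Y.hom
    rw [Scheme.Hom.toImage_imageι_assoc, Over.w])).symm⟩

theorem isDegreeTwo_quadPt (e a : k) : IsDegreeTwo (quadPt e a) := by
  refine ⟨isFinite_quadPt e a, fun s => ?_⟩
  have h := Scheme.Hom.finrank_SpecMap_algebraMap k (QuadAlg e a) s
  refine h.trans ?_
  rw [Module.rankAtStalk_eq_finrank_of_free]
  exact QuadraticAlgebra.finrank_eq_two _ _

theorem IsDegreeTwo.of_iso {Z Z' : Sch k} (ε : Z ≅ Z') (h : IsDegreeTwo Z') : IsDegreeTwo Z := by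
  have h1 := h.1
  have h2 : IsIso ε.hom.left := inferInstanceAs (IsIso ((Over.forget _).map ε.hom))
  have h3 : Flat Z'.hom := inferInstance
  rw [IsDegreeTwo, ← Over.w ε.hom]
  refine ⟨inferInstance, fun s => ?_⟩
  rw [Scheme.Hom.finrank_comp_left_of_isIso]
  exact h.2 s

end Closed

namespace ConicTriple
variable {k : Type u} [Field k] {e a b c : k} {C₁ C₂ C : Sch k} (t : ConicTriple e a b c C₁ C₂ C)

/-- The conjugate pair of points `((-θ : 1 : 0), (θ - e : 1 : 0))` of `C₁ × C₂`. -/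
theorem exists_pair : ∃ (ξ : quadPt e a ⟶ C₁) (η : quadPt e a ⟶ C₂),
    Coord t.i₁ ξ ![-quadθ e a, 1, 0] ∧ Coord t.i₂ η ![quadθ e a - strHom _ e, 1, 0] ∧
      IsClosedImmersion (lift ξ η).left := by
  obtain ⟨ξ, hξ⟩ := exists_quadPt_coord t.form₁
  obtain ⟨η, hη⟩ := exists_quadPt_coord_conj t.form₂
  refine ⟨ξ, η, hξ, hη, ?_⟩
  have h1 := t.form₁.closed
  have h2 := t.form₂.closed
  have p₁ := isProper_of_closed t.i₁
  have p₂ := isProper_of_closed t.i₂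
  have p := isProper_tensor (X := C₁) (Y := C₂)
  have hm := quadPt_mono (i := t.i₁) (.inl rfl) hξ
  have : Mono (lift ξ η) := mono_of_mono_fac (lift_fst ξ η)
  exact isClosedImmersion_of_mono (lift ξ η)

/-- The closure of the graph of the product map, with its projections. -/
theorem exists_graph : ∃ (G B : Sch k) (γ : G ⟶ B) (β : B ⟶ C₁ ⊗ C₂) (z : B ⟶ C),
    IsSchemeTheoreticallyDominant γ.left ∧ QuasiCompact γ.left ∧
    IsClosedImmersion (lift β z).left ∧
    (∀ w, w ∈ coordOpen t.i₁ (γ ≫ β ≫ fst _ _) 2) ∧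
    t.Rel (γ ≫ β ≫ fst _ _) (γ ≫ β ≫ snd _ _) (γ ≫ z) ∧
    ∀ (T : Sch k) (x : T ⟶ C₁) (y : T ⟶ C₂), (∀ w, w ∈ coordOpen t.i₁ x 2) →
      ∃ l : T ⟶ G, l ≫ γ ≫ β = lift x y := by
  have h := t.form.closed
  have p := isProper_of_closed t.i
  set V := coordOpen t.i₁ (fst C₁ C₂) 2
  set j := opnι (C₁ ⊗ C₂) V
  obtain ⟨zG, hzG⟩ := (t.regular_of_mem (j ≫ fst _ _) (j ≫ snd _ _) fun w => w.2).exists_rel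
  obtain ⟨γ₀, hγ₁, hγ₂⟩ : ∃ γ₀ : opn (C₁ ⊗ C₂) V ⟶ (C₁ ⊗ C₂) ⊗ C,
      γ₀ ≫ fst _ _ = j ∧ γ₀ ≫ snd _ _ = zG := ⟨lift j zG, lift_fst _ _, lift_snd _ _⟩
  have q : QuasiCompact γ₀.left := by
    have q1 : QuasiCompact j.left := quasiCompact_coordOpen _ _ _
    have q2 : QuasiCompact (γ₀.left ≫ (fst (C₁ ⊗ C₂) C).left) := by
      rw [← Over.comp_left, hγ₁]; exact q1
    have : IsProper (fst (C₁ ⊗ C₂) C).left :=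
      inferInstanceAs (IsProper (Limits.pullback.fst (C₁ ⊗ C₂).hom C.hom))
    exact QuasiCompact.of_comp γ₀.left (fst (C₁ ⊗ C₂) C).left
  let B : Sch k := Over.mk (γ₀.left.imageι ≫ ((C₁ ⊗ C₂) ⊗ C).hom)
  let ι : B ⟶ (C₁ ⊗ C₂) ⊗ C := Over.homMk γ₀.left.imageι
  have hι : IsClosedImmersion ι.left := inferInstanceAs (IsClosedImmersion γ₀.left.imageι)
  let γ : opn (C₁ ⊗ C₂) V ⟶ B := Over.homMk γ₀.left.toImage (by
    change γ₀.left.toImage ≫ γ₀.left.imageι ≫ _ = _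
    rw [Scheme.Hom.toImage_imageι_assoc, Over.w])
  have hγι : γ ≫ ι = γ₀ := Over.OverMorphism.ext (Scheme.Hom.toImage_imageι _)
  have hfst : γ ≫ ι ≫ fst _ _ = j := by rw [reassoc_of% hγι, hγ₁]
  have hsnd : γ ≫ ι ≫ snd _ _ = zG := by rw [reassoc_of% hγι, hγ₂]
  refine ⟨_, B, γ, ι ≫ fst _ _, ι ≫ snd _ _, ?_, ?_, ?_, ?_, ?_, ?_⟩
  · exact isSchemeTheoreticallyDominant_toImage γ₀.left
  · have h1 : QuasiCompact (γ.left ≫ ι.left) := by rw [← Over.comp_left, hγι]; exact q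
    exact QuasiCompact.of_comp γ.left ι.left
  · have : lift (ι ≫ fst _ _) (ι ≫ snd _ _) = ι :=
      CartesianMonoidalCategory.hom_ext _ _ (by simp) (by simp)
    rw [this]
    exact hι
  · rw [Category.assoc, reassoc_of% hfst]
    exact fun w => w.2
  · rw [Category.assoc, Category.assoc, reassoc_of% hfst, reassoc_of% hfst, hsnd]
    exact hzG
  · intro T x y hx
    refine ⟨opnLift (lift x y) V fun w => ?_, ?_⟩
    · rw [mem_coordOpen_comp, lift_fst]
      exact hx w
    · rw [hfst, opnLift_ι]

/-- The closure of the graph of the product map is a blow-up of `C₁ × C₂`, and by the symmetry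
`exists_swap` also a blow-up of `C₁ × C`. -/
theorem exists_blowupLink : ∃ L : BlowupLink C₁ C₂ C,
    t.Rel (L.β ≫ fst _ _) (L.β ≫ snd _ _) (L.β' ≫ snd _ _) := by
  obtain ⟨G, B, γ, β, z, hd, hq, hcl, hG, hr, hlift⟩ := t.exists_graph
  obtain ⟨t', ht', hsw⟩ := t.exists_swap
  obtain ⟨ξ, η, hξ, hη, hζ⟩ := t.exists_pair
  obtain ⟨ξ', η', hξ', hη', hζ'⟩ := t'.exists_pair
  obtain ⟨ε⟩ := nonempty_closedSub_iso (lift ξ η)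
  obtain ⟨ε'⟩ := nonempty_closedSub_iso (lift ξ' η')
  obtain ⟨β', hβ₁, hβ₂⟩ : ∃ β' : B ⟶ C₁ ⊗ C, β' ≫ fst _ _ = β ≫ fst _ _ ∧ β' ≫ snd _ _ = z :=
    ⟨lift _ _, lift_fst _ _, lift_snd _ _⟩
  obtain ⟨σ, hσ⟩ : ∃ σ : (C₁ ⊗ C₂) ⊗ C ≅ (C₁ ⊗ C) ⊗ C₂, σ.hom =
      lift (lift (fst _ _ ≫ fst _ _) (snd _ _)) (fst _ _ ≫ snd _ _) := ⟨
    { hom := lift (lift (fst _ _ ≫ fst _ _) (snd _ _)) (fst _ _ ≫ snd _ _)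
      inv := lift (lift (fst _ _ ≫ fst _ _) (snd _ _)) (fst _ _ ≫ snd _ _)
      hom_inv_id := by
        refine CartesianMonoidalCategory.hom_ext _ _
          (CartesianMonoidalCategory.hom_ext _ _ ?_ ?_) ?_ <;> simp
      inv_hom_id := by
        refine CartesianMonoidalCategory.hom_ext _ _
          (CartesianMonoidalCategory.hom_ext _ _ ?_ ?_) ?_ <;> simp }, rfl⟩
  have hcl' : IsClosedImmersion (lift β' (β ≫ snd _ _)).left := by
    have h1 : lift β' (β ≫ snd _ _) = lift β z ≫ σ.hom := by
      refine CartesianMonoidalCategory.hom_ext _ _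
          (CartesianMonoidalCategory.hom_ext _ _ ?_ ?_) ?_ <;> simp [hσ, hβ₁, hβ₂]
    have h2 : IsIso σ.hom.left := inferInstanceAs (IsIso ((Over.forget _).map σ.hom))
    rw [h1]
    exact inferInstanceAs (IsClosedImmersion ((lift β z).left ≫ σ.hom.left))
  have hreg {T : Sch k} {x : T ⟶ C₁} (y : T ⟶ C₂)
      (hx : ∀ w, w ∈ coordOpen t.i₁ x 2) : t.Regular x y :=
    t.regular_of_mem x y hx
  refine ⟨⟨B, (lift ξ η).left.ker, (lift ξ' η').left.ker, β, β',
    (isDegreeTwo_quadPt e a).of_iso ε, (isDegreeTwo_quadPt e a).of_iso ε', ⟨ε ≪≫ ε'.symm⟩,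
    t.isBlowup hξ hη γ hG hr hlift,
    t'.isBlowup hξ' hη' γ (z := β ≫ snd _ _) ?_ ?_ ?_, hβ₁.symm⟩, ?_⟩
  · rw [hβ₁, ht']
    exact hG
  · rw [hβ₁, hβ₂]
    exact (hsw _ _ _ hG).mpr hr
  · intro T x z' hx
    rw [ht'] at hx
    obtain ⟨y, hy⟩ := (t'.regular_of_mem x z' (by rwa [ht'])).exists_rel
    have hxy := (hsw _ _ _ hx).mp hy
    obtain ⟨l, hl⟩ := hlift T x y hx
    refine ⟨l, CartesianMonoidalCategory.hom_ext _ _ ?_ ?_⟩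
    · rw [Category.assoc, Category.assoc, hβ₁, reassoc_of% hl, lift_fst, lift_fst]
    · rw [Category.assoc, Category.assoc, hβ₂, lift_snd]
      have h1 := hr.pull l
      rw [reassoc_of% hl, reassoc_of% hl, lift_fst, lift_snd] at h1
      exact Rel.unique (hreg y hx) h1 hxy
  · have h1 := Rel.of_dominant t γ hr
    have h2 : t.Rel (β ≫ fst _ _) (β ≫ snd _ _) (β' ≫ snd _ _) := by rwa [hβ₂]
    exact h2

/-- Where the product of `x` and `y` does not vanish, it is the only point of `C` proportional to it. -/
theorem isGivenBy {a : k} (t : ConicTriple 0 a b c C₁ C₂ C) (L : BlowupLink C₁ C₂ C)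
    (hL : t.Rel (L.β ≫ fst _ _) (L.β ≫ snd _ _) (L.β' ≫ snd _ _)) :
    L.IsGivenBy a t.i₁ t.i₂ t.i := by
  intro K _ _ s x y hx hy hz h1 h2
  rw [← Category.assoc, ← Category.assoc, Category.assoc s] at h1 h2 ⊢
  replace h1 := (coord_iff_homogPoint _ _ hx).mpr h1
  replace h2 := (coord_iff_homogPoint _ _ hy).mpr h2
  refine (coord_iff_homogPoint _ _ hz).mp ?_
  have h3 : (fun j => secK k K (prodVec (algebraMap k K a) x y j)) =
      mv (specK k K) 0 a (fun j => secK k K (x j)) (fun j => secK k K (y j)) := by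
    funext j
    have h4 := strHom_specK (k := k) K a
    fin_cases j <;> simp [mv, mulVec₂, prodVec, h4]
  have hm := unimod_secK (k := k) (unimod_of_ne_zero hz)
  rw [h3] at hm ⊢
  obtain ⟨z, hz'⟩ := exists_coord_of_form t.form hm (t.qv_mv h1 h2)
  have h4 : z = s ≫ L.β' ≫ snd C₁ C :=
    Rel.unique (Regular.of_coord t h1 h2 hm) (Rel.of_coord t h1 h2 hz' fun p q => mul_comm _ _)
      (hL.pull s)
  exact h4 ▸ hz'

end ConicTriple

/-! ### Principal ideals in factorial domains -/

section Principal

/-- In a factorial domain, a locally principal ideal is principal. -/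
theorem exists_eq_span_of_local {A : Type*} [CommRing A] [IsDomain A] [UniqueFactorizationMonoid A]
    (I : Ideal A) (h : ∀ P : Ideal A, P.IsPrime → ∃ y ∈ I, ∃ s ∉ P,
      ∀ x ∈ I, ∃ (n : ℕ) (c : A), s ^ n * x = y * c) :
    ∃ g, I = Ideal.span {g} := by
  by_cases hI : I = ⊥
  · exact ⟨0, by rw [hI]; simp⟩
  obtain ⟨x₀, hx₀, hx0⟩ := Submodule.exists_mem_ne_zero_of_ne_bot hI
  -- a divisor `g` of `I` with as many prime factors as possible
  let S : Set A := {c | ∃ g, x₀ = g * c ∧ I ≤ Ideal.span {g}}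
  have hS : S.Nonempty := ⟨x₀, 1, (one_mul _).symm, by simp⟩
  obtain ⟨c, ⟨g, hgc, hIg⟩, hmin⟩ :=
    (wellFounded_dvdNotUnit (α := A)).has_min S hS
  have hg0 : g ≠ 0 := by rintro rfl; exact hx0 (by rw [hgc, zero_mul])
  have hc0 : c ≠ 0 := by rintro rfl; exact hx0 (by rw [hgc, mul_zero])
  refine ⟨g, le_antisymm hIg ?_⟩
  by_contra hne
  let I' : Ideal A := Submodule.comap (LinearMap.mulLeft A g) I
  have hI' : ∀ x, x ∈ I' ↔ g * x ∈ I := fun x => Iff.rfl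
  have hdiv : ∀ x ∈ I, ∃ x' ∈ I', x = g * x' := fun x hx => by
    obtain ⟨x', rfl⟩ := Ideal.mem_span_singleton.mp (hIg hx)
    exact ⟨x', hx, rfl⟩
  have htop : I' ≠ ⊤ := fun ht => hne ((Ideal.span_singleton_le_iff_mem _).mpr (by
    have : (1 : A) ∈ I' := by rw [ht]; trivial
    simpa using (hI' 1).mp this))
  obtain ⟨P, hP, hIP⟩ := Ideal.exists_le_maximal I' htop
  obtain ⟨y, hy, s, hs, hsy⟩ := h P hP.isPrime
  obtain ⟨y', hy', rfl⟩ := hdiv y hy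
  have hs0 : s ≠ 0 := by rintro rfl; exact hs P.zero_mem
  have hy0 : y' ≠ 0 := by
    rintro rfl
    obtain ⟨n, c', hc'⟩ := hsy x₀ hx₀
    rw [mul_zero, zero_mul] at hc'
    exact (mul_ne_zero (pow_ne_zero n hs0) hx0) hc'
  obtain ⟨p, hp, hpy, hpP⟩ : ∃ p, Prime p ∧ p ∣ y' ∧ p ∈ P := by
    by_contra! H
    have : ∀ z : A, z ≠ 0 → z ∣ y' → z ∉ P := by
      intro z hz
      induction z using UniqueFactorizationMonoid.induction_on_prime with
      | h₁ => exact absurd rfl hz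
      | h₂ z hu => exact fun _ hzP => hP.ne_top (Ideal.eq_top_of_isUnit_mem _ hzP hu)
      | h₃ z q hz0 hq ih =>
        intro hd hm
        rcases hP.isPrime.mem_or_mem hm with h1 | h1
        · exact H q hq (dvd_of_mul_right_dvd hd) h1
        · exact ih hz0 (dvd_of_mul_left_dvd hd) h1
    exact this y' hy0 dvd_rfl (hIP hy')
  have hps : ¬ p ∣ s := fun hd => hs (P.mem_of_dvd hd hpP)
  have key : ∀ x' ∈ I', p ∣ x' := by
    intro x' hx'
    obtain ⟨n, c', hc'⟩ := hsy (g * x') hx'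
    have h1 : s ^ n * x' = y' * c' := mul_left_cancel₀ hg0 (by linear_combination hc')
    have h2 : p ∣ s ^ n * x' := h1 ▸ hpy.mul_right c'
    exact (hp.dvd_or_dvd h2).resolve_left fun h3 => hps (hp.dvd_of_dvd_pow h3)
  obtain ⟨c', rfl⟩ := key c ((hI' c).mpr (hgc ▸ hx₀))
  refine hmin c' ⟨g * p, by rw [hgc]; ring, fun x hx => ?_⟩
    ⟨right_ne_zero_of_mul hc0, p, hp.not_isUnit, mul_comm _ _⟩
  obtain ⟨x', hx', rfl⟩ := hdiv x hx
  obtain ⟨x'', rfl⟩ := key x' hx'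
  exact Ideal.mem_span_singleton.mpr ⟨x'', by ring⟩

/-- The inverse image of a closed subscheme of an affine scheme is given by the extended ideal. -/
theorem comap_ideal_top {X Y : Scheme.{u}} [IsAffine X] [IsAffine Y] (f : X ⟶ Y)
    (I : Y.IdealSheafData) :
    (I.comap f).ideal ⟨⊤, isAffineOpen_top _⟩ =
      (I.ideal ⟨⊤, isAffineOpen_top _⟩).map f.appTop.hom := by
  have hmap : ∀ K : X.IdealSheafData, (K.map f).ideal ⟨⊤, isAffineOpen_top _⟩ =
      (K.ideal ⟨⊤, isAffineOpen_top _⟩).comap f.appTop.hom := fun K =>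
    Scheme.IdealSheafData.ideal_map_of_isAffineHom _ _ _
  refine le_antisymm ?_ ?_
  · let K : X.IdealSheafData := .ofIdealTop ((I.ideal ⟨⊤, isAffineOpen_top _⟩).map f.appTop.hom)
    have hK : K.ideal ⟨⊤, isAffineOpen_top _⟩ = (I.ideal ⟨⊤, isAffineOpen_top _⟩).map f.appTop.hom :=
      (Scheme.IdealSheafData.equivOfIsAffine (X := X)).apply_symm_apply _
    rw [← hK]
    refine (Scheme.IdealSheafData.le_map_iff_comap_le.mp ?_) _
    refine Scheme.IdealSheafData.le_of_isAffine ?_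
    rw [hmap, hK]
    exact Ideal.le_comap_map
  · rw [Ideal.map_le_iff_le_comap, ← hmap]
    exact Scheme.IdealSheafData.le_map_comap (J := I) (f := f) _

/-- An ideal which becomes principal after inverting `s` has an element dividing a multiple of each
of its elements by a power of `s`. -/
theorem exists_mem_of_map_away {A S : Type*} [CommRing A] [CommRing S] [Algebra A S] (s : A)
    [IsLocalization.Away s S] {J : Ideal A} {f : S} (h : J.map (algebraMap A S) = Ideal.span {f}) :
    ∃ y ∈ J, ∀ x ∈ J, ∃ (n : ℕ) (c : A), s ^ n * x = y * c := by
  have hf : f ∈ J.map (algebraMap A S) := h ▸ Ideal.mem_span_singleton_self f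
  obtain ⟨⟨⟨y, hy⟩, ⟨_, n, rfl⟩⟩, hfy⟩ := (IsLocalization.mem_map_algebraMap_iff (.powers s) S).mp hf
  refine ⟨y, hy, fun x hx => ?_⟩
  have hx' : algebraMap A S x ∈ Ideal.span {f} := h ▸ Ideal.mem_map_of_mem _ hx
  obtain ⟨z, hz⟩ := Ideal.mem_span_singleton.mp hx'
  obtain ⟨⟨c, ⟨_, m, rfl⟩⟩, hc⟩ := IsLocalization.surj (.powers s) z
  have h1 : algebraMap A S (s ^ (n + m) * x) = algebraMap A S (y * c) := by
    simp only [map_mul, pow_add, hz] at hfy hc ⊢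
    rw [← hfy, ← hc]
    ring
  obtain ⟨⟨_, l, rfl⟩, hl⟩ := (IsLocalization.eq_iff_exists (.powers s) S).mp h1
  refine ⟨l + (n + m), s ^ l * c, ?_⟩
  simp only at hl
  rw [pow_add]
  linear_combination hl

theorem exists_mem_basicOpen_imp {T : Scheme.{u}} [IsAffine T] {P : Ideal Γ(T, ⊤)} (hP : P.IsPrime) :
    ∃ t : T, ∀ r, t ∈ T.basicOpen r → r ∉ P := by
  refine ⟨(isAffineOpen_top T).fromSpec ⟨P, hP⟩, fun r hr => ?_⟩
  have h := (isAffineOpen_top T).fromSpec_preimage_basicOpen r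
  have h1 : (⟨P, hP⟩ : PrimeSpectrum Γ(T, ⊤)) ∈ PrimeSpectrum.basicOpen r := by
    rw [← h]
    exact hr
  exact h1

/-- The inverse image of an effective Cartier divisor in an affine scheme with a factorial ring of
functions has one equation. -/
theorem IsEffectiveCartier.exists_generator {k : Type u} [Field k] {T X : Sch k} [IsAffine T.left]
    [IsDomain Γ(T.left, ⊤)] [UniqueFactorizationMonoid Γ(T.left, ⊤)] {I : X.left.IdealSheafData}
    (hI : IsEffectiveCartier I) (g : T ⟶ X) :
    ∃ F : Γ(T.left, ⊤), (I.comap g.left).ideal ⟨⊤, isAffineOpen_top _⟩ = Ideal.span {F} := by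
  refine exists_eq_span_of_local _ fun P hP => ?_
  obtain ⟨t, ht⟩ := exists_mem_basicOpen_imp hP
  obtain ⟨U, hU, hgU, -, f, hf, hIf⟩ := hI.exists_local (g.left t) ⊤ trivial
  obtain ⟨s, hsU, hts⟩ := (isAffineOpen_top T.left).exists_basicOpen_le (V := g.left ⁻¹ᵁ U) ⟨t, hgU⟩ trivial
  have hA : IsAffine (opn T (T.left.basicOpen s)).left := (isAffineOpen_top T.left).basicOpen s
  have h1 := comap_ideal_top (opnMap g U (T.left.basicOpen s) hsU).left (I.comap (opnι X U).left)
  have h2 := comap_ideal_top (opnι T (T.left.basicOpen s)).left (I.comap g.left)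
  rw [hIf, Ideal.map_span, Set.image_singleton, ← Scheme.IdealSheafData.comap_comp, ← Over.comp_left,
    opnMap_ι, Over.comp_left, Scheme.IdealSheafData.comap_comp, h2] at h1
  have hloc := (isAffineOpen_top T.left).isLocalization_of_eq_basicOpen s
    (V := (T.left.basicOpen s).ι ''ᵁ ⊤) (homOfLE le_top) (by simp)
  let V := (T.left.basicOpen s).ι ''ᵁ ⊤
  let : Algebra Γ(T.left, ⊤) Γ(T.left, V) := (T.left.presheaf.map (homOfLE le_top).op).hom.toAlgebra
  obtain ⟨y, hy, H⟩ := @exists_mem_of_map_away _ Γ(T.left, V) _ _ _ s hloc _ _ h1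
  exact ⟨y, hy, s, ht s hts, H⟩

end Principal

/-! ### Ternary quadratic forms -/

section TernaryForms
variable {R : Type*} [CommRing R]

/-- The value at `x` of the ternary quadratic form with coefficients `q`; the last three entries are
the coefficients of `x₁x₂`, `x₀x₂` and `x₀x₁`. -/
def tf (q : Fin 6 → R) (x : Fin 3 → R) : R :=
  q 0 * x 0 ^ 2 + q 1 * x 1 ^ 2 + q 2 * x 2 ^ 2 + q 3 * (x 1 * x 2) + q 4 * (x 0 * x 2) +
    q 5 * (x 0 * x 1)

/-- The gradient of `tf q` at `y`, that is, the linear form `tb q y` as a vector. -/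
def tgrad (q : Fin 6 → R) (y : Fin 3 → R) : Fin 3 → R :=
  ![2 * q 0 * y 0 + q 4 * y 2 + q 5 * y 1, 2 * q 1 * y 1 + q 3 * y 2 + q 5 * y 0,
    2 * q 2 * y 2 + q 3 * y 1 + q 4 * y 0]

/-- The polar form of `tf q`. -/
def tb (q : Fin 6 → R) (x y : Fin 3 → R) : R :=
  x 0 * tgrad q y 0 + x 1 * tgrad q y 1 + x 2 * tgrad q y 2

/-- The ternary quadratic form with coefficients `q`, as a polynomial. -/
def tpoly {k : Type u} [Field k] (q : Fin 6 → k) : MvPolynomial (Fin 3) k :=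
  tf (fun i => MvPolynomial.C (q i)) X

theorem eval₂_tpoly {k : Type u} [Field k] (f : k →+* R) (v : Fin 3 → R) (q : Fin 6 → k) :
    eval₂ f v (tpoly q) = tf (fun i => f (q i)) v := by
  simp [tpoly, tf]

theorem tf_map {S : Type*} [CommRing S] (f : R →+* S) (q : Fin 6 → R) (x : Fin 3 → R) :
    f (tf q x) = tf (fun i => f (q i)) (fun i => f (x i)) := by
  simp [tf]

theorem tb_eq (q : Fin 6 → R) (x y : Fin 3 → R) :
    tb q x y = 2 * q 0 * (x 0 * y 0) + 2 * q 1 * (x 1 * y 1) + 2 * q 2 * (x 2 * y 2) +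
      q 3 * (x 1 * y 2 + x 2 * y 1) + q 4 * (x 0 * y 2 + x 2 * y 0) +
      q 5 * (x 0 * y 1 + x 1 * y 0) := by
  simp only [tb, tgrad, Matrix.cons_val]
  ring

theorem tf_comb (q : Fin 6 → R) (x y z : Fin 3 → R) (r s t : R) :
    tf q (fun i => r * x i + s * y i + t * z i) = tf q x * r ^ 2 + tf q y * s ^ 2 + tf q z * t ^ 2 +
      tb q x y * (r * s) + tb q x z * (r * t) + tb q y z * (s * t) := by
  simp only [tf, tb_eq]
  ring

theorem tb_self (q : Fin 6 → R) (x : Fin 3 → R) : tb q x x = 2 * tf q x := by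
  simp only [tf, tb_eq]
  ring

theorem tb_comm (q : Fin 6 → R) (x y : Fin 3 → R) : tb q x y = tb q y x := by
  simp only [tb_eq]
  ring

theorem qf_eq_tpoly {k : Type u} [Field k] (e a b : k) : qf e a b = tpoly ![1, -a, -b, 0, 0, e] := by
  simp [qf, tpoly, tf]
  ring

theorem exists_eq_tpoly {k : Type u} [Field k] {F : MvPolynomial (Fin 3) k} (hF : F.IsHomogeneous 2) :
    ∃ q, F = tpoly q := by
  have h : F ∈ homogeneousSubmodule (Fin 3) k 1 ^ 2 := by
    rw [homogeneousSubmodule_one_pow]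
    exact hF
  clear hF
  rw [homogeneousSubmodule_one_eq_span_X, sq, Submodule.span_mul_span] at h
  induction h using Submodule.span_induction with
  | mem x hx =>
    obtain ⟨_, ⟨i, rfl⟩, _, ⟨j, rfl⟩, rfl⟩ := hx
    fin_cases i <;> fin_cases j
    · exact ⟨![1, 0, 0, 0, 0, 0], by simp [tpoly, tf, sq]⟩
    · exact ⟨![0, 0, 0, 0, 0, 1], by simp [tpoly, tf]⟩
    · exact ⟨![0, 0, 0, 0, 1, 0], by simp [tpoly, tf]⟩
    · exact ⟨![0, 0, 0, 0, 0, 1], by simp [tpoly, tf, mul_comm (X 1 : MvPolynomial (Fin 3) k)]⟩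
    · exact ⟨![0, 1, 0, 0, 0, 0], by simp [tpoly, tf, sq]⟩
    · exact ⟨![0, 0, 0, 1, 0, 0], by simp [tpoly, tf]⟩
    · exact ⟨![0, 0, 0, 0, 1, 0], by simp [tpoly, tf, mul_comm]⟩
    · exact ⟨![0, 0, 0, 1, 0, 0], by simp [tpoly, tf, mul_comm]⟩
    · exact ⟨![0, 0, 1, 0, 0, 0], by simp [tpoly, tf, sq]⟩
  | zero => exact ⟨0, by simp [tpoly, tf]⟩
  | add x y _ _ hx hy =>
    obtain ⟨q, rfl⟩ := hx
    obtain ⟨q', rfl⟩ := hy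
    exact ⟨q + q', by simp [tpoly, tf]; ring⟩
  | smul r x _ hx =>
    obtain ⟨q, rfl⟩ := hx
    exact ⟨r • q, by simp [tpoly, tf, MvPolynomial.smul_eq_C_mul]; ring⟩

/-- The form `tf q` has no singular zero with coordinates in `K`. -/
def NonSing {K : Type*} [Field K] (q : Fin 6 → K) : Prop :=
  ∀ n : Fin 3 → K, n ≠ 0 → (∀ w, tb q n w = 0) → tf q n ≠ 0

theorem tb_comb {q : Fin 6 → R} {x y z n : Fin 3 → R} (hx : tb q n x = 0) (hy : tb q n y = 0)
    (hz : tb q n z = 0) (r s t : R) : tb q n (fun i => r * x i + s * y i + t * z i) = 0 := by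
  rw [tb_eq] at hx hy hz ⊢
  linear_combination r * hx + s * hy + t * hz

variable {k : Type u} [Field k]

/-- Vectors that form a basis: the coordinates of the standard basis. -/
theorem exists_basis_inv {P : Matrix (Fin 3) (Fin 3) k} (h : P.det ≠ 0) :
    ∃ M : Matrix (Fin 3) (Fin 3) k, P * M = 1 ∧ M * P = 1 :=
  ⟨P⁻¹, Matrix.mul_nonsing_inv _ (isUnit_iff_ne_zero.mpr h), Matrix.nonsing_inv_mul _ (isUnit_iff_ne_zero.mpr h)⟩

/-- Two vectors spanning a plane on which the form is regular determine a normal form: the third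
basis vector is the cross product of the gradients, which is orthogonal to the plane. -/
theorem HasForm.exists_qf_of_plane {Y : Sch k} {i : Y ⟶ projSpace k 2} {q : Fin 6 → k}
    (hi : HasForm i (tpoly q)) (hq : NonSing q) {c d : Fin 3 → k} {l e a : k} (hl : l ≠ 0)
    (hd : tf q d = l) (hcd : tb q c d = l * e) (hc : tf q c = -(l * a)) (hD : e ^ 2 + 4 * a ≠ 0) :
    ∃ (b : k) (i' : Y ⟶ projSpace k 2), b ≠ 0 ∧ HasForm i' (qf e a b) := by
  let n : Fin 3 → k := crossProduct (tgrad q c) (tgrad q d)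
  have hnc : tb q n c = 0 := by
    simp only [tb, n, cross_apply, Matrix.cons_val]
    ring
  have hnd : tb q n d = 0 := by
    simp only [tb, n, cross_apply, Matrix.cons_val]
    ring
  let P : Matrix (Fin 3) (Fin 3) k := Matrix.of fun r => ![d r, c r, n r]
  have hdet : P.det = l ^ 2 * (e ^ 2 + 4 * a) := by
    have h1 : P.det = tb q c d ^ 2 - 4 * tf q c * tf q d := by
      rw [Matrix.det_fin_three]
      simp only [P, n, cross_apply, Matrix.of_apply, Matrix.cons_val, tb_eq, tf, tgrad]
      ring
    rw [h1, hcd, hc, hd]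
    ring
  obtain ⟨M, hPM, hMP⟩ := exists_basis_inv (P := P) (by rw [hdet]; exact mul_ne_zero (pow_ne_zero _ hl) hD)
  have hn0 : n ≠ 0 := by
    intro h0
    have : P.det = 0 := by
      rw [Matrix.det_fin_three]
      simp [P, h0]
    rw [hdet] at this
    exact mul_ne_zero (pow_ne_zero _ hl) hD this
  have hexp : ∀ w : Fin 3 → k, ∃ u : Fin 3 → k, w = fun j => u 0 * d j + u 1 * c j + u 2 * n j := by
    refine fun w => ⟨M.mulVec w, ?_⟩
    have h1 : P.mulVec (M.mulVec w) = w := by rw [Matrix.mulVec_mulVec, hPM, Matrix.one_mulVec]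
    conv_lhs => rw [← h1]
    ext j
    simp only [Matrix.mulVec, dotProduct, Fin.sum_univ_three, P, Matrix.of_apply, Matrix.cons_val]
    ring
  have hqn : tf q n ≠ 0 := fun h0 => by
    refine hq n hn0 (fun w => ?_) h0
    obtain ⟨u, rfl⟩ := hexp w
    exact tb_comb hnd hnc (by rw [tb_self, h0, mul_zero]) _ _ _
  obtain ⟨i', hi', -⟩ := hi.linear (M := M) (N := P) (l := l⁻¹) (q' := qf e a (-tf q n / l)) hPM
    (inv_ne_zero hl) fun W v => by
      set f := strHom W
      rw [coordHom_qf]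
      change _ = _ * eval₂ f v (tpoly q)
      rw [eval₂_tpoly]
      set u := actVec W M v with hu
      have hv : v = fun j => u 0 * f (d j) + u 1 * f (c j) + u 2 * f (n j) := by
        have h1 : actVec W P u = v := by rw [hu, ← actVec_mul, hPM, actVec_one]
        conv_lhs => rw [← h1]
        ext j
        change ∑ x : Fin 3, f (P j x) * u x = _
        simp only [Fin.sum_univ_three, P, Matrix.of_apply, Matrix.cons_val]
        ring
      have hT : ∀ x y : Fin 3 → k, tb (fun i => f (q i)) (fun i => f (x i)) (fun i => f (y i)) =
          f (tb q x y) := fun x y => by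
        simp only [tb_eq, map_add, map_mul, map_ofNat]
      have hfl : f l⁻¹ * f l = 1 := by rw [← map_mul, inv_mul_cancel₀ hl, map_one]
      have h2 : tf (fun i => f (q i)) v = tf (fun i => f (q i)) (fun j => u 0 * f (d j) +
        u 1 * f (c j) + u 2 * f (n j)) := by rw [← hv]
      rw [h2, tf_comb, hT, hT, hT, ← tf_map, ← tf_map, ← tf_map, tb_comm q d c, tb_comm q d n,
        tb_comm q c n, hnc, hnd, hcd, hc, hd, qv, div_eq_mul_inv]
      simp only [map_neg, map_mul, map_zero]
      linear_combination (-(u 0) ^ 2 - f e * (u 0 * u 1) + f a * u 1 ^ 2) * hfl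
  exact ⟨_, i', div_ne_zero (neg_ne_zero.mpr hqn) hl, hi'⟩

theorem exists_tb_ne_zero {q : Fin 6 → k} (hq : NonSing q) {v : Fin 3 → k} (hv : v ≠ 0)
    (h0 : tf q v = 0) : ∃ w, tb q v w = 1 := by
  by_contra! H
  refine hq v hv (fun w => ?_) h0
  by_contra hw
  refine H ((tb q v w)⁻¹ • w) ?_
  rw [← inv_mul_cancel₀ hw]
  simp only [tb_eq, Pi.smul_apply, smul_eq_mul]
  ring

/-- A conic with a rational point has normal forms with arbitrary `e` and `a`: its equation is
`XY = μZ²` in suitable coordinates. -/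
theorem HasForm.exists_qf_of_isotropic {Y : Sch k} {i : Y ⟶ projSpace k 2} {q : Fin 6 → k}
    (hi : HasForm i (tpoly q)) (hq : NonSing q) {v : Fin 3 → k} (hv : v ≠ 0) (h0 : tf q v = 0)
    {e a : k} (hD : e ^ 2 + 4 * a ≠ 0) :
    ∃ (b : k) (i' : Y ⟶ projSpace k 2), b ≠ 0 ∧ HasForm i' (qf e a b) := by
  obtain ⟨w', hw'⟩ := exists_tb_ne_zero hq hv h0
  let w : Fin 3 → k := fun j => w' j - tf q w' * v j
  have hvw : tb q v w = 1 := by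
    rw [tf] at h0
    rw [tb_eq] at hw' ⊢
    simp only [w]
    linear_combination hw' - 2 * tf q w' * h0
  have hw : tf q w = 0 := by
    have := tf_comb q w' v 0 1 (-tf q w') 0
    rw [h0, tb_comm, hw'] at this
    have h1 : w = fun j => 1 * w' j + (-tf q w') * v j + 0 * (0 : Fin 3 → k) j := by
      ext j
      simp only [w]
      ring
    rw [h1, this]
    ring
  let n : Fin 3 → k := crossProduct (tgrad q v) (tgrad q w)
  have hnv : tb q v n = 0 := by
    rw [tb_comm]
    simp only [tb, n, cross_apply, Matrix.cons_val]
    ring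
  have hnw : tb q w n = 0 := by
    rw [tb_comm]
    simp only [tb, n, cross_apply, Matrix.cons_val]
    ring
  have hn : tf q n ≠ 0 := by
    let P : Matrix (Fin 3) (Fin 3) k := Matrix.of fun r => ![w r, v r, n r]
    have hdet : P.det = 1 := by
      have h1 : P.det = tb q v w ^ 2 - 4 * tf q v * tf q w := by
        rw [Matrix.det_fin_three]
        simp only [P, n, cross_apply, Matrix.of_apply, Matrix.cons_val, tb_eq, tf, tgrad]
        ring
      rw [h1, hvw, h0, hw]
      ring
    obtain ⟨M, hPM, -⟩ := exists_basis_inv (P := P) (by rw [hdet]; exact one_ne_zero)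
    intro hn0
    refine hq n (fun hz => ?_) (fun x => ?_) hn0
    · rw [Matrix.det_fin_three] at hdet
      simp [P, hz] at hdet
    · have h1 : x = fun j => M.mulVec x 0 * w j + M.mulVec x 1 * v j + M.mulVec x 2 * n j := by
        have h1 : P.mulVec (M.mulVec x) = x := by rw [Matrix.mulVec_mulVec, hPM, Matrix.one_mulVec]
        conv_lhs => rw [← h1]
        ext j
        change ∑ y : Fin 3, P j y * M.mulVec x y = _
        simp only [Fin.sum_univ_three, P, Matrix.of_apply, Matrix.cons_val]
        ring
      rw [h1]
      exact tb_comb (by rw [tb_comm, hnw]) (by rw [tb_comm, hnv]) (by rw [tb_self, hn0, mul_zero]) _ _ _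
  set l := tf q n with hl
  -- in the basis `v, w, n` the form is `XY + l Z²`
  have hF := fun x y z => tf_comb q v w n x y z
  simp only [h0, hw, hvw, hnv, hnw, ← hl] at hF
  refine hi.exists_qf_of_plane hq (c := fun j => -(l * a) * v j + 1 * w j + 0 * n j)
    (d := fun j => (l * e) * v j + 0 * w j + 1 * n j) hn ?_ ?_ ?_ hD
  · rw [hF]
    ring
  · have h2 := hF (-(l * a) + l * e) 1 1
    have h3 := hF (-(l * a)) 1 0
    have h4 := hF (l * e) 0 1
    have : ∀ x y : Fin 3 → k, tb q x y = tf q (fun j => x j + y j) - tf q x - tf q y := fun x y => by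
      simp only [tb_eq, tf]
      ring
    rw [this, h3, h4]
    have h5 : (fun j => (-(l * a) * v j + 1 * w j + 0 * n j) + (l * e * v j + 0 * w j + 1 * n j)) =
        fun j => (-(l * a) + l * e) * v j + 1 * w j + 1 * n j := by
      ext j
      ring
    rw [h5, h2]
    ring
  · rw [hF]
    ring

theorem nonSing_qf {e a b : k} (hD : e ^ 2 + 4 * a ≠ 0) (hb : b ≠ 0) :
    NonSing ![1, -a, -b, 0, 0, e] := by
  intro n hn h h0
  have h1 := h ![1, 0, 0]
  have h2 := h ![0, 1, 0]
  simp only [tb_eq, Matrix.cons_val] at h1 h2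
  have hx : n 1 = 0 := (mul_eq_zero.mp (show (e ^ 2 + 4 * a) * n 1 = 0 by
    linear_combination e * h1 - 2 * h2)).resolve_left hD
  have hx0 : n 0 = 0 := (mul_eq_zero.mp (show (e ^ 2 + 4 * a) * n 0 = 0 by
    linear_combination 2 * a * h1 + e * h2)).resolve_left hD
  simp only [tf, Matrix.cons_val, hx, hx0] at h0
  have hx2 : n 2 = 0 := by
    have : b * n 2 ^ 2 = 0 := by linear_combination -h0
    exact pow_eq_zero_iff two_ne_zero |>.mp ((mul_eq_zero.mp this).resolve_left hb)
  exact hn (by ext j; fin_cases j <;> assumption)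

/-- A conic with a point over `k(ρ)`, where `ρ² = eρ + a`, has a normal form with these `e` and
`a`. -/
theorem HasForm.exists_qf_of_point {Y : Sch k} {i : Y ⟶ projSpace k 2} {e' a' b' : k}
    (hi : HasForm i (qf e' a' b')) (hD' : e' ^ 2 + 4 * a' ≠ 0) (hb' : b' ≠ 0) {e a : k}
    (hD : e ^ 2 + 4 * a ≠ 0) {K : Type*} [Field K] [Algebra k K] {ρ : K}
    (hρ : ρ ^ 2 = algebraMap k K e * ρ + algebraMap k K a) {z : Fin 3 → K} (hz : z ≠ 0)
    (hzc : ∀ j, ∃ c d : k, z j = algebraMap k K c + algebraMap k K d * ρ)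
    (h0 : qv (algebraMap k K e') (algebraMap k K a') (algebraMap k K b') z = 0) :
    ∃ (b : k) (i' : Y ⟶ projSpace k 2), b ≠ 0 ∧ HasForm i' (qf e a b) := by
  have hq := nonSing_qf hD' hb'
  rw [qf_eq_tpoly] at hi
  set q : Fin 6 → k := ![1, -a', -b', 0, 0, e'] with hqdef
  have hφ := FaithfulSMul.algebraMap_injective k K
  set φ := algebraMap k K
  have hqz : ∀ x : Fin 3 → K, tf (fun i => φ (q i)) x = qv (φ e') (φ a') (φ b') x := fun x => by
    simp only [tf, qv, q, Matrix.cons_val, map_neg, map_one, map_zero]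
    ring
  choose c d hcd using hzc
  by_cases hk : ∃ r : k, φ r = ρ
  · obtain ⟨r, rfl⟩ := hk
    refine hi.exists_qf_of_isotropic hq (v := fun j => c j + d j * r) (fun h => hz ?_) ?_ hD
    · ext j
      rw [hcd, ← map_mul, ← map_add, show c j + d j * r = 0 from congrFun h j, map_zero]
      rfl
    · apply hφ
      rw [tf_map, map_zero, hqz]
      rw [← h0]
      congr 1
      ext j
      rw [hcd, map_add, map_mul]
  · have hind : ∀ x y : k, φ x + φ y * ρ = 0 → x = 0 ∧ y = 0 := fun x y h => by
      have hy : y = 0 := by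
        by_contra hy
        refine hk ⟨-x / y, ?_⟩
        have : φ y ≠ 0 := fun h => hy (hφ (by rw [h, map_zero]))
        rw [map_div₀, map_neg, div_eq_iff this]
        linear_combination -h
      subst hy
      exact ⟨hφ (by simpa using h), rfl⟩
    have hkey : φ (tf q c + a * tf q d) + φ (tb q c d + e * tf q d) * ρ = 0 := by
      rw [← h0, ← hqz, funext hcd]
      simp only [tf, tb_eq, map_add, map_mul, map_pow, map_ofNat]
      linear_combination (-(φ (q 0) * φ (d 0) ^ 2 + φ (q 1) * φ (d 1) ^ 2 + φ (q 2) * φ (d 2) ^ 2 +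
        φ (q 3) * (φ (d 1) * φ (d 2)) + φ (q 4) * (φ (d 0) * φ (d 2)) +
        φ (q 5) * (φ (d 0) * φ (d 1)))) * hρ
    obtain ⟨h1, h2⟩ := hind _ _ hkey
    by_cases hd : tf q d = 0
    · rw [hd, mul_zero, add_zero] at h1
      by_cases hc0 : c = 0
      · refine hi.exists_qf_of_isotropic hq (v := d) (fun h => hz ?_) hd hD
        ext j
        rw [hcd, hc0, h]
        simp
      · exact hi.exists_qf_of_isotropic hq hc0 h1 hD
    · refine hi.exists_qf_of_plane hq (c := -c) (d := d) hd rfl ?_ ?_ hD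
      · rw [tb_eq] at h2 ⊢
        simp only [Pi.neg_apply]
        linear_combination -h2
      · have : tf q (-c) = tf q c := by simp only [tf, Pi.neg_apply]; ring
        rw [this]
        linear_combination h1

theorem tb_eq_zero_iff {q : Fin 6 → k} {n : Fin 3 → k} : (∀ w, tb q n w = 0) ↔ tgrad q n = 0 := by
  refine ⟨fun h => ?_, fun h w => by rw [tb_comm, tb, h]; simp⟩
  ext j
  have := h (Pi.single j 1)
  rw [tb_comm, tb] at this
  fin_cases j <;> simpa using this

/-- Away from characteristic two the form is not identically zero on the orthogonal complement of an
anisotropic vector `d`; add `d / 2` to a vector there. -/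
theorem exists_plane_of_two_ne_zero {q : Fin 6 → k} (hq : NonSing q) (h2 : (2 : k) ≠ 0) :
    ∃ c d, tf q d ≠ 0 ∧ tb q c d = tf q d ∧ tf q d ^ 2 - 4 * tf q c * tf q d ≠ 0 := by
  have hB : ∀ x y : Fin 3 → k, tb q x y = tf q (x + y) - tf q x - tf q y := fun x y => by
    simp only [tb_eq, tf, Pi.add_apply]
    ring
  obtain ⟨d, hd⟩ : ∃ d, tf q d ≠ 0 := by
    by_contra! H
    exact hq ![1, 0, 0] (fun h => one_ne_zero (congrFun h 0)) (fun w => by simp only [hB, H, sub_zero])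
      (H _)
  obtain ⟨m, hm0, hm⟩ : ∃ m : Fin 3 → k, m ≠ 0 ∧ tb q m d = 0 := by
    by_cases h : tgrad q d 0 = 0
    · exact ⟨![1, 0, 0], fun h => one_ne_zero (congrFun h 0), by simp [tb, h]⟩
    · exact ⟨![-tgrad q d 1, tgrad q d 0, 0], fun h' => h (congrFun h' 1), by
        simp only [tb, Matrix.cons_val]
        ring⟩
  obtain ⟨c, hcd, hc⟩ : ∃ c, tb q c d = 0 ∧ tf q c ≠ 0 := by
    by_contra! H
    refine hq m hm0 (fun w => ?_) (H m hm)
    have hdd : tb q d d ≠ 0 := by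
      rw [tb_self]
      exact mul_ne_zero h2 hd
    let w' := w - (tb q w d / tb q d d) • d
    have hlin : ∀ (x y z : Fin 3 → k) (t : k), tb q x (y - t • z) = tb q x y - t * tb q x z :=
      fun x y z t => by
        simp only [tb_eq, Pi.sub_apply, Pi.smul_apply, smul_eq_mul]
        ring
    have hw' : tb q w' d = 0 := by
      rw [tb_comm, hlin, tb_comm q d w, div_mul_cancel₀ _ hdd, sub_self]
    have h1 : tb q m w' = 0 := by
      rw [hB, H m hm, H w' hw', H]
      · simp
      · have := hlin d m w' (-1)
        rw [tb_comm, show m + w' = m - (-1 : k) • w' by simp, this, tb_comm q d m, hm, tb_comm, hw']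
        simp
    rw [hlin, hm, mul_zero, sub_zero] at h1
    exact h1
  refine ⟨c + (2⁻¹ : k) • d, d, hd, ?_, ?_⟩
  · have h1 : tb q (c + (2⁻¹ : k) • d) d = tb q c d + 2⁻¹ * tb q d d := by
      simp only [tb_eq, Pi.add_apply, Pi.smul_apply, smul_eq_mul]
      ring
    rw [h1, hcd, tb_self]
    field_simp
    ring
  · have h1 : tf q (c + (2⁻¹ : k) • d) = tf q c + 2⁻¹ * tb q c d + 2⁻¹ * 2⁻¹ * tf q d := by
      simp only [tb_eq, tf, Pi.add_apply, Pi.smul_apply, smul_eq_mul]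
      ring
    rw [h1, hcd]
    have h3 : tf q d ^ 2 - 4 * (tf q c + 2⁻¹ * 0 + 2⁻¹ * 2⁻¹ * tf q d) * tf q d =
        -(2 * 2 * (tf q c * tf q d)) := by
      field_simp
      ring
    rw [h3]
    exact neg_ne_zero.mpr (mul_ne_zero (mul_ne_zero h2 h2) (mul_ne_zero hc hd))

/-- In characteristic two, rescale one of two vectors with nonzero product. -/
theorem exists_plane_of_two_eq_zero {q : Fin 6 → k} {x y : Fin 3 → k} (h : tb q x y ≠ 0)
    (h2 : (2 : k) = 0) :
    ∃ c d, tf q d ≠ 0 ∧ tb q c d = tf q d ∧ tf q d ^ 2 - 4 * tf q c * tf q d ≠ 0 := by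
  obtain ⟨c, d, hd, hcd⟩ : ∃ c d, tf q d ≠ 0 ∧ tb q c d ≠ 0 := by
    by_cases hy : tf q y = 0
    · by_cases hx : tf q x = 0
      · refine ⟨x, x + y, ?_, ?_⟩
        · have : tf q (x + y) = tf q x + tf q y + tb q x y := by
            simp only [tb_eq, tf, Pi.add_apply]
            ring
          rw [this, hx, hy]
          simpa using h
        · have : tb q x (x + y) = 2 * tf q x + tb q x y := by
            simp only [tb_eq, tf, Pi.add_apply]
            ring
          rw [this, hx]
          simpa using h
      · exact ⟨y, x, hx, by rwa [tb_comm]⟩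
    · exact ⟨x, y, hy, h⟩
  refine ⟨(tf q d / tb q c d) • c, d, hd, ?_, ?_⟩
  · have : tb q ((tf q d / tb q c d) • c) d = tf q d / tb q c d * tb q c d := by
      simp only [tb_eq, Pi.smul_apply, smul_eq_mul]
      ring
    rw [this, div_mul_cancel₀ _ hcd]
  · have h4 : (4 : k) = 0 := by linear_combination 2 * h2
    rw [h4]
    simpa using hd

/-- A conic without geometric singular points has a normal form. In characteristic two the point is
that the polar form is not zero, as otherwise `q` would be the square of a linear form. -/
theorem HasForm.exists_qf {Y : Sch k} {i : Y ⟶ projSpace k 2} {q : Fin 6 → k}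
    (hi : HasForm i (tpoly q)) {Ω : Type*} [Field Ω] [IsAlgClosed Ω] [Algebra k Ω]
    (hq : NonSing fun j => algebraMap k Ω (q j)) :
    ∃ (a b : k) (i' : Y ⟶ projSpace k 2), (1 : k) ^ 2 + 4 * a ≠ 0 ∧ b ≠ 0 ∧ HasForm i' (qf 1 a b) := by
  have hφ := FaithfulSMul.algebraMap_injective k Ω
  have hq' : NonSing q := fun n hn h h0 => by
    refine hq (fun j => algebraMap k Ω (n j)) (fun h => hn ?_) ?_ ?_
    · ext j
      exact hφ ((congrFun h j).trans (map_zero _).symm)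
    · rw [tb_eq_zero_iff] at h ⊢
      have h1 : ∀ j, tgrad (fun j => algebraMap k Ω (q j)) (fun j => algebraMap k Ω (n j)) j =
          algebraMap k Ω (tgrad q n j) := fun j => by
        fin_cases j <;> simp [tgrad] <;> exact Or.inl (Or.inl (map_ofNat _ 2).symm)
      ext j
      rw [h1, h]
      simp
    · rw [← tf_map, h0, map_zero]
  obtain ⟨c, d, hd, hcd, hD⟩ : ∃ c d, tf q d ≠ 0 ∧ tb q c d = tf q d ∧
      tf q d ^ 2 - 4 * tf q c * tf q d ≠ 0 := by
    by_cases h2 : (2 : k) = 0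
    · by_contra H
      have hB : ∀ x y, tb q x y = 0 := fun x y => by
        by_contra h
        exact H (exists_plane_of_two_eq_zero h h2)
      have h3 : q 3 = 0 := by simpa [tb_eq] using hB ![0, 1, 0] ![0, 0, 1]
      have h4 : q 4 = 0 := by simpa [tb_eq] using hB ![1, 0, 0] ![0, 0, 1]
      have h5 : q 5 = 0 := by simpa [tb_eq] using hB ![1, 0, 0] ![0, 1, 0]
      have h2' : (2 : Ω) = 0 := by
        have := congrArg (algebraMap k Ω) h2
        rwa [map_ofNat, map_zero] at this
      obtain ⟨r, hr⟩ := IsAlgClosed.exists_pow_nat_eq (algebraMap k Ω (q 0)) two_pos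
      obtain ⟨s, hs⟩ := IsAlgClosed.exists_pow_nat_eq (algebraMap k Ω (q 1)) two_pos
      have hsing : ∀ v : Fin 3 → Ω, ∀ w, tb (fun j => algebraMap k Ω (q j)) v w = 0 := fun v w => by
        simp [tb_eq, h2', h3, h4, h5]
      by_cases h0 : r = 0 ∧ s = 0
      · refine hq ![1, 0, 0] (fun h => one_ne_zero (congrFun h 0)) (hsing _) ?_
        simp [tf, ← hr, h0.1]
      · refine hq ![s, r, 0] (fun h => h0 ⟨congrFun h 1, congrFun h 0⟩) (hsing _) ?_
        simp only [tf, Matrix.cons_val, ← hr, ← hs, h5, map_zero]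
        linear_combination r ^ 2 * s ^ 2 * h2'
    · exact exists_plane_of_two_ne_zero hq' h2
  have hD' : (1 : k) ^ 2 + 4 * (-tf q c / tf q d) ≠ 0 := fun h => by
    refine hD ?_
    field_simp at h
    linear_combination tf q d * h
  obtain ⟨b, i', hb, hi'⟩ := hi.exists_qf_of_plane hq' hd rfl (by rw [hcd, mul_one])
    (by field_simp) hD'
  exact ⟨_, b, i', hD', hb, hi'⟩

end TernaryForms

/-! ### Smooth conics -/

section Smooth
variable {k : Type u} [Field k]

/-- Infinitesimal lifting for smooth affine schemes. -/
theorem exists_lift_of_smooth_affine {R : Type u} [CommRing R] [Algebra k R]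
    (hR : Smooth (specK k R).hom) {A B : Type u} [CommRing A] [Algebra k A] [CommRing B] [Algebra k B]
    (π : A →ₐ[k] B) (hπ : Function.Surjective π) (hn : IsNilpotent (RingHom.ker (π : A →+* B)))
    (φ : specK k B ⟶ specK k R) : ∃ g : specK k A ⟶ specK k R, specMapK π ≫ g = φ := by
  have h2 : (algebraMap k R).Smooth := by
    have := (HasRingHomProperty.Spec_iff (P := @Smooth)).mp hR
    simpa using this
  have h3 : Algebra.Smooth k R := by
    have h := h2
    rw [RingHom.Smooth] at h
    convert h
    exact Algebra.algebra_ext _ _ fun r => rfl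
  let φ' : R →+* B := (secK k B).symm.toRingHom.comp (φ.left.appTop.hom.comp (secK k R).toRingHom)
  let φ₁ : R →ₐ[k] B := { φ' with
    commutes' := fun a => by
      change (secK k B).symm (φ.left.appTop.hom (secK k R (algebraMap k R a))) = _
      rw [specK_strHom, strHom_specK, RingEquiv.symm_apply_apply] }
  let ψ := Algebra.FormallySmooth.liftOfSurjective φ₁ π hπ hn
  have hψ : π.comp ψ = φ₁ := Algebra.FormallySmooth.comp_liftOfSurjective φ₁ π hπ hn
  refine ⟨specMapK ψ, specK_hom_ext fun r => ?_⟩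
  rw [Over.comp_left, Scheme.Hom.comp_appTop, CommRingCat.hom_comp, RingHom.comp_apply,
    specMapK_appTop, specMapK_appTop]
  have := congrArg (secK k B) (AlgHom.congr_fun hψ r)
  exact this.trans (RingEquiv.apply_symm_apply _ _)

/-- Infinitesimal lifting for smooth schemes, over a local base. -/
theorem exists_lift_of_smooth {Y : Sch k} (hY : Smooth Y.hom) {A B : Type u} [CommRing A] [Algebra k A]
    [CommRing B] [Algebra k B] [IsLocalRing B] (π : A →ₐ[k] B) (hπ : Function.Surjective π)
    (hn : IsNilpotent (RingHom.ker (π : A →+* B))) (f : specK k B ⟶ Y) :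
    ∃ g : specK k A ⟶ Y, specMapK π ≫ g = f := by
  obtain ⟨V, hV, hA⟩ := exists_isAffineOpen_mem (f.left (IsLocalRing.closedPoint B : PrimeSpectrum B))
  have hfV : ∀ x, f.left x ∈ V := fun x => by
    have h1 : f.left ⁻¹ᵁ V = ⊤ := (IsLocalRing.closedPoint_mem_iff _).mp hV
    have : x ∈ f.left ⁻¹ᵁ V := by rw [h1]; trivial
    exact this
  obtain ⟨_, ⟨σ⟩⟩ := exists_iso_specK (opn Y V)
  have hσ : IsOpenImmersion (σ.hom ≫ opnι Y V).left := by
    have : IsIso σ.hom.left := inferInstanceAs (IsIso ((Over.forget _).map σ.hom))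
    have : IsOpenImmersion (opnι Y V).left := inferInstance
    rw [Over.comp_left]
    infer_instance
  have h1 : Smooth (specK k Γ((opn Y V).left, ⊤)).hom := by
    rw [← Over.w (σ.hom ≫ opnι Y V)]
    infer_instance
  obtain ⟨g, hg⟩ := exists_lift_of_smooth_affine h1 π hπ hn (opnLift f V hfV ≫ σ.inv)
  refine ⟨g ≫ σ.hom ≫ opnι Y V, ?_⟩
  rw [reassoc_of% hg]
  change (opnLift f V hfV ≫ σ.inv) ≫ σ.hom ≫ opnι Y V = f
  rw [Category.assoc, σ.inv_hom_id_assoc, opnLift_ι]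

theorem tf_expand {R : Type*} [CommRing R] (q : Fin 6 → R) (X : R) (v w u : Fin 3 → R)
    (hv : tf q v = 0) (hg : tgrad q v = 0) :
    tf q (fun j => v j + X * w j + X ^ 2 * u j) =
      X ^ 2 * tf q w + X ^ 3 * (tb q w u + X * tf q u) := by
  have h1 := fun x : Fin 3 → R => show tb q x v = 0 by rw [tb, hg]; simp
  have h2 := tf_comb q v w u 1 X (X ^ 2)
  rw [tb_comm q v w, tb_comm q v u, h1, h1, hv] at h2
  have h3 : (fun j => v j + X * w j + X ^ 2 * u j) = fun j => 1 * v j + X * w j + X ^ 2 * u j := by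
    simp
  rw [h3, h2]
  ring

theorem isLocalRing_quotient_X_pow (Ω : Type*) [Field Ω] :
    IsLocalRing (PowerSeries Ω ⧸ Ideal.span {(PowerSeries.X : PowerSeries Ω) ^ 2}) := by
  have : Nontrivial (PowerSeries Ω ⧸ Ideal.span {(PowerSeries.X : PowerSeries Ω) ^ 2}) := by
    refine Ideal.Quotient.nontrivial_iff.mpr fun h => ?_
    rw [Ideal.span_singleton_eq_top] at h
    have h1 := PowerSeries.X_prime (R := Ω) |>.not_isUnit
    exact h1 ((isUnit_pow_iff two_ne_zero).mp h)
  exact IsLocalRing.of_surjective' (Ideal.Quotient.mk _) Ideal.Quotient.mk_surjective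

theorem Coord.exists_secK {Y : Sch k} {i : Y ⟶ projSpace k 2} {A : Type u} [CommRing A] [Algebra k A]
    {h : specK k A ⟶ Y} {s : Fin 3 → Γ((specK k A).left, ⊤)} (_ : Coord i h s) :
    ∃ v : Fin 3 → A, s = fun j => secK k A (v j) :=
  ⟨fun j => (secK k A).symm (s j), by ext j; exact ((secK k A).apply_symm_apply _).symm⟩

theorem pull_secK {A B : Type u} [CommRing A] [Algebra k A] [CommRing B] [Algebra k B] (π : A →ₐ[k] B)
    {ι : Type*} (v : ι → A) :
    pull (specMapK π) (fun j => secK k A (v j)) = fun j => secK k B (π (v j)) :=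
  funext fun j => specMapK_appTop π (v j)

theorem tf_aeval {A : Type u} [CommRing A] [Algebra k A] (q : Fin 6 → k) (v : Fin 3 → A) :
    aeval v (tpoly q) = tf (fun j => algebraMap k A (q j)) v :=
  eval₂_tpoly _ _ _

theorem Coord.tf_eq_zero {Y : Sch k} {i : Y ⟶ projSpace k 2} {q : Fin 6 → k}
    (hi : HasForm i (tpoly q)) {A : Type u} [CommRing A] [Algebra k A] {h : specK k A ⟶ Y} {v : Fin 3 → A}
    (H : Coord i h fun j => secK k A (v j)) : tf (fun j => algebraMap k A (q j)) v = 0 := by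
  have := H.form_eq_zero hi
  rw [coordHom_specK, tf_aeval] at this
  exact (map_eq_zero_iff _ (secK k A).injective).mp this

theorem exists_coord_secK {Y : Sch k} {i : Y ⟶ projSpace k 2} {q : Fin 6 → k}
    (hi : HasForm i (tpoly q)) {A : Type u} [CommRing A] [Algebra k A] {v : Fin 3 → A} (hv : Unimod v)
    (h0 : tf (fun j => algebraMap k A (q j)) v = 0) :
    ∃ h : specK k A ⟶ Y, Coord i h fun j => secK k A (v j) :=
  exists_coord_of_form hi (unimod_secK hv) (by rw [coordHom_specK, tf_aeval, h0, map_zero])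

/-- Infinitesimal lifting in coordinates: an approximate solution of the equation of a smooth conic is
congruent to an exact one. -/
theorem exists_tf_eq_zero_of_smooth {Y : Sch k} (hY : Smooth Y.hom) {i : Y ⟶ projSpace k 2}
    {q : Fin 6 → k} (hi : HasForm i (tpoly q)) {A B : Type u} [CommRing A] [Algebra k A] [CommRing B]
    [Algebra k B] [IsLocalRing B] (π : A →ₐ[k] B) (hπ : Function.Surjective π)
    (hn : ∀ x y, π x = 0 → π y = 0 → x * y = 0) (p : Fin 3 → A) {j : Fin 3} (hj : IsUnit (p j))
    (hp : π (tf (fun j => algebraMap k A (q j)) p) = 0) :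
    ∃ p' : Fin 3 → A, (∀ a, π (p' a - p a) = 0) ∧ tf (fun j => algebraMap k A (q j)) p' = 0 := by
  have hn' : IsNilpotent (RingHom.ker (π : A →+* B)) := by
    refine ⟨2, ?_⟩
    rw [pow_two]
    exact eq_bot_iff.mpr (Ideal.mul_le.mpr fun x hx y hy => hn x y hx hy)
  obtain ⟨f, hf⟩ := exists_coord_secK hi (A := B) (v := fun j => π (p j))
    (unimod_of_isUnit (j := j) (hj.map _)) (by
      have h := tf_map (π : A →+* B) (fun j => algebraMap k A (q j)) p
      refine Eq.trans ?_ (h.symm.trans hp)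
      congr 1
      ext a
      exact (π.commutes _).symm)
  obtain ⟨g, hg⟩ := exists_lift_of_smooth hY π hπ hn' f
  have hfj : ∀ x, g.left x ∈ (i.left ⁻¹ᵁ (chart k 2 j).1) := fun x => by
    have h1 := range_comap_of_surjective _ (π : A →+* B) hπ
    have h2 : (x : PrimeSpectrum A) ∈ PrimeSpectrum.zeroLocus
        (RingHom.ker (π : A →+* B) : Set A) := fun a ha => by
      have h3 : a ^ 2 ∈ PrimeSpectrum.asIdeal (R := A) x := by
        rw [pow_two, hn a a ha ha]
        exact zero_mem _
      exact (PrimeSpectrum.isPrime (R := A) x).mem_of_pow_mem 2 h3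
    rw [← h1] at h2
    obtain ⟨y, hy⟩ := h2
    have h4 := mem_coordOpen_of_isUnit (i := i) (h := g) (g := specMapK π) (by rw [hg]; exact hf) (j := j)
      ((hj.map _).map (secK k B)) y
    have h5 : (specMapK π).left y = x := hy
    rw [h5] at h4
    exact h4
  obtain ⟨s, hs1, hs⟩ := exists_coord_one i g (𝟙 _) j hfj
  rw [Category.id_comp] at hs
  obtain ⟨V, rfl⟩ := hs.exists_secK
  have hV0 := hs.tf_eq_zero hi
  have hpull := hs.pull (specMapK π)
  rw [hg, pull_secK] at hpull
  have hVj : V j = 1 := (secK k _).injective (hs1.trans (map_one _).symm)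
  refine ⟨fun a => V a * p j, fun a => ?_, ?_⟩
  · have h : secK k B (π (V a)) * secK k B (π (p j)) = secK k B (π (V j)) * secK k B (π (p a)) :=
      hpull.prop hf a j
    rw [← map_mul (secK k B), ← map_mul (secK k B)] at h
    rw [map_sub, map_mul, (secK k B).injective h, hVj, map_one, one_mul, sub_self]
  · rw [tf] at hV0 ⊢
    linear_combination p j ^ 2 * hV0

open PowerSeries in
theorem tf_add_X_mul {Ω : Type*} [Field Ω] {q : Fin 6 → Ω} {v : Fin 3 → Ω} (h0 : tf q v = 0)
    (hg : tgrad q v = 0) (w : Fin 3 → Ω) (u : Fin 3 → PowerSeries Ω) :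
    ∃ r, tf (fun j => PowerSeries.C (q j)) (fun j => PowerSeries.C (v j) +
      PowerSeries.X * PowerSeries.C (w j) + PowerSeries.X ^ 2 * u j) =
      PowerSeries.X ^ 2 * PowerSeries.C (tf q w) + PowerSeries.X ^ 3 * r := by
  refine ⟨_, (tf_expand _ _ _ _ _ ?_ ?_).trans (by rw [tf_map])⟩
  · have := tf_map (PowerSeries.C (R := Ω)) q v
    rw [h0, map_zero] at this
    exact this.symm
  · ext1 j
    have h3 : tgrad (fun j => PowerSeries.C (q j)) (fun j => PowerSeries.C (v j)) j =
        PowerSeries.C (tgrad q v j) := by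
      simp only [tgrad]
      fin_cases j <;> simp <;> exact Or.inl (Or.inl (map_ofNat PowerSeries.C 2).symm)
    rw [h3, hg]
    simp

/-- A smooth conic has no singular point. Indeed, if `v` is singular then all the first order
deformations `v + εw` lie on the conic, and `v + εw` lifts to second order only if `q(w) = 0`. -/
theorem nonSing_of_smooth {Y : Sch k} (hY : Smooth Y.hom) {i : Y ⟶ projSpace k 2} {q : Fin 6 → k}
    (hi : HasForm i (tpoly q)) (hq : tpoly q ≠ 0) {Ω : Type u} [Field Ω] [Algebra k Ω] :
    NonSing fun j => algebraMap k Ω (q j) := by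
  intro v hv hg h0
  rw [tb_eq_zero_iff] at hg
  have hφ := FaithfulSMul.algebraMap_injective k Ω
  suffices h : ∀ w, tf (fun j => algebraMap k Ω (q j)) w = 0 by
    refine hq ?_
    have hz : q = 0 := by
      have e0 := h ![1, 0, 0]
      have e1 := h ![0, 1, 0]
      have e2 := h ![0, 0, 1]
      have e3 := h ![0, 1, 1]
      have e4 := h ![1, 0, 1]
      have e5 := h ![1, 1, 0]
      simp only [tf, Matrix.cons_val] at e0 e1 e2 e3 e4 e5
      ext j
      apply hφ
      rw [Pi.zero_apply, map_zero]
      fin_cases j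
      · change algebraMap k Ω (q 0) = 0
        linear_combination e0
      · change algebraMap k Ω (q 1) = 0
        linear_combination e1
      · change algebraMap k Ω (q 2) = 0
        linear_combination e2
      · change algebraMap k Ω (q 3) = 0
        linear_combination e3 - e1 - e2
      · change algebraMap k Ω (q 4) = 0
        linear_combination e4 - e0 - e2
      · change algebraMap k Ω (q 5) = 0
        linear_combination e5 - e0 - e1
    rw [hz]
    simp [tpoly, tf]
  intro w
  have := isLocalRing_quotient_X_pow Ω
  let J : Ideal (PowerSeries Ω) := Ideal.span {PowerSeries.X ^ 3}
  let J' : Ideal (PowerSeries Ω) := Ideal.span {PowerSeries.X ^ 2}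
  have hJ : J ≤ J' := (Ideal.span_singleton_le_span_singleton).mpr (pow_dvd_pow _ (by norm_num))
  let π : (PowerSeries Ω ⧸ J) →ₐ[k] (PowerSeries Ω ⧸ J') := Ideal.Quotient.factorₐ k hJ
  have hπm : ∀ r, π (Ideal.Quotient.mk J r) = Ideal.Quotient.mk J' r := fun r => rfl
  have hker : ∀ a, π a = 0 → ∃ u, a = Ideal.Quotient.mk J (PowerSeries.X ^ 2 * u) := fun a ha => by
    obtain ⟨r, rfl⟩ := Ideal.Quotient.mk_surjective a
    rw [hπm, Ideal.Quotient.eq_zero_iff_mem] at ha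
    obtain ⟨u, rfl⟩ := Ideal.mem_span_singleton.mp ha
    exact ⟨u, rfl⟩
  let p : Fin 3 → PowerSeries Ω := fun j => PowerSeries.C (v j) + PowerSeries.X * PowerSeries.C (w j)
  have hmkq : ∀ x : Fin 3 → PowerSeries Ω, tf (fun j => algebraMap k (PowerSeries Ω ⧸ J) (q j))
      (fun j => Ideal.Quotient.mk J (x j)) =
        Ideal.Quotient.mk J (tf (fun j => PowerSeries.C (algebraMap k Ω (q j))) x) := fun x => by
    rw [tf_map]
    congr 1
    ext a
    exact congrArg (Ideal.Quotient.mk J) PowerSeries.algebraMap_apply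
  obtain ⟨j, hj⟩ := Function.ne_iff.mp hv
  have hpj : IsUnit (p j) := by
    rw [PowerSeries.isUnit_iff_constantCoeff]
    simpa [p] using hj
  obtain ⟨p', hp', h⟩ := exists_tf_eq_zero_of_smooth hY hi π (fun r => by
    obtain ⟨r, rfl⟩ := Ideal.Quotient.mk_surjective r
    exact ⟨_, hπm r⟩) (fun x y hx hy => by
    obtain ⟨u, rfl⟩ := hker x hx
    obtain ⟨u', rfl⟩ := hker y hy
    rw [← map_mul, Ideal.Quotient.eq_zero_iff_mem]
    exact Ideal.mem_span_singleton.mpr ⟨PowerSeries.X * u * u', by ring⟩)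
    (fun j => Ideal.Quotient.mk J (p j)) (hpj.map _) (by
      obtain ⟨r, hr⟩ := tf_add_X_mul h0 hg w 0
      rw [hmkq, hπm, Ideal.Quotient.eq_zero_iff_mem]
      simp only [Pi.zero_apply, mul_zero, add_zero] at hr
      rw [hr]
      exact Ideal.mem_span_singleton.mpr
        (dvd_add (Dvd.intro _ rfl) ((pow_dvd_pow _ (by norm_num)).mul_right _)))
  choose u hu using fun a => hker _ (hp' a)
  obtain ⟨r, hr⟩ := tf_add_X_mul h0 hg w u
  have h7 : p' = fun a => Ideal.Quotient.mk J (p a + PowerSeries.X ^ 2 * u a) := by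
    ext1 a
    rw [map_add, ← hu]
    ring
  rw [h7, hmkq, Ideal.Quotient.eq_zero_iff_mem, Ideal.mem_span_singleton, hr,
    (dvd_add_left (Dvd.intro _ rfl)), PowerSeries.X_pow_dvd_iff] at h
  have := h 2 (by norm_num)
  rwa [PowerSeries.coeff_X_pow_mul', if_pos le_rfl, PowerSeries.coeff_C, if_pos rfl] at this

theorem IsSmoothConic.exists_qf {Y : Sch k} (hY : IsSmoothConic Y) :
    ∃ (a b : k) (i : Y ⟶ projSpace k 2), (1 : k) ^ 2 + 4 * a ≠ 0 ∧ b ≠ 0 ∧ HasForm i (qf 1 a b) := by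
  obtain ⟨hs, q, hq, i, hi⟩ := hY
  obtain ⟨hq2, -⟩ := hi.2
  obtain ⟨q, rfl⟩ := exists_eq_tpoly (F := q) (by simpa using hq2)
  exact hi.hasForm.exists_qf (nonSing_of_smooth hs hi.hasForm hq (Ω := AlgebraicClosure k))

end Smooth

/-! ### Split conics and their parametrization -/

section IdealSheaf

theorem comap_eq_bot_iff {X Y : Scheme.{u}} (f : X ⟶ Y) (I : Y.IdealSheafData) :
    I.comap f = ⊥ ↔ I ≤ f.ker := by
  have h1 : IsIso (⊥ : X.IdealSheafData).subschemeι := inferInstance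
  have h2 : (⊥ : X.IdealSheafData).map f = f.ker := by
    rw [Scheme.IdealSheafData.map]
    refine le_antisymm ?_ (Scheme.Hom.le_ker_comp _ _)
    conv_rhs => rw [← IsIso.inv_hom_id_assoc (⊥ : X.IdealSheafData).subschemeι f]
    exact Scheme.Hom.le_ker_comp _ _
  rw [← h2, Scheme.IdealSheafData.le_map_iff_comap_le, le_bot_iff]

theorem ideal_top_eq_bot_iff {X : Scheme.{u}} [IsAffine X] (I : X.IdealSheafData) :
    I.ideal ⟨⊤, isAffineOpen_top _⟩ = ⊥ ↔ I = ⊥ :=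
  ⟨fun h => Scheme.IdealSheafData.ext_of_isAffine h, fun h => by rw [h]; rfl⟩

theorem comap_eq_bot_of_span {X Y : Scheme.{u}} [IsAffine X] [IsAffine Y] (f : X ⟶ Y)
    {I : Y.IdealSheafData} {F : Γ(Y, ⊤)} (h : I.ideal ⟨⊤, isAffineOpen_top _⟩ = Ideal.span {F}) :
    I.comap f = ⊥ ↔ f.appTop.hom F = 0 := by
  rw [← ideal_top_eq_bot_iff, comap_ideal_top, h, Ideal.map_span, Set.image_singleton,
    Ideal.span_singleton_eq_bot]

variable {k : Type u} [Field k]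

/-- If the divisor meets the curve in one point, then any two points on it agree. -/
theorem AllOrOnePoint.eq_of_comap_eq_bot {Y : Sch k} {K : Type u} [Field K] [Algebra k K]
    {J : (Y ⊗ pt k K).left.IdealSheafData} (h : IsIso (J.subschemeι ≫ (snd Y (pt k K)).left))
    {T : Sch k} {g g' : T ⟶ Y ⊗ pt k K} (hg : J.comap g.left = ⊥) (hg' : J.comap g'.left = ⊥)
    (hs : g ≫ snd _ _ = g' ≫ snd _ _) : g = g' := by
  rw [comap_eq_bot_iff, ← J.ker_subschemeι] at hg hg'
  have e1 := IsClosedImmersion.lift_fac J.subschemeι g.left hg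
  have e2 := IsClosedImmersion.lift_fac J.subschemeι g'.left hg'
  have e3 : IsClosedImmersion.lift J.subschemeι g.left hg =
      IsClosedImmersion.lift J.subschemeι g'.left hg' := by
    rw [← cancel_mono (J.subschemeι ≫ (snd Y (pt k K)).left), reassoc_of% e1, reassoc_of% e2]
    exact congrArg (fun φ => Over.Hom.left φ) hs
  refine Over.OverMorphism.ext ?_
  rw [← e1, ← e2, e3]

/-- If the divisor meets the curve in one point, then this point is rational. -/
theorem AllOrOnePoint.exists_point {Y : Sch k} {K : Type u} [Field K] [Algebra k K]
    {J : (Y ⊗ pt k K).left.IdealSheafData} (h : IsIso (J.subschemeι ≫ (snd Y (pt k K)).left)) :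
    ∃ y : pt k K ⟶ Y, J.comap (lift y (𝟙 _)).left = ⊥ := by
  let g : pt k K ⟶ Y ⊗ pt k K := Over.homMk (inv (J.subschemeι ≫ (snd Y (pt k K)).left) ≫ J.subschemeι)
    (by rw [← Over.w (snd Y (pt k K)), Category.assoc, IsIso.inv_comp_eq, Category.assoc])
  have h2 : g ≫ snd _ _ = 𝟙 _ := by
    ext1
    change (inv (J.subschemeι ≫ (snd Y (pt k K)).left) ≫ J.subschemeι) ≫ (snd Y (pt k K)).left = _
    rw [Category.assoc, IsIso.inv_hom_id]
    rfl
  refine ⟨g ≫ fst _ _, ?_⟩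
  have h3 : lift (g ≫ fst _ _) (𝟙 _) = g := by
    rw [← h2, ← comp_lift]
    simp
  rw [h3, comap_eq_bot_iff]
  conv_lhs => rw [← J.ker_subschemeι]
  exact Scheme.Hom.le_ker_comp _ _

end IdealSheaf

section Split
variable {k : Type u} [Field k]

/-- A conic in normal form, with a root `θ` of `t² - et - a` in the field `K`, and with the
inverse `δ` of the difference of `θ` and its conjugate `e - θ`. -/
structure SplitConic (k : Type u) [Field k] (K : Type u) [Field K] [Algebra k K] (Y : Sch k) where
  i : Y ⟶ projSpace k 2
  e : k
  a : k
  b : k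
  form : HasForm i (qf e a b)
  hb : b ≠ 0
  θ : K
  δ : K
  hθ : θ ^ 2 = algebraMap k K e * θ + algebraMap k K a
  hδ : δ * (2 * θ - algebraMap k K e) = 1

/-- The parametrization of the conic `N(x₀ + θx₁) = bx₂²` by the projective line: the point with
`x₀ + θx₁ = s₁²`, `x₀ + θ'x₁ = bs₀²` and `x₂ = s₀s₁`, where `θ'` is the conjugate of `θ`. -/
def parVec {R : Type*} [CommRing R] (e b θ δ : R) (s : Fin 2 → R) : Fin 3 → R :=
  ![δ * (θ * b * s 0 ^ 2 - (e - θ) * s 1 ^ 2), δ * (s 1 ^ 2 - b * s 0 ^ 2), s 0 * s 1]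

variable {R : Type*} [CommRing R] {e a b θ δ : R}

theorem parVec_map {S : Type*} [CommRing S] (f : R →+* S) (s : Fin 2 → R) :
    (fun j => f (parVec e b θ δ s j)) = parVec (f e) (f b) (f θ) (f δ) (fun j => f (s j)) := by
  ext j
  fin_cases j <;> simp [parVec]

theorem parVec_fst (hδ : δ * (2 * θ - e) = 1) (s : Fin 2 → R) :
    parVec e b θ δ s 0 + θ * parVec e b θ δ s 1 = s 1 ^ 2 := by
  simp only [parVec, Matrix.cons_val]
  linear_combination s 1 ^ 2 * hδ

theorem parVec_snd (hδ : δ * (2 * θ - e) = 1) (s : Fin 2 → R) :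
    parVec e b θ δ s 0 + (e - θ) * parVec e b θ δ s 1 = b * s 0 ^ 2 := by
  simp only [parVec, Matrix.cons_val]
  linear_combination b * s 0 ^ 2 * hδ

theorem parVec_two (s : Fin 2 → R) : parVec e b θ δ s 2 = s 0 * s 1 := rfl

theorem qv_eq_norm (hθ : θ ^ 2 = e * θ + a) (x : Fin 3 → R) :
    qv e a b x = (x 0 + θ * x 1) * (x 0 + (e - θ) * x 1) - b * x 2 ^ 2 := by
  rw [qv]
  linear_combination x 1 ^ 2 * hθ

theorem qv_parVec (hθ : θ ^ 2 = e * θ + a) (hδ : δ * (2 * θ - e) = 1) (s : Fin 2 → R) :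
    qv e a b (parVec e b θ δ s) = 0 := by
  rw [qv_eq_norm hθ, parVec_fst hδ, parVec_snd hδ, parVec_two]
  ring

theorem unimod_parVec (hδ : δ * (2 * θ - e) = 1) (hb : IsUnit b) {s : Fin 2 → R} (hs : Unimod s) :
    Unimod (parVec e b θ δ s) := by
  have hj : ∀ j, parVec e b θ δ s j ∈ Ideal.span (Set.range (parVec e b θ δ s)) :=
    fun j => Ideal.subset_span ⟨j, rfl⟩
  have hle : Ideal.span (Set.range s) ≤ (Ideal.span (Set.range (parVec e b θ δ s))).radical := by
    rw [Ideal.span_le]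
    rintro _ ⟨j, rfl⟩
    refine ⟨2, ?_⟩
    fin_cases j
    · change s 0 ^ 2 ∈ _
      obtain ⟨u, rfl⟩ := hb
      have h1 := parVec_snd (b := (u : R)) hδ s
      have h2 : s 0 ^ 2 = ↑u⁻¹ * (parVec e u θ δ s 0 + (e - θ) * parVec e u θ δ s 1) := by
        rw [h1, Units.inv_mul_cancel_left]
      rw [h2]
      exact Ideal.mul_mem_left _ _ (add_mem (hj 0) (Ideal.mul_mem_left _ _ (hj 1)))
    · change s 1 ^ 2 ∈ _
      rw [← parVec_fst hδ s]
      exact add_mem (hj 0) (Ideal.mul_mem_left _ _ (hj 1))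
  rw [show Ideal.span (Set.range s) = ⊤ from hs, top_le_iff, Ideal.radical_eq_top] at hle
  exact hle

namespace SplitConic
variable {K : Type u} [Field K] [Algebra k K] {Y : Sch k} (c : SplitConic k K Y)
  {A B : Type u} [CommRing A] [Algebra k A] [Algebra K A] [CommRing B] [Algebra k B] [Algebra K B]

/-- The parametrization over a `K`-algebra. -/
def vec (s : Fin 2 → A) : Fin 3 → A :=
  parVec (algebraMap k A c.e) (algebraMap k A c.b) (algebraMap K A c.θ) (algebraMap K A c.δ) s

/-- The morphism `y` from `Spec A` to the conic is the point with parameter `s`. -/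
def At (y : specK k A ⟶ Y) (s : Fin 2 → A) : Prop := Coord c.i y fun j => secK k A (c.vec s j)

theorem At.unique {c : SplitConic k K Y} {y y' : specK k A ⟶ Y} {s : Fin 2 → A} (h : c.At y s) (h' : c.At y' s) :
    y = y' :=
  have := c.form.mono
  coord_ext h h'

variable [IsScalarTower k K A] [IsScalarTower k K B]

theorem hθ' : algebraMap K A c.θ ^ 2 =
    algebraMap k A c.e * algebraMap K A c.θ + algebraMap k A c.a := by
  rw [IsScalarTower.algebraMap_apply k K A, IsScalarTower.algebraMap_apply k K A, ← map_pow, c.hθ,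
    map_add, map_mul]

theorem hδ' : algebraMap K A c.δ * (2 * algebraMap K A c.θ - algebraMap k A c.e) = 1 := by
  rw [IsScalarTower.algebraMap_apply k K A, ← map_one (algebraMap K A), ← c.hδ, map_mul,
    map_sub, map_mul, map_ofNat]

theorem exists_at {s : Fin 2 → A} (hs : Unimod s) : ∃ y, c.At y s := by
  refine exists_coord_of_form c.form (unimod_secK (unimod_parVec c.hδ' ?_ hs)) ?_
  · exact (isUnit_iff_ne_zero.mpr c.hb).map _
  · rw [coordHom_specK, aeval_def, eval₂_qf, vec, qv_parVec c.hθ' c.hδ', map_zero]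

variable {c}

theorem vec_map (f : A →ₐ[K] B) (s : Fin 2 → A) : (fun j => f (c.vec s j)) = c.vec (fun j => f (s j)) := by
  have := parVec_map (f : A →+* B) (e := algebraMap k A c.e) (b := algebraMap k A c.b)
    (θ := algebraMap K A c.θ) (δ := algebraMap K A c.δ) s
  refine this.trans ?_
  rw [vec]
  congr 1
  · exact (f.restrictScalars k).commutes c.e
  · exact (f.restrictScalars k).commutes c.b
  · exact f.commutes c.θ
  · exact f.commutes c.δ

theorem At.pull {y : specK k A ⟶ Y} {s : Fin 2 → A} (h : c.At y s) (f : A →ₐ[K] B) :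
    c.At (specMapK (f.restrictScalars k) ≫ y) (fun j => f (s j)) := by
  have := Coord.pull h (specMapK (f.restrictScalars k))
  rw [pull_secK] at this
  rw [At, ← vec_map f]
  exact this

/-- Points with proportional coordinates have proportional parameters, in the affine chart. -/
theorem At.param_eq {y : specK k A ⟶ Y} {r r' : A} (h : c.At y ![r, 1]) (h' : c.At y ![r', 1]) :
    r = r' := by
  have hp : ∀ p q, c.vec ![r, 1] p * c.vec ![r', 1] q = c.vec ![r, 1] q * c.vec ![r', 1] p :=
    fun p q => (secK k A).injective (by rw [map_mul, map_mul]; exact Coord.prop h h' p q)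
  have h1 := parVec_fst (b := algebraMap k A c.b) (c.hδ' (A := A)) ![r, 1]
  have h1' := parVec_fst (b := algebraMap k A c.b) (c.hδ' (A := A)) ![r', 1]
  have h2 : c.vec ![r, 1] 2 = r * 1 := rfl
  have h2' : c.vec ![r', 1] 2 = r' * 1 := rfl
  change c.vec ![r, 1] 0 + _ * c.vec ![r, 1] 1 = 1 ^ 2 at h1
  change c.vec ![r', 1] 0 + _ * c.vec ![r', 1] 1 = 1 ^ 2 at h1'
  have e0 := hp 2 0
  have e1 := hp 2 1
  rw [h2, h2'] at e0 e1
  linear_combination e0 + algebraMap K A c.θ * e1 - r * h1' + r' * h1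

/-- Over a field, points with the same parameter up to a factor. -/
theorem At.prop {L : Type u} [Field L] [Algebra k L] [Algebra K L] [IsScalarTower k K L]
    {y : specK k L ⟶ Y} {s s' : Fin 2 → L} (h : c.At y s) (h' : c.At y s') :
    s 0 * s' 1 = s 1 * s' 0 := by
  have hp : ∀ p q, c.vec s p * c.vec s' q = c.vec s q * c.vec s' p :=
    fun p q => (secK k L).injective (by rw [map_mul, map_mul]; exact Coord.prop h h' p q)
  have hb : algebraMap k L c.b ≠ 0 := by simpa using c.hb
  have h1 := parVec_fst (b := algebraMap k L c.b) (c.hδ' (A := L)) s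
  have h1' := parVec_fst (b := algebraMap k L c.b) (c.hδ' (A := L)) s'
  have h3 := parVec_snd (b := algebraMap k L c.b) (c.hδ' (A := L)) s
  have h3' := parVec_snd (b := algebraMap k L c.b) (c.hδ' (A := L)) s'
  have h2 : c.vec s 2 = s 0 * s 1 := rfl
  have h2' : c.vec s' 2 = s' 0 * s' 1 := rfl
  change c.vec s 0 + _ * c.vec s 1 = _ at h1 h3
  change c.vec s' 0 + _ * c.vec s' 1 = _ at h1' h3'
  have e0 := hp 2 0
  have e1 := hp 2 1
  have e2 := hp 0 1
  rw [h2, h2'] at e0 e1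
  set t := algebraMap K L c.θ
  set ee := algebraMap k L c.e
  have f1 : s 0 * s 1 * s' 1 ^ 2 = s 1 ^ 2 * (s' 0 * s' 1) := by
    rw [← h1, ← h1']
    linear_combination e0 + t * e1
  have f2 : s 0 * s 1 * s' 0 ^ 2 = s 0 ^ 2 * (s' 0 * s' 1) := mul_left_cancel₀ hb (by
    linear_combination (-(s 0 * s 1)) * h3' + (s' 0 * s' 1) * h3 + e0 + (ee - t) * e1)
  have f3 : s 0 ^ 2 * s' 1 ^ 2 = s 1 ^ 2 * s' 0 ^ 2 := mul_left_cancel₀ hb (by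
    linear_combination (-(s' 1 ^ 2)) * h3 + (s 1 ^ 2) * h3' -
      (c.vec s 0 + (ee - t) * c.vec s 1) * h1' + (c.vec s' 0 + (ee - t) * c.vec s' 1) * h1 +
        (2 * t - ee) * e2)
  by_contra hne
  have hd : s 0 * s' 1 - s 1 * s' 0 ≠ 0 := sub_ne_zero.mpr hne
  have g1 : s 1 * s' 1 = 0 := (mul_eq_zero.mp (show (s 0 * s' 1 - s 1 * s' 0) * (s 1 * s' 1) = 0 by
    linear_combination f1)).resolve_left hd
  have g2 : s 0 * s' 0 = 0 := (mul_eq_zero.mp (show (s 0 * s' 1 - s 1 * s' 0) * (s 0 * s' 0) = 0 by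
    linear_combination -f2)).resolve_left hd
  rcases mul_eq_zero.mp g1 with h | h <;> rcases mul_eq_zero.mp g2 with h'' | h'' <;>
    simp_all

/-- A point over a field has homogeneous coordinates. -/
theorem exists_coord_pt {L : Type u} [Field L] [Algebra k L] (i : Y ⟶ projSpace k 2) (y : pt k L ⟶ Y) :
    ∃ x : Fin 3 → L, x ≠ 0 ∧ Coord i y fun j => secK k L (x j) := by
  have hsub : Subsingleton (pt k L).left := inferInstanceAs (Subsingleton (PrimeSpectrum L))
  obtain ⟨w⟩ : Nonempty (pt k L).left := inferInstanceAs (Nonempty (PrimeSpectrum L))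
  obtain ⟨j, hj⟩ := exists_mem_chart ((y ≫ i).left w)
  obtain ⟨s, hs1, hs⟩ := exists_coord_one i y (𝟙 _) j fun x => by
    rw [Subsingleton.elim x w]
    exact hj
  rw [Category.id_comp] at hs
  obtain ⟨v, rfl⟩ := Coord.exists_secK (A := L) hs
  refine ⟨v, fun h => one_ne_zero (α := L) ?_, hs⟩
  rw [← (secK k L).injective (hs1.trans (map_one _).symm), h]
  rfl

/-- Every point over a field has a parameter. -/
theorem exists_param {L : Type u} [Field L] [Algebra k L] [Algebra K L] [IsScalarTower k K L]
    (c : SplitConic k K Y) (y : pt k L ⟶ Y) : ∃ s : Fin 2 → L, s ≠ 0 ∧ c.At y s := by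
  obtain ⟨x, hx, H⟩ := exists_coord_pt c.i y
  have hb : algebraMap k L c.b ≠ 0 := by simpa using c.hb
  have h0 : qv (algebraMap k L c.e) (algebraMap k L c.a) (algebraMap k L c.b) x = 0 := by
    have := Coord.form_eq_zero c.form H
    have h2 := (coordHom_specK L x (qf c.e c.a c.b)).symm.trans this
    rw [aeval_def, eval₂_qf] at h2
    exact (map_eq_zero_iff _ (secK k L).injective).mp h2
  rw [qv_eq_norm c.hθ'] at h0
  have hδ := c.hδ' (A := L)
  have key : ∀ s : Fin 2 → L, s ≠ 0 → (∀ p q, x p * c.vec s q = x q * c.vec s p) → c.At y s :=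
    fun s hs hp => H.of_prop (unimod_secK (unimod_parVec hδ (isUnit_iff_ne_zero.mpr hb)
      (unimod_of_ne_zero hs))) fun p q => by
        have h3 : secK k L (x p) * secK k L (c.vec s q) = secK k L (x q) * secK k L (c.vec s p) := by
          rw [← map_mul, ← map_mul, hp]
        exact h3
  by_cases hL : x 0 + algebraMap K L c.θ * x 1 = 0
  · have hx2 : x 2 = 0 := by
      rw [hL] at h0
      have : algebraMap k L c.b * x 2 ^ 2 = 0 := by linear_combination -h0
      exact pow_eq_zero_iff two_ne_zero |>.mp ((mul_eq_zero.mp this).resolve_left hb)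
    refine ⟨![1, 0], fun h => one_ne_zero (congrFun h 0), key _ (fun h => one_ne_zero (congrFun h 0)) ?_⟩
    have e0 : c.vec ![(1 : L), 0] 0 = algebraMap K L c.δ * algebraMap K L c.θ * algebraMap k L c.b := by
      simp [vec, parVec]
      ring
    have e1 : c.vec ![(1 : L), 0] 1 = -(algebraMap K L c.δ * algebraMap k L c.b) := by
      simp [vec, parVec]
    have e2 : c.vec ![(1 : L), 0] 2 = 0 := by simp [vec, parVec]
    have hx0 : x 0 = -(algebraMap K L c.θ * x 1) := by linear_combination hL
    intro p q
    fin_cases p <;> fin_cases q <;> simp [e0, e1, e2, hx0, hx2] <;> ring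
  · set l := x 0 + algebraMap K L c.θ * x 1 with hl
    have e0 : c.vec ![x 2, l] 0 = l * x 0 := by
      simp only [vec, parVec, Matrix.cons_val]
      linear_combination l * x 0 * hδ - algebraMap K L c.δ * algebraMap K L c.θ * h0 -
        algebraMap K L c.δ * l * (algebraMap k L c.e - algebraMap K L c.θ) * hl
    have e1 : c.vec ![x 2, l] 1 = l * x 1 := by
      simp only [vec, parVec, Matrix.cons_val]
      linear_combination l * x 1 * hδ + algebraMap K L c.δ * h0 + algebraMap K L c.δ * l * hl
    have e2 : c.vec ![x 2, l] 2 = l * x 2 := by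
      simp only [vec, parVec, Matrix.cons_val]
      ring
    have hv : ∀ p, c.vec ![x 2, l] p = l * x p := fun p => by
      fin_cases p <;> assumption
    exact ⟨![x 2, l], fun h => hL (congrFun h 1), key _ (fun h => hL (congrFun h 1)) fun p q => by
      rw [hv, hv]
      ring⟩

end SplitConic
end Split

/-! ### Linear equations on products of projective lines -/

section Trilinear
variable {F : Type*} [Field F]

/-- The trilinear form with coefficients `f`. -/
def tri (f : Fin 2 → Fin 2 → Fin 2 → F) (s t r : Fin 2 → F) : F :=
  ∑ i, ∑ j, ∑ l, f i j l * (s i * t j * r l)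

theorem tri_fst (f : Fin 2 → Fin 2 → Fin 2 → F) (s t r : Fin 2 → F) :
    tri f s t r = tri f ![1, 0] t r * s 0 + tri f ![0, 1] t r * s 1 := by
  simp [tri, Fin.sum_univ_two]
  ring

theorem tri_snd (f : Fin 2 → Fin 2 → Fin 2 → F) (s t r : Fin 2 → F) :
    tri f s t r = tri f s ![1, 0] r * t 0 + tri f s ![0, 1] r * t 1 := by
  simp [tri, Fin.sum_univ_two]
  ring

theorem tri_trd (f : Fin 2 → Fin 2 → Fin 2 → F) (s t r : Fin 2 → F) :
    tri f s t r = tri f s t ![1, 0] * r 0 + tri f s t ![0, 1] * r 1 := by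
  simp [tri, Fin.sum_univ_two]
  ring

/-- A set of points of the projective line is everything or a single point. -/
def AllOrOne (S : (Fin 2 → F) → Prop) : Prop :=
  (∀ s, s ≠ 0 → S s) ∨ ∃ s₀ : Fin 2 → F, s₀ ≠ 0 ∧ ∀ s, s ≠ 0 → (S s ↔ s₀ 0 * s 1 = s₀ 1 * s 0)

theorem ne_zero_of_one (x : F) : (![x, 1] : Fin 2 → F) ≠ 0 := fun h => one_ne_zero (congrFun h 1)

theorem AllOrOne.smul {S : (Fin 2 → F) → Prop} (h : AllOrOne S) {s : Fin 2 → F} (hs : s ≠ 0) {l : F}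
    (hl : l ≠ 0) : S (l • s) ↔ S s := by
  have hls : l • s ≠ 0 := smul_ne_zero hl hs
  rcases h with h | ⟨s₀, -, h⟩
  · exact ⟨fun _ => h _ hs, fun _ => h _ hls⟩
  · rw [h _ hls, h _ hs]
    simp only [Pi.smul_apply, smul_eq_mul]
    refine ⟨fun h => mul_left_cancel₀ hl (by linear_combination h), fun h => by linear_combination l * h⟩

/-- A set of points of the projective line that is everything or one point, and that is given by a
linear equation on the affine line, is given by it everywhere. -/
theorem AllOrOne.iff_linear {S : (Fin 2 → F) → Prop} (h : AllOrOne S) {α β : F}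
    (hS : ∀ x, S ![x, 1] ↔ α * x + β = 0) {s : Fin 2 → F} (hs : s ≠ 0) :
    S s ↔ α * s 0 + β * s 1 = 0 := by
  by_cases h1 : s 1 = 0
  · have h0 : s 0 ≠ 0 := fun h0 => hs (by ext j; fin_cases j <;> assumption)
    have h2 : s = s 0 • ![1, 0] := by ext j; fin_cases j <;> simp [h1]
    have he : (![1, 0] : Fin 2 → F) ≠ 0 := fun h => one_ne_zero (congrFun h 0)
    rw [h2, h.smul he h0]
    simp only [Pi.smul_apply, smul_eq_mul, Matrix.cons_val, mul_zero, add_zero, mul_one,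
      mul_eq_zero, h0, or_false]
    rcases h with h | ⟨s₀, hs₀, h⟩
    · refine ⟨fun _ => ?_, fun _ => h _ he⟩
      have e0 := (hS 0).mp (h _ (ne_zero_of_one _))
      have e1 := (hS 1).mp (h _ (ne_zero_of_one _))
      linear_combination e1 - e0
    · have hx : ∀ x, α * x + β = 0 ↔ s₀ 0 = s₀ 1 * x := fun x => by
        rw [← hS, h _ (ne_zero_of_one _)]
        simp
      rw [h _ he]
      simp only [Matrix.cons_val, mul_zero, mul_one]
      constructor
      · intro h10
        by_contra hα
        have := (hx (-β / α)).mp (by field_simp; ring)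
        rw [← h10, zero_mul] at this
        exact hs₀ (by ext j; fin_cases j; exacts [this, h10.symm])
      · intro hα
        by_contra h10
        have h10' : s₀ 1 ≠ 0 := fun h => h10 h.symm
        have e1 := (hx (s₀ 0 / s₀ 1)).mpr (by field_simp)
        have e2 := (hx (s₀ 0 / s₀ 1 + 1)).mp (by rw [hα] at e1 ⊢; linear_combination e1)
        field_simp at e2
        exact h10' (by linear_combination -e2)
  · have h2 : s = s 1 • ![s 0 / s 1, 1] := by
      ext j
      fin_cases j
      · exact (mul_div_cancel₀ _ h1).symm
      · exact (mul_one _).symm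
    have h3 : S s ↔ S ![s 0 / s 1, 1] := by
      conv_lhs => rw [h2]
      exact h.smul (ne_zero_of_one _) h1
    rw [h3, hS]
    field_simp
    rw [mul_zero, mul_comm (s 1)]

/-- A ternary relation on the projective line for which all lines are contained in it or meet it in
one point, and which is given on the affine part by a function of degree one in each variable, is
given by a trilinear form. -/
theorem iff_tri_of_affine {I : (Fin 2 → F) → (Fin 2 → F) → (Fin 2 → F) → Prop} {G : F → F → F → F}
    (hI : ∀ x y z, I ![x, 1] ![y, 1] ![z, 1] ↔ G x y z = 0)
    (h₁ : ∀ t r, t ≠ 0 → r ≠ 0 → AllOrOne fun s => I s t r)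
    (h₂ : ∀ s r, s ≠ 0 → r ≠ 0 → AllOrOne fun t => I s t r)
    (h₃ : ∀ s t, s ≠ 0 → t ≠ 0 → AllOrOne fun r => I s t r)
    (g₁ : ∀ x y z, G x y z = (G 1 y z - G 0 y z) * x + G 0 y z)
    (g₂ : ∀ x y z, G x y z = (G x 1 z - G x 0 z) * y + G x 0 z)
    (g₃ : ∀ x y z, G x y z = (G x y 1 - G x y 0) * z + G x y 0) {f : Fin 2 → Fin 2 → Fin 2 → F}
    (hf : ∀ x y z, x ∈ ({0, 1} : Set F) → y ∈ ({0, 1} : Set F) → z ∈ ({0, 1} : Set F) →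
      tri f ![x, 1] ![y, 1] ![z, 1] = G x y z)
    {s t r : Fin 2 → F} (hs : s ≠ 0) (ht : t ≠ 0) (hr : r ≠ 0) : I s t r ↔ tri f s t r = 0 := by
  have hG : ∀ x y z, tri f ![x, 1] ![y, 1] ![z, 1] = G x y z := fun x y z => by
    have l1 : ∀ y z, tri f ![x, 1] y z = (tri f ![1, 1] y z - tri f ![0, 1] y z) * x +
        tri f ![0, 1] y z := fun y z => by
      rw [tri_fst f ![x, 1], tri_fst f ![1, 1]]
      simp
    have l2 : ∀ x z, tri f x ![y, 1] z = (tri f x ![1, 1] z - tri f x ![0, 1] z) * y +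
        tri f x ![0, 1] z := fun x z => by
      rw [tri_snd f x ![y, 1], tri_snd f x ![1, 1]]
      simp
    have l3 : ∀ x y, tri f x y ![z, 1] = (tri f x y ![1, 1] - tri f x y ![0, 1]) * z +
        tri f x y ![0, 1] := fun x y => by
      rw [tri_trd f x y ![z, 1], tri_trd f x y ![1, 1]]
      simp
    rw [g₁ x y z, g₂ 0 y z, g₂ 1 y z, g₃ 0 0 z, g₃ 0 1 z, g₃ 1 0 z, g₃ 1 1 z, l1, l2, l2, l3, l3, l3, l3]
    simp [hf]
  have i1 : ∀ s, s ≠ 0 → ∀ y z, I s ![y, 1] ![z, 1] ↔ tri f s ![y, 1] ![z, 1] = 0 := fun s hs y z => by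
    rw [tri_fst]
    refine (h₁ _ _ (ne_zero_of_one y) (ne_zero_of_one z)).iff_linear (fun x => ?_) hs
    rw [hI, ← hG, tri_fst]
    simp
  have i2 : ∀ s, s ≠ 0 → ∀ t, t ≠ 0 → ∀ z, I s t ![z, 1] ↔ tri f s t ![z, 1] = 0 := fun s hs t ht z => by
    rw [tri_snd]
    refine (h₂ _ _ hs (ne_zero_of_one z)).iff_linear (fun x => ?_) ht
    rw [i1 s hs, tri_snd]
    simp
  rw [tri_trd]
  refine (h₃ _ _ hs ht).iff_linear (fun x => ?_) hr
  rw [i2 s hs t ht, tri_trd]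
  simp

end Trilinear

theorem exists_smul_of_prop {F : Type*} [Field F] {s s' : Fin 2 → F} (hs : s ≠ 0) (hs' : s' ≠ 0)
    (h : s' 0 * s 1 = s' 1 * s 0) : ∃ l : F, l ≠ 0 ∧ s = l • s' := by
  by_cases h0 : s' 0 = 0
  · have h1 : s' 1 ≠ 0 := fun h1 => hs' (by ext j; fin_cases j <;> assumption)
    have hs0 : s 0 = 0 := by
      rw [h0, zero_mul] at h
      exact (mul_eq_zero.mp h.symm).resolve_left h1
    have hs1 : s 1 ≠ 0 := fun h1 => hs (by ext j; fin_cases j <;> assumption)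
    refine ⟨s 1 / s' 1, div_ne_zero hs1 h1, ?_⟩
    ext j
    fin_cases j
    · simp [hs0, h0]
    · exact (div_mul_cancel₀ _ h1).symm
  · have e1 : s 1 = s 0 / s' 0 * s' 1 := by
      field_simp
      linear_combination h
    have e0 : s 0 = s 0 / s' 0 * s' 0 := (div_mul_cancel₀ _ h0).symm
    refine ⟨s 0 / s' 0, fun hl => hs ?_, ?_⟩
    · ext j
      fin_cases j
      · exact e0.trans (by rw [hl, zero_mul]; rfl)
      · exact e1.trans (by rw [hl, zero_mul]; rfl)
    · ext j
      fin_cases j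
      exacts [e0, e1]

theorem specMapK_comp {k : Type u} [Field k] {A B C : Type u} [CommRing A] [Algebra k A] [CommRing B]
    [Algebra k B] [CommRing C] [Algebra k C] (f : A →ₐ[k] B) (g : B →ₐ[k] C) :
    specMapK g ≫ specMapK f = specMapK (g.comp f) := by
  refine specK_hom_ext fun r => ?_
  rw [Over.comp_left, Scheme.Hom.comp_appTop, CommRingCat.hom_comp, RingHom.comp_apply,
    specMapK_appTop, specMapK_appTop, specMapK_appTop]
  rfl

section Slot
variable {k : Type u} [Field k] {K : Type u} [Field K] [Algebra k K] {Y : Sch k} (c : SplitConic k K Y)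
  {Ω : Type u} [Field Ω] [Algebra k Ω] [Algebra K Ω] [IsScalarTower k K Ω]
  {J : (Y ⊗ pt k Ω).left.IdealSheafData}

variable {c} in
theorem SplitConic.At.smul {y : specK k Ω ⟶ Y} {s : Fin 2 → Ω} (h : c.At y s) {l : Ω} (hl : l ≠ 0)
    (hs : s ≠ 0) : c.At y (l • s) := by
  have hv : ∀ p, c.vec (l • s) p = l ^ 2 * c.vec s p := fun p => by
    fin_cases p <;> simp [SplitConic.vec, parVec] <;> ring
  have hb : algebraMap k Ω c.b ≠ 0 := by simpa using c.hb
  refine Coord.of_prop h (unimod_secK (unimod_parVec c.hδ' (isUnit_iff_ne_zero.mpr hb)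
    (unimod_of_ne_zero (smul_ne_zero hl hs)))) fun p q => ?_
  have h3 : secK k Ω (c.vec s p) * secK k Ω (c.vec (l • s) q) =
      secK k Ω (c.vec s q) * secK k Ω (c.vec (l • s) p) := by
    rw [← map_mul, ← map_mul, hv, hv]
    congr 1
    ring
  exact h3

/-- In terms of the parameters, a divisor with intersection number one is everything or a single point. -/
theorem AllOrOnePoint.allOrOne (h : AllOrOnePoint J) :
    AllOrOne fun s : Fin 2 → Ω => ∃ y : pt k Ω ⟶ Y, c.At y s ∧ J.comap (lift y (𝟙 _)).left = ⊥ := by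
  rcases h with rfl | h
  · left
    intro s hs
    obtain ⟨y, hy⟩ := c.exists_at (unimod_of_ne_zero hs)
    exact ⟨y, hy, Scheme.IdealSheafData.comap_bot _⟩
  · right
    obtain ⟨y₀, hy₀⟩ := AllOrOnePoint.exists_point h
    obtain ⟨s₀, hs₀, hys₀⟩ := c.exists_param (L := Ω) y₀
    refine ⟨s₀, hs₀, fun s hs => ⟨?_, fun hss => ?_⟩⟩
    · rintro ⟨y, hy, hyJ⟩
      have := AllOrOnePoint.eq_of_comap_eq_bot h hyJ hy₀ (by simp)
      have h2 : y = y₀ := by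
        have := congrArg (fun φ => φ ≫ fst _ _) this
        simpa using this
      subst h2
      exact hys₀.prop hy
    · obtain ⟨l, hl, rfl⟩ := exists_smul_of_prop hs hs₀ hss
      exact ⟨y₀, hys₀.smul hl hs₀, hy₀⟩

/-- The structure morphism of the spectrum of an `Ω`-algebra. -/
def toPt (k : Type u) [Field k] (Ω : Type u) [Field Ω] [Algebra k Ω] (A : Type u) [CommRing A] [Algebra k A]
    [Algebra Ω A] [IsScalarTower k Ω A] : specK k A ⟶ pt k Ω :=
  specMapK ((Algebra.ofId Ω A).restrictScalars k)

theorem specMapK_toPt {A B : Type u} [CommRing A] [Algebra k A] [Algebra Ω A] [IsScalarTower k Ω A]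
    [CommRing B] [Algebra k B] [Algebra Ω B] [IsScalarTower k Ω B] (f : A →ₐ[k] B)
    (hf : ∀ r, f (algebraMap Ω A r) = algebraMap Ω B r) : specMapK f ≫ toPt k Ω A = toPt k Ω B := by
  refine (specMapK_comp _ _).trans ?_
  congr 1
  ext r
  exact hf r

theorem toPt_self : toPt k Ω Ω = 𝟙 (pt k Ω) := by
  refine specK_hom_ext fun r => ?_
  refine (specMapK_appTop _ r).trans ?_
  simp
  rfl

open Polynomial in
/-- If the divisor has one point on the conic, then its equation on the affine line has degree at most
one: otherwise the coordinate `X` and a root `α` would be two different points with values in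
`(Polynomial Ω)/(F)`. -/
theorem AllOrOnePoint.natDegree_le_one [IsAlgClosed Ω] (h : AllOrOnePoint J)
    {y : specK k (Polynomial Ω) ⟶ Y} (hy : c.At y ![Polynomial.X, 1]) {F : Polynomial Ω}
    (hF : (J.comap (lift y (toPt k Ω (Polynomial Ω))).left).ideal
      ⟨⊤, isAffineOpen_top _⟩ = Ideal.span {secK k (Polynomial Ω) F}) : F.natDegree ≤ 1 := by
  by_cases hF0 : F = 0
  · simp [hF0]
  by_cases hd : F.natDegree = 0
  · omega
  rcases h with rfl | h
  · refine absurd ?_ hF0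
    have h1 : (⊥ : (Y ⊗ pt k Ω).left.IdealSheafData).comap
        (lift y (toPt k Ω (Polynomial Ω))).left = ⊥ :=
      Scheme.IdealSheafData.comap_bot _
    rw [(ideal_top_eq_bot_iff _).mpr h1] at hF
    have h2 := Ideal.span_singleton_eq_bot.mp hF.symm
    exact (map_eq_zero_iff _ (secK k (Polynomial Ω)).injective).mp h2
  obtain ⟨α, hα⟩ := IsAlgClosed.exists_root F (fun h => hd (natDegree_eq_of_degree_eq_some h))
  let Q := Polynomial Ω ⧸ Ideal.span {F}
  let mk : Polynomial Ω →ₐ[Ω] Q := Ideal.Quotient.mkₐ Ω _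
  let G : specK k (Polynomial Ω) ⟶ Y ⊗ pt k Ω := lift y (toPt k Ω (Polynomial Ω))
  have hmk := hy.pull (mk.restrictScalars K)
  have hev := hy.pull ((aeval α : Polynomial Ω →ₐ[Ω] Ω).restrictScalars K)
  set y' := specMapK (((aeval α : Polynomial Ω →ₐ[Ω] Ω).restrictScalars K).restrictScalars k) ≫ y with hy'
  have hc : ∀ (B : Type u) [CommRing B] [Algebra Ω B] [Algebra k B] [Algebra K B] [IsScalarTower k Ω B]
      [IsScalarTower K Ω B] [IsScalarTower k K B] (φ : Polynomial Ω →ₐ[Ω] B),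
      specMapK ((φ.restrictScalars K).restrictScalars k) ≫ G =
        lift (specMapK ((φ.restrictScalars K).restrictScalars k) ≫ y)
          (toPt k Ω B) := by
    intro B _ _ _ _ _ _ _ φ
    rw [comp_lift, specMapK_toPt]
    exact φ.commutes
  have e1 : J.comap (specMapK ((mk.restrictScalars K).restrictScalars k) ≫ G).left = ⊥ := by
    rw [Over.comp_left, Scheme.IdealSheafData.comap_comp, comap_eq_bot_of_span _ hF, specMapK_appTop]
    have : mk F = 0 := Ideal.Quotient.eq_zero_iff_mem.mpr (Ideal.mem_span_singleton_self F)
    exact (congrArg _ this).trans (map_zero _)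
  let ev : pt k Ω ⟶ specK k (Polynomial Ω) :=
    specMapK (((aeval α : Polynomial Ω →ₐ[Ω] Ω).restrictScalars K).restrictScalars k)
  have hevG : ev ≫ G = lift (y' : pt k Ω ⟶ Y) (𝟙 (pt k Ω)) :=
    (hc Ω _).trans (congrArg (fun t => lift y' t) toPt_self)
  have e2 : J.comap (ev ≫ G).left = ⊥ := by
    have : IsAffine (pt k Ω).left := inferInstanceAs (IsAffine (specK k Ω).left)
    rw [Over.comp_left, Scheme.IdealSheafData.comap_comp, comap_eq_bot_of_span _ hF]
    refine (specMapK_appTop _ F).trans ?_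
    have : (aeval α : Polynomial Ω →ₐ[Ω] Ω) F = 0 := hα
    exact (congrArg _ this).trans (map_zero _)
  have e3 : J.comap (toPt k Ω Q ≫ ev ≫ G).left = ⊥ := by
    rw [Over.comp_left, Scheme.IdealSheafData.comap_comp, e2]
    exact Scheme.IdealSheafData.comap_bot _
  have hQ : ∀ y'' : pt k Ω ⟶ Y, toPt k Ω Q ≫ lift y'' (𝟙 _) = lift (toPt k Ω Q ≫ y'') (toPt k Ω Q) :=
    fun y'' => (comp_lift _ _ _).trans (by rw [Category.comp_id])
  have e4 := AllOrOnePoint.eq_of_comap_eq_bot h e1 e3 (by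
    rw [hc, hevG]
    exact (lift_snd _ _).trans ((congrArg (· ≫ snd _ _) (hQ y')).trans (lift_snd _ _)).symm)
  rw [hc, hevG] at e4
  have e5 : specMapK ((mk.restrictScalars K).restrictScalars k) ≫ y = toPt k Ω Q ≫ y' :=
    (lift_fst _ _).symm.trans ((congrArg (· ≫ fst Y (pt k Ω)) (e4.trans (hQ y'))).trans (lift_fst _ _))
  have e6 := hev.pull ((Algebra.ofId Ω Q).restrictScalars K)
  have e7 : c.At (specMapK ((mk.restrictScalars K).restrictScalars k) ≫ y) ![mk Polynomial.X, 1] := by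
    convert hmk using 1
    funext j
    fin_cases j <;> simp
  have e8 : c.At (specMapK ((mk.restrictScalars K).restrictScalars k) ≫ y) ![algebraMap Ω Q α, 1] := by
    rw [e5]
    convert e6 using 1
    · rfl
    funext j
    fin_cases j <;> simp [Algebra.ofId_apply]
  have e9 := e7.param_eq e8
  have e10 : F ∣ Polynomial.X - Polynomial.C α := by
    rw [← Ideal.mem_span_singleton, ← Ideal.Quotient.eq_zero_iff_mem, map_sub]
    exact sub_eq_zero.mpr e9
  exact (natDegree_le_of_dvd e10 (X_sub_C_ne_zero α)).trans (natDegree_X_sub_C α).le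

end Slot

/-! ### The trilinear form of the incidence relation -/

section Incidence
variable {k : Type u} [Field k] {C₁ C₂ C P : Sch k} (𝒟 : ((C₁ ⊗ C₂) ⊗ P).left.IdealSheafData) (ι : C ⟶ P)

/-- The point `(x, y)` of `C₁ × C₂` lies on the divisor with parameter `z`. -/
def Inc {W : Sch k} (x : W ⟶ C₁) (y : W ⟶ C₂) (z : W ⟶ C) : Prop :=
  𝒟.comap (lift (lift x y) (z ≫ ι)).left = ⊥

variable {𝒟 ι}

theorem Inc.pull {W W' : Sch k} {x : W ⟶ C₁} {y : W ⟶ C₂} {z : W ⟶ C} (h : Inc 𝒟 ι x y z)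
    (g : W' ⟶ W) : Inc 𝒟 ι (g ≫ x) (g ≫ y) (g ≫ z) := by
  have h1 : lift (lift (g ≫ x) (g ≫ y)) ((g ≫ z) ≫ ι) = g ≫ lift (lift x y) (z ≫ ι) := by
    simp only [comp_lift, Category.assoc]
  rw [Inc, h1, Over.comp_left, Scheme.IdealSheafData.comap_comp, h]
  exact Scheme.IdealSheafData.comap_bot _

/-- Incidence can be tested after an injective extension of the ring of values. -/
theorem Inc.of_pull {A B : Type u} [CommRing A] [Algebra k A] [CommRing B] [Algebra k B]
    {x : specK k A ⟶ C₁} {y : specK k A ⟶ C₂} {z : specK k A ⟶ C} (f : A →ₐ[k] B)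
    (hf : Function.Injective f) (h : Inc 𝒟 ι (specMapK f ≫ x) (specMapK f ≫ y) (specMapK f ≫ z)) :
    Inc 𝒟 ι x y z := by
  have h1 : lift (lift (specMapK f ≫ x) (specMapK f ≫ y)) ((specMapK f ≫ z) ≫ ι) =
      specMapK f ≫ lift (lift x y) (z ≫ ι) := by
    simp only [comp_lift, Category.assoc]
  rw [Inc, h1, Over.comp_left, Scheme.IdealSheafData.comap_comp, ← ideal_top_eq_bot_iff,
    comap_ideal_top] at h
  rw [Inc, ← ideal_top_eq_bot_iff, eq_bot_iff]
  intro a ha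
  have h2 : (specMapK f).left.appTop.hom a = 0 := by
    have := Ideal.mem_map_of_mem (specMapK f).left.appTop.hom ha
    rw [h] at this
    exact this
  obtain ⟨a, rfl⟩ := (secK k A).surjective a
  rw [specMapK_appTop] at h2
  have h3 := hf (((map_eq_zero_iff _ (secK k B).injective).mp h2).trans (map_zero f).symm)
  exact (congrArg _ h3).trans (map_zero _)

variable {K : Type u} [Field K] [Algebra k K] (c₁ : SplitConic k K C₁) (c₂ : SplitConic k K C₂)
  (c₃ : SplitConic k K C)

theorem unimod_one {A : Type*} [CommRing A] (a : A) : Unimod ![a, 1] := unimod_of_isUnit (j := 1) isUnit_one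

/-- The equation of the universal divisor in the affine parameters of the three conics. -/
theorem exists_equation (h𝒟 : IsEffectiveCartier 𝒟) (ι : C ⟶ P) :
    ∃ F : MvPolynomial (Fin 3) K, ∀ (B : Type u) [CommRing B] [Algebra k B] [Algebra K B]
      [IsScalarTower k K B] (x : specK k B ⟶ C₁) (y : specK k B ⟶ C₂) (z : specK k B ⟶ C) (p q r : B),
      c₁.At x ![p, 1] → c₂.At y ![q, 1] → c₃.At z ![r, 1] →
        (𝒟.comap (lift (lift x y) (z ≫ ι)).left).ideal ⟨⊤, isAffineOpen_top _⟩ =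
          Ideal.span {secK k B (aeval ![p, q, r] F)} := by
  let A := MvPolynomial (Fin 3) K
  obtain ⟨x₀, hx₀⟩ := c₁.exists_at (unimod_one (X 0 : A))
  obtain ⟨y₀, hy₀⟩ := c₂.exists_at (unimod_one (X 1 : A))
  obtain ⟨z₀, hz₀⟩ := c₃.exists_at (unimod_one (X 2 : A))
  have : IsDomain Γ((specK k A).left, ⊤) := (secK k A).symm.toMulEquiv.isDomain _
  have : UniqueFactorizationMonoid Γ((specK k A).left, ⊤) :=
    (secK k A).toMulEquiv.uniqueFactorizationMonoid inferInstance
  obtain ⟨F', hF'⟩ := h𝒟.exists_generator (lift (lift x₀ y₀) (z₀ ≫ ι))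
  obtain ⟨F, rfl⟩ := (secK k A).surjective F'
  refine ⟨F, fun B _ _ _ _ x y z p q r hx hy hz => ?_⟩
  let φ : A →ₐ[K] B := aeval ![p, q, r]
  have ex : ∀ (j : Fin 3) (a : B), ![p, q, r] j = a →
      (fun i => φ ((![X j, 1] : Fin 2 → A) i)) = ![a, 1] := fun j a h => by
    ext i
    fin_cases i
    · exact (aeval_X _ _).trans h
    · exact map_one φ
  have hx' : x = specMapK (φ.restrictScalars k) ≫ x₀ := hx.unique (by
    have := hx₀.pull φ
    rwa [ex 0 p rfl] at this)
  have hy' : y = specMapK (φ.restrictScalars k) ≫ y₀ := hy.unique (by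
    have := hy₀.pull φ
    rwa [ex 1 q rfl] at this)
  have hz' : z = specMapK (φ.restrictScalars k) ≫ z₀ := hz.unique (by
    have := hz₀.pull φ
    rwa [ex 2 r rfl] at this)
  have h1 : lift (lift x y) (z ≫ ι) = specMapK (φ.restrictScalars k) ≫ lift (lift x₀ y₀) (z₀ ≫ ι) := by
    rw [hx', hy', hz']
    simp only [comp_lift, Category.assoc]
  rw [h1, Over.comp_left, Scheme.IdealSheafData.comap_comp, comap_ideal_top, hF', Ideal.map_span,
    Set.image_singleton, specMapK_appTop]
  rfl

variable {c₁ c₂ c₃} {Ω : Type u} [Field Ω] [Algebra k Ω] [Algebra K Ω] [IsScalarTower k K Ω]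

theorem SplitConic.At.base {Y : Sch k} {c : SplitConic k K Y} {y : pt k Ω ⟶ Y} {a : Ω} (h : c.At y ![a, 1]) :
    c.At (toPt k Ω (Polynomial Ω) ≫ y) ![Polynomial.C a, 1] := by
  have := h.pull ((Algebra.ofId Ω (Polynomial Ω)).restrictScalars K)
  convert this using 1
  · rfl
  funext j
  fin_cases j
  · rfl
  · exact (map_one _).symm

theorem eq_linear_of_natDegree_le_one {F : Polynomial Ω} (h : F.natDegree ≤ 1) {g : Ω → Ω}
    (hg : ∀ x, g x = F.eval x) (x : Ω) : g x = (g 1 - g 0) * x + g 0 := by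
  rw [hg, hg, hg, Polynomial.eq_X_add_C_of_natDegree_le_one h]
  simp

theorem eval_aeval (F : MvPolynomial (Fin 3) K) (p : Fin 3 → Polynomial Ω) (x : Ω) :
    (aeval p F).eval x = aeval (fun j => (p j).eval x) F := by
  let e : Polynomial Ω →ₐ[K] Ω := (Polynomial.aeval x).restrictScalars K
  have h : ∀ G : Polynomial Ω, e G = G.eval x := fun G => Polynomial.coe_aeval_eq_eval x ▸ rfl
  rw [← h, ← AlgHom.comp_apply, comp_aeval]
  simp only [h]

theorem AllOrOne.congr {S T : (Fin 2 → Ω) → Prop} (h : AllOrOne S) (hST : ∀ s, s ≠ 0 → (T s ↔ S s)) :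
    AllOrOne T := by
  rcases h with h | ⟨s₀, hs₀, h⟩
  · exact .inl fun s hs => (hST s hs).mpr (h s hs)
  · exact .inr ⟨s₀, hs₀, fun s hs => (hST s hs).trans (h s hs)⟩

set_option maxHeartbeats 1000000 in
/-- In the parameters of the three conics the incidence relation is given by a trilinear form. -/
theorem exists_tri [IsAlgClosed Ω] (c₁ : SplitConic k K C₁) (c₂ : SplitConic k K C₂)
    (c₃ : SplitConic k K C) (h𝒟 : IsBidegreeOneOne C₁ C₂ P 𝒟) (hι : IsDegreeOne 𝒟 ι) :
    ∃ f : Fin 2 → Fin 2 → Fin 2 → K, ∀ (x : specK k Ω ⟶ C₁) (y : specK k Ω ⟶ C₂)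
      (z : specK k Ω ⟶ C) (s t r : Fin 2 → Ω), s ≠ 0 → t ≠ 0 → r ≠ 0 → c₁.At x s → c₂.At y t → c₃.At z r →
        (Inc 𝒟 ι x y z ↔ tri (fun i j l => algebraMap K Ω (f i j l)) s t r = 0) := by
  obtain ⟨F, hF⟩ := exists_equation c₁ c₂ c₃ h𝒟.cartier ι
  let I : (Fin 2 → Ω) → (Fin 2 → Ω) → (Fin 2 → Ω) → Prop := fun s t r =>
    ∃ (x : pt k Ω ⟶ C₁) (y : pt k Ω ⟶ C₂) (z : pt k Ω ⟶ C), c₁.At x s ∧ c₂.At y t ∧ c₃.At z r ∧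
      Inc 𝒟 ι x y z
  have hIiff : ∀ {x : pt k Ω ⟶ C₁} {y : pt k Ω ⟶ C₂} {z : pt k Ω ⟶ C} {s t r : Fin 2 → Ω},
      c₁.At x s → c₂.At y t → c₃.At z r → (I s t r ↔ Inc 𝒟 ι x y z) := by
    intro x y z s t r hx hy hz
    refine ⟨?_, fun h => ⟨x, y, z, hx, hy, hz, h⟩⟩
    rintro ⟨x', y', z', hx', hy', hz', h⟩
    rwa [hx.unique hx', hy.unique hy', hz.unique hz']
  let G : Ω → Ω → Ω → Ω := fun p q r => aeval ![p, q, r] F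
  have pts : ∀ {Y : Sch k} (c : SplitConic k K Y) {s : Fin 2 → Ω}, s ≠ 0 → ∃ x : pt k Ω ⟶ Y, c.At x s :=
    fun c s hs => c.exists_at (unimod_of_ne_zero hs)
  -- The restrictions of the divisor to the three kinds of lines.
  have e1 : ∀ {W : Sch k} (x : W ⟶ C₁) (w : W ⟶ pt k Ω) (y : pt k Ω ⟶ C₂) (z : pt k Ω ⟶ C), 𝒟.comap
      (lift (lift x (w ≫ y)) ((w ≫ z) ≫ ι)).left = (𝒟.comap (lift (lift (fst C₁ (pt k Ω))
        (snd C₁ (pt k Ω) ≫ y)) (snd C₁ (pt k Ω) ≫ z ≫ ι)).left).comap (lift x w).left := by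
    intro W x w y z
    rw [← Scheme.IdealSheafData.comap_comp, ← Over.comp_left]
    simp [comp_lift]
  have e2 : ∀ {W : Sch k} (y : W ⟶ C₂) (w : W ⟶ pt k Ω) (x : pt k Ω ⟶ C₁) (z : pt k Ω ⟶ C), 𝒟.comap
      (lift (lift (w ≫ x) y) ((w ≫ z) ≫ ι)).left = (𝒟.comap (lift (lift (snd C₂ (pt k Ω) ≫ x)
        (fst C₂ (pt k Ω))) (snd C₂ (pt k Ω) ≫ z ≫ ι)).left).comap (lift y w).left := by
    intro W x w y z
    rw [← Scheme.IdealSheafData.comap_comp, ← Over.comp_left]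
    simp [comp_lift]
  have e3 : ∀ {W : Sch k} (z : W ⟶ C) (w : W ⟶ pt k Ω) (x : pt k Ω ⟶ C₁) (y : pt k Ω ⟶ C₂), 𝒟.comap
      (lift (lift (w ≫ x) (w ≫ y)) (z ≫ ι)).left = (𝒟.comap (lift (snd C (pt k Ω) ≫ lift x y)
        (fst C (pt k Ω) ≫ ι)).left).comap (lift z w).left := by
    intro W x w y z
    rw [← Scheme.IdealSheafData.comap_comp, ← Over.comp_left]
    simp [comp_lift]
  have hIG : ∀ p q r, I ![p, 1] ![q, 1] ![r, 1] ↔ G p q r = 0 := fun p q r => by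
    obtain ⟨x, hx⟩ := pts c₁ (ne_zero_of_one p)
    obtain ⟨y, hy⟩ := pts c₂ (ne_zero_of_one q)
    obtain ⟨z, hz⟩ := pts c₃ (ne_zero_of_one r)
    rw [hIiff hx hy hz]
    have : IsAffine (pt k Ω).left := inferInstanceAs (IsAffine (specK k Ω).left)
    have h := hF Ω x y z p q r hx hy hz
    refine ((ideal_top_eq_bot_iff (X := (pt k Ω).left) _).symm.trans (Eq.congr_left h)).trans ?_
    exact Ideal.span_singleton_eq_bot.trans (map_eq_zero_iff _ (secK k Ω).injective)
  have r1 := fun (y : pt k Ω ⟶ C₂) (z : pt k Ω ⟶ C) => h𝒟.snd_ruling Ω (z ≫ ι) y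
  have r2 := fun (x : pt k Ω ⟶ C₁) (z : pt k Ω ⟶ C) => h𝒟.fst_ruling Ω (z ≫ ι) x
  have r3 := fun (x : pt k Ω ⟶ C₁) (y : pt k Ω ⟶ C₂) => hι Ω (lift x y)
  have h1 : ∀ t r, t ≠ 0 → r ≠ 0 → AllOrOne fun s => I s t r := fun t r ht hr => by
    obtain ⟨y, hy⟩ := pts c₂ ht
    obtain ⟨z, hz⟩ := pts c₃ hr
    refine (AllOrOnePoint.allOrOne c₁ (r1 y z)).congr fun s hs => ?_
    obtain ⟨x, hx⟩ := pts c₁ hs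
    rw [hIiff hx hy hz]
    have h := e1 x (𝟙 _) y z
    rw [Category.id_comp, Category.id_comp] at h
    rw [Inc, h]
    exact ⟨fun h => ⟨x, hx, h⟩, fun ⟨x', hx', h⟩ => hx.unique hx' ▸ h⟩
  have h2 : ∀ s r, s ≠ 0 → r ≠ 0 → AllOrOne fun t => I s t r := fun s r hs hr => by
    obtain ⟨x, hx⟩ := pts c₁ hs
    obtain ⟨z, hz⟩ := pts c₃ hr
    refine (AllOrOnePoint.allOrOne c₂ (r2 x z)).congr fun t ht => ?_
    obtain ⟨y, hy⟩ := pts c₂ ht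
    rw [hIiff hx hy hz]
    have h := e2 y (𝟙 _) x z
    rw [Category.id_comp, Category.id_comp] at h
    rw [Inc, h]
    exact ⟨fun h => ⟨y, hy, h⟩, fun ⟨x', hx', h⟩ => hy.unique hx' ▸ h⟩
  have h3 : ∀ s t, s ≠ 0 → t ≠ 0 → AllOrOne fun r => I s t r := fun s t hs ht => by
    obtain ⟨x, hx⟩ := pts c₁ hs
    obtain ⟨y, hy⟩ := pts c₂ ht
    refine (AllOrOnePoint.allOrOne c₃ (r3 x y)).congr fun r hr => ?_
    obtain ⟨z, hz⟩ := pts c₃ hr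
    rw [hIiff hx hy hz]
    have h := e3 z (𝟙 _) x y
    rw [Category.id_comp, Category.id_comp] at h
    rw [Inc, h]
    exact ⟨fun h => ⟨z, hz, h⟩, fun ⟨x', hx', h⟩ => hz.unique hx' ▸ h⟩
  -- The equation has degree at most one in each variable.
  let XX : Polynomial Ω := Polynomial.X
  let CC : Ω → Polynomial Ω := Polynomial.C
  obtain ⟨xX, hxX⟩ := c₁.exists_at (unimod_one XX)
  obtain ⟨yX, hyX⟩ := c₂.exists_at (unimod_one XX)
  obtain ⟨zX, hzX⟩ := c₃.exists_at (unimod_one XX)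
  have g1 : ∀ p q r, G p q r = (G 1 q r - G 0 q r) * p + G 0 q r := fun p q r => by
    obtain ⟨y, hy⟩ := pts c₂ (ne_zero_of_one q)
    obtain ⟨z, hz⟩ := pts c₃ (ne_zero_of_one r)
    have hd : (aeval ![XX, CC q, CC r] F).natDegree ≤ 1 := by
      refine (r1 y z).natDegree_le_one c₁ hxX ?_
      rw [← e1]
      exact hF _ _ _ _ _ _ _ hxX hy.base hz.base
    refine eq_linear_of_natDegree_le_one (g := fun p => G p q r) hd (fun x => ?_) p
    refine Eq.trans ?_ (eval_aeval F _ x).symm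
    refine congrArg (fun w => aeval w F) ?_
    ext j
    fin_cases j <;> simp [XX, CC]
  have g2 : ∀ p q r, G p q r = (G p 1 r - G p 0 r) * q + G p 0 r := fun p q r => by
    obtain ⟨x, hx⟩ := pts c₁ (ne_zero_of_one p)
    obtain ⟨z, hz⟩ := pts c₃ (ne_zero_of_one r)
    have hd : (aeval ![CC p, XX, CC r] F).natDegree ≤ 1 := by
      refine (r2 x z).natDegree_le_one c₂ hyX ?_
      rw [← e2]
      exact hF _ _ _ _ _ _ _ hx.base hyX hz.base
    refine eq_linear_of_natDegree_le_one (g := fun q => G p q r) hd (fun x => ?_) q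
    refine Eq.trans ?_ (eval_aeval F _ x).symm
    refine congrArg (fun w => aeval w F) ?_
    ext j
    fin_cases j <;> simp [XX, CC]
  have g3 : ∀ p q r, G p q r = (G p q 1 - G p q 0) * r + G p q 0 := fun p q r => by
    obtain ⟨x, hx⟩ := pts c₁ (ne_zero_of_one p)
    obtain ⟨y, hy⟩ := pts c₂ (ne_zero_of_one q)
    have hd : (aeval ![CC p, CC q, XX] F).natDegree ≤ 1 := by
      refine (r3 x y).natDegree_le_one c₃ hzX ?_
      rw [← e3]
      exact hF _ _ _ _ _ _ _ hx.base hy.base hzX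
    refine eq_linear_of_natDegree_le_one (g := fun r => G p q r) hd (fun x => ?_) r
    refine Eq.trans ?_ (eval_aeval F _ x).symm
    refine congrArg (fun w => aeval w F) ?_
    ext j
    fin_cases j <;> simp [XX, CC]
  -- The coefficients are the iterated differences of the values at the vertices of the cube, which
  -- lie in `K`.
  let v : K → K → K → K := fun p q r => aeval ![p, q, r] F
  have hv : ∀ p q r, algebraMap K Ω (v p q r) = G (algebraMap K Ω p) (algebraMap K Ω q) (algebraMap K Ω r) := by
    intro p q r
    change algebraMap K Ω (aeval _ F) = aeval _ F
    rw [← Algebra.ofId_apply, ← AlgHom.comp_apply, comp_aeval]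
    congr 2
    ext j
    fin_cases j <;> rfl
  let d : (K → K) → Fin 2 → K := fun φ i => if i = 0 then φ 1 - φ 0 else φ 0
  refine ⟨fun i j l => d (fun p => d (fun q => d (fun r => v p q r) l) j) i,
    fun x y z s t r hs ht hr hx hy hz => ?_⟩
  refine (hIiff hx hy hz).symm.trans (iff_tri_of_affine hIG h1 h2 h3 g1 g2 g3 ?_ hs ht hr)
  rintro p q r (rfl | rfl) (rfl | rfl) (rfl | rfl) <;>
    simp [tri, Fin.sum_univ_two, d, hv] <;> ring

end Incidence

/-! ### Fibres of relative effective Cartier divisors -/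

section Fibre

/-- An equation of a relative effective Cartier divisor does not vanish at all points of a
nonempty geometric fibre: it remains regular on the fibre since `A / f` is flat, whereas by the
Nullstellensatz it would be nilpotent if it vanished at all points. -/
theorem exists_algHom_ne_zero {R A Ω : Type u} [CommRing R] [CommRing A] [Algebra R A] [Field Ω]
    [IsAlgClosed Ω] [Algebra R Ω] [Algebra.FiniteType R A] {f : A} (hf : f ∈ nonZeroDivisors A)
    (hflat : Module.Flat R (A ⧸ Ideal.span {f})) (φ₀ : A →ₐ[R] Ω) : ∃ φ : A →ₐ[R] Ω, φ f ≠ 0 := by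
  by_contra! h
  let B := TensorProduct R Ω A
  let F : B := 1 ⊗ₜ f
  have hinj : Function.Injective fun b : B => F * b := by
    have h1 := LinearMap.lTensor_injective_of_exact_of_flat
      ((Ideal.Quotient.mkₐ R (Ideal.span {f})).toLinearMap) Ideal.Quotient.mk_surjective
      (LinearMap.mulLeft R f) (fun a b hab => (mul_cancel_left_mem_nonZeroDivisors hf).mp hab)
      (fun a => ?_) Ω
    · have h2 : ∀ b : B, LinearMap.lTensor Ω (LinearMap.mulLeft R f) b = F * b := fun b => by
        induction b using TensorProduct.induction_on with
        | zero => simp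
        | add x y hx hy => rw [map_add, hx, hy, mul_add]
        | tmul x y =>
          refine Eq.trans ?_ (Algebra.TensorProduct.tmul_mul_tmul _ _ _ _).symm
          rw [one_mul]
          rfl
      intro a b hab
      exact h1 ((h2 a).trans (hab.trans (h2 b).symm))
    · change Ideal.Quotient.mk _ a = 0 ↔ _
      rw [Ideal.Quotient.eq_zero_iff_mem, Ideal.mem_span_singleton]
      exact ⟨fun ⟨b, hb⟩ => ⟨b, hb.symm⟩, fun ⟨b, hb⟩ => ⟨b, hb.symm⟩⟩
  have hJ : IsJacobsonRing B := isJacobsonRing_of_finiteType (A := Ω)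
  have hnil : IsNilpotent F := by
    rw [← mem_nilradical, nilradical, Ideal.radical_eq_jacobson, Ideal.jacobson, Submodule.mem_sInf]
    rintro m ⟨-, hm⟩
    let _ : Field (B ⧸ m) := Ideal.Quotient.field m
    have hfin : Module.Finite Ω (B ⧸ m) := finite_of_finite_type_of_isJacobsonRing Ω (B ⧸ m)
    let e : Ω ≃ₐ[Ω] (B ⧸ m) := AlgEquiv.ofBijective (Algebra.ofId Ω (B ⧸ m))
      IsAlgClosed.algebraMap_bijective_of_isIntegral
    have h1 := h ((((e.symm : (B ⧸ m) →ₐ[Ω] Ω).comp (Ideal.Quotient.mkₐ Ω m)).restrictScalars R).comp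
      Algebra.TensorProduct.includeRight)
    exact Ideal.Quotient.eq_zero_iff_mem.mp ((map_eq_zero_iff _ e.symm.injective).mp h1)
  obtain ⟨n, hn⟩ := hnil
  have hpow : ∀ m, F ^ m = 0 → (1 : B) = 0 := fun m hm => by
    induction m with
    | zero => rwa [pow_zero] at hm
    | succ m ih => exact ih (hinj (by simpa only [mul_zero, ← pow_succ'] using hm))
  let ψ : B →ₐ[Ω] Ω := Algebra.TensorProduct.lift (AlgHom.id Ω Ω) φ₀ fun _ _ => Commute.all _ _
  have h1 := congrArg ψ (hpow n hn)
  rw [map_one, map_zero] at h1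
  exact one_ne_zero h1

/-- A variant for ring homomorphisms. -/
theorem exists_ringHom_ne_zero {R A S Ω : Type u} [CommRing R] [CommRing A] [CommRing S] [Field Ω]
    [IsAlgClosed Ω] (e : R →+* A) (he : e.FiniteType) (q : A →+* S) (hq : Function.Surjective q) {f : A}
    (hf : f ∈ nonZeroDivisors A) (hker : RingHom.ker q = Ideal.span {f}) (hflat : (q.comp e).Flat)
    (χ₀ : A →+* Ω) : ∃ χ : A →+* Ω, χ.comp e = χ₀.comp e ∧ χ f ≠ 0 := by
  let _ : Algebra R A := e.toAlgebra
  let _ : Algebra R S := (q.comp e).toAlgebra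
  let _ : Algebra R Ω := (χ₀.comp e).toAlgebra
  have : Algebra.FiniteType R A := he
  have : Module.Flat R S := hflat
  let q' : A →ₐ[R] S := { q with commutes' := fun _ => rfl }
  let φ₀ : A →ₐ[R] Ω := { χ₀ with commutes' := fun _ => rfl }
  have h1 : Module.Flat R (A ⧸ RingHom.ker q') :=
    Module.Flat.of_linearEquiv (Ideal.quotientKerAlgEquivOfSurjective (f := q') hq).toLinearEquiv
  obtain ⟨φ, hφ⟩ := exists_algHom_ne_zero (R := R) hf (by rw [← hker]; exact h1) φ₀
  exact ⟨φ, φ.comp_algebraMap, hφ⟩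

theorem specMap_appLE_fromSpec' {X : Scheme.{u}} {R : CommRingCat.{u}} (p : Spec R ⟶ X) {U : X.Opens}
    (hU : IsAffineOpen U) (i : ⊤ ≤ p ⁻¹ᵁ U) :
    Spec.map (p.appLE U ⊤ i ≫ (Scheme.ΓSpecIso R).hom) ≫ hU.fromSpec = p := by
  rw [Spec.map_comp, Category.assoc, IsAffineOpen.SpecMap_appLE_fromSpec p hU (isAffineOpen_top _),
    IsAffineOpen.fromSpec_top, Scheme.isoSpec_Spec_inv, ← Spec.map_comp_assoc, Iso.inv_hom_id, Spec.map_id,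
    Category.id_comp]

/-- The fibre of `π` through `w` contains a point at which the equation `f` does not vanish. -/
theorem exists_comp_eq_of_flat {X P : Scheme.{u}} {Ω : Type u} [Field Ω] [IsAlgClosed Ω]
    {I : X.IdealSheafData} (π : X ⟶ P) [LocallyOfFiniteType π] [hfl : Flat (I.subschemeι ≫ π)]
    {V : P.Opens} (hV : IsAffineOpen V) (U : X.affineOpens) (hUV : U.1 ≤ π ⁻¹ᵁ V) {f : Γ(X, U.1)}
    (hf : f ∈ nonZeroDivisors Γ(X, U.1)) (hfI : I.ideal U = Ideal.span {f})
    (w : Spec (CommRingCat.of Ω) ⟶ X) (hw : ⊤ ≤ w ⁻¹ᵁ U.1) :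
    ∃ p : Spec (CommRingCat.of Ω) ⟶ X, p ≫ π = w ≫ π ∧ I.comap p ≠ ⊥ := by
  obtain ⟨χ, h1, h2⟩ := exists_ringHom_ne_zero (π.appLE V U.1 hUV).hom
    (π.finiteType_appLE hV U.2 hUV) (I.subschemeι.app U).hom (I.subschemeι_app_surjective U) hf
    ((I.ker_subschemeι_app U).trans hfI) (by
      have h1 := hfl.flat_appLE hV (U.2.preimage I.subschemeι) (I.subschemeι.preimage_mono hUV)
      rwa [← Scheme.Hom.appLE_comp_appLE _ _ _ U.1 _ hUV le_rfl, ← Scheme.Hom.app_eq_appLE] at h1)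
    (w.appLE U.1 ⊤ hw ≫ (Scheme.ΓSpecIso _).hom).hom
  have hπ : ∀ φ : Γ(X, U.1) ⟶ CommRingCat.of Ω, (Spec.map φ ≫ U.2.fromSpec) ≫ π =
      Spec.map (π.appLE V U.1 hUV ≫ φ) ≫ hV.fromSpec := fun φ => by
    rw [Category.assoc, ← IsAffineOpen.SpecMap_appLE_fromSpec π hV U.2 hUV, Spec.map_comp, Category.assoc]
  set p := Spec.map (CommRingCat.ofHom χ) ≫ U.2.fromSpec with hp
  have hpU : ⊤ ≤ p ⁻¹ᵁ U.1 := fun x _ => by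
    have : p x ∈ Set.range U.2.fromSpec := ⟨_, rfl⟩
    rwa [U.2.range_fromSpec] at this
  refine ⟨p, ?_, fun h => h2 ?_⟩
  · conv_rhs => rw [← specMap_appLE_fromSpec' w U.2 hw]
    rw [hp, hπ, hπ]
    congr 2
    ext1
    exact h1
  · have h3 : p.appLE U.1 ⊤ hpU ≫ (Scheme.ΓSpecIso _).hom = CommRingCat.ofHom χ :=
      by
      have hm : IsOpenImmersion U.2.fromSpec := U.2.isOpenImmersion_fromSpec
      exact Spec.map_injective ((cancel_mono U.2.fromSpec).mp (specMap_appLE_fromSpec' p U.2 hpU))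
    have h4 : f ∈ p.ker.ideal U := (comap_eq_bot_iff p I).mp h U (hfI ▸ Ideal.mem_span_singleton_self f)
    rw [Scheme.Hom.ker_apply] at h4
    have h5 : (p.appLE U.1 ⊤ hpU).hom f = 0 := by
      rw [Scheme.Hom.appLE, CommRingCat.hom_comp, RingHom.comp_apply, show (p.app U.1).hom f = 0 from h4, map_zero]
    have h6 := congrArg (fun φ => φ.hom f) h3
    refine h6.symm.trans ?_
    rw [CommRingCat.hom_comp, RingHom.comp_apply, h5, map_zero]

variable {k : Type u} [Field k] {Ω : Type u} [Field Ω] [Algebra k Ω]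

/-- A relative effective Cartier divisor contains no nonempty geometric fibre. -/
theorem exists_point_comap_ne_bot [IsAlgClosed Ω] {X P : Sch k} {I : X.left.IdealSheafData}
    (hI : IsEffectiveCartier I) (π : X ⟶ P) [LocallyOfFiniteType π.left] (hfl : Flat (I.subschemeι ≫ π.left))
    (w : pt k Ω ⟶ X) : ∃ p : pt k Ω ⟶ X, p ≫ π = w ≫ π ∧ I.comap p.left ≠ ⊥ := by
  have hpt : IsAffine (pt k Ω).left := inferInstanceAs (IsAffine (specK k Ω).left)
  obtain ⟨w₀⟩ : Nonempty (pt k Ω).left := inferInstanceAs (Nonempty (PrimeSpectrum Ω))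
  have hsub : Subsingleton (pt k Ω).left := inferInstanceAs (Subsingleton (PrimeSpectrum Ω))
  obtain ⟨V, hV, hwV⟩ : ∃ V : P.left.Opens, IsAffineOpen V ∧ (w ≫ π).left w₀ ∈ V := by
    obtain ⟨V, hV, h, -⟩ := TopologicalSpace.Opens.isBasis_iff_nbhd.mp
      P.left.isBasis_affineOpens (show (w ≫ π).left w₀ ∈ ⊤ from trivial)
    exact ⟨V, hV, h⟩
  obtain ⟨U₀, hA, hwU, hle, f, hf, hfI⟩ := hI.exists_local (w.left w₀) (π.left ⁻¹ᵁ V) hwV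
  rw [ideal_comap_opnι] at hfI
  let U : X.left.affineOpens :=
    ⟨(opnι X U₀).left ''ᵁ ⊤, (isAffineOpen_top _).image_of_isOpenImmersion _⟩
  have hUV : U.1 ≤ π.left ⁻¹ᵁ V := by
    change U₀.ι ''ᵁ ⊤ ≤ _
    rwa [Scheme.Opens.ι_image_top]
  have hwU' : w.left w₀ ∈ U.1 := ⟨⟨_, hwU⟩, trivial, rfl⟩
  obtain ⟨p, hp, hpI⟩ := exists_comp_eq_of_flat π.left hV U hUV hf hfI w.left
    fun x _ => Subsingleton.elim w₀ x ▸ hwU'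
  have h1 : p ≫ π.left ≫ P.hom = (w.left ≫ π.left) ≫ P.hom :=
    (Category.assoc _ _ _).symm.trans (congrArg (· ≫ P.hom) hp)
  exact ⟨Over.homMk p ((congrArg (p ≫ ·) (Over.w π).symm).trans (h1.trans (Over.w (w ≫ π)))),
    Over.OverMorphism.ext hp, hpI⟩

variable {C₁ C₂ C P : Sch k} {𝒟 : ((C₁ ⊗ C₂) ⊗ P).left.IdealSheafData} {ι : C ⟶ P}
  {K : Type u} [Field K] [Algebra k K]

/-- No divisor of the family is everything. -/
theorem exists_not_inc [IsAlgClosed Ω] [IsProper C₁.hom] [IsProper C₂.hom]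
    (h𝒟 : IsBidegreeOneOne C₁ C₂ P 𝒟) (x : pt k Ω ⟶ C₁) (y : pt k Ω ⟶ C₂) (z : pt k Ω ⟶ C) :
    ∃ (x' : pt k Ω ⟶ C₁) (y' : pt k Ω ⟶ C₂), ¬ Inc 𝒟 ι x' y' z := by
  have h1 := isProper_tensor (X := C₁) (Y := C₂)
  have h2 : LocallyOfFiniteType (snd (C₁ ⊗ C₂) P).left :=
    inferInstanceAs (LocallyOfFiniteType (Limits.pullback.snd (C₁ ⊗ C₂).hom P.hom))
  obtain ⟨p, hp, hpI⟩ := exists_point_comap_ne_bot h𝒟.cartier (snd (C₁ ⊗ C₂) P) h𝒟.flat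
    (lift (lift x y) (z ≫ ι))
  refine ⟨p ≫ fst _ _ ≫ fst _ _, p ≫ fst _ _ ≫ snd _ _, fun h => hpI ?_⟩
  have h3 : lift (lift (p ≫ fst _ _ ≫ fst _ _) (p ≫ fst _ _ ≫ snd _ _)) (z ≫ ι) = p := by
    rw [lift_snd] at hp
    refine CartesianMonoidalCategory.hom_ext _ _ (CartesianMonoidalCategory.hom_ext _ _ ?_ ?_) ?_ <;>
      simp [hp]
  rwa [Inc, h3] at h

/-- The trilinear form of the incidence relation; no divisor of the family is everything. -/
theorem exists_tri_nondeg (c₁ : SplitConic k K C₁) (c₂ : SplitConic k K C₂)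
    (c₃ : SplitConic k K C) (h𝒟 : IsBidegreeOneOne C₁ C₂ P 𝒟) (hι : IsDegreeOne 𝒟 ι) :
    ∃ f : Fin 2 → Fin 2 → Fin 2 → K, (∀ (x : pt k K ⟶ C₁) (y : pt k K ⟶ C₂)
      (z : pt k K ⟶ C) (s t r : Fin 2 → K), s ≠ 0 → t ≠ 0 → r ≠ 0 → c₁.At x s → c₂.At y t → c₃.At z r →
        (Inc 𝒟 ι x y z ↔ tri f s t r = 0)) ∧ ∀ r : Fin 2 → K, r ≠ 0 → ∃ i j, f i j 0 * r 0 + f i j 1 * r 1 ≠ 0 := by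
  let Ω := AlgebraicClosure K
  obtain ⟨f, hf⟩ := exists_tri (Ω := Ω) c₁ c₂ c₃ h𝒟 hι
  have hinj := (algebraMap K Ω).injective
  have hne : ∀ {s : Fin 2 → K}, s ≠ 0 → (fun j => algebraMap K Ω (s j)) ≠ 0 := fun hs h =>
    hs (funext fun j => (map_eq_zero_iff _ hinj).mp (congrFun h j))
  refine ⟨f, fun x y z s t r hs ht hr hx hy hz => ?_, fun r hr => ?_⟩
  · let b : K →ₐ[k] Ω := (Algebra.ofId K Ω).restrictScalars k
    have h1 := hf _ _ _ _ _ _ (hne hs) (hne ht) (hne hr) (hx.pull (Algebra.ofId K Ω))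
      (hy.pull (Algebra.ofId K Ω)) (hz.pull (Algebra.ofId K Ω))
    have h2 : Inc 𝒟 ι x y z ↔ Inc 𝒟 ι (specMapK b ≫ x) (specMapK b ≫ y) (specMapK b ≫ z) :=
      ⟨fun h => Inc.pull h _, fun h => Inc.of_pull b hinj h⟩
    rw [h2]
    refine h1.trans ?_
    rw [← map_eq_zero_iff (algebraMap K Ω) hinj]
    simp [tri]
  · by_contra! h
    have hc₁ := c₁.form.closed
    have hc₂ := c₂.form.closed
    have p₁ := isProper_of_closed c₁.i
    have p₂ := isProper_of_closed c₂.i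
    have h10 : (![0, 1] : Fin 2 → Ω) ≠ 0 := ne_zero_of_one 0
    obtain ⟨x₀, -⟩ := c₁.exists_at (unimod_of_ne_zero h10)
    obtain ⟨y₀, -⟩ := c₂.exists_at (unimod_of_ne_zero h10)
    obtain ⟨z, hz⟩ := c₃.exists_at (unimod_of_ne_zero (hne hr))
    obtain ⟨x, y, hxy⟩ := exists_not_inc (ι := ι) h𝒟 x₀ y₀ z
    obtain ⟨s, hs, hx⟩ := c₁.exists_param (L := Ω) x
    obtain ⟨t, ht, hy⟩ := c₂.exists_param (L := Ω) y
    refine hxy ((hf x y z s t _ hs ht (hne hr) hx hy hz).mpr ?_)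
    refine Finset.sum_eq_zero fun i _ => Finset.sum_eq_zero fun j _ => ?_
    have h1 := congrArg (algebraMap K Ω) (h i j)
    rw [map_add, map_mul, map_mul, map_zero] at h1
    rw [Fin.sum_univ_two]
    linear_combination (s i * t j) * h1

end Fibre

/-! ### The Galois action on parameters -/

section Proportional
variable {F : Type*} [Field F]

/-- Two linear maps from a plane that are proportional at each vector, with nonzero factors, are
proportional. -/
theorem exists_smul_of_pointwise {W : Type*} [AddCommGroup W] [Module F W] {f g : Fin 2 → W}
    (h : ∀ s : Fin 2 → F, s ≠ 0 → ∃ c : F, c ≠ 0 ∧ s 0 • f 0 + s 1 • f 1 = c • (s 0 • g 0 + s 1 • g 1)) :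
    ∃ c : F, c ≠ 0 ∧ ∀ j, f j = c • g j := by
  obtain ⟨α, hα, h0⟩ := h ![1, 0] fun h => one_ne_zero (congrFun h 0)
  obtain ⟨β, hβ, h1⟩ := h ![0, 1] fun h => one_ne_zero (congrFun h 1)
  simp only [Matrix.cons_val, one_smul, zero_smul, add_zero, zero_add] at h0 h1
  by_cases hg0 : g 0 = 0
  · exact ⟨β, hβ, fun j => by fin_cases j; exacts [by simp [h0, hg0], h1]⟩
  refine ⟨α, hα, fun j => by
    fin_cases j
    · exact h0
    change f 1 = α • g 1
    rw [h1]
    by_contra hne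
    have hαβ : α - β ≠ 0 := fun h => hne (by rw [sub_eq_zero.mp h])
    by_cases hl : ∃ l : F, g 1 = l • g 0
    · obtain ⟨l, hl⟩ := hl
      obtain ⟨c, hc, h2⟩ := h ![-l, 1] fun h => one_ne_zero (congrFun h 1)
      have h3 : (l * (β - α)) • g 0 = 0 := by
        simp only [Matrix.cons_val, h0, h1, hl, smul_smul] at h2
        rw [← add_smul, ← add_smul, one_mul l, neg_add_cancel, zero_smul, smul_zero] at h2
        rw [← h2]
        congr 1
        ring
      have hl0 : l = 0 := by
        have := (smul_eq_zero.mp h3).resolve_right hg0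
        exact (mul_eq_zero.mp this).resolve_right fun h => hαβ (by rw [← neg_sub, h, neg_zero])
      exact hne (by rw [hl, hl0]; simp)
    · obtain ⟨c, hc, h2⟩ := h ![1, 1] fun h => one_ne_zero (congrFun h 0)
      simp only [Matrix.cons_val, one_smul, h0, h1, smul_add] at h2
      have h3 : (α - c) • g 0 = (c - β) • g 1 := by
        rw [sub_smul, sub_smul, sub_eq_sub_iff_add_eq_add, h2, add_comm]
      by_cases hcβ : c - β = 0
      · rw [hcβ, zero_smul] at h3
        have h4 := (smul_eq_zero.mp h3).resolve_right hg0
        exact hαβ (by linear_combination h4 + hcβ)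
      · exact hl ⟨(c - β)⁻¹ * (α - c), by rw [mul_smul, h3, inv_smul_smul₀ hcβ]⟩⟩

/-- Trilinear forms with the same zeros are proportional. -/
theorem exists_smul_of_tri {f g : Fin 2 → Fin 2 → Fin 2 → F} (h : ∀ s t r : Fin 2 → F, s ≠ 0 → t ≠ 0 →
    r ≠ 0 → (tri f s t r = 0 ↔ tri g s t r = 0)) : ∃ c : F, c ≠ 0 ∧ ∀ i j l, f i j l = c * g i j l := by
  have h3 : ∀ s : Fin 2 → F, s ≠ 0 → ∀ t : Fin 2 → F, t ≠ 0 → ∃ c : F, c ≠ 0 ∧ ∀ l,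
      (fun l => tri f s t (Pi.single l 1)) l = c • (fun l => tri g s t (Pi.single l 1)) l := fun s hs t ht => by
    refine exists_smul_of_pointwise fun r hr => ?_
    have e : ∀ f : Fin 2 → Fin 2 → Fin 2 → F, r 0 • tri f s t (Pi.single 0 1) +
        r 1 • tri f s t (Pi.single 1 1) = tri f s t r := fun f => by
      simp [tri, Fin.sum_univ_two]
      ring
    rw [e, e]
    by_cases h0 : tri g s t r = 0
    · exact ⟨1, one_ne_zero, by rw [(h s t r hs ht hr).mpr h0, h0, smul_zero]⟩
    · exact ⟨tri f s t r / tri g s t r, div_ne_zero (fun h1 => h0 ((h s t r hs ht hr).mp h1)) h0,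
        (div_mul_cancel₀ _ h0).symm⟩
  have h2 : ∀ s : Fin 2 → F, s ≠ 0 → ∃ c : F, c ≠ 0 ∧ ∀ j,
      (fun j l => tri f s (Pi.single j 1) (Pi.single l 1)) j =
        c • (fun j l => tri g s (Pi.single j 1) (Pi.single l 1)) j := fun s hs => by
    refine exists_smul_of_pointwise fun t ht => ?_
    obtain ⟨c, hc, H⟩ := h3 s hs t ht
    refine ⟨c, hc, funext fun l => ?_⟩
    have e : ∀ f : Fin 2 → Fin 2 → Fin 2 → F, t 0 • tri f s (Pi.single 0 1) (Pi.single l 1) +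
        t 1 • tri f s (Pi.single 1 1) (Pi.single l 1) = tri f s t (Pi.single l 1) := fun f => by
      simp [tri, Fin.sum_univ_two]
      ring
    have := H l
    simp only [← e] at this
    exact this
  obtain ⟨c, hc, H⟩ := exists_smul_of_pointwise (F := F) (f := f) (g := g) fun s hs => by
    obtain ⟨c, hc, H⟩ := h2 s hs
    refine ⟨c, hc, funext fun j => funext fun l => ?_⟩
    have e : ∀ f : Fin 2 → Fin 2 → Fin 2 → F, tri f s (Pi.single j 1) (Pi.single l 1) =
        s 0 • f 0 j l + s 1 • f 1 j l := fun f => by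
      fin_cases j <;> fin_cases l <;> simp [tri, Fin.sum_univ_two] <;> ring
    have := congrFun (H j) l
    simp only [e, Pi.smul_apply] at this
    exact this
  exact ⟨c, hc, fun i j l => by rw [H]; rfl⟩

end Proportional

section Galois
variable {k : Type u} [Field k] {K : Type u} [Field K] [Algebra k K]

/-- The weights of the semilinear action on the parameters: an automorphism that moves `θ` acts by
`(s₀, s₁) ↦ (s₁, bs₀)`. -/
def wt {F : Type*} [Field F] (b : F) (ε : Bool) (i : Fin 2) : F := bif ε then ![b, 1] i else 1

/-- The permutation of the parameters. -/
def fl (ε : Bool) (i : Fin 2) : Fin 2 := bif ε then i.rev else i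

/-- The action on the parameters. -/
def act {F : Type*} [Field F] (b : F) (ε : Bool) (s : Fin 2 → F) : Fin 2 → F :=
  bif ε then ![s 1, b * s 0] else s

/-- The automorphism `σ` moves the root `θ` if and only if `ε` is true. -/
def SplitConic.Moves {Y : Sch k} (c : SplitConic k K Y) (σ : K ≃ₐ[k] K) (ε : Bool) : Prop :=
  σ c.θ = bif ε then algebraMap k K c.e - c.θ else c.θ

variable {Y : Sch k} {c : SplitConic k K Y} {σ : K ≃ₐ[k] K} {ε : Bool}

theorem SplitConic.exists_moves (c : SplitConic k K Y) (σ : K ≃ₐ[k] K) : ∃ ε, c.Moves σ ε := by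
  have h1 := congrArg σ c.hθ
  rw [map_pow, map_add, map_mul, AlgEquiv.commutes, AlgEquiv.commutes] at h1
  have h2 : (σ c.θ - c.θ) * (σ c.θ - (algebraMap k K c.e - c.θ)) = 0 := by
    linear_combination h1 - c.hθ
  rcases mul_eq_zero.mp h2 with h | h
  · exact ⟨false, sub_eq_zero.mp h⟩
  · exact ⟨true, sub_eq_zero.mp h⟩

theorem SplitConic.Moves.map_δ (h : c.Moves σ ε) : σ c.δ = bif ε then -c.δ else c.δ := by
  have h1 := congrArg σ c.hδ
  rw [map_mul, map_sub, map_mul, AlgEquiv.commutes, h, map_one, map_ofNat] at h1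
  have h2 : 2 * c.θ - algebraMap k K c.e ≠ 0 := right_ne_zero_of_mul (c.hδ.trans_ne one_ne_zero)
  cases ε
  · exact mul_right_cancel₀ h2 (h1.trans c.hδ.symm)
  · refine mul_right_cancel₀ h2 ?_
    simp only [cond_true] at h1 ⊢
    linear_combination -h1 + c.hδ

theorem SplitConic.hbK (c : SplitConic k K Y) : algebraMap k K c.b ≠ 0 := by simpa using c.hb

theorem act_ne_zero {F : Type*} [Field F] {b : F} (hb : b ≠ 0) {s : Fin 2 → F} (hs : s ≠ 0) :
    act b ε s ≠ 0 := by
  cases ε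
  · exact hs
  · intro h
    have h0 : s 1 = 0 := congrFun h 0
    have h1 : b * s 0 = 0 := congrFun h 1
    exact hs (by ext j; fin_cases j; exacts [(mul_eq_zero.mp h1).resolve_left hb, h0])

/-- Up to a factor, conjugating the point with parameter `s` is the action on parameters. -/
theorem SplitConic.Moves.map_vec (h : c.Moves σ ε) (s : Fin 2 → K) (j : Fin 3) :
    c.vec (act (algebraMap k K c.b) ε fun j => σ (s j)) j =
      (bif ε then algebraMap k K c.b else 1) * σ (c.vec s j) := by
  have h1 := h.map_δ
  have hδ := c.hδ
  rw [SplitConic.Moves] at h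
  cases ε <;> fin_cases j <;>
    simp [SplitConic.vec, parVec, act, h, h1, Algebra.algebraMap_self] <;> ring

theorem SplitConic.Moves.at (h : c.Moves σ ε) {y : pt k K ⟶ Y} {s : Fin 2 → K} (hs : s ≠ 0)
    (hy : c.At y s) : c.At (specMapK (σ : K →ₐ[k] K) ≫ y) (act (algebraMap k K c.b) ε fun j => σ (s j)) := by
  have hσ : (fun j => σ (s j)) ≠ 0 := fun h => hs (funext fun j => by simpa using congrFun h j)
  have h1 := Coord.pull hy (specMapK (σ : K →ₐ[k] K))
  rw [pull_secK] at h1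
  refine Coord.of_prop h1 (unimod_secK (unimod_parVec c.hδ' (isUnit_iff_ne_zero.mpr c.hbK)
    (unimod_of_ne_zero (act_ne_zero c.hbK hσ)))) fun p q => ?_
  have h3 : secK k K (σ (c.vec s p)) * secK k K (c.vec (act (algebraMap k K c.b) ε fun j => σ (s j)) q) =
      secK k K (σ (c.vec s q)) * secK k K (c.vec (act (algebraMap k K c.b) ε fun j => σ (s j)) p) := by
    rw [← map_mul, ← map_mul, h.map_vec, h.map_vec]
    congr 1
    ring
  exact h3

end Galois

/-! ### Equivariance of the trilinear form and Galois descent -/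

section Galois
variable {k : Type u} [Field k] {K : Type u} [Field K] [Algebra k K]

section
variable {F : Type*} [Field F] (b : F) (i : Fin 2)
theorem wt_false : wt b false i = 1 := rfl
theorem wt_true_zero : wt b true 0 = b := rfl
theorem wt_true_one : wt b true 1 = 1 := rfl
theorem fl_false : fl false i = i := rfl
theorem fl_true_zero : fl true 0 = 1 := rfl
theorem fl_true_one : fl true 1 = 0 := rfl
end

theorem tri_act {F : Type*} [Field F] (f : Fin 2 → Fin 2 → Fin 2 → F) (b₁ b₂ b₃ : F) (ε₁ ε₂ ε₃ : Bool)
    (s t r : Fin 2 → F) : tri f (act b₁ ε₁ s) (act b₂ ε₂ t) (act b₃ ε₃ r) =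
      tri (fun i j l => wt b₁ ε₁ i * wt b₂ ε₂ j * wt b₃ ε₃ l * f (fl ε₁ i) (fl ε₂ j) (fl ε₃ l)) s t r := by
  cases ε₁ <;> cases ε₂ <;> cases ε₃ <;>
    simp only [tri, act, wt_false, wt_true_zero, wt_true_one, fl_false, fl_true_zero, fl_true_one,
      Fin.sum_univ_two, cond_true, cond_false, Matrix.cons_val] <;>
    ring

/-- The trilinear form `f` is equivariant up to a factor under the automorphisms of `K` over `k`, which
act on the parameters by `act`. -/
def IsEquivariant {C₁ C₂ C : Sch k} (f : Fin 2 → Fin 2 → Fin 2 → K) (c₁ : SplitConic k K C₁) (c₂ : SplitConic k K C₂)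
    (c₃ : SplitConic k K C) : Prop :=
  ∀ (σ : K ≃ₐ[k] K) (ε₁ ε₂ ε₃ : Bool), c₁.Moves σ ε₁ → c₂.Moves σ ε₂ → c₃.Moves σ ε₃ →
    ∃ μ : K, μ ≠ 0 ∧ ∀ i j l, σ (f i j l) = μ * (wt (algebraMap k K c₁.b) ε₁ i *
      wt (algebraMap k K c₂.b) ε₂ j * wt (algebraMap k K c₃.b) ε₃ l * f (fl ε₁ i) (fl ε₂ j) (fl ε₃ l))

/-- The trilinear form of the incidence relation is equivariant, as the relation is defined over `k`
and determines the form up to a factor. -/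
theorem exists_tri_galois {C₁ C₂ C P : Sch k} {𝒟 : ((C₁ ⊗ C₂) ⊗ P).left.IdealSheafData} {ι : C ⟶ P}
    (c₁ : SplitConic k K C₁) (c₂ : SplitConic k K C₂) (c₃ : SplitConic k K C)
    (h𝒟 : IsBidegreeOneOne C₁ C₂ P 𝒟) (hι : IsDegreeOne 𝒟 ι) :
    ∃ f : Fin 2 → Fin 2 → Fin 2 → K,
      (∀ r : Fin 2 → K, r ≠ 0 → ∃ i j, f i j 0 * r 0 + f i j 1 * r 1 ≠ 0) ∧
      IsEquivariant f c₁ c₂ c₃ := by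
  obtain ⟨f, hf, hne⟩ := exists_tri_nondeg c₁ c₂ c₃ h𝒟 hι
  refine ⟨f, hne, fun σ ε₁ ε₂ ε₃ m₁ m₂ m₃ => exists_smul_of_tri fun s t r hs' ht' hr' => ?_⟩
  have lift : ∀ s : Fin 2 → K, s ≠ 0 → ∃ s' : Fin 2 → K, s' ≠ 0 ∧ s = fun j => σ (s' j) := fun s hs =>
    ⟨fun j => σ.symm (s j), fun h => hs (funext fun j => by simpa using congrFun h j), by simp⟩
  have hσ : ∀ {s : Fin 2 → K}, s ≠ 0 → (fun j => σ (s j)) ≠ 0 := fun hs h =>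
    hs (funext fun j => by simpa using congrFun h j)
  obtain ⟨s, hs, rfl⟩ := lift s hs'
  obtain ⟨t, ht, rfl⟩ := lift t ht'
  obtain ⟨r, hr, rfl⟩ := lift r hr'
  obtain ⟨x, hx⟩ := c₁.exists_at (unimod_of_ne_zero hs)
  obtain ⟨y, hy⟩ := c₂.exists_at (unimod_of_ne_zero ht)
  obtain ⟨z, hz⟩ := c₃.exists_at (unimod_of_ne_zero hr)
  have h1 := hf x y z s t r hs ht hr hx hy hz
  have h2 := hf _ _ _ _ _ _ (act_ne_zero c₁.hbK (hσ hs)) (act_ne_zero c₂.hbK (hσ ht))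
    (act_ne_zero c₃.hbK (hσ hr)) (m₁.at hs hx) (m₂.at ht hy) (m₃.at hr hz)
  rw [tri_act] at h2
  refine Iff.trans ?_ ((h1.symm.trans
    ⟨fun h => Inc.pull h _, fun h => Inc.of_pull (σ : K →ₐ[k] K) σ.injective h⟩).trans h2)
  have h3 : tri (fun i j l => σ (f i j l)) (fun j => σ (s j)) (fun j => σ (t j)) (fun j => σ (r j)) =
      σ (tri f s t r) := by simp [tri]
  exact (Eq.congr_left h3).trans (map_eq_zero_iff σ σ.injective)

variable [IsGalois k K]

/-- The field of definition of `θ` is `k + kθ`. -/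
theorem SplitConic.exists_eq_add_mul {Y : Sch k} (c : SplitConic k K Y) {y : K}
    (hy : ∀ σ : K ≃ₐ[k] K, c.Moves σ false → σ y = y) :
    ∃ p q : k, y = algebraMap k K p + algebraMap k K q * c.θ := by
  have key : ∀ d : K, (∀ σ : K ≃ₐ[k] K, σ d = d) → ∃ q, algebraMap k K q = d :=
    fun d hd => (InfiniteGalois.mem_range_algebraMap_iff_fixed d).mpr hd
  by_cases hall : ∀ σ : K ≃ₐ[k] K, c.Moves σ false
  · obtain ⟨p, hp⟩ := key y fun σ => hy σ (hall σ)
    exact ⟨p, 0, by simp [hp]⟩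
  push Not at hall
  obtain ⟨τ, hτ⟩ := hall
  obtain ⟨ε, hm⟩ := c.exists_moves τ
  cases ε
  · exact absurd hm hτ
  have hθ : ∀ σ : K ≃ₐ[k] K, c.Moves σ true → σ (τ y) = y ∧ σ y = τ y := fun σ hσ => by
    rw [SplitConic.Moves, cond_true] at hσ hm
    have hinv : σ.symm (τ c.θ) = c.θ := by
      rw [hm, ← hσ, AlgEquiv.symm_apply_apply]
    refine ⟨hy (τ.trans σ) ?_, ?_⟩
    · change σ (τ c.θ) = c.θ
      rw [hm, map_sub, AlgEquiv.commutes, hσ, sub_sub_cancel]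
    · have := hy (τ.trans σ.symm) hinv
      have h2 : σ.symm (τ y) = y := this
      rw [← h2, AlgEquiv.apply_symm_apply, h2]
  have hθ' : ∀ σ : K ≃ₐ[k] K, c.Moves σ false → σ (τ y) = τ y := fun σ hσ => by
    rw [SplitConic.Moves] at hσ hm
    have : τ.symm (σ (τ y)) = y := hy ((τ.trans σ).trans τ.symm) (by
      change τ.symm (σ (τ c.θ)) = c.θ
      rw [hm, cond_true, map_sub, AlgEquiv.commutes, hσ, cond_false, ← cond_true (algebraMap k K c.e - c.θ) c.θ,
        ← hm, AlgEquiv.symm_apply_apply])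
    conv_rhs => rw [← this, AlgEquiv.apply_symm_apply]
  obtain ⟨q, hq⟩ := key ((y - τ y) * c.δ) fun σ => by
    obtain ⟨ε, hσ⟩ := c.exists_moves σ
    rw [map_mul, map_sub, hσ.map_δ]
    cases ε
    · rw [hy σ hσ, hθ' σ hσ]
      rfl
    · rw [(hθ σ hσ).1, (hθ σ hσ).2, cond_true]
      ring
  obtain ⟨p, hp⟩ := key (y - algebraMap k K q * c.θ) fun σ => by
    obtain ⟨ε, hσ⟩ := c.exists_moves σ
    rw [map_sub, map_mul, AlgEquiv.commutes, hσ]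
    cases ε
    · rw [hy σ hσ]
      rfl
    · rw [(hθ σ hσ).2, cond_true, hq]
      linear_combination (y - τ y) * c.hδ
  exact ⟨p, q, by rw [hp, sub_add_cancel]⟩

/-- A vector on which all automorphisms act by scalars is proportional to a vector over `k`. -/
theorem exists_smul_algebraMap {ι : Type*} {R : ι → K} (hR : R ≠ 0)
    (h : ∀ σ : K ≃ₐ[k] K, ∃ κ : K, κ ≠ 0 ∧ ∀ j, σ (R j) = κ * R j) :
    ∃ (R' : ι → k) (c : K), c ≠ 0 ∧ ∀ j, algebraMap k K (R' j) = c * R j := by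
  obtain ⟨q, hq⟩ := Function.ne_iff.mp hR
  have : ∀ j, ∃ p, algebraMap k K p = (R q)⁻¹ * R j := fun j =>
    (InfiniteGalois.mem_range_algebraMap_iff_fixed _).mpr fun σ => by
      obtain ⟨κ, hκ, H⟩ := h σ
      rw [map_mul, map_inv₀, H, H, mul_inv, mul_mul_mul_comm, inv_mul_cancel₀ hκ, one_mul]
  choose R' hR' using this
  exact ⟨R', _, inv_ne_zero hq, hR'⟩

end Galois

/-! ### The Albert relation -/

section Albert
variable {k : Type u} [Field k] {K : Type u} [Field K] [Algebra k K] {C₁ C₂ C : Sch k}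

/-- The Plücker coordinates of the pencil of bilinear forms given by a trilinear form. -/
def plu {F : Type*} [Field F] (f : Fin 2 → Fin 2 → Fin 2 → F) (i j i' j' : Fin 2) : F :=
  f i j 0 * f i' j' 1 - f i j 1 * f i' j' 0

theorem exists_plu_ne_zero {F : Type*} [Field F] {f : Fin 2 → Fin 2 → Fin 2 → F}
    (hf : ∀ r : Fin 2 → F, r ≠ 0 → ∃ i j, f i j 0 * r 0 + f i j 1 * r 1 ≠ 0) :
    ∃ i j i' j', plu f i j i' j' ≠ 0 := by
  obtain ⟨i, j, h⟩ := hf ![1, 0] fun h => one_ne_zero (congrFun h 0)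
  obtain ⟨i', j', h'⟩ := hf ![-f i j 1, f i j 0] fun h0 => h (by
    have := congrFun h0 1
    simpa using this)
  refine ⟨i, j, i', j', fun h0 => h' ?_⟩
  simp only [Matrix.cons_val, plu] at h0 ⊢
  linear_combination h0

variable {c₁ : SplitConic k K C₁} {c₂ : SplitConic k K C₂} {c₃ : SplitConic k K C}
  {f : Fin 2 → Fin 2 → Fin 2 → K}

/-- The Plücker coordinates are equivariant, too. The third conic only contributes to the factor. -/
theorem IsEquivariant.map_plu (h : IsEquivariant f c₁ c₂ c₃) {σ : K ≃ₐ[k] K} {ε₁ ε₂ : Bool}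
    (m₁ : c₁.Moves σ ε₁) (m₂ : c₂.Moves σ ε₂) : ∃ μ : K, μ ≠ 0 ∧ ∀ i j i' j', σ (plu f i j i' j') =
      μ * (wt (algebraMap k K c₁.b) ε₁ i * wt (algebraMap k K c₂.b) ε₂ j *
        (wt (algebraMap k K c₁.b) ε₁ i' * wt (algebraMap k K c₂.b) ε₂ j')) *
          plu f (fl ε₁ i) (fl ε₂ j) (fl ε₁ i') (fl ε₂ j') := by
  obtain ⟨ε₃, m₃⟩ := c₃.exists_moves σ
  obtain ⟨μ, hμ, H⟩ := h σ ε₁ ε₂ ε₃ m₁ m₂ m₃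
  refine ⟨μ ^ 2 * bif ε₃ then -algebraMap k K c₃.b else 1, mul_ne_zero (pow_ne_zero _ hμ) ?_,
    fun i j i' j' => ?_⟩
  · cases ε₃
    exacts [one_ne_zero, neg_ne_zero.mpr c₃.hbK]
  · simp only [plu, map_sub, map_mul, H]
    cases ε₃ <;> simp only [wt_false, wt_true_zero, wt_true_one, fl_false, fl_true_zero, fl_true_one,
      cond_true, cond_false] <;> ring

/-- **Albert's relation** for two conics with a Brauer product: an isotropic vector of the form
`-b₁N₁ ⊥ b₂N₂ ⊥ M` in six variables, where the binary form `M` has discriminant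
`(1 + 4a₁)(1 + 4a₂)`. It consists of the Plücker coordinates of the pencil, after Galois descent, and
the relation is the Plücker relation. -/
theorem IsEquivariant.exists_albert [IsGalois k K] (h : IsEquivariant f c₁ c₂ c₃)
    (hne : ∃ i j i' j', plu f i j i' j' ≠ 0) (he₁ : c₁.e = 1) (he₂ : c₂.e = 1) :
    ∃ v : Fin 6 → k, v ≠ 0 ∧ -(c₁.b * (v 0 ^ 2 + v 0 * v 1 - c₁.a * v 1 ^ 2)) +
      c₂.b * (v 2 ^ 2 + v 2 * v 3 - c₂.a * v 3 ^ 2) + (1 + 4 * c₂.a) * (v 5 ^ 2 + v 5 * v 4) +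
        (c₂.a - c₁.a) * v 4 ^ 2 = 0 := by
  have hb₁ := c₁.hbK
  have hb₂ := c₂.hbK
  have hθ₁ := c₁.hθ
  have hθ₂ := c₂.hθ
  have hδ₁ := c₁.hδ
  have hδ₂ := c₂.hδ
  rw [he₁, map_one] at hθ₁ hδ₁
  rw [he₂, map_one] at hθ₂ hδ₂
  -- Up to a common factor, the automorphisms exchange `G` and `G'`, `H` and `H'`, and `p` and `±p'`. The
  -- vector `R` consists of the combinations on which they act by this factor alone; here
  -- `G = R₀ + θ₁R₁` and `H = R₂ + θ₂R₃`.
  let G := plu f 1 0 1 1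
  let G' := -(plu f 0 0 0 1) * (algebraMap k K c₁.b)⁻¹
  let H := plu f 0 1 1 1
  let H' := -(plu f 0 0 1 0) * (algebraMap k K c₂.b)⁻¹
  let p := plu f 0 0 1 1
  let p' := plu f 0 1 1 0
  let G₁ := (G - G') * c₁.δ
  let H₁ := (H - H') * c₂.δ
  let x := (p - p') * c₁.δ
  let m := ((c₁.θ - c₂.θ) * x - p) * c₂.δ
  let R : Fin 6 → K := ![G - c₁.θ * G₁, G₁, H - c₂.θ * H₁, H₁, x, m]
  have hG₁ : (2 * c₁.θ - 1) * G₁ = G - G' := by linear_combination (G - G') * hδ₁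
  have hH₁ : (2 * c₂.θ - 1) * H₁ = H - H' := by linear_combination (H - H') * hδ₂
  have hx : (2 * c₁.θ - 1) * x = p - p' := by linear_combination (p - p') * hδ₁
  have hm : (2 * c₂.θ - 1) * m = (c₁.θ - c₂.θ) * x - p := by
    linear_combination ((c₁.θ - c₂.θ) * x - p) * hδ₂
  have hR : R ≠ 0 := by
    intro h0
    have e0 : G - c₁.θ * G₁ = 0 := congrFun h0 0
    have e1 : G₁ = 0 := congrFun h0 1
    have e2 : H - c₂.θ * H₁ = 0 := congrFun h0 2
    have e3 : H₁ = 0 := congrFun h0 3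
    have e4 : x = 0 := congrFun h0 4
    have e5 : m = 0 := congrFun h0 5
    have hG : plu f 1 0 1 1 = 0 := by linear_combination e0 + c₁.θ * e1
    have hG' : plu f 0 0 0 1 = 0 := by
      have : G' = 0 := by linear_combination -(2 * c₁.θ - 1) * e1 + hG₁ + hG
      exact neg_eq_zero.mp ((mul_eq_zero.mp this).resolve_right (inv_ne_zero hb₁))
    have hH : plu f 0 1 1 1 = 0 := by linear_combination e2 + c₂.θ * e3
    have hH' : plu f 0 0 1 0 = 0 := by
      have : H' = 0 := by linear_combination -(2 * c₂.θ - 1) * e3 + hH₁ + hH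
      exact neg_eq_zero.mp ((mul_eq_zero.mp this).resolve_right (inv_ne_zero hb₂))
    have hp : plu f 0 0 1 1 = 0 := by
      linear_combination hm - (2 * c₂.θ - 1) * e5 + (c₁.θ - c₂.θ) * e4
    have hp' : plu f 0 1 1 0 = 0 := by linear_combination -(2 * c₁.θ - 1) * e4 + hx + hp
    have hs : ∀ i j i' j', plu f i j i' j' = -plu f i' j' i j := fun i j i' j' => by
      simp only [plu]
      ring
    have hd : ∀ i j, plu f i j i j = 0 := fun i j => by
      simp only [plu]
      ring
    obtain ⟨i, j, i', j', h⟩ := hne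
    refine h ?_
    fin_cases i <;> fin_cases j <;> fin_cases i' <;> fin_cases j' <;>
      first | exact hd _ _ | assumption | (rw [hs]; exact neg_eq_zero.mpr ‹_›)
  obtain ⟨v, κ, hκ, hv⟩ := exists_smul_algebraMap hR fun σ => by
    obtain ⟨ε₁, m₁⟩ := c₁.exists_moves σ
    obtain ⟨ε₂, m₂⟩ := c₂.exists_moves σ
    obtain ⟨μ, hμ, hσ⟩ := h.map_plu m₁ m₂
    have d₁ := m₁.map_δ
    have d₂ := m₂.map_δ
    rw [SplitConic.Moves, he₁, map_one] at m₁
    rw [SplitConic.Moves, he₂, map_one] at m₂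
    refine ⟨μ * (bif ε₁ then -algebraMap k K c₁.b else 1) * (bif ε₂ then -algebraMap k K c₂.b else 1),
      ?_, ?_⟩
    · cases ε₁ <;> cases ε₂ <;> simp [hμ, hb₁, hb₂]
    set κ := μ * (bif ε₁ then -algebraMap k K c₁.b else 1) * (bif ε₂ then -algebraMap k K c₂.b else 1) with hκ
    have eG : σ G = κ * bif ε₁ then G' else G := by
      rw [hσ, hκ]
      cases ε₁ <;> cases ε₂ <;>
        simp only [wt_false, wt_true_zero, wt_true_one, fl_false, fl_true_zero, fl_true_one,
          cond_true, cond_false, G, G', plu] <;> field_simp <;> ring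
    have eG' : σ G' = κ * bif ε₁ then G else G' := by
      rw [map_mul, map_neg, map_inv₀, AlgEquiv.commutes, hσ, hκ]
      cases ε₁ <;> cases ε₂ <;>
        simp only [wt_false, wt_true_zero, wt_true_one, fl_false, fl_true_zero, fl_true_one,
          cond_true, cond_false, G, G', plu] <;> field_simp <;> ring
    have eH : σ H = κ * bif ε₂ then H' else H := by
      rw [hσ, hκ]
      cases ε₁ <;> cases ε₂ <;>
        simp only [wt_false, wt_true_zero, wt_true_one, fl_false, fl_true_zero, fl_true_one,
          cond_true, cond_false, H, H', plu] <;> field_simp <;> ring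
    have eH' : σ H' = κ * bif ε₂ then H else H' := by
      rw [map_mul, map_neg, map_inv₀, AlgEquiv.commutes, hσ, hκ]
      cases ε₁ <;> cases ε₂ <;>
        simp only [wt_false, wt_true_zero, wt_true_one, fl_false, fl_true_zero, fl_true_one,
          cond_true, cond_false, H, H', plu] <;> field_simp <;> ring
    have ep : σ p = κ * (bif ε₂ then -(bif ε₁ then p else p') else bif ε₁ then p' else p) := by
      rw [hσ, hκ]
      cases ε₁ <;> cases ε₂ <;>
        simp only [wt_false, wt_true_zero, wt_true_one, fl_false, fl_true_zero, fl_true_one,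
          cond_true, cond_false, p, p', plu] <;> ring
    have ep' : σ p' = κ * (bif ε₂ then -(bif ε₁ then p' else p) else bif ε₁ then p else p') := by
      rw [hσ, hκ]
      cases ε₁ <;> cases ε₂ <;>
        simp only [wt_false, wt_true_zero, wt_true_one, fl_false, fl_true_zero, fl_true_one,
          cond_true, cond_false, p, p', plu] <;> ring
    clear_value κ G G' H H' p p'
    have eG₁ : σ G₁ = κ * G₁ := by
      rw [map_mul, map_sub, eG, eG', d₁]
      cases ε₁ <;> simp only [cond_true, cond_false] <;> ring
    have eH₁ : σ H₁ = κ * H₁ := by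
      rw [map_mul, map_sub, eH, eH', d₂]
      cases ε₂ <;> simp only [cond_true, cond_false] <;> ring
    have ex : σ x = κ * x := by
      rw [map_mul, map_sub, ep, ep', d₁]
      cases ε₁ <;> cases ε₂ <;> simp only [cond_true, cond_false] <;> ring
    have em : σ m = κ * m := by
      rw [map_mul, map_sub, map_mul, map_sub, ep, ex, d₂, m₁, m₂]
      cases ε₁ <;> cases ε₂ <;> simp only [cond_true, cond_false]
      · ring
      · linear_combination (-κ * c₂.δ) * hx
      · linear_combination (-κ * c₂.δ) * hx
      · ring
    intro j
    fin_cases j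
    · change σ (G - c₁.θ * G₁) = κ * (G - c₁.θ * G₁)
      rw [map_sub, map_mul, eG, eG₁, m₁]
      cases ε₁ <;> simp only [cond_true, cond_false]
      · ring
      · linear_combination κ * hG₁
    · exact eG₁
    · change σ (H - c₂.θ * H₁) = κ * (H - c₂.θ * H₁)
      rw [map_sub, map_mul, eH, eH₁, m₂]
      cases ε₂ <;> simp only [cond_true, cond_false]
      · ring
      · linear_combination κ * hH₁
    · exact eH₁
    · exact ex
    · exact em
  -- The Plücker relation.
  have hP : -(algebraMap k K c₁.b * (G * G')) + algebraMap k K c₂.b * (H * H') + p * p' = 0 := by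
    simp only [G, G', H, H', p, p', plu]
    field_simp
    ring
  refine ⟨v, fun h0 => hR (funext fun j => ?_), (algebraMap k K).injective ?_⟩
  · have := hv j
    rw [h0, Pi.zero_apply, map_zero] at this
    exact (mul_eq_zero.mp this.symm).resolve_left hκ
  have v0 : algebraMap k K (v 0) = κ * (G - c₁.θ * G₁) := hv 0
  have v1 : algebraMap k K (v 1) = κ * G₁ := hv 1
  have v2 : algebraMap k K (v 2) = κ * (H - c₂.θ * H₁) := hv 2
  have v3 : algebraMap k K (v 3) = κ * H₁ := hv 3
  have v4 : algebraMap k K (v 4) = κ * x := hv 4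
  have v5 : algebraMap k K (v 5) = κ * m := hv 5
  simp only [map_add, map_sub, map_mul, map_neg, map_pow, map_one, map_zero, map_ofNat, v0, v1, v2, v3, v4, v5]
  have n₁ : (G - c₁.θ * G₁) ^ 2 + (G - c₁.θ * G₁) * G₁ - algebraMap k K c₁.a * G₁ ^ 2 = G * G' := by
    linear_combination G₁ ^ 2 * hθ₁ - G * hG₁
  have n₂ : (H - c₂.θ * H₁) ^ 2 + (H - c₂.θ * H₁) * H₁ - algebraMap k K c₂.a * H₁ ^ 2 = H * H' := by
    linear_combination H₁ ^ 2 * hθ₂ - H * hH₁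
  have n₃ : (1 + 4 * algebraMap k K c₂.a) * (m ^ 2 + m * x) +
      (algebraMap k K c₂.a - algebraMap k K c₁.a) * x ^ 2 = p * p' := by
    have e1 : p = (c₁.θ - c₂.θ) * x - (2 * c₂.θ - 1) * m := by linear_combination hm
    have e2 : p' = p - (2 * c₁.θ - 1) * x := by linear_combination hx
    rw [e2, e1]
    linear_combination (x ^ 2) * hθ₁ - (x ^ 2 + 4 * (m ^ 2 + m * x)) * hθ₂
  linear_combination κ ^ 2 * (hP - algebraMap k K c₁.b * n₁ + algebraMap k K c₂.b * n₂ + n₃)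

end Albert

/-! ### A common quadratic algebra -/

section CommonRoot
variable {k : Type u} [Field k] {L : Type u} [Field L] [Algebra k L]

/-- The conic `qf e a b` has a point with coordinates in `k + kρ`. -/
def HasPt (e a b : k) (ρ : L) : Prop :=
  ∃ z : Fin 3 → L, z ≠ 0 ∧ (∀ j, ∃ c d : k, z j = algebraMap k L c + algebraMap k L d * ρ) ∧
    qv (algebraMap k L e) (algebraMap k L a) (algebraMap k L b) z = 0

theorem HasPt.of_add {e a b m : k} {ρ : L} (h : HasPt e a b (ρ + algebraMap k L m)) : HasPt e a b ρ := by
  obtain ⟨z, hz, hc, h0⟩ := h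
  refine ⟨z, hz, fun j => ?_, h0⟩
  obtain ⟨c, d, h⟩ := hc j
  exact ⟨c + d * m, d, by rw [h, map_add, map_mul]; ring⟩

theorem HasPt.of_base {e a b ρ₀ : k} (h : HasPt e a b ρ₀) (ρ : L) : HasPt e a b ρ := by
  obtain ⟨z, hz, -, h0⟩ := h
  refine ⟨fun j => algebraMap k L (z j), fun h => hz (funext fun j => ?_), fun j => ⟨z j, 0, by simp⟩, ?_⟩
  · exact (map_eq_zero_iff _ (algebraMap k L).injective).mp (congrFun h j)
  · rw [← qv_map]
    exact (congrArg _ h0).trans (map_zero _)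

theorem hasPt_root {e a b : k} {ρ : L} (hρ : ρ ^ 2 = algebraMap k L e * ρ + algebraMap k L a) : HasPt e a b ρ := by
  refine ⟨![ρ, -1, 0], fun h => ?_, fun j => ?_, ?_⟩
  · exact one_ne_zero (neg_eq_zero.mp (congrFun h 1))
  · fin_cases j
    exacts [⟨0, 1, by simp⟩, ⟨-1, 0, by simp⟩, ⟨0, 0, by simp⟩]
  · simp only [qv, Matrix.cons_val]
    linear_combination hρ

/-- If `N(ρ, -x) = bN(g)`, then `(ρ, -x) / g` is a point of the conic `N = b`. -/
theorem hasPt_of_norm {a b x g₀ g₁ : k} {ρ : L} (hρ : ρ ^ 2 = algebraMap k L x * ρ +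
    algebraMap k L (a * x ^ 2 + b * (g₀ ^ 2 + g₀ * g₁ - a * g₁ ^ 2)))
    (hne : ¬(g₀ = 0 ∧ g₁ = 0 ∧ x = 0 ∧ ρ = 0)) : HasPt 1 a b ρ := by
  have hinj : ∀ {c : k}, algebraMap k L c = 0 → c = 0 := fun h =>
    (map_eq_zero_iff _ (algebraMap k L).injective).mp h
  simp only [map_add, map_mul, map_sub, map_pow] at hρ
  by_cases hN : g₀ ^ 2 + g₀ * g₁ - a * g₁ ^ 2 = 0
  · have hN' := congrArg (algebraMap k L) hN
    simp only [map_add, map_mul, map_sub, map_pow, map_zero] at hN'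
    by_cases hg : g₀ = 0 ∧ g₁ = 0
    · refine ⟨![ρ, -algebraMap k L x, 0], fun h => hne ⟨hg.1, hg.2, ?_, congrFun h 0⟩, fun j => ?_, ?_⟩
      · exact hinj (neg_eq_zero.mp (congrFun h 1))
      · fin_cases j
        exacts [⟨0, 1, by simp⟩, ⟨-x, 0, by simp⟩, ⟨0, 0, by simp⟩]
      · simp only [qv, Matrix.cons_val, map_one]
        linear_combination hρ + algebraMap k L b * hN'
    · refine ⟨![algebraMap k L g₀, algebraMap k L g₁, 0], fun h => hg
        ⟨hinj (congrFun h 0), hinj (congrFun h 1)⟩, fun j => ?_, ?_⟩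
      · fin_cases j
        exacts [⟨g₀, 0, by simp⟩, ⟨g₁, 0, by simp⟩, ⟨0, 0, by simp⟩]
      · simp only [qv, Matrix.cons_val, map_one]
        linear_combination hN'
  · refine ⟨![ρ * algebraMap k L (g₀ + g₁) + algebraMap k L (a * x * g₁),
      -(ρ * algebraMap k L g₁) - algebraMap k L (x * g₀),
      algebraMap k L (g₀ ^ 2 + g₀ * g₁ - a * g₁ ^ 2)], fun h => hN (hinj (congrFun h 2)), fun j => ?_, ?_⟩
    · fin_cases j
      exacts [⟨a * x * g₁, g₀ + g₁, by simp; ring⟩, ⟨-(x * g₀), -g₁, by simp; ring⟩, ⟨g₀ ^ 2 + g₀ * g₁ - a * g₁ ^ 2, 0, by simp⟩]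
    · simp only [qv, Matrix.cons_val, map_add, map_mul, map_sub, map_pow, map_one]
      linear_combination (algebraMap k L g₀ ^ 2 + algebraMap k L g₀ * algebraMap k L g₁ -
        algebraMap k L a * algebraMap k L g₁ ^ 2) * hρ

/-- The six-dimensional quadratic form of Albert's relation. Its zeros are used through `hasPt_of_norm`,
with a root `ρ` of `t² - v₄t - (a₁v₄² + b₁N₁(v₀, v₁))` for the first conic and `ρ + v₅` for the second. -/
def albert (a₁ b₁ a₂ b₂ : k) (v : Fin 6 → k) : k :=
  -(b₁ * (v 0 ^ 2 + v 0 * v 1 - a₁ * v 1 ^ 2)) + b₂ * (v 2 ^ 2 + v 2 * v 3 - a₂ * v 3 ^ 2) +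
    (1 + 4 * a₂) * (v 5 ^ 2 + v 5 * v 4) + (a₂ - a₁) * v 4 ^ 2

variable {a₁ b₁ a₂ b₂ : k} {v : Fin 6 → k}

theorem hasPt_of_albert₁ {ρ : L} (hρ : ρ ^ 2 = algebraMap k L (v 4) * ρ +
    algebraMap k L (a₁ * v 4 ^ 2 + b₁ * (v 0 ^ 2 + v 0 * v 1 - a₁ * v 1 ^ 2)))
    (hne : ¬(v 0 = 0 ∧ v 1 = 0 ∧ v 4 = 0 ∧ ρ = 0)) : HasPt 1 a₁ b₁ ρ :=
  hasPt_of_norm hρ hne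

theorem hasPt_of_albert₂ (hv : albert a₁ b₁ a₂ b₂ v = 0) {ρ : L} (hρ : ρ ^ 2 = algebraMap k L (v 4) * ρ +
    algebraMap k L (a₁ * v 4 ^ 2 + b₁ * (v 0 ^ 2 + v 0 * v 1 - a₁ * v 1 ^ 2)))
    (hne : ¬(v 2 = 0 ∧ v 3 = 0 ∧ 2 * v 5 + v 4 = 0 ∧ ρ + algebraMap k L (v 5) = 0)) : HasPt 1 a₂ b₂ ρ := by
  refine HasPt.of_add (m := v 5) (hasPt_of_norm (x := 2 * v 5 + v 4) ?_ hne)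
  have h := congrArg (algebraMap k L) hv
  simp only [albert, map_add, map_mul, map_sub, map_pow, map_neg, map_zero, map_one, map_ofNat] at h hρ ⊢
  linear_combination hρ - h

theorem exists_common_of_disc (hv : albert a₁ b₁ a₂ b₂ v = 0)
    (hD : v 4 ^ 2 + 4 * (a₁ * v 4 ^ 2 + b₁ * (v 0 ^ 2 + v 0 * v 1 - a₁ * v 1 ^ 2)) ≠ 0) :
    ∃ e a : k, e ^ 2 + 4 * a ≠ 0 ∧ ∀ (L : Type u) [Field L] [Algebra k L] (ρ : L),
      ρ ^ 2 = algebraMap k L e * ρ + algebraMap k L a → HasPt 1 a₁ b₁ ρ ∧ HasPt 1 a₂ b₂ ρ := by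
  refine ⟨_, _, hD, fun L _ _ ρ hρ => ⟨hasPt_of_albert₁ hρ ?_, hasPt_of_albert₂ hv hρ ?_⟩⟩
  · rintro ⟨h0, h1, h4, -⟩
    exact hD (by rw [h0, h1, h4]; ring)
  · rintro ⟨h2, h3, h4, -⟩
    rw [albert, h2, h3] at hv
    exact hD (by linear_combination -4 * hv + (1 + 4 * a₂) * (2 * v 5 + v 4) * h4)

/-- Two conics whose Albert form has an isotropic vector have points in a common separable quadratic
algebra. -/
theorem exists_common_root (hb₁ : b₁ ≠ 0) (hb₂ : b₂ ≠ 0) (hD₁ : 1 + 4 * a₁ ≠ 0) (hD₂ : 1 + 4 * a₂ ≠ 0)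
    (hv0 : v ≠ 0) (hv : albert a₁ b₁ a₂ b₂ v = 0) :
    ∃ e a : k, e ^ 2 + 4 * a ≠ 0 ∧ ∀ (L : Type u) [Field L] [Algebra k L] (ρ : L),
      ρ ^ 2 = algebraMap k L e * ρ + algebraMap k L a → HasPt 1 a₁ b₁ ρ ∧ HasPt 1 a₂ b₂ ρ := by
  by_cases hD : v 4 ^ 2 + 4 * (a₁ * v 4 ^ 2 + b₁ * (v 0 ^ 2 + v 0 * v 1 - a₁ * v 1 ^ 2)) ≠ 0
  · exact exists_common_of_disc hv hD
  rw [not_not] at hD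
  have hex : v 0 ≠ 0 ∨ v 1 ≠ 0 ∨ v 2 ≠ 0 ∨ v 3 ≠ 0 ∨ v 4 ≠ 0 ∨ v 5 ≠ 0 := by
    by_contra! h
    exact hv0 (funext fun j => by fin_cases j; exacts [h.1, h.2.1, h.2.2.1, h.2.2.2.1, h.2.2.2.2.1, h.2.2.2.2.2])
  by_cases h2 : (2 : k) = 0
  · -- In characteristic two, the vector is moved along a line of isotropic vectors to one
    -- with `v 4 = 1`.
    have h4 : v 4 = 0 := pow_eq_zero_iff two_ne_zero |>.mp (by linear_combination hD - 2 * (a₁ * v 4 ^ 2 + b₁ *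
      (v 0 ^ 2 + v 0 * v 1 - a₁ * v 1 ^ 2)) * h2)
    obtain ⟨p, q, r, s, hw⟩ : ∃ p q r s : k,
        -(b₁ * (v 0 * q + v 1 * p)) + b₂ * (v 2 * s + v 3 * r) + v 5 = -1 := by
      by_cases h0 : v 0 = 0
      swap
      · exact ⟨0, (1 + v 5) / (b₁ * v 0), 0, 0, by field_simp; ring⟩
      by_cases h1 : v 1 = 0
      swap
      · exact ⟨(1 + v 5) / (b₁ * v 1), 0, 0, 0, by field_simp; ring⟩
      by_cases h2' : v 2 = 0
      swap
      · exact ⟨0, 0, 0, -(1 + v 5) / (b₂ * v 2), by field_simp; ring⟩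
      by_cases h3 : v 3 = 0
      swap
      · exact ⟨0, 0, -(1 + v 5) / (b₂ * v 3), 0, by field_simp; ring⟩
      rw [albert, h0, h1, h2', h3, h4] at hv
      have h5 : v 5 = 0 := pow_eq_zero_iff two_ne_zero |>.mp
        ((mul_eq_zero.mp (show (1 + 4 * a₂) * v 5 ^ 2 = 0 by linear_combination hv)).resolve_left hD₂)
      simp_all
    let l := albert a₁ b₁ a₂ b₂ ![p, q, r, s, 1, 0]
    refine exists_common_of_disc (a₂ := a₂) (b₂ := b₂)
      (v := ![l * v 0 + p, l * v 1 + q, l * v 2 + r, l * v 3 + s, 1, l * v 5]) ?_ ?_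
    · have hl : albert a₁ b₁ a₂ b₂ ![p, q, r, s, 1, 0] = l := rfl
      clear_value l
      simp only [albert, Matrix.cons_val, h4] at hl hv ⊢
      linear_combination l ^ 2 * hv + l * hw + hl + l * (-(b₁ * (v 0 * p - a₁ * v 1 * q)) +
        b₂ * (v 2 * r - a₂ * v 3 * s) + 2 * a₂ * v 5) * h2
    · intro h
      simp only [Matrix.cons_val] at h
      refine one_ne_zero (α := k) ?_
      linear_combination h - 2 * (a₁ * 1 ^ 2 + b₁ * ((l * v 0 + p) ^ 2 + (l * v 0 + p) * (l * v 1 + q) -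
        a₁ * (l * v 1 + q) ^ 2)) * h2
  · -- Otherwise one of the conics has a rational point, and the other one has a point over the algebra
    -- of its own normal form.
    have hρ : (v 4 / 2) ^ 2 = algebraMap k k (v 4) * (v 4 / 2) +
        algebraMap k k (a₁ * v 4 ^ 2 + b₁ * (v 0 ^ 2 + v 0 * v 1 - a₁ * v 1 ^ 2)) := by
      simp only [Algebra.algebraMap_self, RingHom.id_apply]
      field_simp
      linear_combination -hD
    by_cases h1 : v 0 = 0 ∧ v 1 = 0 ∧ v 4 = 0
    · have hpt : HasPt 1 a₂ b₂ (v 4 / 2) := hasPt_of_albert₂ hv hρ (by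
        rintro ⟨e2, e3, e4, -⟩
        rw [h1.2.2, add_zero] at e4
        have e5 := (mul_eq_zero.mp e4).resolve_left h2
        simp_all)
      exact ⟨1, a₁, by simpa using hD₁, fun L _ _ ρ hρ => ⟨hasPt_root hρ, hpt.of_base ρ⟩⟩
    · have hpt : HasPt 1 a₁ b₁ (v 4 / 2) := hasPt_of_albert₁ hρ fun h => h1 ⟨h.1, h.2.1, h.2.2.1⟩
      exact ⟨1, a₂, by simpa using hD₂, fun L _ _ ρ hρ => ⟨hpt.of_base ρ, hasPt_root hρ⟩⟩

end CommonRoot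

/-! ### The third conic -/

section Third
variable {k : Type u} [Field k] {K : Type u} [Field K] [Algebra k K] {C₁ C₂ C : Sch k}

theorem SplitConic.vec_smul {Y : Sch k} (c : SplitConic k K Y) (l : K) (s : Fin 2 → K) (p : Fin 3) :
    c.vec (l • s) p = l ^ 2 * c.vec s p := by
  fin_cases p <;> simp [SplitConic.vec, parVec] <;> ring

theorem qv_smul {R : Type*} [CommRing R] (e a b l : R) (v : Fin 3 → R) :
    qv e a b (fun p => l * v p) = l ^ 2 * qv e a b v := by
  simp only [qv]
  ring

variable {c₁ : SplitConic k K C₁} {c₂ : SplitConic k K C₂} {c₃ : SplitConic k K C}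
  {f : Fin 2 → Fin 2 → Fin 2 → K} [IsGalois k K]

/-- If the first two conics are split by the same quadratic algebra, so is the third: over it, the
pencil has a member through a point of `C₁ × C₂` that is defined over this algebra. -/
theorem IsEquivariant.hasPt_third (h : IsEquivariant f c₁ c₂ c₃) (hθ : ∀ σ, c₁.Moves σ false → c₂.Moves σ false)
    {i j : Fin 2} {l : Fin 2} (hf : f i j l ≠ 0) : HasPt c₃.e c₃.a c₃.b c₁.θ := by
  -- The zero of the linear form `f i j` is preserved by the automorphisms that fix `θ`.
  set r : Fin 2 → K := ![f i j 1, -f i j 0] with hr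
  have hδ := c₃.hδ' (A := K)
  have hu : ∃ q, c₃.vec r q ≠ 0 := by
    by_contra! hv
    have h1 := parVec_fst (b := algebraMap k K c₃.b) hδ r
    have h2 := parVec_snd (b := algebraMap k K c₃.b) hδ r
    change c₃.vec r 0 + _ * c₃.vec r 1 = _ at h1
    change c₃.vec r 0 + _ * c₃.vec r 1 = _ at h2
    rw [hv, hv] at h1 h2
    have e1 : f i j 0 = 0 := by simpa [hr] using h1.symm
    have e2 : f i j 1 = 0 := by simpa [hr, c₃.hb] using h2.symm
    fin_cases l
    exacts [hf e1, hf e2]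
  obtain ⟨q, hq⟩ := hu
  refine ⟨fun p => (c₃.vec r q)⁻¹ * c₃.vec r p, fun h0 => ?_, fun p => c₁.exists_eq_add_mul fun σ hσ => ?_, ?_⟩
  · have := congrFun h0 q
    simp [hq] at this
  · obtain ⟨ε, m₃⟩ := c₃.exists_moves σ
    obtain ⟨μ, hμ, H⟩ := h σ false false ε hσ (hθ σ hσ) m₃
    obtain ⟨ν, hν, hact⟩ : ∃ ν : K, ν ≠ 0 ∧ act (algebraMap k K c₃.b) ε (fun j => σ (r j)) = ν • r := by
      cases ε
      · refine ⟨μ, hμ, ?_⟩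
        ext l
        fin_cases l <;> simp [act, hr, H, wt_false, fl_false]
      · refine ⟨-(μ * algebraMap k K c₃.b), neg_ne_zero.mpr (mul_ne_zero hμ c₃.hbK), ?_⟩
        ext l
        fin_cases l <;> simp [act, hr, H, wt_false, fl_false, wt_true_zero, wt_true_one, fl_true_zero,
          fl_true_one] <;> ring
    have hb : (bif ε then algebraMap k K c₃.b else 1) ≠ 0 := by
      cases ε
      exacts [one_ne_zero, c₃.hbK]
    have key : ∀ p, σ (c₃.vec r p) = (bif ε then algebraMap k K c₃.b else 1)⁻¹ * ν ^ 2 * c₃.vec r p := fun p => by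
      have := m₃.map_vec r p
      rw [hact, c₃.vec_smul] at this
      rw [mul_assoc, this, inv_mul_cancel_left₀ hb]
    rw [map_mul, map_inv₀, key, key]
    field_simp
  · rw [qv_smul]
    refine mul_eq_zero_of_right _ ?_
    exact qv_parVec (c₃.hθ' (A := K)) hδ r

theorem wt_mul_wt {F : Type*} [Field F] (b : F) (i : Fin 2) : wt b true i * wt b true (fl true i) = b := by
  fin_cases i
  exacts [mul_one b, one_mul b]

/-- If the three conics are split by the same quadratic algebra, then `b₁b₂b₃` is a norm. -/
theorem IsEquivariant.exists_norm_eq (h : IsEquivariant f c₁ c₂ c₃)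
    (h₂ : ∀ σ ε, c₁.Moves σ ε → c₂.Moves σ ε) (h₃ : ∀ σ ε, c₁.Moves σ ε → c₃.Moves σ ε)
    {i j l : Fin 2} (hf : f i j l ≠ 0) :
    ∃ u₀ u₁ : k, u₀ ^ 2 + c₁.e * u₀ * u₁ - c₁.a * u₁ ^ 2 = c₁.b * c₂.b * c₃.b := by
  have hinj := (algebraMap k K).injective
  by_cases hall : ∀ σ : K ≃ₐ[k] K, c₁.Moves σ false
  · -- If `θ` is in `k`, then the norm form is a product of two linear forms and represents everything.
    obtain ⟨t, ht⟩ := (InfiniteGalois.mem_range_algebraMap_iff_fixed c₁.θ).mpr hall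
    have hθ : t ^ 2 = c₁.e * t + c₁.a := hinj (by simp only [map_pow, map_add, map_mul, ht, c₁.hθ])
    have hd : 2 * t - c₁.e ≠ 0 := fun h0 => by
      have h1 := congrArg (algebraMap k K) h0
      rw [map_sub, map_mul, map_ofNat, ht, map_zero] at h1
      exact one_ne_zero (c₁.hδ.symm.trans (mul_eq_zero_of_right _ h1))
    refine ⟨c₁.b * c₂.b * c₃.b - t * ((c₁.b * c₂.b * c₃.b - 1) / (2 * t - c₁.e)),
      (c₁.b * c₂.b * c₃.b - 1) / (2 * t - c₁.e), ?_⟩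
    set B := c₁.b * c₂.b * c₃.b
    obtain ⟨w, hw⟩ : ∃ w, w = (B - 1) / (2 * t - c₁.e) := ⟨_, rfl⟩
    have hw' : w * (2 * t - c₁.e) = B - 1 := by rw [hw, div_mul_cancel₀ _ hd]
    rw [← hw]
    linear_combination -B * hw' + w ^ 2 * hθ
  push Not at hall
  obtain ⟨τ, hτ⟩ := hall
  obtain ⟨ε, hm⟩ := c₁.exists_moves τ
  cases ε
  · exact absurd hm hτ
  obtain ⟨μ, hμ, H⟩ := h τ true true true hm (h₂ _ _ hm) (h₃ _ _ hm)
  have hfl : ∀ i, fl true (fl true i) = i := fun i => by fin_cases i <;> rfl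
  have e1 := H i j l
  have e2 := H (fl true i) (fl true j) (fl true l)
  rw [hfl, hfl, hfl] at e2
  set f' := f (fl true i) (fl true j) (fl true l)
  obtain ⟨p, q, hpq⟩ := c₁.exists_eq_add_mul (y := f' / f i j l) fun σ hσ => by
    obtain ⟨μ, hμ, H⟩ := h σ false false false hσ (h₂ _ _ hσ) (h₃ _ _ hσ)
    rw [map_div₀, H, H]
    simp only [wt_false, fl_false]
    field_simp
    rfl
  have hf' : f' ≠ 0 := fun h0 => hf (by simpa [h0] using e1)
  have hW : ∃ w : k, w ≠ 0 ∧ algebraMap k K w = wt (algebraMap k K c₁.b) true i *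
      wt (algebraMap k K c₂.b) true j * wt (algebraMap k K c₃.b) true l := by
    have hw : ∀ (b : k) (i : Fin 2), algebraMap k K (wt b true i) = wt (algebraMap k K b) true i :=
      fun b i => by
        fin_cases i
        exacts [rfl, map_one _]
    have h0 : ∀ (b : k) (i : Fin 2), b ≠ 0 → wt b true i ≠ 0 := fun b i hb => by
      fin_cases i
      exacts [hb, one_ne_zero]
    exact ⟨wt c₁.b true i * wt c₂.b true j * wt c₃.b true l,
      mul_ne_zero (mul_ne_zero (h0 _ _ c₁.hb) (h0 _ _ c₂.hb)) (h0 _ _ c₃.hb), by simp only [map_mul, hw]⟩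
  obtain ⟨w, hw0, hw⟩ := hW
  have hwK : algebraMap k K w ≠ 0 := by simpa using hw0
  -- `N(p, q) = y τ(y)` with `y = f' / f i j l`, and `τ` exchanges the two coefficients up to weights.
  have hN : (algebraMap k K w) ^ 2 * (f' / f i j l * τ (f' / f i j l)) =
      algebraMap k K (c₁.b * c₂.b * c₃.b) := by
    have h1 := wt_mul_wt (algebraMap k K c₁.b) i
    have h2 := wt_mul_wt (algebraMap k K c₂.b) j
    have h3 := wt_mul_wt (algebraMap k K c₃.b) l
    rw [map_div₀, e1, e2, ← hw, map_mul, map_mul]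
    field_simp
    rw [hw]
    linear_combination algebraMap k K c₂.b * algebraMap k K c₃.b * h1 +
      wt (algebraMap k K c₁.b) true i * wt (algebraMap k K c₁.b) true (fl true i) *
        (algebraMap k K c₃.b * h2 + wt (algebraMap k K c₂.b) true j * wt (algebraMap k K c₂.b) true (fl true j) * h3)
  refine ⟨p * w, q * w, hinj ?_⟩
  rw [← hN, hpq, map_add, map_mul, AlgEquiv.commutes, AlgEquiv.commutes, hm, cond_true]
  simp only [map_add, map_mul, map_sub, map_pow]
  linear_combination (algebraMap k K w * algebraMap k K q) ^ 2 * c₁.hθ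

end Third

/-! ### Existence of the normal forms -/

section NormalForm
variable {k : Type u} [Field k]

/-- Separable quadratic equations have roots in the separable closure. -/
theorem exists_root_separableClosure {e a : k} (hD : e ^ 2 + 4 * a ≠ 0) :
    ∃ θ : SeparableClosure k, θ ^ 2 = algebraMap k _ e * θ + algebraMap k _ a := by
  let p : Polynomial k := Polynomial.X ^ 2 - Polynomial.C e * Polynomial.X - Polynomial.C a
  have hdeg : p.degree = 2 := by
    have : p = Polynomial.C 1 * Polynomial.X ^ 2 + Polynomial.C (-e) * Polynomial.X + Polynomial.C (-a) := by
      simp only [p, map_neg, map_one]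
      ring
    rw [this]
    exact Polynomial.degree_quadratic one_ne_zero
  have hsep : p.Separable := by
    refine ⟨Polynomial.C (-4 / (e ^ 2 + 4 * a)),
      Polynomial.C ((e ^ 2 + 4 * a)⁻¹) * (Polynomial.C 2 * Polynomial.X - Polynomial.C e), ?_⟩
    have hder : p.derivative = Polynomial.C 2 * Polynomial.X - Polynomial.C e := by
      have h2 : (Polynomial.C 2 : Polynomial k) = 2 := map_ofNat _ 2
      simp only [p, Polynomial.derivative_sub, Polynomial.derivative_X_pow, Polynomial.derivative_C_mul,
        Polynomial.derivative_X, Polynomial.derivative_C, h2]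
      norm_num
      exact h2
    have h1 : Polynomial.C ((e ^ 2 + 4 * a)⁻¹) * (Polynomial.C e ^ 2 + Polynomial.C 4 * Polynomial.C a) = 1 := by
      rw [← map_pow, ← map_mul, ← map_add, ← map_mul, inv_mul_cancel₀ hD, map_one]
    have h2 : (Polynomial.C 2 : Polynomial k) = 2 := map_ofNat _ 2
    have h4 : (Polynomial.C 4 : Polynomial k) = 4 := map_ofNat _ 4
    rw [hder, div_eq_mul_inv, map_mul, map_neg, h2, h4]
    rw [h4] at h1
    linear_combination h1
  obtain ⟨θ, hθ⟩ := IsSepClosed.exists_aeval_eq_zero (SeparableClosure k) p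
    (by rw [hdeg]; exact two_ne_zero) hsep
  refine ⟨θ, ?_⟩
  simp only [p, map_sub, map_pow, map_mul, Polynomial.aeval_X, Polynomial.aeval_C] at hθ
  linear_combination hθ

/-- A conic in normal form with a root of its quadratic polynomial. -/
def HasForm.split {K : Type u} [Field K] [Algebra k K] {Y : Sch k} {i : Y ⟶ projSpace k 2} {e a b : k}
    (form : HasForm i (qf e a b)) (hb : b ≠ 0) (hD : e ^ 2 + 4 * a ≠ 0) {θ : K}
    (hθ : θ ^ 2 = algebraMap k K e * θ + algebraMap k K a) : SplitConic k K Y where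
  i := i
  e := e
  a := a
  b := b
  form := form
  hb := hb
  θ := θ
  δ := (2 * θ - algebraMap k K e)⁻¹
  hθ := hθ
  hδ := inv_mul_cancel₀ fun h => hD <| (algebraMap k K).injective <| by
    rw [map_add, map_mul, map_pow, map_ofNat, map_zero]
    linear_combination (2 * θ - algebraMap k K e) * h - 4 * hθ

/-- If `N(u) = lb` for the norm form `N` of `t² - et - a`, then `N(x) = bx₂²` is equivalent to
`N(ux) = l(bx₂)²`, so that the constant `b` of a normal form can be replaced by `l`. -/
theorem HasForm.mul_norm {Y : Sch k} {i : Y ⟶ projSpace k 2} {e a b l u₀ u₁ : k}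
    (form : HasForm i (qf e a b)) (hb : b ≠ 0) (hl : l ≠ 0)
    (hu : u₀ ^ 2 + e * u₀ * u₁ - a * u₁ ^ 2 = l * b) :
    ∃ i' : Y ⟶ projSpace k 2, HasForm i' (qf e a l) := by
  let M : Matrix (Fin 3) (Fin 3) k := !![u₀, a * u₁, 0; u₁, u₀ + e * u₁, 0; 0, 0, b]
  have hdet : M.det = l * b * b := by
    rw [← hu]
    simp only [M, Matrix.det_fin_three, Matrix.of_apply, Matrix.cons_val', Matrix.cons_val]
    ring
  obtain ⟨N, -, hN⟩ := exists_basis_inv (P := M) (by rw [hdet]; exact mul_ne_zero (mul_ne_zero hl hb) hb)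
  obtain ⟨i', hi', -⟩ := form.linear hN (q' := qf e a l) (mul_ne_zero hl hb) fun W v => by
    have actM : actVec W M v = ![strHom W u₀ * v 0 + strHom W a * strHom W u₁ * v 1,
        strHom W u₁ * v 0 + (strHom W u₀ + strHom W e * strHom W u₁) * v 1, strHom W b * v 2] := by
      ext j
      fin_cases j <;> simp [actVec, M, Matrix.mulVec, dotProduct, Fin.sum_univ_three]
    have h1 := congrArg (strHom W) hu
    simp only [map_sub, map_add, map_mul, map_pow] at h1
    rw [actM, coordHom_qf, coordHom_qf, map_mul]
    simp only [qv, Matrix.cons_val]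
    linear_combination (v 0 ^ 2 + strHom W e * (v 0 * v 1) - strHom W a * v 1 ^ 2) * h1
  exact ⟨i', hi'⟩

/-- Completing the square, away from characteristic two. -/
theorem HasForm.complete_square {Y : Sch k} {i : Y ⟶ projSpace k 2} {e a b : k}
    (form : HasForm i (qf e a b)) (h2 : (2 : k) ≠ 0) :
    ∃ i' : Y ⟶ projSpace k 2, HasForm i' (qf 0 (a + (e / 2) ^ 2) b) := by
  let M : Matrix (Fin 3) (Fin 3) k := !![1, e / 2, 0; 0, 1, 0; 0, 0, 1]
  let N : Matrix (Fin 3) (Fin 3) k := !![1, -(e / 2), 0; 0, 1, 0; 0, 0, 1]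
  have hN : N * M = 1 := by
    ext p q
    fin_cases p <;> fin_cases q <;> simp [M, N, Matrix.mul_apply, Fin.sum_univ_three]
  obtain ⟨i', hi', -⟩ := form.linear hN (q' := qf 0 (a + (e / 2) ^ 2) b) one_ne_zero fun W v => by
    have actM : actVec W M v = ![v 0 + strHom W (e / 2) * v 1, v 1, v 2] := by
      ext j
      fin_cases j <;> simp [actVec, M, Matrix.mulVec, dotProduct, Fin.sum_univ_three]
    have h1 : strHom W e = 2 * strHom W (e / 2) := by
      rw [← map_ofNat (strHom W) 2, ← map_mul, mul_div_cancel₀ _ h2]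
    rw [actM, coordHom_qf, coordHom_qf, map_one, map_zero, map_add, map_pow, h1]
    simp only [qv, Matrix.cons_val]
    ring
  exact ⟨i', hi'⟩

/-- Two conics with a Brauer product which is a conic have, together with the product, normal forms
with the same quadratic algebra, in which the constants multiply. -/
theorem exists_conicTriple {C₁ C₂ C : Sch k} (h₁ : IsSmoothConic C₁) (h₂ : IsSmoothConic C₂)
    (hC : IsSmoothConic C) (hprod : IsBrauerProduct C₁ C₂ C) :
    ∃ e a b c : k, Nonempty (ConicTriple e a b c C₁ C₂ C) ∧ ((2 : k) ≠ 0 → e = 0) := by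
  obtain ⟨-, P, 𝒟, hP, ι, -, hι⟩ := hprod
  obtain ⟨a₁, b₁, i₁, hD₁, hb₁, f₁⟩ := h₁.exists_qf
  obtain ⟨a₂, b₂, i₂, hD₂, hb₂, f₂⟩ := h₂.exists_qf
  obtain ⟨a₃, b₃, i₃, hD₃, hb₃, f₃⟩ := hC.exists_qf
  obtain ⟨θ₁, hθ₁⟩ := exists_root_separableClosure hD₁
  obtain ⟨θ₂, hθ₂⟩ := exists_root_separableClosure hD₂
  obtain ⟨θ₃, hθ₃⟩ := exists_root_separableClosure hD₃
  -- The trilinear form over the separable closure yields a common quadratic algebra.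
  obtain ⟨f, hf, heq⟩ := exists_tri_galois (f₁.split hb₁ hD₁ hθ₁) (f₂.split hb₂ hD₂ hθ₂)
    (f₃.split hb₃ hD₃ hθ₃) hP.universal_mem hι
  obtain ⟨v, hv0, hv⟩ := heq.exists_albert (exists_plu_ne_zero hf) rfl rfl
  rw [one_pow] at hD₁ hD₂
  obtain ⟨e, a, hD, hpt⟩ := exists_common_root hb₁ hb₂ hD₁ hD₂ hv0 hv
  obtain ⟨ρ, hρ⟩ := exists_root_separableClosure hD
  obtain ⟨⟨z₁, hz₁, hc₁, h0₁⟩, z₂, hz₂, hc₂, h0₂⟩ := hpt _ ρ hρ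
  obtain ⟨b, j₁, hb, g₁⟩ := f₁.exists_qf_of_point (by rwa [one_pow]) hb₁ hD hρ hz₁ hc₁ h0₁
  obtain ⟨c, j₂, hc, g₂⟩ := f₂.exists_qf_of_point (by rwa [one_pow]) hb₂ hD hρ hz₂ hc₂ h0₂
  have hr : (![1, 0] : Fin 2 → SeparableClosure k) ≠ 0 := fun h => one_ne_zero (congrFun h 0)
  -- With the first two conics in normal form over that algebra, the form gives a point of the third
  -- conic over it.
  obtain ⟨f', hf', heq'⟩ := exists_tri_galois (g₁.split hb hD hρ) (g₂.split hc hD hρ)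
    (f₃.split hb₃ hD₃ hθ₃) hP.universal_mem hι
  obtain ⟨i, j, hij⟩ := hf' _ hr
  obtain ⟨z₃, hz₃, hc₃, h0₃⟩ := heq'.hasPt_third (fun _ h => h) (i := i) (j := j) (l := 0)
    fun h => hij (by simp [h])
  obtain ⟨d, j₃, hd, g₃⟩ := f₃.exists_qf_of_point hD₃ hb₃ hD hρ hz₃ hc₃ h0₃
  -- With all three conics in normal form over that algebra, it gives the relation of the constants.
  obtain ⟨f'', hf'', heq''⟩ := exists_tri_galois (g₁.split hb hD hρ) (g₂.split hc hD hρ)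
    (g₃.split hd hD hρ) hP.universal_mem hι
  obtain ⟨i, j, hij⟩ := hf'' _ hr
  obtain ⟨u₀, u₁, hu⟩ := heq''.exists_norm_eq (fun _ _ h => h) (fun _ _ h => h) (i := i) (j := j) (l := 0)
    fun h => hij (by simp [h])
  obtain ⟨j, g⟩ := g₃.mul_norm hd (mul_ne_zero hb hc) hu
  by_cases h2 : (2 : k) = 0
  · exact ⟨e, a, b, c, ⟨⟨j₁, j₂, j, g₁, g₂, g, hb, hc, hD⟩⟩, fun h => absurd h2 h⟩
  · obtain ⟨j₁, g₁⟩ := g₁.complete_square h2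
    obtain ⟨j₂, g₂⟩ := g₂.complete_square h2
    obtain ⟨j, g⟩ := g.complete_square h2
    refine ⟨0, _, b, c, ⟨⟨j₁, j₂, j, g₁, g₂, g, hb, hc, fun h => hD ?_⟩⟩, fun _ => rfl⟩
    have h1 : 2 * (e / 2) = e := mul_div_cancel₀ _ h2
    linear_combination h - (e + 2 * (e / 2)) * h1

end NormalForm

end Conics

end

open Conics
theorem mainTheorem3 (k : Type u) [Field k] (C₁ C₂ C : Sch k)
    (h₁ : IsSmoothConic C₁) (h₂ : IsSmoothConic C₂)
    (hC : IsSmoothConic C) (hprod : IsBrauerProduct C₁ C₂ C) :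
    Scheme.BirationalOver (C₁ ⊗ C₂).hom (C₁ ⊗ C).hom ∧
    (∃ (hX : IsQuasiProjVar (C₁ ⊗ C₂)) (hY : IsQuasiProjVar (C₁ ⊗ C)),
      K₀.cls ⟨C₁ ⊗ C₂, hX⟩ = K₀.cls ⟨C₁ ⊗ C, hY⟩) ∧
    ∃ L : BlowupLink C₁ C₂ C, (2 : k) ≠ 0 →
      ∃ (a b c : k) (i₁ : C₁ ⟶ projSpace k 2) (i₂ : C₂ ⟶ projSpace k 2) (i : C ⟶ projSpace k 2),
        a ≠ 0 ∧ b ≠ 0 ∧ c ≠ 0 ∧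
        IsHypersurface i₁ 2 (diagForm a b) ∧ IsHypersurface i₂ 2 (diagForm a c) ∧
        IsHypersurface i 2 (diagForm a (b * c)) ∧ L.IsGivenBy a i₁ i₂ i := by
  obtain ⟨e, a, b, c, ⟨t⟩, he⟩ := exists_conicTriple h₁ h₂ hC hprod
  obtain ⟨L, hL⟩ := t.exists_blowupLink
  refine ⟨t.birationalOver, ⟨isQuasiProjVar_prod t.form₁ t.form₂ t.discr,
    isQuasiProjVar_prod t.form₁ t.form t.discr, t.cls_eq _ _⟩, L, fun h2 => ?_⟩
  obtain rfl := he h2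
  refine ⟨a, b, c, t.i₁, t.i₂, t.i, ?_, t.hb, t.hc, ?_, ?_, ?_, t.isGivenBy L hL⟩
  · rintro rfl
    exact t.discr (by ring)
  · rw [← qf_zero]
    exact t.form₁.isHypersurface (isHomogeneous_qf _ _ _)
  · rw [← qf_zero]
    exact t.form₂.isHypersurface (isHomogeneous_qf _ _ _)
  · rw [← qf_zero]
    exact t.form.isHypersurface (isHomogeneous_qf _ _ _)
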